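/- **Setting.** Let $\gamma_1,\dots,\gamma_{2n}$ be the Majorana (Weyl–Brauer) operators of $n$ fermionic modes, and for $I=\{i_1<\dots<i_4\}\subseteq[2n]$ put $\gamma_I=\gamma_{i_1}\gamma_{i_2}\gamma_{i_3}\gamma_{i_4}$. The sparse SYK-4 Hamiltonian with sparsity parameter $p\in(0,1]$ is $$H=-\binom{2n}{4}^{-1/2}p^{-1/2}\sum_{|I|=4}J_IX_I\gamma_I,$$ where the $J_I$ are standard Gaussians, the $X_I$ are Bernoulli variables with $\Pr(X_I=1)=p$, and all of them are independent. Let $n_2=2\lfloor n/4\rfloor$ and $n_1=2n-n_2$. Call $\phi_1,\dots,\phi_{n_1}$ the first $n_1$ and $\chi_1,\dots,\chi_{n_2}$ the last $n_2$ of the operators $\gamma_i$, add $n_2$ ancilla Majorana operators $\sigma_1,\dots,\sigma_{n_2}$ that anticommute with each other and with all $\gamma_i$, and let $$\tau_j=i\binom{n_1}{3}^{-1/2}p^{-1/2}\sum_{S\subset[n_1],\,|S|=3}J_{S\cup\{n_1+j\}}X_{S\cup\{n_1+j\}}\,\phi_S,\qquad \zeta=\sum_{j=1}^{n_2}\tau_j\sigma_j,$$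 $$\rho_0=2^{-(n_2+n_1/2)}\prod_{j=1}^{n_2}(\mathbb I+i\sigma_j\chi_j),\qquad \rho_\theta=e^{-\theta\zeta}\rho_0e^{\theta\zeta}.$$ Here $\rho_0$ is the Gaussian state that is maximally entangled between the $\sigma$ and the $\chi$ modes, and $\rho_\theta$ is the Hastings–O'Donnell state. The energy $\mathrm{Tr}(H\rho)$ of a state $\rho$ of all the modes is that of its restriction to the modes $\phi,\chi$ (the ancillas are traced out). An *efficient quantum algorithm* is a single classical program that, on input $n$, a precision parameter $k\ge1$ and the coefficients of $H$ rounded down to $n+k$ binary digits after the point, runs for a number of bit operations that is polynomial in $n$, $k$ and the length of the coefficients, and writes a quantum circuit over Hadamard, phase and CNOT gates and $Z$-rotations by rational angles. The state that it outputs is the state $\rho^{(k)}$ of the first $n_2+n_1/2$ of $2(n_2+n_1/2)$ qubits after this circuit has been applied to $|0\cdots0\rangle$. **Theorem.** For every constant $K>0$ there are constants $\theta\in\mathbb R$, $c>0$, $n_0$ and an efficient quantum algorithm such that for all $n\ge n_0$ and all $p\in[K\log n/n,\,1]$, with probability at least $1-e^{-cn}$ over the draw of $H$: 1. the Hastings–O'Donnell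 state has energy $\mathrm{Tr}(H\rho_\theta)\ge c\sqrt n$; and 2. for every $k\ge1$ the state $\rho^{(k)}$ that the algorithm outputs is within trace distance $1/k$ of $\rho_\theta$, and it too has energy $\mathrm{Tr}(H\rho^{(k)})\ge c\sqrt n$. -/

import Mathlib

open MeasureTheory ProbabilityTheory

namespace SparseSYK

/-! ### Qubit matrices and Majorana operators -/

/-- Computational basis of `N` qubits. -/
abbrev Basis (N : ℕ) : Type := Fin N → Fin 2

/-- Operators on `N` qubits. -/
abbrev Op (N : ℕ) : Type := Matrix (Basis N) (Basis N) ℂ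

def pauliX : Matrix (Fin 2) (Fin 2) ℂ := !![0, 1; 1, 0]

def pauliY : Matrix (Fin 2) (Fin 2) ℂ := !![0, -Complex.I; Complex.I, 0]

def pauliZ : Matrix (Fin 2) (Fin 2) ℂ := !![1, 0; 0, -1]

/-- The tensor product `f 0 ⊗ f 1 ⊗ ⋯ ⊗ f (N - 1)` of one-qubit matrices. -/
def tensor {N : ℕ} (f : Fin N → Matrix (Fin 2) (Fin 2) ℂ) : Op N :=
  Matrix.of fun x y => ∏ i, f i (x i) (y i)

/-- The Weyl-Brauer (Majorana) matrices on `N` qubits, numbered from `0` to `2 * N - 1`: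
number `2 * i` is `Z ⊗ ⋯ ⊗ Z ⊗ X ⊗ 1 ⊗ ⋯ ⊗ 1` and number `2 * i + 1` is
`Z ⊗ ⋯ ⊗ Z ⊗ Y ⊗ 1 ⊗ ⋯ ⊗ 1`, with `X`, `Y` on qubit `i`. -/
def majorana (N j : ℕ) : Op N :=
  tensor fun i =>
    if (i : ℕ) < j / 2 then pauliZ
    else if (i : ℕ) = j / 2 then (if j % 2 = 0 then pauliX else pauliY)
    else 1

/-- The ordered product `γ_{i₁} γ_{i₂} ⋯` over the elements `i₁ < i₂ < ⋯` of `s`. -/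
def majoranaProd (N : ℕ) (s : Finset ℕ) : Op N :=
  ((s.sort (· ≤ ·)).map (majorana N)).prod

/-- Partial trace over the last `b` of `a + b` qubits. -/
def reduce {a b : ℕ} (ρ : Op (a + b)) : Op a :=
  Matrix.of fun x y => ∑ z : Basis b, ρ (Fin.append x z) (Fin.append y z)

/-- The trace distance `(1/2) Tr √((ρ - σ)† (ρ - σ))`: half the sum of the singular values
of `ρ - σ`. -/
noncomputable def traceDist {N : ℕ} (ρ σ : Op N) : ℝ :=
  (1 / 2) * ∑ i, √((Matrix.isHermitian_conjTranspose_mul_self (ρ - σ)).eigenvalues i)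

/-- The energy `Tr (H ρ)` (a real number for Hermitian `H` and `ρ`). -/
noncomputable def energy {N : ℕ} (H ρ : Op N) : ℝ := ((H * ρ).trace).re

/-! ### The sparse SYK-4 model -/

/-- The four-element sets of indices of Majorana modes. -/
abbrev Quad (n : ℕ) : Type := ↥(Finset.powersetCard 4 (Finset.range (2 * n)))

/-- The disorder: a pair `(J_I, X_I)` for every four-element set `I`. -/
abbrev Disorder (n : ℕ) : Type := Quad n → ℝ × ℝ

/-- The law of the disorder: all `J_I` are standard Gaussians, all `X_I` are Bernoulli with
`P(X_I = 1) = p`, and all of them are independent. -/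
noncomputable def disorderLaw (n : ℕ) (p : unitInterval) : Measure (Disorder n) :=
  Measure.pi fun _ => (gaussianReal 0 1).prod (bernoulliMeasure (1 : ℝ) 0 p)

/-- The product `J_I X_I` (and `0` if `I` is not a four-element set of modes). -/
def coupling {n : ℕ} (ω : Disorder n) (I : Finset ℕ) : ℝ :=
  if h : I ∈ Finset.powersetCard 4 (Finset.range (2 * n)) then (ω ⟨I, h⟩).1 * (ω ⟨I, h⟩).2 else 0

/-- The coefficient of `γ_I` in the Hamiltonian; the sign is `i ^ (q / 2)` for `q = 4`. -/
noncomputable def hamCoeff {n : ℕ} (p : unitInterval) (ω : Disorder n) (I : Finset ℕ) : ℝ :=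
  -((√((2 * n).choose 4 : ℝ))⁻¹ * (√(p : ℝ))⁻¹ * coupling ω I)

/-- The sparse SYK-4 Hamiltonian on `n` fermionic modes (`2 * n` Majorana modes). -/
noncomputable def hamiltonian {n : ℕ} (p : unitInterval) (ω : Disorder n) : Op n :=
  ∑ I ∈ Finset.powersetCard 4 (Finset.range (2 * n)), (hamCoeff p ω I : ℂ) • majoranaProd n I

/-! ### The Hastings-O'Donnell state

The `2 * n` Majorana modes are split into `n₁` modes `φ` (the first ones) and `n₂` modes `χ`
(the last ones).  There are `n₂` further ancilla modes `σ`, numbered after the `χ` modes.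
The `2 * n + n₂` modes live on `n + n₂ / 2` qubits, of which the first `n` carry `φ` and `χ`. -/

/-- Half of the number of `χ` modes, which is also the number of ancilla qubits for `σ`. -/
def halfChi (n : ℕ) : ℕ := n / 4

/-- The number `n₂` of `χ` modes and of `σ` modes. -/
def nTwo (n : ℕ) : ℕ := 2 * halfChi n

/-- The number `n₁` of `φ` modes. -/
def nOne (n : ℕ) : ℕ := 2 * n - nTwo n

/-- The number of qubits that carry the modes `φ`, `χ` and `σ`. -/
def hoQubits (n : ℕ) : ℕ := n + halfChi n

def chiOp (n t : ℕ) : Op (hoQubits n) := majorana (hoQubits n) (nOne n + t)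

def sigmaOp (n t : ℕ) : Op (hoQubits n) := majorana (hoQubits n) (2 * n + t)

/-- `τ_t = i (n₁ choose 3)^(-1/2) p^(-1/2) ∑ J_{S,t} X_{S,t} φ_S` over the three-element sets `S`
of `φ` modes, where `(S, t)` stands for the four-element set of `S` and the mode `χ_t`. -/
noncomputable def tau {n : ℕ} (p : unitInterval) (ω : Disorder n) (t : ℕ) : Op (hoQubits n) :=
  (Complex.I * ((√((nOne n).choose 3 : ℝ))⁻¹ : ℝ) * ((√(p : ℝ))⁻¹ : ℝ)) •
    ∑ S ∈ Finset.powersetCard 3 (Finset.range (nOne n)),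
      (coupling ω (insert (nOne n + t) S) : ℂ) • majoranaProd (hoQubits n) S

/-- `ζ = ∑ τ_t σ_t`. -/
noncomputable def zeta {n : ℕ} (p : unitInterval) (ω : Disorder n) : Op (hoQubits n) :=
  ∑ t ∈ Finset.range (nTwo n), tau p ω t * sigmaOp n t

/-- The Gaussian state that is maximally entangled between the `σ` and the `χ` modes. -/
noncomputable def rhoZero (n : ℕ) : Op (hoQubits n) :=
  ((2 : ℂ) ^ hoQubits n)⁻¹ •
    ((List.range (nTwo n)).map fun t => 1 + Complex.I • (sigmaOp n t * chiOp n t)).prod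

/-- The Hastings-O'Donnell state `e^{-θζ} ρ₀ e^{θζ}`. -/
noncomputable def hoState {n : ℕ} (p : unitInterval) (ω : Disorder n) (θ : ℝ) : Op (hoQubits n) :=
  NormedSpace.exp (-((θ : ℂ) • zeta p ω)) * rhoZero n * NormedSpace.exp ((θ : ℂ) • zeta p ω)

/-! ### Quantum circuits -/

/-- Elementary gates; the angle of a `Z` rotation is a rational number. -/
inductive Gate where
  | had (q : ℕ)
  | phase (q : ℕ)
  | cnot (c t : ℕ)
  | rz (q : ℕ) (α : ℚ)

/-- The one-qubit matrix `U` on qubit `q` (the identity if there is no such qubit). -/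
def onQubit (N q : ℕ) (U : Matrix (Fin 2) (Fin 2) ℂ) : Op N :=
  tensor fun i => if (i : ℕ) = q then U else 1

/-- The unitary of a gate on `N` qubits (the identity if a qubit does not exist). -/
noncomputable def Gate.toOp (N : ℕ) : Gate → Op N
  | .had q => onQubit N q ((((√2)⁻¹ : ℝ) : ℂ) • !![1, 1; 1, -1])
  | .phase q => onQubit N q !![1, 0; 0, Complex.I]
  | .cnot c t =>
      if c < N ∧ t < N ∧ c ≠ t then
        onQubit N c !![1, 0; 0, 0] + onQubit N c !![0, 0; 0, 1] * onQubit N t pauliX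
      else 1
  | .rz q α =>
      onQubit N q
        !![Complex.exp (-(Complex.I * (α : ℂ) / 2)), 0; 0, Complex.exp (Complex.I * (α : ℂ) / 2)]

/-- The unitary of a circuit; the head of the list acts first. -/
noncomputable def circuitOp (N : ℕ) : List Gate → Op N
  | [] => 1
  | g :: gs => circuitOp N gs * g.toOp N

/-- The state of the first `N` of `N + N` qubits after a circuit has been applied to `|0 ⋯ 0⟩`
(the last `N` qubits are workspace and are discarded). -/
noncomputable def circuitState (N : ℕ) (gs : List Gate) : Op N :=
  reduce (circuitOp (N + N) gs * Matrix.single (0 : Basis (N + N)) (0 : Basis (N + N)) 1 *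
    (circuitOp (N + N) gs).conjTranspose)

/-! ### Classical programs that write circuits, with their running time

A program works on integer registers and is charged for the binary length of every number that it
reads or computes (the logarithmic cost of a random access machine).  Its input is a number `n`,
a precision parameter `k` and a table with one integer for every four-element set of
`{0, …, 2 * n - 1}`. -/

/-- Binary length of an integer. -/
def bitLen (z : ℤ) : ℕ := Nat.size z.natAbs

/-- Integer expressions: constants, registers, arithmetic (`quot` is floor division) and entries
of the input table. -/
inductive Expr where
  | lit (z : ℤ)
  | reg (x : ℕ)
  | plus (e₁ e₂ : Expr)
  | minus (e₁ e₂ : Expr)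
  | times (e₁ e₂ : Expr)
  | quot (e₁ e₂ : Expr)
  | entry (e₁ e₂ e₃ e₄ : Expr)

/-- The entry of the input table at `{i, j, k, l}` (`0` if this is not a valid index). -/
def tableEntry {n : ℕ} (a : Quad n → ℤ) (i j k l : ℕ) : ℤ :=
  if h : ({i, j, k, l} : Finset ℕ) ∈ Finset.powersetCard 4 (Finset.range (2 * n)) then
    a ⟨{i, j, k, l}, h⟩ else 0

def Expr.eval {n : ℕ} (a : Quad n → ℤ) (r : ℕ → ℤ) : Expr → ℤ
  | .lit z => z
  | .reg x => r x
  | .plus e₁ e₂ => e₁.eval a r + e₂.eval a r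
  | .minus e₁ e₂ => e₁.eval a r - e₂.eval a r
  | .times e₁ e₂ => e₁.eval a r * e₂.eval a r
  | .quot e₁ e₂ => Int.fdiv (e₁.eval a r) (e₂.eval a r)
  | .entry e₁ e₂ e₃ e₄ =>
      tableEntry a (e₁.eval a r).toNat (e₂.eval a r).toNat (e₃.eval a r).toNat (e₄.eval a r).toNat

/-- The cost of the evaluation: `1` plus the binary length of the value, at every node. -/
def Expr.cost {n : ℕ} (a : Quad n → ℤ) (r : ℕ → ℤ) (e : Expr) : ℕ :=
  1 + bitLen (e.eval a r) +
    match e with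
    | .lit _ => 0
    | .reg _ => 0
    | .plus e₁ e₂ => e₁.cost a r + e₂.cost a r
    | .minus e₁ e₂ => e₁.cost a r + e₂.cost a r
    | .times e₁ e₂ => e₁.cost a r + e₂.cost a r
    | .quot e₁ e₂ => e₁.cost a r + e₂.cost a r
    | .entry e₁ e₂ e₃ e₄ => e₁.cost a r + e₂.cost a r + e₃.cost a r + e₄.cost a r

/-- Programs.  `loop x e P` executes `P` for `x = 0, 1, …, e - 1`; the last four instructions append
a gate to the circuit, and `rz e e₁ e₂` rotates by the angle `e₁ / e₂`. -/
inductive Prog where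
  | skip
  | assign (x : ℕ) (e : Expr)
  | seq (P Q : Prog)
  | ifLe (e₁ e₂ : Expr) (P Q : Prog)
  | loop (x : ℕ) (e : Expr) (P : Prog)
  | had (e : Expr)
  | phase (e : Expr)
  | cnot (e₁ e₂ : Expr)
  | rz (e e₁ e₂ : Expr)

/-- A configuration: the registers, the circuit written so far and the time used so far. -/
structure Config where
  regs : ℕ → ℤ
  circuit : List Gate
  time : ℕ

/-- Let time pass. -/
def Config.spend (s : Config) (m : ℕ) : Config := { s with time := s.time + m }

/-- Set a register. -/
def Config.set (s : Config) (x : ℕ) (z : ℤ) : Config :=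
  { s with regs := Function.update s.regs x z }

/-- Append a gate to the circuit. -/
def Config.emit (s : Config) (g : Gate) : Config := { s with circuit := s.circuit ++ [g] }

/-- Execution of a program. -/
def Prog.exec {n : ℕ} (a : Quad n → ℤ) : Prog → Config → Config
  | .skip, s => s.spend 1
  | .assign x e, s => (s.set x (e.eval a s.regs)).spend (1 + e.cost a s.regs)
  | .seq P Q, s => Q.exec a (P.exec a s)
  | .ifLe e₁ e₂ P Q, s =>
      let s' := s.spend (1 + e₁.cost a s.regs + e₂.cost a s.regs)
      if e₁.eval a s.regs ≤ e₂.eval a s.regs then P.exec a s' else Q.exec a s'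
  | .loop x e P, s =>
      (List.range (e.eval a s.regs).toNat).foldl
        (fun s' i => P.exec a ((s'.set x i).spend (1 + bitLen i)))
        (s.spend (1 + e.cost a s.regs))
  | .had e, s => (s.emit (.had (e.eval a s.regs).toNat)).spend (1 + e.cost a s.regs)
  | .phase e, s => (s.emit (.phase (e.eval a s.regs).toNat)).spend (1 + e.cost a s.regs)
  | .cnot e₁ e₂, s =>
      (s.emit (.cnot (e₁.eval a s.regs).toNat (e₂.eval a s.regs).toNat)).spend
        (1 + e₁.cost a s.regs + e₂.cost a s.regs)
  | .rz e e₁ e₂, s =>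
      (s.emit (.rz (e.eval a s.regs).toNat
        ((e₁.eval a s.regs : ℚ) / (e₂.eval a s.regs : ℚ)))).spend
        (1 + e.cost a s.regs + e₁.cost a s.regs + e₂.cost a s.regs)

/-- The final configuration of `P` on input `(n, k, a)`: register `0` starts with `n`, register `1`
with `k` and all others with `0`. -/
def Prog.run (P : Prog) (n k : ℕ) (a : Quad n → ℤ) : Config :=
  P.exec a ⟨fun x => if x = 0 then (n : ℤ) else if x = 1 then (k : ℤ) else 0, [], 0⟩

/-- The largest binary length of an entry of the input table. -/
def tableBits {n : ℕ} (a : Quad n → ℤ) : ℕ := Finset.univ.sup fun I => bitLen (a I)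

/-- `P` runs in polynomial time: its running time (and hence the number of gates that it writes)
is at most a polynomial in `n`, `k` and the length of the entries of the table, for every input. -/
def Prog.PolyTime (P : Prog) : Prop :=
  ∃ d : ℕ, ∀ (n k : ℕ) (a : Quad n → ℤ), (P.run n k a).time ≤ (n + k + tableBits a + 2) ^ d

/-- The description of the Hamiltonian that the algorithm receives: its coefficients, rounded down
to `n + k` binary digits after the point. -/
noncomputable def hamTable {n : ℕ} (p : unitInterval) (ω : Disorder n) (k : ℕ) : Quad n → ℤ :=
  fun I => ⌊(2 : ℝ) ^ (n + k) * hamCoeff p ω I⌋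

/-- The state that the circuit written by `P` prepares, for the Hamiltonian drawn and
precision `k`. -/
noncomputable def algState {n : ℕ} (P : Prog) (p : unitInterval) (ω : Disorder n) (k : ℕ) :
    Op (hoQubits n) :=
  circuitState (hoQubits n) (P.run n k (hamTable p ω k)).circuit

/-- The energy of a state of the modes `φ`, `χ`, `σ`: the ancillas are traced out. -/
noncomputable def sykEnergy {n : ℕ} (p : unitInterval) (ω : Disorder n) (ρ : Op (hoQubits n)) : ℝ :=
  energy (hamiltonian p ω) (reduce (a := n) (b := halfChi n) ρ)

end SparseSYK

open SparseSYK

/-!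
**Energy of the Hastings–O'Donnell state.** The quads of three `φ` modes and one `χ` mode contribute
to `H` a multiple of `i ∑ t, τ t * χ t` (`sum_mixed_smul_majoranaProd`). Since `χ t * ρ₀` is
`σ t * ρ₀` up to a factor `±i` and `ρ₀` is maximally mixed on the `φ` and `σ` modes, the energy of
these terms in `ρ_θ` is a sum of normalized traces of a conjugate of `τ t` by an exponential of `ζ`
against `σ t` (`trace_tau_chi_hoState`, `sykEnergy_hoState`). To first order in `θ` it is `|θ|` times
a multiple of the sum of the normalized squares `‖τ t‖²`, which is of order `n` and yields energy of
order `√n` after the scaling. The error of the expansion involves the Hilbert–Schmidt norms of the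
`τ t` and of the commutators `[ζ, τ t]` only (`sum_trace_conjExp_ge`), so no operator norm of a
random matrix has to be bounded for the energy.

The squared norm of `[ζ, τ s]` is the sum over `t` of the squared norms of `{τ t, τ s}`. The term
`t = s` is controlled by hypercontractivity for polynomials in Majorana operators
(`hypercontractivity`). For `t ≠ s` the coefficients of `τ t` and `τ s` are independent, and the sum
is controlled by Gaussian exponential moments, one block of coefficients at a time
(`measure_anticomm_gt_le`). The coefficients of the remaining quads are independent of `ρ_θ`, so they
contribute a centred Gaussian of bounded variance that is rarely below `-(energyRate / 2) * √n`
(`measure_restEnergy_lt_le`). The exceptional sets have measure `exp (-c n)` as soon as `p ≥ 1 / n`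
(`exists_measure_not_good_le`), and outside them the energy bound is deterministic
(`Good.sykEnergy_hoState_ge`).

**The algorithm.** The state `ρ₀` is prepared from Bell pairs, bit flips and exchanges of Majorana
modes (`circuitState_prep`). The exponential of `ζ` is replaced by a product formula with a number of
steps polynomial in `n` and `k`. Each of its factors is a rotation generated by a product of four
Majorana operators, which is realized by braiding the four modes to the positions `0, 1, 2, 3`,
rotating there and braiding back (`circuitOp_term`). The angles come from the rounded coefficients
and an integer square root for the ratio of the normalizations of `ζ` and `H`. The error in operator
norm is at most `21 / (k n³)` (`Good.norm_trotter_sub_exp_le`); it bounds the trace distance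
(`traceDist_le`) and, since `‖H‖` is polynomially bounded, the change of the energy
(`sykEnergy_sub_le`).

The program computes `2 ^ (n + k)` by doubling and the square root by linear search, and then runs
nested loops over the modes of each term. The circuit that it writes is determined from the output of
the loop bodies (`Prog.exec_nested`, `hoProg_circuit`), and a polynomial bound on its running time
follows from its syntax together with bounds on the contents of the registers (`Prog.exists_time_le`,
`hoProg_polyTime`).
-/

namespace SparseSYK

/-! ### Tensor products and the Clifford relations -/

lemma tensor_mul {N : ℕ} (f g : Fin N → Matrix (Fin 2) (Fin 2) ℂ) :
    tensor f * tensor g = tensor fun i => f i * g i := by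
  ext x y
  simp only [tensor, Matrix.mul_apply, Matrix.of_apply, Finset.prod_univ_sum,
    ← Finset.prod_mul_distrib]
  rw [Fintype.piFinset_univ]

lemma tensor_one {N : ℕ} : tensor (fun _ : Fin N => (1 : Matrix (Fin 2) (Fin 2) ℂ)) = 1 := by
  ext x y
  simp only [tensor, Matrix.of_apply, Matrix.one_apply, Finset.prod_ite_zero, Finset.prod_const_one]
  simp [funext_iff]

lemma tensor_smul {N : ℕ} (c : Fin N → ℂ) (f : Fin N → Matrix (Fin 2) (Fin 2) ℂ) :
    tensor (fun i => c i • f i) = (∏ i, c i) • tensor f := by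
  ext x y
  simp [tensor, Finset.prod_mul_distrib]

lemma tensor_conjTranspose {N : ℕ} (f : Fin N → Matrix (Fin 2) (Fin 2) ℂ) :
    (tensor f).conjTranspose = tensor fun i => (f i).conjTranspose := by
  ext x y
  simp [tensor, Matrix.conjTranspose_apply]

lemma tensor_commute {N : ℕ} {f g : Fin N → Matrix (Fin 2) (Fin 2) ℂ}
    (h : ∀ i, f i * g i = g i * f i) : tensor f * tensor g = tensor g * tensor f := by
  simp only [tensor_mul, h]

lemma tensor_anticommute {N : ℕ} {f g : Fin N → Matrix (Fin 2) (Fin 2) ℂ} (q : Fin N)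
    (h : ∀ i, i ≠ q → f i * g i = g i * f i) (hq : f q * g q = -(g q * f q)) :
    tensor f * tensor g = -(tensor g * tensor f) := by
  have : (fun i => f i * g i) = fun i => (if i = q then (-1 : ℂ) else 1) • (g i * f i) := by
    funext i
    split_ifs with hi
    · subst hi; simp [hq]
    · simp [h i hi]
  rw [tensor_mul, this, tensor_smul, tensor_mul]
  simp

lemma pauliX_sq : pauliX * pauliX = 1 := by
  ext i j; fin_cases i <;> fin_cases j <;> simp [pauliX]
lemma pauliY_sq : pauliY * pauliY = 1 := by
  ext i j; fin_cases i <;> fin_cases j <;> simp [pauliY]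
lemma pauliZ_sq : pauliZ * pauliZ = 1 := by
  ext i j; fin_cases i <;> fin_cases j <;> simp [pauliZ]
lemma pauliX_conjTranspose : pauliX.conjTranspose = pauliX := by
  ext i j; fin_cases i <;> fin_cases j <;> simp [pauliX]
lemma pauliY_conjTranspose : pauliY.conjTranspose = pauliY := by
  ext i j; fin_cases i <;> fin_cases j <;> simp [pauliY]
lemma pauliZ_conjTranspose : pauliZ.conjTranspose = pauliZ := by
  ext i j; fin_cases i <;> fin_cases j <;> simp [pauliZ]
lemma pauliX_mul_pauliY : pauliX * pauliY = Complex.I • pauliZ := by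
  ext i j; fin_cases i <;> fin_cases j <;> simp [pauliX, pauliY, pauliZ]
lemma pauliY_mul_pauliX : pauliY * pauliX = -(Complex.I • pauliZ) := by
  ext i j; fin_cases i <;> fin_cases j <;> simp [pauliX, pauliY, pauliZ]
lemma pauliY_mul_pauliZ : pauliY * pauliZ = Complex.I • pauliX := by
  ext i j; fin_cases i <;> fin_cases j <;> simp [pauliX, pauliY, pauliZ]
lemma pauliZ_mul_pauliY : pauliZ * pauliY = -(Complex.I • pauliX) := by
  ext i j; fin_cases i <;> fin_cases j <;> simp [pauliX, pauliY, pauliZ]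
lemma pauliZ_mul_pauliX : pauliZ * pauliX = Complex.I • pauliY := by
  ext i j; fin_cases i <;> fin_cases j <;> simp [pauliX, pauliY, pauliZ]
lemma pauliX_mul_pauliZ : pauliX * pauliZ = -(Complex.I • pauliY) := by
  ext i j; fin_cases i <;> fin_cases j <;> simp [pauliX, pauliY, pauliZ]

lemma majorana_mul_self (N j : ℕ) : majorana N j * majorana N j = 1 := by
  rw [majorana, tensor_mul, ← tensor_one]
  congr 1; funext i
  split_ifs <;> simp [pauliX_sq, pauliY_sq, pauliZ_sq]

lemma majorana_conjTranspose (N j : ℕ) : (majorana N j).conjTranspose = majorana N j := by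
  rw [majorana, tensor_conjTranspose]
  congr 1; funext i
  split_ifs <;> simp [pauliX_conjTranspose, pauliY_conjTranspose, pauliZ_conjTranspose]

lemma majorana_anticommute_of_lt {N j k : ℕ} (hjk : j < k) (hk : k < 2 * N) :
    majorana N j * majorana N k = -(majorana N k * majorana N j) := by
  have hj2 : j / 2 ≤ k / 2 := Nat.div_le_div_right hjk.le
  refine tensor_anticommute ⟨j / 2, by omega⟩ ?_ ?_
  · rintro ⟨i, hi⟩ hne
    have hne' : i ≠ j / 2 := fun h => hne (Fin.ext h)
    by_cases h1 : i < j / 2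
    · have : i < k / 2 := by omega
      simp [h1, this]
    · simp [h1, hne']
  · rcases hj2.eq_or_lt with h | h
    · have hj0 : j % 2 = 0 := by omega
      have hk0 : k % 2 ≠ 0 := by omega
      simp only [h, lt_irrefl, if_false, if_true, hj0, hk0, pauliX_mul_pauliY, pauliY_mul_pauliX,
        neg_neg]
    · simp only [h, lt_irrefl, if_false, if_true]
      split_ifs <;> simp [pauliX_mul_pauliZ, pauliZ_mul_pauliX, pauliY_mul_pauliZ,
        pauliZ_mul_pauliY]

lemma majorana_anticommute {N j k : ℕ} (hjk : j ≠ k) (hj : j < 2 * N) (hk : k < 2 * N) :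
    majorana N j * majorana N k = -(majorana N k * majorana N j) := by
  rcases lt_or_gt_of_ne hjk with h | h
  · exact majorana_anticommute_of_lt h hk
  · rw [majorana_anticommute_of_lt h hj, neg_neg]

/-- The parity operator `Z ⊗ ⋯ ⊗ Z`, which anticommutes with every Majorana operator. -/
def parity (N : ℕ) : Op N := tensor fun _ => pauliZ

lemma parity_mul_self (N : ℕ) : parity N * parity N = 1 := by
  rw [parity, tensor_mul, ← tensor_one]; simp [pauliZ_sq]

lemma parity_mul_majorana {N j : ℕ} (hj : j < 2 * N) :
    parity N * majorana N j = -(majorana N j * parity N) := by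
  refine tensor_anticommute ⟨j / 2, by omega⟩ ?_ ?_
  · rintro ⟨i, hi⟩ hne
    have hne' : i ≠ j / 2 := fun h => hne (Fin.ext h)
    simp only [hne', if_false]; split_ifs <;> simp
  · simp only [lt_irrefl, if_false, if_true]
    split_ifs <;> simp [pauliX_mul_pauliZ, pauliZ_mul_pauliX, pauliY_mul_pauliZ,
        pauliZ_mul_pauliY]

/-- The operator `γ_j Γ` with `Γ` the parity.  It anticommutes with `γ_j` and commutes with all
other Majorana operators, so that `Commute (flip N j) A` says that `A` does not involve `γ_j`. -/
def flip (N j : ℕ) : Op N := majorana N j * parity N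

lemma flip_mul_inv (N j : ℕ) : flip N j * (parity N * majorana N j) = 1 := by
  rw [flip, mul_assoc, ← mul_assoc (parity N), parity_mul_self, one_mul, majorana_mul_self]

lemma flip_commute {N i j : ℕ} (hij : i ≠ j) (hi : i < 2 * N) (hj : j < 2 * N) :
    Commute (flip N j) (majorana N i) := by
  rw [Commute, SemiconjBy, flip, mul_assoc, parity_mul_majorana hi, mul_neg, ← mul_assoc,
    majorana_anticommute hij.symm hj hi, neg_mul, neg_neg, mul_assoc]

lemma flip_anticommute {N j : ℕ} (hj : j < 2 * N) :
    flip N j * majorana N j = -(majorana N j * flip N j) := by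
  rw [flip, mul_assoc, parity_mul_majorana hj, mul_neg]

/-- The trace is invariant under conjugation by `flip N j`, so it vanishes on operators that
anticommute with it. -/
lemma trace_eq_zero_of_flip {N j : ℕ} {A : Op N} (h : flip N j * A = -(A * flip N j)) :
    A.trace = 0 := by
  have h1 : A.trace = (flip N j * A * (parity N * majorana N j)).trace := by
    rw [Matrix.trace_mul_comm, ← mul_assoc,
      (mul_eq_one_comm.mp (flip_mul_inv N j) : parity N * majorana N j * flip N j = 1), one_mul]
  rw [h, neg_mul, mul_assoc, flip_mul_inv, mul_one, Matrix.trace_neg] at h1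
  linear_combination h1 / 2

/-! ### Ordered products of Majorana operators -/

lemma sort_insert_of_lt {s : Finset ℕ} {m : ℕ} (h : ∀ x ∈ s, x < m) :
    (insert m s).sort (· ≤ ·) = s.sort (· ≤ ·) ++ [m] := by
  have hm : m ∉ s := fun hm => lt_irrefl _ (h m hm)
  refine List.Perm.eq_of_pairwise' (r := (· ≤ ·)) (Finset.pairwise_sort _ _) ?_ ?_
  · rw [List.pairwise_append]
    refine ⟨Finset.pairwise_sort _ _, by simp, ?_⟩
    intro a ha b hb
    simp only [List.mem_singleton] at hb
    subst hb
    exact (h a (by simpa using ha)).le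
  · refine (List.perm_ext_iff_of_nodup (Finset.sort_nodup _ _) ?_).mpr ?_
    · rw [List.nodup_append]
      refine ⟨Finset.sort_nodup _ _, by simp, ?_⟩
      intro a ha b hb
      simp only [List.mem_singleton] at hb
      subst hb
      exact (h a (by simpa using ha)).ne
    · intro a; simp [or_comm]

lemma majoranaProd_empty (N : ℕ) : majoranaProd N ∅ = 1 := by simp [majoranaProd]

lemma majoranaProd_insert {N m : ℕ} {s : Finset ℕ} (h : ∀ x ∈ s, x < m) :
    majoranaProd N (insert m s) = majoranaProd N s * majorana N m := by
  simp [majoranaProd, sort_insert_of_lt h]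

lemma majoranaProd_conjTranspose_mul_self (N : ℕ) (s : Finset ℕ) :
    (majoranaProd N s).conjTranspose * majoranaProd N s = 1 := by
  induction s using Finset.induction_on_max with
  | empty => simp [majoranaProd_empty]
  | insert m s hm ih =>
    rw [majoranaProd_insert hm, Matrix.conjTranspose_mul, majorana_conjTranspose, mul_assoc,
      ← mul_assoc _ (majoranaProd N s), ih, one_mul, majorana_mul_self]

lemma majorana_mul_majoranaProd {N j : ℕ} {s : Finset ℕ} (hj : j < 2 * N) (hs : ∀ x ∈ s, x < 2 * N)
    (hjs : j ∉ s) :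
    majorana N j * majoranaProd N s = (-1 : ℂ) ^ s.card • (majoranaProd N s * majorana N j) := by
  induction s using Finset.induction_on_max with
  | empty => simp [majoranaProd_empty]
  | insert m s hm ih =>
    have hms : m ∉ s := fun h => lt_irrefl _ (hm m h)
    simp only [Finset.mem_insert, not_or] at hjs
    rw [majoranaProd_insert hm, ← mul_assoc, ih (fun x hx => hs x (by simp [hx])) hjs.2,
      smul_mul_assoc, mul_assoc, majorana_anticommute hjs.1 hj (hs m (by simp)),
      Finset.card_insert_of_notMem hms, pow_succ, mul_neg, mul_assoc]
    simp

lemma majoranaProd_conjTranspose {N : ℕ} {s : Finset ℕ} (hs : ∀ x ∈ s, x < 2 * N) :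
    (majoranaProd N s).conjTranspose = (-1 : ℂ) ^ s.card.choose 2 • majoranaProd N s := by
  induction s using Finset.induction_on_max with
  | empty => simp [majoranaProd_empty]
  | insert m s hm ih =>
    have hms : m ∉ s := fun h => lt_irrefl _ (hm m h)
    rw [majoranaProd_insert hm, Matrix.conjTranspose_mul, majorana_conjTranspose,
      ih (fun x hx => hs x (by simp [hx])), mul_smul_comm,
      majorana_mul_majoranaProd (hs m (by simp)) (fun x hx => hs x (by simp [hx])) hms, smul_smul,
      Finset.card_insert_of_notMem hms, Nat.choose_succ_succ' s.card 1, pow_add,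
      Nat.choose_one_right, mul_comm]

lemma majoranaProd_mul_of_disjoint {N : ℕ} {s t : Finset ℕ} (hs : ∀ x ∈ s, x < 2 * N)
    (ht : ∀ x ∈ t, x < 2 * N) (hst : Disjoint s t) :
    majoranaProd N s * majoranaProd N t =
      (-1 : ℂ) ^ (s.card * t.card) • (majoranaProd N t * majoranaProd N s) := by
  induction s using Finset.induction_on_max with
  | empty => simp [majoranaProd_empty]
  | insert m s hm ih =>
    have hms : m ∉ s := fun h => lt_irrefl _ (hm m h)
    rw [Finset.disjoint_insert_left] at hst
    rw [majoranaProd_insert hm, mul_assoc, majorana_mul_majoranaProd (hs m (by simp)) ht hst.1,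
      mul_smul_comm, ← mul_assoc, ih (fun x hx => hs x (by simp [hx])) hst.2,
      Finset.card_insert_of_notMem hms, smul_mul_assoc, smul_smul, mul_assoc, add_mul, one_mul,
      pow_add, mul_comm ((-1 : ℂ) ^ t.card)]

lemma flip_commute_majoranaProd {N j : ℕ} {s : Finset ℕ} (hj : j < 2 * N)
    (hs : ∀ x ∈ s, x < 2 * N) (hjs : j ∉ s) : Commute (flip N j) (majoranaProd N s) := by
  induction s using Finset.induction_on_max with
  | empty => simp [majoranaProd_empty]
  | insert m s hm ih =>
    simp only [Finset.mem_insert, not_or] at hjs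
    rw [majoranaProd_insert hm]
    exact (ih (fun x hx => hs x (by simp [hx])) hjs.2).mul_right
      (flip_commute (Ne.symm hjs.1) (hs m (by simp)) hj)

lemma flip_anticommute_majoranaProd {N j : ℕ} {s : Finset ℕ}
    (hs : ∀ x ∈ s, x < 2 * N) (hjs : j ∈ s) :
    flip N j * majoranaProd N s = -(majoranaProd N s * flip N j) := by
  induction s using Finset.induction_on_max with
  | empty => simp at hjs
  | insert m s hm ih =>
    have hms : m ∉ s := fun h => lt_irrefl _ (hm m h)
    have hs' : ∀ x ∈ s, x < 2 * N := fun x hx => hs x (by simp [hx])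
    have hm2 := hs m (by simp)
    rw [majoranaProd_insert hm]
    by_cases hjm : j = m
    · subst hjm
      rw [← mul_assoc, (flip_commute_majoranaProd hm2 hs' hms).eq, mul_assoc,
        flip_anticommute hm2, mul_neg, mul_assoc]
    · have hjs' : j ∈ s := by simpa [hjm] using hjs
      rw [← mul_assoc, ih hs' hjs', neg_mul, mul_assoc,
        (flip_commute (Ne.symm hjm) hm2 (hs' j hjs')).eq, mul_assoc]

lemma conjTranspose_flip_comm {N j : ℕ} {s : Finset ℕ} {c : ℂ} (hs : ∀ x ∈ s, x < 2 * N)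
    (h : flip N j * majoranaProd N s = c • (majoranaProd N s * flip N j)) :
    flip N j * (majoranaProd N s).conjTranspose =
      c • ((majoranaProd N s).conjTranspose * flip N j) := by
  rw [majoranaProd_conjTranspose hs, mul_smul_comm, h, smul_mul_assoc, smul_comm]

/-- Distinct ordered Majorana products are orthogonal for the Hilbert-Schmidt inner product. -/
lemma trace_majoranaProd_mul {N : ℕ} {s t : Finset ℕ} (hs : ∀ x ∈ s, x < 2 * N)
    (ht : ∀ x ∈ t, x < 2 * N) (hst : s ≠ t) :
    ((majoranaProd N s).conjTranspose * majoranaProd N t).trace = 0 := by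
  have key : ∀ j, ((j ∈ s ∧ j ∉ t) ∨ (j ∈ t ∧ j ∉ s)) →
      ((majoranaProd N s).conjTranspose * majoranaProd N t).trace = 0 := by
    rintro j (⟨h1, h2⟩ | ⟨h1, h2⟩)
    · refine trace_eq_zero_of_flip (j := j) ?_
      rw [← mul_assoc, conjTranspose_flip_comm (c := -1) hs
        (by rw [flip_anticommute_majoranaProd hs h1]; simp), smul_mul_assoc, mul_assoc,
        (flip_commute_majoranaProd (hs j h1) ht h2).eq, mul_assoc]
      simp
    · refine trace_eq_zero_of_flip (j := j) ?_
      rw [← mul_assoc, conjTranspose_flip_comm (c := 1) hs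
        (by rw [(flip_commute_majoranaProd (ht j h1) hs h2).eq]; simp), one_smul, mul_assoc,
        flip_anticommute_majoranaProd ht h1, mul_assoc]
      simp
  by_contra hne
  refine hst (Finset.ext fun j => ?_)
  by_contra hj
  refine hne (key j ?_)
  tauto

end SparseSYK
namespace SparseSYK

/-! ### Adding qubits and tracing them out -/

open scoped Kronecker in
/-- The operator `A ⊗ 1` on `a + b` qubits. -/
def extend (a b : ℕ) : Op a →ₐ[ℂ] Op (a + b) where
  toFun A := (A ⊗ₖ (1 : Op b)).submatrix (Fin.appendEquiv a b).symm (Fin.appendEquiv a b).symm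
  map_one' := by simp
  map_mul' A B := by
    rw [Matrix.submatrix_mul_equiv, ← Matrix.mul_kronecker_mul, one_mul]
  map_zero' := by simp
  map_add' A B := by rw [Matrix.add_kronecker]; rfl
  commutes' r := by
    simp only [Algebra.algebraMap_eq_smul_one, Matrix.smul_kronecker, Matrix.one_kronecker_one]
    rw [Matrix.submatrix_smul]; simp

lemma extend_append {a b : ℕ} (A : Op a) (x y : Basis a) (z w : Basis b) :
    extend a b A (Fin.append x z) (Fin.append y w) = A x y * (1 : Op b) z w := by
  have h : ∀ (x : Basis a) (z : Basis b), (Fin.appendEquiv a b).symm (Fin.append x z) = (x, z) :=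
    fun x z => (Fin.appendEquiv a b).symm_apply_apply (x, z)
  simp [extend, h]

lemma basis_append_ext {a b : ℕ} {A B : Op (a + b)}
    (h : ∀ (x y : Basis a) (z w : Basis b),
      A (Fin.append x z) (Fin.append y w) = B (Fin.append x z) (Fin.append y w)) : A = B := by
  ext x y
  obtain ⟨⟨x, z⟩, rfl⟩ := (Fin.appendEquiv a b).surjective x
  obtain ⟨⟨y, w⟩, rfl⟩ := (Fin.appendEquiv a b).surjective y
  exact h x y z w

lemma sum_basis_append {a b : ℕ} {M : Type*} [AddCommMonoid M] (f : Basis (a + b) → M) :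
    ∑ x, f x = ∑ x : Basis a, ∑ z : Basis b, f (Fin.append x z) := by
  rw [← (Fin.appendEquiv a b).sum_comp, Fintype.sum_prod_type]; rfl

lemma extend_tensor {a b : ℕ} (f : Fin a → Matrix (Fin 2) (Fin 2) ℂ) :
    extend a b (tensor f) = tensor (Fin.append f fun _ => 1) := by
  refine basis_append_ext fun x y z w => ?_
  rw [extend_append, ← tensor_one]
  simp only [tensor, Matrix.of_apply, Fin.prod_univ_add, Fin.append_left, Fin.append_right]
  congr 1
  refine Finset.prod_congr rfl fun i _ => ?_
  rw [Fin.append_right, Fin.append_right]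

lemma extend_majorana {a b j : ℕ} (hj : j < 2 * a) :
    extend a b (majorana a j) = majorana (a + b) j := by
  rw [majorana, extend_tensor, majorana]
  congr 1; funext i
  refine Fin.addCases (fun i => ?_) (fun i => ?_) i
  · simp
  · have h1 : ¬ (a + (i : ℕ) < j / 2) := by omega
    have h2 : ¬ (a + (i : ℕ) = j / 2) := by omega
    simp [h1, h2]

lemma extend_onQubit {a b q : ℕ} (hq : q < a) (U : Matrix (Fin 2) (Fin 2) ℂ) :
    extend a b (onQubit a q U) = onQubit (a + b) q U := by
  rw [onQubit, extend_tensor, onQubit]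
  congr 1; funext i
  refine Fin.addCases (fun i => ?_) (fun i => ?_) i
  · simp
  · have h2 : ¬ (a + (i : ℕ) = q) := by omega
    simp [h2]

lemma extend_majoranaProd {a b : ℕ} {s : Finset ℕ} (hs : ∀ x ∈ s, x < 2 * a) :
    extend a b (majoranaProd a s) = majoranaProd (a + b) s := by
  rw [majoranaProd, map_list_prod, List.map_map, majoranaProd]
  congr 1
  refine List.map_congr_left fun j hj => ?_
  exact extend_majorana (hs j (by simpa using hj))

lemma reduce_extend_mul {a b : ℕ} (A : Op a) (ρ : Op (a + b)) :
    reduce (extend a b A * ρ) = A * reduce ρ := by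
  ext x y
  simp only [reduce, Matrix.of_apply, Matrix.mul_apply, sum_basis_append, extend_append,
    Matrix.one_apply, Finset.mul_sum]
  rw [Finset.sum_comm]
  simp

lemma trace_reduce {a b : ℕ} (ρ : Op (a + b)) : (reduce ρ).trace = ρ.trace := by
  simp [Matrix.trace, reduce, sum_basis_append]

lemma trace_mul_reduce {a b : ℕ} (A : Op a) (ρ : Op (a + b)) :
    (A * reduce ρ).trace = (extend a b A * ρ).trace := by
  rw [← reduce_extend_mul, trace_reduce]

/-- The Hamiltonian on the qubits that also carry the ancilla modes. -/
noncomputable def hamExt {n : ℕ} (p : unitInterval) (ω : Disorder n) : Op (hoQubits n) :=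
  ∑ I ∈ Finset.powersetCard 4 (Finset.range (2 * n)),
    (hamCoeff p ω I : ℂ) • majoranaProd (hoQubits n) I

lemma sykEnergy_eq {n : ℕ} (p : unitInterval) (ω : Disorder n) (ρ : Op (hoQubits n)) :
    sykEnergy p ω ρ = ((hamExt p ω * ρ).trace).re := by
  have h : extend n (halfChi n) (hamiltonian p ω) = hamExt p ω := by
    rw [hamiltonian, map_sum, hamExt]
    refine Finset.sum_congr rfl fun I hI => ?_
    rw [map_smul, extend_majoranaProd]
    · rfl
    · intro x hx
      simpa using (Finset.mem_powersetCard.mp hI).1 hx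
  rw [← h]
  exact congrArg Complex.re (trace_mul_reduce (a := n) (b := halfChi n) _ ρ)

end SparseSYK
namespace SparseSYK

/-! ### The Hilbert-Schmidt norm -/

section HilbertSchmidt
open scoped Matrix.Norms.Frobenius

variable {m : Type*} [Fintype m]

lemma trace_conjTranspose_mul_eq_sum (A B : Matrix m m ℂ) :
    (A.conjTranspose * B).trace = ∑ x, ∑ y, star (A x y) * B x y := by
  simp only [Matrix.trace, Matrix.diag, Matrix.mul_apply, Matrix.conjTranspose_apply]
  exact Finset.sum_comm

lemma frobenius_sq_eq_sum (A : Matrix m m ℂ) : ‖A‖ ^ 2 = ∑ x, ∑ y, ‖A x y‖ ^ 2 := by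
  rw [Matrix.frobenius_norm_def, ← Real.sqrt_eq_rpow, Real.sq_sqrt (by positivity)]
  simp

lemma trace_conjTranspose_mul_self (A : Matrix m m ℂ) :
    (A.conjTranspose * A).trace = ((‖A‖ ^ 2 : ℝ) : ℂ) := by
  rw [trace_conjTranspose_mul_eq_sum, frobenius_sq_eq_sum]
  push_cast
  refine Finset.sum_congr rfl fun x _ => Finset.sum_congr rfl fun y _ => ?_
  exact Complex.conj_mul' _

lemma norm_trace_conjTranspose_mul_le (A B : Matrix m m ℂ) :
    ‖(A.conjTranspose * B).trace‖ ≤ ‖A‖ * ‖B‖ := by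
  rw [trace_conjTranspose_mul_eq_sum, ← Fintype.sum_prod_type' (f := fun x y => star (A x y) * B x y)]
  refine (norm_sum_le _ _).trans ?_
  simp only [norm_mul, norm_star]
  refine (Real.sum_mul_le_sqrt_mul_sqrt _ _ _).trans (le_of_eq ?_)
  rw [Fintype.sum_prod_type' (f := fun x y => ‖A x y‖ ^ 2),
    Fintype.sum_prod_type' (f := fun x y => ‖B x y‖ ^ 2), ← frobenius_sq_eq_sum,
    ← frobenius_sq_eq_sum, Real.sqrt_sq (norm_nonneg _), Real.sqrt_sq (norm_nonneg _)]

lemma frobenius_eq_of_trace {A B : Matrix m m ℂ}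
    (h : (A.conjTranspose * A).trace = (B.conjTranspose * B).trace) : ‖A‖ = ‖B‖ := by
  rw [trace_conjTranspose_mul_self, trace_conjTranspose_mul_self] at h
  have h' : ‖A‖ ^ 2 = ‖B‖ ^ 2 := by exact_mod_cast h
  exact (pow_left_inj₀ (norm_nonneg _) (norm_nonneg _) two_ne_zero).mp h'

lemma frobenius_sq_add {A B : Matrix m m ℂ} (h : (A.conjTranspose * B).trace = 0) :
    ‖A + B‖ ^ 2 = ‖A‖ ^ 2 + ‖B‖ ^ 2 := by
  have h' : (B.conjTranspose * A).trace = 0 := by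
    have := congrArg star h
    rwa [← Matrix.trace_conjTranspose, Matrix.conjTranspose_mul, Matrix.conjTranspose_conjTranspose,
      star_zero] at this
  have h3 := trace_conjTranspose_mul_self (A + B)
  rw [Matrix.conjTranspose_add, add_mul, mul_add, mul_add, Matrix.trace_add, Matrix.trace_add,
    Matrix.trace_add, h, h', trace_conjTranspose_mul_self, trace_conjTranspose_mul_self] at h3
  simp only [add_zero, zero_add] at h3
  exact_mod_cast h3.symm

lemma frobenius_sq_sum {ι : Type*} (s : Finset ι) (A : ι → Matrix m m ℂ)
    (h : ∀ i ∈ s, ∀ j ∈ s, i ≠ j → ((A i).conjTranspose * A j).trace = 0) :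
    ‖∑ i ∈ s, A i‖ ^ 2 = ∑ i ∈ s, ‖A i‖ ^ 2 := by
  classical
  induction s using Finset.induction_on with
  | empty => simp
  | insert a s ha ih =>
    rw [Finset.sum_insert ha, Finset.sum_insert ha, frobenius_sq_add, ih]
    · exact fun i hi j hj => h i (by simp [hi]) j (by simp [hj])
    · rw [Matrix.mul_sum, Matrix.trace_sum]
      refine Finset.sum_eq_zero fun j hj => h a (by simp) j (by simp [hj]) ?_
      rintro rfl; exact ha hj

lemma frobenius_mul_conjTranspose (A : Matrix m m ℂ) :
    ‖A * A.conjTranspose‖ = ‖A.conjTranspose * A‖ := by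
  refine frobenius_eq_of_trace ?_
  simp only [Matrix.conjTranspose_mul, Matrix.conjTranspose_conjTranspose]
  rw [mul_assoc, Matrix.trace_mul_comm]
  simp only [mul_assoc]

lemma frobenius_conjTranspose_mul_sq_le (A B : Matrix m m ℂ) :
    ‖A.conjTranspose * B‖ ^ 2 ≤ ‖A.conjTranspose * A‖ * ‖B.conjTranspose * B‖ := by
  have h := trace_conjTranspose_mul_self (A.conjTranspose * B)
  rw [Matrix.conjTranspose_mul, Matrix.conjTranspose_conjTranspose, mul_assoc,
    Matrix.trace_mul_comm, ← mul_assoc, mul_assoc] at h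
  have h2 := norm_trace_conjTranspose_mul_le (A * A.conjTranspose) (B * B.conjTranspose)
  rw [Matrix.conjTranspose_mul, Matrix.conjTranspose_conjTranspose, h,
    frobenius_mul_conjTranspose, frobenius_mul_conjTranspose, Complex.norm_real,
    Real.norm_of_nonneg (by positivity)] at h2
  exact h2

variable [DecidableEq m]

lemma frobenius_isometry_mul {U : Matrix m m ℂ} (hU : U.conjTranspose * U = 1)
    (A : Matrix m m ℂ) : ‖U * A‖ = ‖A‖ := by
  refine frobenius_eq_of_trace ?_
  rw [Matrix.conjTranspose_mul, mul_assoc, ← mul_assoc _ U, hU, one_mul]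

lemma frobenius_mul_isometry {U : Matrix m m ℂ} (hU : U.conjTranspose * U = 1)
    (A : Matrix m m ℂ) : ‖A * U‖ = ‖A‖ := by
  refine frobenius_eq_of_trace ?_
  rw [Matrix.conjTranspose_mul, mul_assoc, Matrix.trace_mul_comm, mul_assoc, mul_assoc,
    mul_eq_one_comm.mp hU, mul_one]

lemma frobenius_one_sq : ‖(1 : Matrix m m ℂ)‖ ^ 2 = Fintype.card m := by
  have := trace_conjTranspose_mul_self (1 : Matrix m m ℂ)
  rw [Matrix.conjTranspose_one, one_mul, Matrix.trace_one] at this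
  exact_mod_cast this.symm

end HilbertSchmidt

/-! ### Hypercontractivity for Majorana polynomials -/

section Hypercontractivity
open scoped Matrix.Norms.Frobenius

/-- Polynomials of degree at most `k` in the first `m` Majorana operators on `N` qubits. -/
def majoranaPoly (N m k : ℕ) : Submodule ℂ (Op N) :=
  Submodule.span ℂ (majoranaProd N '' {s | (∀ x ∈ s, x < m) ∧ s.card ≤ k})

lemma majoranaProd_mem_majoranaPoly {N m k : ℕ} {s : Finset ℕ} (h : ∀ x ∈ s, x < m)
    (hk : s.card ≤ k) : majoranaProd N s ∈ majoranaPoly N m k :=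
  Submodule.subset_span ⟨s, ⟨h, hk⟩, rfl⟩

/-- A polynomial in `m + 1` variables is affine in the last one, and the coefficient of the last
variable has lower degree. -/
lemma exists_of_mem_majoranaPoly_succ {N m k : ℕ} {f : Op N}
    (hf : f ∈ majoranaPoly N (m + 1) (k + 1)) :
    ∃ g ∈ majoranaPoly N m (k + 1), ∃ h ∈ majoranaPoly N m k, f = g + h * majorana N m := by
  induction hf using Submodule.span_induction with
  | mem x hx =>
    obtain ⟨s, ⟨hs, hk⟩, rfl⟩ := hx
    by_cases hm : m ∈ s
    · have h1 : ∀ x ∈ s.erase m, x < m := fun x hx => by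
        have := hs x (Finset.mem_of_mem_erase hx)
        have := Finset.ne_of_mem_erase hx
        omega
      refine ⟨0, zero_mem _, majoranaProd N (s.erase m), majoranaProd_mem_majoranaPoly h1 ?_, ?_⟩
      · rw [Finset.card_erase_of_mem hm]; omega
      · rw [← majoranaProd_insert h1, Finset.insert_erase hm, zero_add]
    · refine ⟨majoranaProd N s, majoranaProd_mem_majoranaPoly (fun x hx => ?_) hk, 0, zero_mem _,
        by simp⟩
      have := hs x hx
      have : x ≠ m := by rintro rfl; exact hm hx
      omega
  | zero => exact ⟨0, zero_mem _, 0, zero_mem _, by simp⟩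
  | add x y _ _ hx hy =>
    obtain ⟨g, hg, h, hh, rfl⟩ := hx
    obtain ⟨g', hg', h', hh', rfl⟩ := hy
    exact ⟨g + g', add_mem hg hg', h + h', add_mem hh hh', by rw [add_mul]; abel⟩
  | smul a x _ hx =>
    obtain ⟨g, hg, h, hh, rfl⟩ := hx
    exact ⟨a • g, Submodule.smul_mem _ _ hg, a • h, Submodule.smul_mem _ _ hh, by simp⟩

lemma majoranaPoly_zero {N m : ℕ} {f : Op N} (hf : f ∈ majoranaPoly N m 0) : ∃ c : ℂ, f = c • 1 := by
  induction hf using Submodule.span_induction with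
  | mem x hx =>
    obtain ⟨s, ⟨-, hk⟩, rfl⟩ := hx
    rw [Finset.card_eq_zero.mp (Nat.le_zero.mp hk)]
    exact ⟨1, by simp [majoranaProd_empty]⟩
  | zero => exact ⟨0, by simp⟩
  | add x y _ _ hx hy =>
    obtain ⟨c, rfl⟩ := hx
    obtain ⟨d, rfl⟩ := hy
    exact ⟨c + d, by rw [add_smul]⟩
  | smul a x _ hx =>
    obtain ⟨c, rfl⟩ := hx
    exact ⟨a * c, by rw [mul_smul]⟩

lemma majoranaPoly_zero_left {N k : ℕ} {f : Op N} (hf : f ∈ majoranaPoly N 0 k) :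
    ∃ c : ℂ, f = c • 1 := by
  refine majoranaPoly_zero (m := 0) (Submodule.span_mono ?_ hf)
  rintro _ ⟨s, ⟨hs, -⟩, rfl⟩
  refine ⟨s, ⟨hs, ?_⟩, rfl⟩
  rw [Nat.le_zero, Finset.card_eq_zero]
  exact Finset.eq_empty_of_forall_notMem fun x hx => by simpa using hs x hx

lemma flip_commute_majoranaPoly {N m k : ℕ} (hm : m < 2 * N) {f : Op N}
    (hf : f ∈ majoranaPoly N m k) : Commute (flip N m) f := by
  induction hf using Submodule.span_induction with
  | mem x hx =>
    obtain ⟨s, ⟨hs, -⟩, rfl⟩ := hx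
    exact flip_commute_majoranaProd hm (fun x hx => (hs x hx).trans hm)
      fun h => lt_irrefl _ (hs m h)
  | zero => exact Commute.zero_right _
  | add x y _ _ hx hy => exact hx.add_right hy
  | smul a x _ hx => exact hx.smul_right a

lemma flip_conjTranspose {N j : ℕ} (hj : j < 2 * N) : (flip N j).conjTranspose = -flip N j := by
  rw [flip, Matrix.conjTranspose_mul, majorana_conjTranspose, parity, tensor_conjTranspose]
  simp only [pauliZ_conjTranspose]
  exact parity_mul_majorana hj

lemma Commute.flip_conjTranspose {N j : ℕ} (hj : j < 2 * N) {A : Op N}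
    (h : Commute (flip N j) A) : Commute (flip N j) A.conjTranspose := by
  have := congrArg Matrix.conjTranspose h.eq
  rw [Matrix.conjTranspose_mul, Matrix.conjTranspose_mul, SparseSYK.flip_conjTranspose hj, mul_neg,
    neg_mul, neg_inj] at this
  exact this.symm

lemma card_basis (N : ℕ) : Fintype.card (Basis N) = 2 ^ N := by simp

lemma hypercontractivity_scalar {N : ℕ} (c : ℂ) (k : ℕ) :
    2 ^ N * ‖(c • (1 : Op N)).conjTranspose * c • (1 : Op N)‖ ^ 2 ≤
      9 ^ k * (‖c • (1 : Op N)‖ ^ 2) ^ 2 := by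
  have h1 : (c • (1 : Op N)).conjTranspose * c • (1 : Op N) = (star c * c) • 1 := by
    simp [Matrix.conjTranspose_smul, smul_smul, mul_comm]
  have h2 : ‖(1 : Op N)‖ ^ 2 = 2 ^ N := by rw [frobenius_one_sq, card_basis]; simp
  rw [h1, norm_smul, norm_smul, norm_mul, norm_star, mul_pow, mul_pow, mul_pow, h2]
  have h9 : (1 : ℝ) ≤ 9 ^ k := one_le_pow₀ (by norm_num)
  have : 0 ≤ (‖c‖ ^ 2 * 2 ^ N) ^ 2 := by positivity
  nlinarith

/-- The numerical core of the induction step. Here `a`, `b`, `x` stand for the norms of `g† g`,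
`h† h` and `g† h`, the squared norms of `g` and `h` are `G` and `H`, and `e`, `o` are the norms of
the even and of the odd part of `f† f`. -/
lemma hypercontractivity_arith {d c a b e o x G H : ℝ} (hd : 0 < d) (hc : 0 < c) (ha : 0 ≤ a)
    (hb : 0 ≤ b) (he : 0 ≤ e) (ho : 0 ≤ o) (hG : 0 ≤ G) (hH : 0 ≤ H) (hE : e ≤ a + b)
    (hO : o ≤ 2 * x) (hX : x ^ 2 ≤ a * b) (hA : d * a ^ 2 ≤ c * 9 * G ^ 2)
    (hB : d * b ^ 2 ≤ c * H ^ 2) :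
    d * (e ^ 2 + o ^ 2) ≤ c * 9 * (G + H) ^ 2 := by
  have hab : d * (a * b) ≤ 3 * c * (G * H) := by
    refine (sq_le_sq₀ (by positivity) (by positivity)).mp ?_
    have := mul_le_mul hA hB (by positivity) (by positivity)
    nlinarith
  have hE2 : e ^ 2 ≤ (a + b) ^ 2 := by gcongr
  have hO2 : o ^ 2 ≤ (2 * x) ^ 2 := by gcongr
  have h1 : e ^ 2 + o ^ 2 ≤ (a + b) ^ 2 + 4 * (a * b) := by nlinarith
  calc _ ≤ d * ((a + b) ^ 2 + (4 * (a * b))) := mul_le_mul_of_nonneg_left h1 hd.le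
    _ = d * a ^ 2 + d * b ^ 2 + 6 * (d * (a * b)) := by ring
    _ ≤ c * 9 * G ^ 2 + c * H ^ 2 + 6 * (3 * c * (G * H)) := by gcongr
    _ ≤ _ := by nlinarith [mul_nonneg hc.le (sq_nonneg H)]

/-- Fermionic hypercontractivity: `tr (f† f)² ≤ 9 ^ k (tr f† f)²` for the normalized trace and a
Majorana polynomial `f` of degree at most `k`.  The proof is Bonami's induction on the number of
variables: in `f = g + h γ` the parts of `f† f` of even and odd degree in `γ` are orthogonal. -/
theorem hypercontractivity {N : ℕ} : ∀ (m k : ℕ) (f : Op N), m ≤ 2 * N → f ∈ majoranaPoly N m k →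
    2 ^ N * ‖f.conjTranspose * f‖ ^ 2 ≤ 9 ^ k * (‖f‖ ^ 2) ^ 2
  | 0, k, f, _, hf => by
    obtain ⟨c, rfl⟩ := majoranaPoly_zero_left hf
    exact hypercontractivity_scalar c k
  | m + 1, 0, f, _, hf => by
    obtain ⟨c, rfl⟩ := majoranaPoly_zero hf
    exact hypercontractivity_scalar c 0
  | m + 1, k + 1, f, hm, hf => by
    obtain ⟨g, hg, h, hh, rfl⟩ := exists_of_mem_majoranaPoly_succ hf
    have hm' : m < 2 * N := by omega
    have ihg := hypercontractivity m (k + 1) g hm'.le hg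
    have ihh := hypercontractivity m k h hm'.le hh
    set γ := majorana N m with hγ
    have hγγ : γ * γ = 1 := majorana_mul_self N m
    have hγh : γ.conjTranspose = γ := majorana_conjTranspose N m
    have hγu : γ.conjTranspose * γ = 1 := by rw [hγh, hγγ]
    have cg := flip_commute_majoranaPoly hm' hg
    have ch := flip_commute_majoranaPoly hm' hh
    have cg' := Commute.flip_conjTranspose hm' cg
    have ch' := Commute.flip_conjTranspose hm' ch
    have aγ : flip N m * γ = -(γ * flip N m) := flip_anticommute hm'
    have odd : ∀ A B : Op N, Commute (flip N m) A → Commute (flip N m) B →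
        flip N m * (A * γ * B) = -(A * γ * B * flip N m) := by
      intro A B hA hB
      rw [← mul_assoc, ← mul_assoc, hA.eq, mul_assoc A, aγ, mul_neg, neg_mul, mul_assoc A, mul_assoc γ,
        hB.eq]
      simp only [mul_assoc]
    have hnorm : ‖g + h * γ‖ ^ 2 = ‖g‖ ^ 2 + ‖h‖ ^ 2 := by
      rw [frobenius_sq_add, frobenius_mul_isometry hγu]
      refine trace_eq_zero_of_flip (j := m) ?_
      have := odd (g.conjTranspose * h) 1 (cg'.mul_right ch) (Commute.one_right _)
      rw [mul_one] at this
      rw [← mul_assoc g.conjTranspose]; exact this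
    have hexp : (g + h * γ).conjTranspose * (g + h * γ) =
        (g.conjTranspose * g + γ * (h.conjTranspose * h) * γ) +
          (g.conjTranspose * h * γ + γ * (h.conjTranspose * g)) := by
      rw [Matrix.conjTranspose_add, Matrix.conjTranspose_mul, hγh]
      noncomm_ring
    have hsplit : ‖(g + h * γ).conjTranspose * (g + h * γ)‖ ^ 2 =
        ‖g.conjTranspose * g + γ * (h.conjTranspose * h) * γ‖ ^ 2 +
          ‖g.conjTranspose * h * γ + γ * (h.conjTranspose * g)‖ ^ 2 := by
      rw [hexp, frobenius_sq_add]
      have cE : Commute (flip N m) (g.conjTranspose * g + γ * (h.conjTranspose * h) * γ) := by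
        refine (cg'.mul_right cg).add_right ?_
        have h1 := odd 1 (h.conjTranspose * h) (Commute.one_right _) (ch'.mul_right ch)
        rw [one_mul] at h1
        change _ = _
        rw [← mul_assoc, h1, neg_mul, mul_assoc, aγ, mul_neg, neg_neg]
        simp only [mul_assoc]
      have cE' := Commute.flip_conjTranspose hm' cE
      refine trace_eq_zero_of_flip (j := m) ?_
      have h1 := odd (g.conjTranspose * h) 1 (cg'.mul_right ch) (Commute.one_right _)
      have h2 := odd 1 (h.conjTranspose * g) (Commute.one_right _) (ch'.mul_right cg)
      rw [mul_one] at h1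
      rw [one_mul] at h2
      rw [← mul_assoc, cE'.eq, mul_assoc, mul_add, h1, h2, ← neg_add, ← add_mul, mul_neg,
        mul_assoc _ _ (flip N m)]
    have hE : ‖g.conjTranspose * g + γ * (h.conjTranspose * h) * γ‖ ≤
        ‖g.conjTranspose * g‖ + ‖h.conjTranspose * h‖ := by
      refine (norm_add_le _ _).trans (le_of_eq ?_)
      rw [frobenius_mul_isometry hγu, frobenius_isometry_mul hγu]
    have hO : ‖g.conjTranspose * h * γ + γ * (h.conjTranspose * g)‖ ≤
        2 * ‖g.conjTranspose * h‖ := by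
      refine (norm_add_le _ _).trans (le_of_eq ?_)
      rw [frobenius_mul_isometry hγu, frobenius_isometry_mul hγu,
        ← Matrix.frobenius_norm_conjTranspose (h.conjTranspose * g), Matrix.conjTranspose_mul,
        Matrix.conjTranspose_conjTranspose]
      ring
    have hgh := frobenius_conjTranspose_mul_sq_le g h
    rw [hnorm, hsplit, pow_succ (9 : ℝ) k]
    rw [pow_succ (9 : ℝ) k] at ihg
    exact hypercontractivity_arith (by positivity) (by positivity) (norm_nonneg _) (norm_nonneg _)
      (norm_nonneg _) (norm_nonneg _) (by positivity) (by positivity) hE hO hgh ihg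
      ihh

end Hypercontractivity

end SparseSYK
namespace SparseSYK

/-! ### Conjugation by a one-parameter unitary group -/

section ConjExp
open scoped Matrix.Norms.Frobenius

variable {m : Type*} [Fintype m] [DecidableEq m]

/-- The conjugated operator `e^{sY} X e^{-sY}`. -/
noncomputable def conjExp (Y X : Matrix m m ℂ) (s : ℝ) : Matrix m m ℂ :=
  NormedSpace.exp (s • Y) * X * NormedSpace.exp (s • -Y)

lemma conjExp_zero (Y X : Matrix m m ℂ) : conjExp Y X 0 = X := by simp [conjExp]

lemma hasDerivAt_conjExp (Y X : Matrix m m ℂ) (s : ℝ) :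
    HasDerivAt (conjExp Y X) (conjExp Y (Y * X - X * Y) s) s := by
  have h1 := hasDerivAt_exp_smul_const (𝕂 := ℝ) Y s
  have h2 := hasDerivAt_exp_smul_const' (𝕂 := ℝ) (-Y) s
  convert! (h1.mul_const X).mul h2 using 1
  simp only [conjExp]
  noncomm_ring

lemma exp_skew_conjTranspose_mul {Y : Matrix m m ℂ} (hY : Y.conjTranspose = -Y) (s : ℝ) :
    (NormedSpace.exp (s • Y)).conjTranspose * NormedSpace.exp (s • Y) = 1 := by
  rw [← Matrix.exp_conjTranspose, Matrix.conjTranspose_smul, hY, star_trivial, smul_neg,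
    ← Matrix.exp_add_of_commute _ _ (Commute.refl (s • Y)).neg_left, neg_add_cancel, NormedSpace.exp_zero]

lemma norm_conjExp {Y : Matrix m m ℂ} (hY : Y.conjTranspose = -Y) (X : Matrix m m ℂ) (s : ℝ) :
    ‖conjExp Y X s‖ = ‖X‖ := by
  rw [conjExp, frobenius_mul_isometry, frobenius_isometry_mul (exp_skew_conjTranspose_mul hY s)]
  exact exp_skew_conjTranspose_mul (Y := -Y) (by rw [Matrix.conjTranspose_neg, hY]) s

/-- The derivative of the conjugation is the conjugated commutator, whose norm is constant. -/
lemma norm_conjExp_sub_le {Y : Matrix m m ℂ} (hY : Y.conjTranspose = -Y) (X : Matrix m m ℂ)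
    {s : ℝ} (hs : 0 ≤ s) : ‖conjExp Y X s - X‖ ≤ s * ‖Y * X - X * Y‖ := by
  have := norm_image_sub_le_of_norm_deriv_le_segment' (f := conjExp Y X) (a := 0) (b := s)
    (fun x _ => (hasDerivAt_conjExp Y X x).hasDerivWithinAt)
    (fun x _ => (norm_conjExp hY _ x).le) s ⟨hs, le_rfl⟩
  rw [conjExp_zero, sub_zero, mul_comm] at this
  exact this

/-- Cyclicity of the trace moves a commutator with the generator of the conjugation from one factor
to the other. -/
lemma trace_conjExp_commutator (Y X σ : Matrix m m ℂ) (s : ℝ) :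
    (conjExp Y (Y * X - X * Y) s * σ).trace = (conjExp Y X s * (σ * Y - Y * σ)).trace := by
  have h1 : NormedSpace.exp (s • Y) * Y = Y * NormedSpace.exp (s • Y) :=
    (((Commute.refl Y).smul_right s).exp_right).eq.symm
  have h2 : Y * NormedSpace.exp (s • -Y) = NormedSpace.exp (s • -Y) * Y :=
    (((Commute.refl Y).neg_right.smul_right s).exp_right).eq
  have h3 : conjExp Y (Y * X - X * Y) s = Y * conjExp Y X s - conjExp Y X s * Y := by
    simp only [conjExp, mul_sub, sub_mul]
    rw [← mul_assoc, h1, ← mul_assoc, mul_assoc _ Y, h2]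
    simp only [mul_assoc]
  rw [h3, sub_mul, mul_sub, Matrix.trace_sub, Matrix.trace_sub, mul_assoc, Matrix.trace_mul_comm Y]
  simp only [mul_assoc]

/-- First-order expansion of `∑ Tr (e^{sY} τ_t e^{-sY} σ_t)` when `[σ_t, Y] = 2 τ_t`.  The error of
the derivative is controlled by Hilbert-Schmidt norms of commutators because conjugation by
a unitary preserves them. -/
lemma sum_trace_conjExp_ge {ι : Type*} (T : Finset ι) {Y : Matrix m m ℂ}
    (hY : Y.conjTranspose = -Y) (τ σ : ι → Matrix m m ℂ)
    (hτ : ∀ t ∈ T, (τ t).conjTranspose = τ t) (hσ : ∀ t ∈ T, σ t * Y - Y * σ t = (2 : ℂ) • τ t)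
    {s₀ : ℝ} (hs₀ : 0 ≤ s₀) :
    (∑ t ∈ T, (τ t * σ t).trace.re) +
        s₀ * (2 * ∑ t ∈ T, ‖τ t‖ ^ 2 - 2 * s₀ * ∑ t ∈ T, ‖Y * τ t - τ t * Y‖ * ‖τ t‖) ≤
      ∑ t ∈ T, (conjExp Y (τ t) s₀ * σ t).trace.re := by
  set F : ℝ → ℝ := fun s => ∑ t ∈ T, (conjExp Y (τ t) s * σ t).trace.re with hF
  have hder : ∀ s, HasDerivAt F (∑ t ∈ T, 2 * (conjExp Y (τ t) s * τ t).trace.re) s := by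
    intro s
    refine HasDerivAt.fun_sum fun t ht => ?_
    let L : Matrix m m ℂ →ₗ[ℝ] ℝ :=
      Complex.reLm ∘ₗ ((Matrix.traceLinearMap m ℝ ℂ) ∘ₗ (LinearMap.mulRight ℝ (σ t)))
    have h := (LinearMap.toContinuousLinearMap L).hasFDerivAt.comp_hasDerivAt s
      (hasDerivAt_conjExp Y (τ t) s)
    have e : L (conjExp Y (Y * τ t - τ t * Y) s) = 2 * (conjExp Y (τ t) s * τ t).trace.re := by
      change (conjExp Y (Y * τ t - τ t * Y) s * σ t).trace.re = _
      rw [trace_conjExp_commutator, hσ t ht, mul_smul_comm, Matrix.trace_smul]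
      simp
    rw [← e]
    exact h
  have hbound : ∀ s ∈ interior (Set.Icc 0 s₀),
      2 * ∑ t ∈ T, ‖τ t‖ ^ 2 - 2 * s₀ * ∑ t ∈ T, ‖Y * τ t - τ t * Y‖ * ‖τ t‖ ≤ deriv F s := by
    intro s hs
    have hs' := interior_subset hs
    rw [(hder s).deriv, Finset.mul_sum, Finset.mul_sum, ← Finset.sum_sub_distrib]
    refine Finset.sum_le_sum fun t ht => ?_
    have h1 : (conjExp Y (τ t) s * τ t).trace =
        ((τ t).conjTranspose * (conjExp Y (τ t) s - τ t)).trace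
          + ((τ t).conjTranspose * τ t).trace := by
      rw [← Matrix.trace_add, ← mul_add, sub_add_cancel, hτ t ht, Matrix.trace_mul_comm]
    have h2 := norm_trace_conjTranspose_mul_le (τ t) (conjExp Y (τ t) s - τ t)
    have h3 := norm_conjExp_sub_le hY (τ t) hs'.1
    have h4 := (abs_le.mp (Complex.abs_re_le_norm
      ((τ t).conjTranspose * (conjExp Y (τ t) s - τ t)).trace)).1
    rw [h1, trace_conjTranspose_mul_self, Complex.add_re, Complex.ofReal_re]
    have h5 : s * ‖Y * τ t - τ t * Y‖ ≤ s₀ * ‖Y * τ t - τ t * Y‖ := by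
      gcongr; exact hs'.2
    have h6 := mul_le_mul_of_nonneg_left (h3.trans h5) (norm_nonneg (τ t))
    nlinarith
  have := (convex_Icc 0 s₀).mul_sub_le_image_sub_of_le_deriv
    (fun s _ => (hder s).continuousAt.continuousWithinAt)
    (fun s _ => (hder s).differentiableAt.differentiableWithinAt) hbound 0 ⟨le_rfl, hs₀⟩ s₀
    ⟨hs₀, le_rfl⟩ hs₀
  simp only [hF, conjExp_zero] at this
  linarith

end ConjExp

end SparseSYK
namespace SparseSYK

/-! ### Algebra of the operators `τ`, `σ`, `χ` and `ζ` -/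

section Algebra
open scoped Matrix.Norms.Frobenius

lemma nTwo_le (n : ℕ) : 2 * nTwo n ≤ n := by unfold nTwo halfChi; omega

lemma nOne_add_nTwo (n : ℕ) : nOne n + nTwo n = 2 * n := by
  unfold nOne nTwo halfChi; omega

lemma two_mul_hoQubits (n : ℕ) : 2 * hoQubits n = 2 * n + nTwo n := by
  unfold hoQubits nTwo; ring

/-- The cubic polynomial `i ∑ c_S φ_S` in the modes `φ`. -/
noncomputable def phiSum (n : ℕ) (c : Finset ℕ → ℝ) : Op (hoQubits n) :=
  ∑ S ∈ Finset.powersetCard 3 (Finset.range (nOne n)),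
    (Complex.I * (c S : ℂ)) • majoranaProd (hoQubits n) S

/-- The normalization `D = (n₁ choose 3)^(-1/2) p^(-1/2)` of the operators `τ_t`. -/
noncomputable def tauScale (n : ℕ) (p : unitInterval) : ℝ :=
  (√((nOne n).choose 3 : ℝ))⁻¹ * (√(p : ℝ))⁻¹

lemma tau_eq {n : ℕ} (p : unitInterval) (ω : Disorder n) (t : ℕ) :
    tau p ω t = phiSum n fun S => tauScale n p * coupling ω (insert (nOne n + t) S) := by
  rw [tau, phiSum, Finset.smul_sum]
  refine Finset.sum_congr rfl fun S _ => ?_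
  rw [smul_smul, tauScale]
  push_cast
  ring_nf

lemma phi_index {n : ℕ} {S : Finset ℕ} (hS : S ∈ Finset.powersetCard 3 (Finset.range (nOne n))) :
    (∀ x ∈ S, x < nOne n) ∧ (∀ x ∈ S, x < 2 * hoQubits n) ∧ S.card = 3 := by
  rw [Finset.mem_powersetCard] at hS
  have h1 : ∀ x ∈ S, x < nOne n := fun x hx => Finset.mem_range.mp (hS.1 hx)
  refine ⟨h1, fun x hx => ?_, hS.2⟩
  have := h1 x hx
  have := nOne_add_nTwo n
  have := two_mul_hoQubits n
  omega

lemma phiSum_conjTranspose (n : ℕ) (c : Finset ℕ → ℝ) :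
    (phiSum n c).conjTranspose = phiSum n c := by
  rw [phiSum, Matrix.conjTranspose_sum]
  refine Finset.sum_congr rfl fun S hS => ?_
  obtain ⟨-, h2, h3⟩ := phi_index hS
  rw [Matrix.conjTranspose_smul, majoranaProd_conjTranspose h2, h3, smul_smul]
  congr 1
  simp [Nat.choose, pow_succ]

lemma flip_commute_phiSum {n j : ℕ} (c : Finset ℕ → ℝ) (h1 : nOne n ≤ j) (h2 : j < 2 * hoQubits n) :
    Commute (flip (hoQubits n) j) (phiSum n c) := by
  refine Commute.sum_right _ _ _ fun S hS => Commute.smul_right ?_ _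
  obtain ⟨h3, h4, -⟩ := phi_index hS
  exact flip_commute_majoranaProd h2 h4 fun h => absurd (h3 _ h) (by omega)

lemma majorana_mul_phiSum {n j : ℕ} (c : Finset ℕ → ℝ) (h1 : nOne n ≤ j)
    (h2 : j < 2 * hoQubits n) :
    majorana (hoQubits n) j * phiSum n c = -(phiSum n c * majorana (hoQubits n) j) := by
  rw [phiSum, Finset.mul_sum, Finset.sum_mul, ← Finset.sum_neg_distrib]
  refine Finset.sum_congr rfl fun S hS => ?_
  obtain ⟨h3, h4, h5⟩ := phi_index hS
  rw [mul_smul_comm, majorana_mul_majoranaProd h2 h4 fun h => absurd (h3 _ h) (by omega), h5,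
    smul_mul_assoc]
  simp [pow_succ]

lemma norm_majoranaProd_sq (N : ℕ) (S : Finset ℕ) : ‖majoranaProd N S‖ ^ 2 = 2 ^ N := by
  have h := frobenius_isometry_mul (majoranaProd_conjTranspose_mul_self N S) 1
  rw [mul_one] at h
  rw [h, frobenius_one_sq, card_basis]; simp

/-- Different Majorana monomials are orthogonal. -/
lemma norm_sum_majoranaProd_sq {N : ℕ} (𝒮 : Finset (Finset ℕ)) (h𝒮 : ∀ S ∈ 𝒮, ∀ x ∈ S, x < 2 * N)
    (c : Finset ℕ → ℝ) :
    ‖∑ S ∈ 𝒮, (Complex.I * (c S : ℂ)) • majoranaProd N S‖ ^ 2 = 2 ^ N * ∑ S ∈ 𝒮, c S ^ 2 := by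
  rw [frobenius_sq_sum, Finset.mul_sum]
  · refine Finset.sum_congr rfl fun S _ => ?_
    rw [norm_smul, mul_pow, norm_majoranaProd_sq]
    simp [mul_comm]
  · intro S hS T hT hST
    rw [Matrix.conjTranspose_smul, smul_mul_assoc, mul_smul_comm, Matrix.trace_smul,
      Matrix.trace_smul, trace_majoranaProd_mul (h𝒮 S hS) (h𝒮 T hT) hST, smul_zero, smul_zero]

lemma norm_phiSum_sq (n : ℕ) (c : Finset ℕ → ℝ) :
    ‖phiSum n c‖ ^ 2 =
      2 ^ hoQubits n * ∑ S ∈ Finset.powersetCard 3 (Finset.range (nOne n)), c S ^ 2 :=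
  norm_sum_majoranaProd_sq _ (fun _ hS => (phi_index hS).2.1) c

/-- Hypercontractivity bounds `‖τ²‖` by `‖τ‖²`. -/
lemma norm_phiSum_mul_self_sq_le (n : ℕ) (c : Finset ℕ → ℝ) :
    2 ^ hoQubits n * ‖phiSum n c * phiSum n c‖ ^ 2 ≤ 729 * (‖phiSum n c‖ ^ 2) ^ 2 := by
  have h := hypercontractivity (N := hoQubits n) (nOne n) 3 (phiSum n c)
    (by have := nOne_add_nTwo n; have := two_mul_hoQubits n; omega)
    (Submodule.sum_mem _ fun S hS => Submodule.smul_mem _ _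
      (majoranaProd_mem_majoranaPoly (phi_index hS).1 (phi_index hS).2.2.le))
  rw [phiSum_conjTranspose] at h
  norm_num at h
  exact h

/-- The anticommutator of a cubic polynomial with `φ_S` only involves the coefficients of the sets
that meet `S`, since operators with disjoint supports of odd size anticommute. -/
lemma norm_phiSum_anticomm_sq_le {n : ℕ} (c : Finset ℕ → ℝ) {S : Finset ℕ}
    (hS : S ∈ Finset.powersetCard 3 (Finset.range (nOne n))) :
    ‖phiSum n c * majoranaProd (hoQubits n) S + majoranaProd (hoQubits n) S * phiSum n c‖ ^ 2 ≤
      4 * (2 ^ hoQubits n * ∑ T ∈ (Finset.powersetCard 3 (Finset.range (nOne n))).filter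
        (fun T => ¬ Disjoint T S), c T ^ 2) := by
  obtain ⟨-, hS2, hS3⟩ := phi_index hS
  set A := ∑ T ∈ (Finset.powersetCard 3 (Finset.range (nOne n))).filter (fun T => ¬ Disjoint T S),
    (Complex.I * (c T : ℂ)) • majoranaProd (hoQubits n) T with hA
  have e : phiSum n c * majoranaProd (hoQubits n) S + majoranaProd (hoQubits n) S * phiSum n c =
      A * majoranaProd (hoQubits n) S + majoranaProd (hoQubits n) S * A := by
    have h0 : phiSum n c = (∑ T ∈ (Finset.powersetCard 3 (Finset.range (nOne n))).filter
        (fun T => Disjoint T S), (Complex.I * (c T : ℂ)) • majoranaProd (hoQubits n) T) + A :=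
      (Finset.sum_filter_add_sum_filter_not _ _ _).symm
    rw [h0, add_mul, mul_add, add_add_add_comm, add_eq_right, Finset.sum_mul, Finset.mul_sum,
      ← Finset.sum_add_distrib]
    refine Finset.sum_eq_zero fun T hT => ?_
    rw [Finset.mem_filter] at hT
    obtain ⟨-, hT2, hT3⟩ := phi_index hT.1
    rw [smul_mul_assoc, mul_smul_comm, majoranaProd_mul_of_disjoint hT2 hS2 hT.2, hT3, hS3]
    simp [pow_succ]
  have hu := majoranaProd_conjTranspose_mul_self (hoQubits n) S
  have h1 : ‖A * majoranaProd (hoQubits n) S + majoranaProd (hoQubits n) S * A‖ ≤ 2 * ‖A‖ := by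
    refine (norm_add_le _ _).trans (le_of_eq ?_)
    rw [frobenius_mul_isometry hu, frobenius_isometry_mul hu]; ring
  rw [e, ← norm_sum_majoranaProd_sq _ (fun T hT => (phi_index (Finset.mem_filter.mp hT).1).2.1) c,
    ← hA]
  calc _ ≤ (2 * ‖A‖) ^ 2 := by gcongr
    _ = _ := by ring

lemma sigma_index {n t : ℕ} (ht : t < nTwo n) : nOne n ≤ 2 * n + t ∧ 2 * n + t < 2 * hoQubits n := by
  have := nOne_add_nTwo n; have := two_mul_hoQubits n; omega

lemma chi_index {n t : ℕ} (ht : t < nTwo n) :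
    nOne n ≤ nOne n + t ∧ nOne n + t < 2 * hoQubits n := by
  have := nOne_add_nTwo n; have := two_mul_hoQubits n; omega

lemma sigma_mul_self (n t : ℕ) : sigmaOp n t * sigmaOp n t = 1 := majorana_mul_self _ _

lemma sigma_anticommute {n s t : ℕ} (hs : s < nTwo n) (ht : t < nTwo n) (hst : s ≠ t) :
    sigmaOp n s * sigmaOp n t = -(sigmaOp n t * sigmaOp n s) :=
  majorana_anticommute (by omega) (sigma_index hs).2 (sigma_index ht).2

lemma chi_anticommute {n s t : ℕ} (hs : s < nTwo n) (ht : t < nTwo n) (hst : s ≠ t) :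
    chiOp n s * chiOp n t = -(chiOp n t * chiOp n s) :=
  majorana_anticommute (by omega) (chi_index hs).2 (chi_index ht).2

lemma chi_sigma_anticommute {n s t : ℕ} (hs : s < nTwo n) (ht : t < nTwo n) :
    chiOp n s * sigmaOp n t = -(sigmaOp n t * chiOp n s) :=
  majorana_anticommute (by have := nOne_add_nTwo n; omega) (chi_index hs).2 (sigma_index ht).2

variable {n : ℕ} (p : unitInterval) (ω : Disorder n)

lemma tau_conjTranspose (t : ℕ) : (tau p ω t).conjTranspose = tau p ω t := by
  rw [tau_eq, phiSum_conjTranspose]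

lemma sigma_mul_tau {s : ℕ} (hs : s < nTwo n) (t : ℕ) :
    sigmaOp n s * tau p ω t = -(tau p ω t * sigmaOp n s) := by
  rw [tau_eq]
  exact majorana_mul_phiSum _ (sigma_index hs).1 (sigma_index hs).2

lemma chi_mul_tau {s : ℕ} (hs : s < nTwo n) (t : ℕ) :
    chiOp n s * tau p ω t = -(tau p ω t * chiOp n s) := by
  rw [tau_eq]
  exact majorana_mul_phiSum _ (chi_index hs).1 (chi_index hs).2

lemma zeta_conjTranspose : (zeta p ω).conjTranspose = -zeta p ω := by
  rw [zeta, Matrix.conjTranspose_sum, ← Finset.sum_neg_distrib]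
  refine Finset.sum_congr rfl fun t ht => ?_
  rw [Matrix.conjTranspose_mul, tau_conjTranspose, sigmaOp, majorana_conjTranspose]
  exact sigma_mul_tau p ω (Finset.mem_range.mp ht) t

lemma chi_commute_zeta {s : ℕ} (hs : s < nTwo n) : Commute (chiOp n s) (zeta p ω) := by
  refine Commute.sum_right _ _ _ fun t ht => ?_
  change _ = _
  rw [← mul_assoc, chi_mul_tau p ω hs, neg_mul, mul_assoc,
    chi_sigma_anticommute hs (Finset.mem_range.mp ht), mul_neg, neg_neg, mul_assoc]

/-- Only the summand `τ_s σ_s` of `ζ` does not commute with `σ_s`. -/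
lemma zeta_commutator_sigma {s : ℕ} (hs : s < nTwo n) :
    zeta p ω * sigmaOp n s - sigmaOp n s * zeta p ω = (2 : ℂ) • tau p ω s := by
  rw [zeta, Finset.sum_mul, Finset.mul_sum, ← Finset.sum_sub_distrib,
    Finset.sum_eq_single_of_mem s (Finset.mem_range.mpr hs)]
  · rw [← mul_assoc, sigma_mul_tau p ω hs, neg_mul, mul_assoc, sigma_mul_self, mul_one,
      sub_neg_eq_add, two_smul]
  · intro t ht hts
    rw [← mul_assoc, sigma_mul_tau p ω hs, neg_mul, mul_assoc, mul_assoc,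
      sigma_anticommute hs (Finset.mem_range.mp ht) (Ne.symm hts), mul_neg, neg_neg, sub_self]

lemma flip_commute_tau {j : ℕ} (h1 : nOne n ≤ j) (h2 : j < 2 * hoQubits n) (t : ℕ) :
    Commute (flip (hoQubits n) j) (tau p ω t) := by
  rw [tau_eq]; exact flip_commute_phiSum _ h1 h2

/-- Since `σ_t` anticommutes with the cubic `τ_s`, the commutator with `ζ` is made of the
anticommutators of the `τ` operators. -/
lemma zeta_commutator_tau (s : ℕ) :
    zeta p ω * tau p ω s - tau p ω s * zeta p ω =
      ∑ t ∈ Finset.range (nTwo n),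
        -((tau p ω t * tau p ω s + tau p ω s * tau p ω t) * sigmaOp n t) := by
  rw [zeta, Finset.sum_mul, Finset.mul_sum, ← Finset.sum_sub_distrib]
  refine Finset.sum_congr rfl fun t ht => ?_
  rw [mul_assoc, sigma_mul_tau p ω (Finset.mem_range.mp ht)]
  noncomm_ring

/-- The operators `{τ_t, τ_s} σ_t` are orthogonal for different `t`. -/
lemma norm_zeta_commutator_tau_sq (s : ℕ) :
    ‖zeta p ω * tau p ω s - tau p ω s * zeta p ω‖ ^ 2 =
      ∑ t ∈ Finset.range (nTwo n), ‖tau p ω t * tau p ω s + tau p ω s * tau p ω t‖ ^ 2 := by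
  rw [zeta_commutator_tau, frobenius_sq_sum]
  · refine Finset.sum_congr rfl fun t _ => ?_
    rw [norm_neg, frobenius_mul_isometry]
    rw [sigmaOp, majorana_conjTranspose, majorana_mul_self]
  · intro t ht u hu htu
    have ht' := sigma_index (Finset.mem_range.mp ht)
    have hu' := sigma_index (Finset.mem_range.mp hu)
    refine trace_eq_zero_of_flip (j := 2 * n + t) ?_
    have hc : ∀ v, Commute (flip (hoQubits n) (2 * n + t))
        (tau p ω v * tau p ω s + tau p ω s * tau p ω v) := fun v =>
      ((flip_commute_tau p ω ht'.1 ht'.2 v).mul_right (flip_commute_tau p ω ht'.1 ht'.2 s)).add_right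
        ((flip_commute_tau p ω ht'.1 ht'.2 s).mul_right (flip_commute_tau p ω ht'.1 ht'.2 v))
    have hct := Commute.flip_conjTranspose ht'.2 (hc t)
    have hu2 : Commute (flip (hoQubits n) (2 * n + t)) (sigmaOp n u) :=
      flip_commute (by omega) hu'.2 ht'.2
    have hs2 : flip (hoQubits n) (2 * n + t) * sigmaOp n t =
      -(sigmaOp n t * flip (hoQubits n) (2 * n + t)) := flip_anticommute ht'.2
    have hsig : (sigmaOp n t).conjTranspose = sigmaOp n t := majorana_conjTranspose _ _
    rw [Matrix.conjTranspose_neg, Matrix.conjTranspose_mul, neg_mul_neg, hsig]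
    have hrest := (hct.mul_right ((hc u).mul_right hu2)).eq
    rw [mul_assoc, ← mul_assoc, hs2, neg_mul, mul_assoc, hrest]
    simp only [mul_assoc]

end Algebra

/-! ### The initial state -/

section InitialState

/-- `χ_t` acts on the initial state like `-i σ_t`. -/
lemma chi_mul_rhoZero {n t : ℕ} (ht : t < nTwo n) :
    chiOp n t * rhoZero n = -(Complex.I • (sigmaOp n t * rhoZero n)) := by
  have key : ∀ l : List ℕ, (∀ s ∈ l, s < nTwo n) → t ∈ l →
      chiOp n t * (l.map fun t => 1 + Complex.I • (sigmaOp n t * chiOp n t)).prod =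
      -(Complex.I • (sigmaOp n t *
        (l.map fun t => 1 + Complex.I • (sigmaOp n t * chiOp n t)).prod)) := by
    intro l
    induction l with
    | nil => simp
    | cons a l ih =>
      intro hl hmem
      rw [List.map_cons, List.prod_cons]
      by_cases hta : t = a
      · subst hta
        have hχ : chiOp n t * chiOp n t = 1 := majorana_mul_self _ _
        have e1 : chiOp n t * (1 + Complex.I • (sigmaOp n t * chiOp n t)) =
            -(Complex.I • (sigmaOp n t * (1 + Complex.I • (sigmaOp n t * chiOp n t)))) := by
          rw [mul_add, mul_add, mul_smul_comm, mul_smul_comm, ← mul_assoc, ← mul_assoc,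
            chi_sigma_anticommute ht ht, neg_mul, mul_assoc, hχ, sigma_mul_self, smul_add,
            smul_smul, Complex.I_mul_I]
          simp
        rw [← mul_assoc, e1, neg_mul, smul_mul_assoc, mul_assoc]
      · have hmem' : t ∈ l := by simpa [hta] using hmem
        have ha : a < nTwo n := hl a (by simp)
        have h1 : Commute (chiOp n t) (1 + Complex.I • (sigmaOp n a * chiOp n a)) := by
          refine (Commute.one_right _).add_right (Commute.smul_right ?_ _)
          change _ = _
          rw [← mul_assoc, chi_sigma_anticommute ht ha, neg_mul, mul_assoc,
            chi_anticommute ht ha hta, mul_neg, neg_neg, mul_assoc]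
        have h2 : Commute (sigmaOp n t) (1 + Complex.I • (sigmaOp n a * chiOp n a)) := by
          refine (Commute.one_right _).add_right (Commute.smul_right ?_ _)
          change _ = _
          rw [← mul_assoc, sigma_anticommute ht ha hta, neg_mul, mul_assoc, mul_assoc,
            chi_sigma_anticommute ha ht, mul_neg]
        rw [← mul_assoc, h1.eq, mul_assoc, ih (fun s hs => hl s (by simp [hs])) hmem',
          ← mul_assoc (sigmaOp n t), h2.eq, mul_neg, mul_smul_comm, mul_assoc]
  rw [rhoZero, mul_smul_comm, mul_smul_comm,
    key _ (fun s hs => List.mem_range.mp hs) (List.mem_range.mpr ht), smul_neg, smul_comm]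

/-- The initial state is maximally mixed on the modes `φ` and `σ`. -/
lemma trace_mul_rhoZero {n : ℕ} {A : Op (hoQubits n)}
    (hA : ∀ t < nTwo n, Commute (flip (hoQubits n) (nOne n + t)) A) :
    (A * rhoZero n).trace = ((2 : ℂ) ^ hoQubits n)⁻¹ * A.trace := by
  have key : ∀ m ≤ nTwo n,
      (A * ((List.range m).map fun t => 1 + Complex.I • (sigmaOp n t * chiOp n t)).prod).trace =
        A.trace ∧ ∀ t, m ≤ t → t < nTwo n → Commute (flip (hoQubits n) (nOne n + t))
          ((List.range m).map fun t => 1 + Complex.I • (sigmaOp n t * chiOp n t)).prod := by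
    intro m
    induction m with
    | zero => simp
    | succ m ih =>
      intro hm
      obtain ⟨ih1, ih2⟩ := ih (by omega)
      have hσ : ∀ t, t < nTwo n → Commute (flip (hoQubits n) (nOne n + t)) (sigmaOp n m) :=
        fun t ht => flip_commute (by have := nOne_add_nTwo n; omega)
          (sigma_index (by omega : m < nTwo n)).2 (chi_index ht).2
      constructor
      · rw [List.range_succ, List.map_append, List.prod_append, List.map_singleton,
          List.prod_singleton, ← mul_assoc, mul_add, mul_one, Matrix.trace_add, ih1, add_eq_left,
          mul_smul_comm, Matrix.trace_smul]
        refine smul_eq_zero_of_right _ (trace_eq_zero_of_flip (j := nOne n + m) ?_)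
        have h1 : flip (hoQubits n) (nOne n + m) * chiOp n m =
          -(chiOp n m * flip (hoQubits n) (nOne n + m)) := flip_anticommute (chi_index hm).2
        rw [← mul_assoc _ (sigmaOp n m), ← mul_assoc (flip _ _), (((hA m hm).mul_right
          (ih2 m le_rfl hm)).mul_right (hσ m hm)).eq, mul_assoc _ (flip _ _), h1, mul_neg,
          ← mul_assoc]
      · intro t hmt ht
        rw [List.range_succ, List.map_append, List.prod_append, List.map_singleton,
          List.prod_singleton]
        refine (ih2 t (by omega) ht).mul_right ((Commute.one_right _).add_right
          (Commute.smul_right ((hσ t ht).mul_right ?_) _))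
        exact flip_commute (by omega) (chi_index (by omega : m < nTwo n)).2 (chi_index ht).2
  rw [rhoZero, mul_smul_comm, Matrix.trace_smul, (key _ le_rfl).1, smul_eq_mul]

end InitialState

end SparseSYK
namespace SparseSYK

/-! ### The energy of the Hastings-O'Donnell state -/

/-- The four-element sets that consist of three `φ` modes and one `χ` mode. -/
def mixedQuads (n : ℕ) : Finset (Finset ℕ) :=
  (Finset.range (nTwo n) ×ˢ Finset.powersetCard 3 (Finset.range (nOne n))).image
    fun x => insert (nOne n + x.1) x.2

lemma insert_chi_injOn (n : ℕ) : Set.InjOn (fun x : ℕ × Finset ℕ => insert (nOne n + x.1) x.2)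
    (Finset.range (nTwo n) ×ˢ Finset.powersetCard 3 (Finset.range (nOne n)) : Finset _) := by
  rintro ⟨t, S⟩ h1 ⟨u, T⟩ h2 h
  simp only [Finset.coe_product, Set.mem_prod, Finset.mem_coe] at h1 h2
  have hS := (phi_index h1.2).1
  have hT := (phi_index h2.2).1
  simp only at h
  have htu : t = u := by
    have : nOne n + t ∈ insert (nOne n + u) T := h ▸ Finset.mem_insert_self _ _
    rcases Finset.mem_insert.mp this with h' | h'
    · omega
    · have := hT _ h'; omega
  subst htu
  have hS' : nOne n + t ∉ S := fun h => by have := hS _ h; omega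
  have hT' : nOne n + t ∉ T := fun h => by have := hT _ h; omega
  rw [← Finset.erase_insert hS', h, Finset.erase_insert hT']

lemma sum_mixedQuads {M : Type*} [AddCommMonoid M] (n : ℕ) (f : Finset ℕ → M) :
    ∑ I ∈ mixedQuads n, f I = ∑ t ∈ Finset.range (nTwo n),
      ∑ S ∈ Finset.powersetCard 3 (Finset.range (nOne n)), f (insert (nOne n + t) S) := by
  rw [mixedQuads, Finset.sum_image (insert_chi_injOn n), Finset.sum_product]

lemma insert_chi_mem {n t : ℕ} {S : Finset ℕ} (ht : t < nTwo n)
    (hS : S ∈ Finset.powersetCard 3 (Finset.range (nOne n))) :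
    insert (nOne n + t) S ∈ Finset.powersetCard 4 (Finset.range (2 * n)) := by
  obtain ⟨h1, -, h3⟩ := phi_index hS
  have := nOne_add_nTwo n
  rw [Finset.mem_powersetCard]
  refine ⟨fun x hx => ?_, ?_⟩
  · rcases Finset.mem_insert.mp hx with rfl | hx
    · simp; omega
    · have := h1 x hx; simp; omega
  · rw [Finset.card_insert_of_notMem (fun h => by have := h1 _ h; omega), h3]

lemma mixedQuads_subset (n : ℕ) :
    mixedQuads n ⊆ Finset.powersetCard 4 (Finset.range (2 * n)) := by
  intro I hI
  obtain ⟨⟨t, S⟩, h, rfl⟩ := Finset.mem_image.mp hI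
  rw [Finset.mem_product, Finset.mem_range] at h
  exact insert_chi_mem h.1 h.2

/-- The ratio of the normalizations of `H` and of the operators `τ_t`. -/
noncomputable def scaleRatio (n : ℕ) : ℝ := √((nOne n).choose 3 : ℝ) / √((2 * n).choose 4 : ℝ)

variable {n : ℕ} (p : unitInterval) (ω : Disorder n)

lemma hamCoeff_eq (hn : 0 < (nOne n).choose 3) (I : Finset ℕ) :
    hamCoeff p ω I = -(scaleRatio n * (tauScale n p * coupling ω I)) := by
  have h : √((nOne n).choose 3 : ℝ) ≠ 0 := (Real.sqrt_pos.mpr (by exact_mod_cast hn)).ne'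
  rw [hamCoeff, scaleRatio, tauScale]
  field_simp

/-- The part of the energy that comes from the quads that are not mixed. -/
noncomputable def restEnergy (θ : ℝ) : ℝ :=
  ∑ I ∈ Finset.powersetCard 4 (Finset.range (2 * n)) \ mixedQuads n,
    hamCoeff p ω I * ((majoranaProd (hoQubits n) I * hoState p ω θ).trace).re

/-- The part of the Hamiltonian that the state is adapted to is `i ∑ τ_t χ_t`, up to the ratio of the
normalizations. -/
lemma sum_mixed_smul_majoranaProd (hn : 0 < (nOne n).choose 3) :
    ∑ I ∈ mixedQuads n, (hamCoeff p ω I : ℂ) • majoranaProd (hoQubits n) I =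
      ((scaleRatio n : ℂ) * Complex.I) • ∑ t ∈ Finset.range (nTwo n), tau p ω t * chiOp n t := by
  rw [sum_mixedQuads, Finset.smul_sum]
  refine Finset.sum_congr rfl fun t _ => ?_
  rw [tau_eq, phiSum, Finset.sum_mul, Finset.smul_sum]
  refine Finset.sum_congr rfl fun S hS => ?_
  have h1 := (phi_index hS).1
  rw [majoranaProd_insert fun x hx => (h1 x hx).trans_le (Nat.le_add_right _ _),
    hamCoeff_eq p ω hn, smul_mul_assoc, smul_smul, chiOp]
  congr 1
  push_cast
  linear_combination -(scaleRatio n : ℂ) * tauScale n p * coupling ω (insert (nOne n + t) S) *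
    Complex.I_mul_I

lemma hoState_neg (s : ℝ) : hoState p ω (-s) =
    NormedSpace.exp (s • zeta p ω) * rhoZero n * NormedSpace.exp (s • -zeta p ω) := by
  rw [hoState]
  congr 2
  · congr 1
    rw [Complex.ofReal_neg, neg_smul, neg_neg]; rfl
  · rw [Complex.ofReal_neg, neg_smul, smul_neg]; rfl

open scoped Matrix.Norms.Frobenius in
lemma commute_exp_smul {N : ℕ} {A B : Op N} (h : Commute A B) (s : ℝ) :
    Commute A (NormedSpace.exp (s • B)) :=
  (h.smul_right s).exp_right

/-- The contribution of a `χ` mode to the energy is a trace in the infinite temperature state: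
`χ_t` is exchanged for `σ_t`, and the state is maximally mixed on the modes `φ` and `σ`. -/
lemma trace_tau_chi_hoState {t : ℕ} (ht : t < nTwo n) (s : ℝ) :
    Complex.I * (tau p ω t * chiOp n t * hoState p ω (-s)).trace =
      ((2 : ℂ) ^ hoQubits n)⁻¹ * (conjExp (-zeta p ω) (tau p ω t) s * sigmaOp n t).trace := by
  set U := NormedSpace.exp (s • zeta p ω)
  set V := NormedSpace.exp (s • -zeta p ω)
  have hχ : Commute (chiOp n t) U := commute_exp_smul (chi_commute_zeta p ω ht) s
  have hflip : ∀ u < nTwo n, ∀ v < nTwo n, Commute (flip (hoQubits n) (nOne n + u)) (sigmaOp n v) :=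
    fun u hu v hv => flip_commute (by have := nOne_add_nTwo n; omega) (sigma_index hv).2
      (chi_index hu).2
  have hζ : ∀ u < nTwo n, Commute (flip (hoQubits n) (nOne n + u)) (zeta p ω) := fun u hu =>
    Commute.sum_right _ _ _ fun v hv => (flip_commute_tau p ω (chi_index hu).1
      (chi_index hu).2 v).mul_right (hflip u hu v (Finset.mem_range.mp hv))
  have h1 : tau p ω t * chiOp n t * hoState p ω (-s) =
      -(Complex.I • (tau p ω t * U * sigmaOp n t * rhoZero n * V)) := by
    rw [hoState_neg]
    calc _ = tau p ω t * (chiOp n t * U) * rhoZero n * V := by simp only [mul_assoc]; rfl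
      _ = tau p ω t * U * (chiOp n t * rhoZero n) * V := by rw [hχ.eq]; simp only [mul_assoc]
      _ = _ := by
        rw [chi_mul_rhoZero ht]
        simp only [mul_neg, neg_mul, mul_smul_comm, smul_mul_assoc, mul_assoc]
  have h2 : conjExp (-zeta p ω) (tau p ω t) s = V * tau p ω t * U := by
    rw [conjExp, neg_neg]
  rw [h1, h2, Matrix.trace_neg, Matrix.trace_smul, smul_eq_mul, mul_neg, ← mul_assoc,
    Complex.I_mul_I, neg_mul, neg_neg, one_mul, Matrix.trace_mul_comm, ← trace_mul_rhoZero]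
  · simp only [mul_assoc]
  · intro u hu
    exact ((((commute_exp_smul (hζ u hu).neg_right s).mul_right
      (flip_commute_tau p ω (chi_index hu).1 (chi_index hu).2 t)).mul_right
      (commute_exp_smul (hζ u hu) s)).mul_right (hflip u hu t ht))

/-- The energy of the mixed quads is a sum of normalized traces of `e^{-sζ} τ_t e^{sζ} σ_t`. -/
lemma sykEnergy_hoState (hn : 0 < (nOne n).choose 3) (s : ℝ) :
    sykEnergy p ω (hoState p ω (-s)) =
      scaleRatio n * ((2 ^ hoQubits n)⁻¹ * ∑ t ∈ Finset.range (nTwo n),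
        (conjExp (-zeta p ω) (tau p ω t) s * sigmaOp n t).trace.re) + restEnergy p ω (-s) := by
  have hre : restEnergy p ω (-s) = ((∑ I ∈ Finset.powersetCard 4 (Finset.range (2 * n)) \ mixedQuads n,
      (hamCoeff p ω I : ℂ) • majoranaProd (hoQubits n) I) * hoState p ω (-s)).trace.re := by
    rw [restEnergy, Finset.sum_mul, Matrix.trace_sum, Complex.re_sum]
    refine Finset.sum_congr rfl fun I _ => ?_
    rw [smul_mul_assoc, Matrix.trace_smul, smul_eq_mul, Complex.re_ofReal_mul]
  rw [sykEnergy_eq, hamExt, ← Finset.sum_sdiff (mixedQuads_subset n), add_mul, Matrix.trace_add,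
    Complex.add_re, ← hre, add_comm]
  congr 1
  rw [sum_mixed_smul_majoranaProd p ω hn, smul_mul_assoc, Matrix.trace_smul, smul_eq_mul, mul_assoc,
    Complex.re_ofReal_mul, Finset.sum_mul, Matrix.trace_sum, Finset.mul_sum]
  congr 1
  rw [Finset.sum_congr rfl fun t ht => trace_tau_chi_hoState p ω (Finset.mem_range.mp ht) s,
    ← Finset.mul_sum, ← Complex.re_sum, ← Complex.re_ofReal_mul]
  push_cast
  rfl

lemma trace_tau_mul_sigma {t : ℕ} (ht : t < nTwo n) : (tau p ω t * sigmaOp n t).trace = 0 := by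
  have hs := sigma_index ht
  refine trace_eq_zero_of_flip (j := 2 * n + t) ?_
  have h : flip (hoQubits n) (2 * n + t) * sigmaOp n t =
      -(sigmaOp n t * flip (hoQubits n) (2 * n + t)) := flip_anticommute hs.2
  rw [← mul_assoc, (flip_commute_tau p ω hs.1 hs.2 t).eq, mul_assoc, h, mul_neg, mul_assoc]

open scoped Matrix.Norms.Frobenius in
/-- The part of the energy due to the mixed quads is at least linear in the angle `s`, up to
a quadratic correction. -/
lemma sum_trace_conjExp_zeta_ge {s : ℝ} (hs : 0 ≤ s) :
    s * (2 * ∑ t ∈ Finset.range (nTwo n), ‖tau p ω t‖ ^ 2 - 2 * s * ∑ t ∈ Finset.range (nTwo n),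
        ‖zeta p ω * tau p ω t - tau p ω t * zeta p ω‖ * ‖tau p ω t‖) ≤
      ∑ t ∈ Finset.range (nTwo n), (conjExp (-zeta p ω) (tau p ω t) s * sigmaOp n t).trace.re := by
  have hY : (-zeta p ω).conjTranspose = -(-zeta p ω) := by
    rw [Matrix.conjTranspose_neg, zeta_conjTranspose]
  have hσ : ∀ t ∈ Finset.range (nTwo n),
      sigmaOp n t * -zeta p ω - -zeta p ω * sigmaOp n t = (2 : ℂ) • tau p ω t := fun t ht => by
    rw [← zeta_commutator_sigma p ω (Finset.mem_range.mp ht)]; noncomm_ring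
  have e : ∀ t, ‖-zeta p ω * tau p ω t - tau p ω t * -zeta p ω‖ =
      ‖zeta p ω * tau p ω t - tau p ω t * zeta p ω‖ := fun t => by
    rw [← norm_neg]; congr 1; noncomm_ring
  have h0 : ∑ t ∈ Finset.range (nTwo n), (tau p ω t * sigmaOp n t).trace.re = 0 :=
    Finset.sum_eq_zero fun t ht => by
      rw [trace_tau_mul_sigma p ω (Finset.mem_range.mp ht), Complex.zero_re]
  have h := sum_trace_conjExp_ge (Finset.range (nTwo n)) hY (tau p ω) (sigmaOp n)
    (fun t _ => tau_conjTranspose p ω t) hσ hs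
  rw [h0, zero_add] at h
  simpa only [e] using h

end SparseSYK
namespace SparseSYK

/-! ### Exponential moments of the disorder -/

section Moments
open scoped ENNReal

/-- The law of one pair `(J, X)`. -/
noncomputable abbrev siteLaw (p : unitInterval) : Measure (ℝ × ℝ) :=
  (gaussianReal 0 1).prod (bernoulliMeasure (1 : ℝ) 0 p)

lemma lintegral_exp_mul_gaussian (a : ℝ) :
    ∫⁻ x, ENNReal.ofReal (Real.exp (a * x)) ∂gaussianReal 0 1 =
      ENNReal.ofReal (Real.exp (a ^ 2 / 2)) := by
  rw [← ofReal_integral_eq_lintegral_ofReal (integrable_exp_mul_gaussianReal a)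
    (ae_of_all _ fun x => (Real.exp_pos _).le)]
  have h := congrFun (mgf_fun_id_gaussianReal (μ := 0) (v := 1)) a
  rw [mgf] at h
  rw [h]
  simp

lemma lintegral_exp_sq_gaussian {t : ℝ} (ht : t < 1 / 2) :
    ∫⁻ x, ENNReal.ofReal (Real.exp (t * x ^ 2)) ∂gaussianReal 0 1 =
      ENNReal.ofReal (√(1 - 2 * t))⁻¹ := by
  have hb : 0 < 1 / 2 - t := by linarith
  have hpdf : ∀ x : ℝ, gaussianPDF 0 1 x * ENNReal.ofReal (Real.exp (t * x ^ 2)) =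
      ENNReal.ofReal ((√(2 * Real.pi))⁻¹ * Real.exp (-(1 / 2 - t) * x ^ 2)) := by
    intro x
    rw [gaussianPDF, ← ENNReal.ofReal_mul (gaussianPDFReal_nonneg _ _ _), gaussianPDFReal, mul_assoc,
      ← Real.exp_add]
    congr 4
    · simp
    · simp; ring
  rw [gaussianReal_of_var_ne_zero _ one_ne_zero,
    lintegral_withDensity_eq_lintegral_mul _ (by fun_prop) (by fun_prop)]
  simp only [Pi.mul_apply, hpdf]
  rw [← ofReal_integral_eq_lintegral_ofReal ((integrable_exp_neg_mul_sq hb).const_mul _)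
    (ae_of_all _ fun x => by positivity), integral_const_mul, integral_gaussian]
  congr 1
  rw [← Real.sqrt_inv, ← Real.sqrt_inv, ← Real.sqrt_mul (by positivity)]
  congr 1
  have : 1 - 2 * t ≠ 0 := by linarith
  field_simp

lemma lintegral_siteLaw (p : unitInterval) {f : ℝ × ℝ → ℝ≥0∞} (hf : Measurable f) :
    ∫⁻ x, f x ∂siteLaw p = ENNReal.ofReal p * ∫⁻ x, f (x, 1) ∂gaussianReal 0 1 +
      ENNReal.ofReal (1 - p) * ∫⁻ x, f (x, 0) ∂gaussianReal 0 1 := by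
  have h : ∀ q : unitInterval, ((unitInterval.toNNReal q : NNReal) : ℝ≥0∞) = ENNReal.ofReal q :=
    fun q => by
      rw [ENNReal.ofReal, Real.toNNReal_of_nonneg q.2.1]; rfl
  rw [siteLaw, lintegral_prod_symm _ hf.aemeasurable, bernoulliMeasure_def, lintegral_add_measure,
    lintegral_smul_measure, lintegral_smul_measure, lintegral_dirac, lintegral_dirac]
  simp only [ENNReal.smul_def, smul_eq_mul, h, unitInterval.coe_symm_eq]

lemma lintegral_pi_prod {ι : Type*} [Fintype ι] {X : Type*} [MeasurableSpace X]
    (μ : Measure X) [IsProbabilityMeasure μ] {g : ι → X → ℝ≥0∞} (hg : ∀ i, Measurable (g i)) :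
    ∫⁻ ω, ∏ i, g i (ω i) ∂Measure.pi (fun _ : ι => μ) = ∏ i, ∫⁻ x, g i x ∂μ := by
  have hind : iIndepFun (fun i (ω : ι → X) => g i (ω i)) (Measure.pi fun _ : ι => μ) :=
    iIndepFun_pi fun i => (hg i).aemeasurable
  rw [lintegral_prod_eq_prod_lintegral_of_indepFun _ _ hind
    fun i => (hg i).comp (measurable_pi_apply i)]
  refine Finset.prod_congr rfl fun i _ => ?_
  exact (measurePreserving_eval (fun _ : ι => μ) i).lintegral_comp (hg i)

instance (p : unitInterval) : IsProbabilityMeasure (siteLaw p) := by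
  unfold siteLaw; infer_instance

/-- The exponential moment of a sum of independent terms, when every term has exponential moment at
most `exp (c i)`. -/
lemma lintegral_exp_sum_le {ι : Type*} [Fintype ι] {X : Type*} [MeasurableSpace X]
    (μ : Measure X) [IsProbabilityMeasure μ] (F : Finset ι) {g : ι → X → ℝ}
    (hg : ∀ i, Measurable (g i)) {c : ι → ℝ}
    (h : ∀ i ∈ F, ∫⁻ x, ENNReal.ofReal (Real.exp (g i x)) ∂μ ≤ ENNReal.ofReal (Real.exp (c i))) :
    ∫⁻ ω, ENNReal.ofReal (Real.exp (∑ i ∈ F, g i (ω i))) ∂Measure.pi (fun _ : ι => μ) ≤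
      ENNReal.ofReal (Real.exp (∑ i ∈ F, c i)) := by
  classical
  have e : ∀ ω : ι → X, ENNReal.ofReal (Real.exp (∑ i ∈ F, g i (ω i))) =
      ∏ i, ENNReal.ofReal (Real.exp (if i ∈ F then g i (ω i) else 0)) := by
    intro ω
    rw [← ENNReal.ofReal_prod_of_nonneg fun i _ => (Real.exp_pos _).le, ← Real.exp_sum,
      Finset.sum_ite_mem, Finset.univ_inter]
  simp only [e]
  rw [lintegral_pi_prod μ (g := fun i x => ENNReal.ofReal (Real.exp (if i ∈ F then g i x else 0)))]
  · have e2 : ENNReal.ofReal (Real.exp (∑ i ∈ F, c i)) =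
        ∏ i, ENNReal.ofReal (Real.exp (if i ∈ F then c i else 0)) := by
      rw [← ENNReal.ofReal_prod_of_nonneg fun i _ => (Real.exp_pos _).le, ← Real.exp_sum,
        Finset.sum_ite_mem, Finset.univ_inter]
    rw [e2]
    refine Finset.prod_le_prod' fun i _ => ?_
    by_cases hi : i ∈ F
    · simpa [hi] using h i hi
    · simp [hi]
  · intro i
    by_cases hi : i ∈ F
    · simp only [hi, if_true]
      exact (Real.measurable_exp.comp (hg i)).ennreal_ofReal
    · simp [hi]

lemma ofReal_mix_le {p : unitInterval} {a b c : ℝ} (ha : 0 ≤ a) (hb : 0 ≤ b)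
    (h : p * a + (1 - p) * b ≤ c) :
    ENNReal.ofReal p * ENNReal.ofReal a + ENNReal.ofReal (1 - p) * ENNReal.ofReal b ≤
      ENNReal.ofReal c := by
  have h1 := p.2.1
  have h2 : (0 : ℝ) ≤ 1 - p := by linarith [p.2.2]
  rw [← ENNReal.ofReal_mul h1, ← ENNReal.ofReal_mul h2,
    ← ENNReal.ofReal_add (by positivity) (by positivity)]
  exact ENNReal.ofReal_le_ofReal h

/-- The exponential moment behind the upper tail bounds. With probability `1 - p` the exponent
vanishes, which is why the bound is `1 + O(p)`. -/
lemma lintegral_exp_weight_le (p : unitInterval) :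
    ∫⁻ x : ℝ × ℝ, ENNReal.ofReal (Real.exp ((x.1 ^ 2 + 1) * x.2 ^ 2 / 4)) ∂siteLaw p ≤
      ENNReal.ofReal (Real.exp p) := by
  rw [lintegral_siteLaw p (by fun_prop)]
  have h1 : ∀ x : ℝ, ENNReal.ofReal (Real.exp ((x ^ 2 + 1) * 1 ^ 2 / 4)) =
      ENNReal.ofReal (Real.exp (1 / 4)) * ENNReal.ofReal (Real.exp (1 / 4 * x ^ 2)) := by
    intro x
    rw [← ENNReal.ofReal_mul (Real.exp_pos _).le, ← Real.exp_add]
    congr 2; ring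
  simp only [h1]
  rw [lintegral_const_mul _ (by fun_prop), lintegral_exp_sq_gaussian (by norm_num),
    ← ENNReal.ofReal_mul (Real.exp_pos _).le]
  have h2 : ∫⁻ x : ℝ, ENNReal.ofReal (Real.exp ((x ^ 2 + 1) * 0 ^ 2 / 4)) ∂gaussianReal 0 1 =
      ENNReal.ofReal 1 := by simp
  rw [h2]
  refine ofReal_mix_le (by positivity) (by norm_num) ?_
  have h3 : Real.exp (1 / 4) * (√(1 - 2 * (1 / 4)))⁻¹ ≤ 2 := by
    have he : Real.exp (1 / 4) ≤ 4 / 3 := by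
      have h := Real.add_one_le_exp (-(1 / 4 : ℝ))
      rw [Real.exp_neg, le_inv_comm₀ (by norm_num) (Real.exp_pos _)] at h
      norm_num at h ⊢; linarith
    have hs : (√(1 - 2 * (1 / 4)))⁻¹ ≤ 3 / 2 := by
      rw [inv_le_comm₀ (Real.sqrt_pos.mpr (by norm_num)) (by norm_num)]
      refine Real.le_sqrt_of_sq_le (by norm_num)
    calc _ ≤ 4 / 3 * (3 / 2 : ℝ) := by gcongr
      _ = 2 := by norm_num
  have h4 := Real.add_one_le_exp (p : ℝ)
  have := mul_le_mul_of_nonneg_left h3 p.2.1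
  linarith

/-- The exponential moment behind the lower tail bound. -/
lemma lintegral_exp_neg_sq_le (p : unitInterval) :
    ∫⁻ x : ℝ × ℝ, ENNReal.ofReal (Real.exp (-(3 / 2 * (x.1 * x.2) ^ 2))) ∂siteLaw p ≤
      ENNReal.ofReal (Real.exp (-(p / 2))) := by
  rw [lintegral_siteLaw p (by fun_prop)]
  have h1 : ∀ x : ℝ, Real.exp (-(3 / 2 * (x * 1) ^ 2)) = Real.exp (-(3 / 2) * x ^ 2) := by
    intro x; congr 1; ring
  simp only [h1]
  rw [lintegral_exp_sq_gaussian (by norm_num)]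
  have h2 : ∫⁻ x : ℝ, ENNReal.ofReal (Real.exp (-(3 / 2 * (x * 0) ^ 2))) ∂gaussianReal 0 1 =
      ENNReal.ofReal 1 := by simp
  rw [h2]
  refine ofReal_mix_le (by positivity) (by norm_num) ?_
  have h3 : (√(1 - 2 * (-(3 / 2))))⁻¹ = 1 / 2 := by
    rw [show (1 - 2 * (-(3 / 2)) : ℝ) = 2 ^ 2 by norm_num, Real.sqrt_sq (by norm_num)]
    norm_num
  rw [h3]
  have h4 := Real.add_one_le_exp (-(p / 2 : ℝ))
  linarith

/-- A coupling behaves like a centered variable of variance `p`, as long as `|a| ≤ 1`. -/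
lemma lintegral_exp_coupling_le (p : unitInterval) {a : ℝ} (ha : a ^ 2 ≤ 1) :
    ∫⁻ x : ℝ × ℝ, ENNReal.ofReal (Real.exp (a * (x.1 * x.2))) ∂siteLaw p ≤
      ENNReal.ofReal (Real.exp (p * a ^ 2)) := by
  rw [lintegral_siteLaw p (by fun_prop)]
  simp only [mul_one]
  rw [lintegral_exp_mul_gaussian]
  have h2 : ∫⁻ x : ℝ, ENNReal.ofReal (Real.exp (a * (x * 0))) ∂gaussianReal 0 1 =
      ENNReal.ofReal 1 := by simp
  rw [h2]
  refine ofReal_mix_le (by positivity) (by norm_num) ?_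
  have h3 : Real.exp (a ^ 2 / 2) ≤ 1 + a ^ 2 := by
    have h := Real.add_one_le_exp (-(a ^ 2 / 2))
    rw [Real.exp_neg, le_inv_comm₀ (by nlinarith) (Real.exp_pos _)] at h
    refine h.trans ?_
    rw [inv_le_iff_one_le_mul₀ (by nlinarith)]
    nlinarith [sq_nonneg a]
  have h4 := Real.add_one_le_exp ((p : ℝ) * a ^ 2)
  have := mul_le_mul_of_nonneg_left h3 p.2.1
  linarith

end Moments

end SparseSYK
namespace SparseSYK

/-! ### Expectation values in the initial state -/

section StateBound
open scoped Matrix.Norms.L2Operator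

lemma l2_opNorm_le_one_of_isometry {m : Type*} [Fintype m] [DecidableEq m] {U : Matrix m m ℂ}
    (hU : U.conjTranspose * U = 1) : ‖U‖ ≤ 1 := by
  have h := Matrix.l2_opNorm_conjTranspose_mul_self U
  have h1 : ‖(1 : Matrix m m ℂ)‖ ≤ 1 := by
    have := Matrix.l2_opNorm_conjTranspose_mul_self (1 : Matrix m m ℂ)
    rw [Matrix.conjTranspose_one, one_mul] at this
    by_contra hlt
    nlinarith
  rw [hU] at h
  nlinarith [norm_nonneg U]

/-- The Hilbert-Schmidt norm of a product, written with sums of squares because the norm instance in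
force is the operator norm. -/
lemma sum_norm_sq_mul_le {m : Type*} [Fintype m] [DecidableEq m] (M A : Matrix m m ℂ) :
    ∑ x, ∑ y, ‖(M * A) x y‖ ^ 2 ≤ ‖M‖ ^ 2 * ∑ x, ∑ y, ‖A x y‖ ^ 2 := by
  rw [Finset.sum_comm, Finset.sum_comm (f := fun x y => ‖A x y‖ ^ 2), Finset.mul_sum]
  refine Finset.sum_le_sum fun y _ => ?_
  have h := Matrix.l2_opNorm_mulVec M (WithLp.toLp 2 fun x => A x y)
  have h2 := pow_le_pow_left₀ (norm_nonneg _) h 2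
  rw [mul_pow, EuclideanSpace.norm_sq_eq, EuclideanSpace.norm_sq_eq] at h2
  exact h2

/-- The factors `1 + i σ_t χ_t` are commuting multiples of projections, so the initial state is
a multiple of a projection. -/
lemma rhoZero_isProj (n : ℕ) : (rhoZero n).conjTranspose = rhoZero n ∧
    rhoZero n * rhoZero n = ((2 : ℂ) ^ hoQubits n)⁻¹ • (2 : ℂ) ^ nTwo n • rhoZero n := by
  set e : ℕ → Op (hoQubits n) := fun t => 1 + Complex.I • (sigmaOp n t * chiOp n t) with he
  have hσ : ∀ t, (sigmaOp n t).conjTranspose = sigmaOp n t := fun t => majorana_conjTranspose _ _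
  have hχ : ∀ t, (chiOp n t).conjTranspose = chiOp n t := fun t => majorana_conjTranspose _ _
  have hχχ : ∀ t, chiOp n t * chiOp n t = 1 := fun t => majorana_mul_self _ _
  have e_herm : ∀ t < nTwo n, (e t).conjTranspose = e t := by
    intro t ht
    simp only [he, Matrix.conjTranspose_add, Matrix.conjTranspose_one, Matrix.conjTranspose_smul,
      Matrix.conjTranspose_mul, hσ, hχ, chi_sigma_anticommute ht ht]
    simp
  have e_sq : ∀ t < nTwo n, e t * e t = (2 : ℂ) • e t := by
    intro t ht
    have h1 : (sigmaOp n t * chiOp n t) * (sigmaOp n t * chiOp n t) = -1 := by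
      rw [mul_assoc, ← mul_assoc (chiOp n t), chi_sigma_anticommute ht ht, neg_mul, mul_neg,
        mul_assoc, hχχ, mul_one, sigma_mul_self]
    simp only [he, add_mul, mul_add, one_mul, mul_one, smul_mul_smul_comm, h1, Complex.I_mul_I,
      two_smul]
    simp; abel
  have e_comm : ∀ s < nTwo n, ∀ t < nTwo n, Commute (e s) (e t) := by
    intro s hs t ht
    by_cases hst : s = t
    · rw [hst]
    refine (Commute.one_right _).add_right (Commute.smul_right ?_ _)
    refine (Commute.one_left _).add_left (Commute.smul_left ?_ _)
    have c1 := sigma_anticommute hs ht hst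
    have c2 := chi_anticommute hs ht hst
    have c3 := chi_sigma_anticommute hs ht
    have c4 := chi_sigma_anticommute ht hs
    change _ = _
    calc sigmaOp n s * chiOp n s * (sigmaOp n t * chiOp n t)
        = sigmaOp n s * (chiOp n s * sigmaOp n t) * chiOp n t := by noncomm_ring
      _ = -(sigmaOp n s * sigmaOp n t * (chiOp n s * chiOp n t)) := by rw [c3]; noncomm_ring
      _ = -(sigmaOp n t * (sigmaOp n s * chiOp n t) * chiOp n s) := by rw [c1, c2]; noncomm_ring
      _ = _ := by
        rw [← neg_eq_iff_eq_neg.mpr c4]; noncomm_ring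
  have key : ∀ l : List ℕ, (∀ s ∈ l, s < nTwo n) →
      (∀ t < nTwo n, Commute (e t) (l.map e).prod) ∧ (l.map e).prod.conjTranspose = (l.map e).prod ∧
        (l.map e).prod * (l.map e).prod = (2 : ℂ) ^ l.length • (l.map e).prod := by
    intro l
    induction l with
    | nil => simp
    | cons a l ih =>
      intro hl
      obtain ⟨h1, h2, h3⟩ := ih fun s hs => hl s (by simp [hs])
      have ha := hl a (by simp)
      rw [List.map_cons, List.prod_cons]
      refine ⟨fun t ht => (e_comm t ht a ha).mul_right (h1 t ht), ?_, ?_⟩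
      · rw [Matrix.conjTranspose_mul, h2, e_herm a ha, (h1 a ha).eq]
      · rw [mul_assoc, ← mul_assoc _ (e a), ← (h1 a ha).eq, mul_assoc (e a), h3, ← mul_assoc,
          e_sq a ha, List.length_cons, pow_succ, mul_smul_comm, smul_mul_assoc, smul_smul, mul_comm]
  obtain ⟨-, h2, h3⟩ := key (List.range (nTwo n)) fun s hs => List.mem_range.mp hs
  rw [List.length_range] at h3
  constructor
  · rw [rhoZero, Matrix.conjTranspose_smul, h2]
    simp only [star_inv₀, star_pow, star_ofNat]
    rfl
  · rw [rhoZero, smul_mul_smul_comm, h3, ← smul_smul, smul_comm (((2 : ℂ) ^ hoQubits n)⁻¹)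
      ((2 : ℂ) ^ nTwo n)]

lemma trace_rhoZero (n : ℕ) : (rhoZero n).trace = 1 := by
  have h := trace_mul_rhoZero (n := n) (A := 1) fun t _ => Commute.one_right _
  rw [one_mul, Matrix.trace_one, card_basis] at h
  rw [h]
  push_cast
  exact inv_mul_cancel₀ (pow_ne_zero _ two_ne_zero)

/-- Expectation values in the initial state are bounded by operator norms. -/
lemma norm_trace_mul_rhoZero_le {n : ℕ} (M : Op (hoQubits n)) :
    ‖(M * rhoZero n).trace‖ ≤ ‖M‖ := by
  obtain ⟨h1, h2⟩ := rhoZero_isProj n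
  obtain ⟨c, hc⟩ : ∃ c : ℂ, c = ((2 : ℂ) ^ hoQubits n)⁻¹ * (2 : ℂ) ^ nTwo n := ⟨_, rfl⟩
  rw [smul_smul, ← hc] at h2
  have hc0 : c ≠ 0 := hc ▸ mul_ne_zero (inv_ne_zero (pow_ne_zero _ two_ne_zero))
    (pow_ne_zero _ two_ne_zero)
  have htr1 := trace_rhoZero n
  generalize rhoZero n = r at h1 h2 htr1 ⊢
  set B : ℝ := ∑ x, ∑ y, ‖r x y‖ ^ 2 with hB
  have hBnn : 0 ≤ B := by positivity
  have htr : c = (B : ℂ) := by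
    have h3 := congrArg Matrix.trace h2
    rw [Matrix.trace_smul, htr1, smul_eq_mul, mul_one] at h3
    rw [← h3, hB]
    nth_rewrite 1 [← h1]
    rw [trace_conjTranspose_mul_eq_sum]
    push_cast
    exact Finset.sum_congr rfl fun x _ => Finset.sum_congr rfl fun y _ => Complex.conj_mul' _
  have h4 : c * (M * r).trace = (r.conjTranspose * (M * r)).trace := by
    rw [h1, Matrix.trace_mul_comm r, mul_assoc, h2, mul_smul_comm, Matrix.trace_smul, smul_eq_mul]
  have h5 : ‖(r.conjTranspose * (M * r)).trace‖ ≤ √B * √(∑ x, ∑ y, ‖(M * r) x y‖ ^ 2) := by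
    rw [trace_conjTranspose_mul_eq_sum,
      ← Fintype.sum_prod_type' (f := fun x y => star (r x y) * (M * r) x y)]
    refine (norm_sum_le _ _).trans ?_
    simp only [norm_mul, norm_star]
    refine (Real.sum_mul_le_sqrt_mul_sqrt _ _ _).trans (le_of_eq ?_)
    rw [Fintype.sum_prod_type' (f := fun x y => ‖r x y‖ ^ 2),
      Fintype.sum_prod_type' (f := fun x y => ‖(M * r) x y‖ ^ 2)]
  have h6 : √(∑ x, ∑ y, ‖(M * r) x y‖ ^ 2) ≤ ‖M‖ * √B := by
    rw [← Real.sqrt_sq (norm_nonneg M), ← Real.sqrt_mul (sq_nonneg _)]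
    exact Real.sqrt_le_sqrt (sum_norm_sq_mul_le M r)
  have h7 : ‖c‖ * ‖(M * r).trace‖ ≤ ‖c‖ * ‖M‖ := by
    rw [← norm_mul, h4]
    refine h5.trans ((mul_le_mul_of_nonneg_left h6 (Real.sqrt_nonneg _)).trans (le_of_eq ?_))
    rw [htr, Complex.norm_real, Real.norm_of_nonneg hBnn]
    linear_combination ‖M‖ * Real.mul_self_sqrt hBnn
  exact le_of_mul_le_mul_left h7 (norm_pos_iff.mpr hc0)

variable {n : ℕ} (p : unitInterval) (ω : Disorder n)

lemma exp_zeta_isometry (s : ℝ) : (NormedSpace.exp (s • zeta p ω)).conjTranspose *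
    NormedSpace.exp (s • zeta p ω) = 1 :=
  exp_skew_conjTranspose_mul (zeta_conjTranspose p ω) s

lemma exp_neg_zeta (s : ℝ) : NormedSpace.exp (s • -zeta p ω) =
    (NormedSpace.exp (s • zeta p ω)).conjTranspose := by
  rw [← Matrix.exp_conjTranspose, Matrix.conjTranspose_smul, zeta_conjTranspose, star_trivial]

lemma abs_re_trace_majoranaProd_hoState_le (I : Finset ℕ) (s : ℝ) :
    |((majoranaProd (hoQubits n) I * hoState p ω (-s)).trace).re| ≤ 1 := by
  refine (Complex.abs_re_le_norm _).trans ?_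
  rw [hoState_neg, ← mul_assoc, Matrix.trace_mul_comm, ← mul_assoc, ← mul_assoc]
  refine (norm_trace_mul_rhoZero_le _).trans (l2_opNorm_le_one_of_isometry ?_)
  have h1 := exp_zeta_isometry p ω s
  have h2 := majoranaProd_conjTranspose_mul_self (hoQubits n) I
  rw [exp_neg_zeta]
  set U := NormedSpace.exp (s • zeta p ω)
  set W := majoranaProd (hoQubits n) I
  have h3 : U * U.conjTranspose = 1 := mul_eq_one_comm.mp h1
  rw [Matrix.conjTranspose_mul, Matrix.conjTranspose_mul, Matrix.conjTranspose_conjTranspose]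
  calc _ = U.conjTranspose * (W.conjTranspose * (U * U.conjTranspose) * W) * U := by
        simp only [mul_assoc]
    _ = 1 := by rw [h3, mul_one, h2, mul_one, h1]

end StateBound

/-! ### Continuity in the disorder -/

section Continuity

variable {n : ℕ} (p : unitInterval)

lemma continuous_coupling (I : Finset ℕ) : Continuous fun ω : Disorder n => coupling ω I := by
  unfold coupling
  split_ifs
  · fun_prop
  · exact continuous_const

lemma continuous_hamCoeff (I : Finset ℕ) : Continuous fun ω : Disorder n => hamCoeff p ω I := by
  unfold hamCoeff
  exact (continuous_const.mul (continuous_coupling I)).neg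

lemma continuous_tau (t : ℕ) : Continuous fun ω : Disorder n => tau p ω t := by
  unfold tau
  refine Continuous.fun_const_smul ?_ _
  refine continuous_finsetSum _ fun S _ => ?_
  have h : Continuous fun ω : Disorder n => (coupling ω (insert (nOne n + t) S) : ℂ) :=
    Complex.continuous_ofReal.comp (continuous_coupling _)
  exact h.fun_smul continuous_const

lemma continuous_zeta : Continuous fun ω : Disorder n => zeta p ω := by
  unfold zeta
  exact continuous_finsetSum _ fun t _ => (continuous_tau p t).mul continuous_const

open scoped Matrix.Norms.Frobenius in
lemma continuous_op_exp (N : ℕ) : Continuous fun A : Op N => NormedSpace.exp A :=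
  NormedSpace.exp_continuous

lemma continuous_hoState (θ : ℝ) : Continuous fun ω : Disorder n => hoState p ω θ := by
  unfold hoState
  have h : Continuous fun ω : Disorder n => (θ : ℂ) • zeta p ω :=
    (continuous_zeta p).fun_const_smul _
  have h1 : Continuous fun ω : Disorder n => NormedSpace.exp (-((θ : ℂ) • zeta p ω)) :=
    (continuous_op_exp _).comp h.neg
  have h2 : Continuous fun ω : Disorder n => NormedSpace.exp ((θ : ℂ) • zeta p ω) :=
    (continuous_op_exp _).comp h
  exact (h1.mul continuous_const).mul h2

lemma continuous_restEnergy (θ : ℝ) : Continuous fun ω : Disorder n => restEnergy p ω θ := by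
  unfold restEnergy
  refine continuous_finsetSum _ fun I _ => (continuous_hamCoeff p I).mul
    (Complex.continuous_re.comp ?_)
  exact (continuous_const.mul (continuous_hoState p θ)).matrix_trace

end Continuity

end SparseSYK
namespace SparseSYK

/-! ### Concentration of sums of independent couplings -/

section Chernoff
open scoped ENNReal

variable {n : ℕ} (p : unitInterval)

/-- The quantity `(J_I² + 1) X_I²`, which bounds both `(J_I X_I)²` and `X_I²`. -/
noncomputable def weight (ω : Disorder n) (I : Finset ℕ) : ℝ :=
  if h : I ∈ Finset.powersetCard 4 (Finset.range (2 * n)) then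
    ((ω ⟨I, h⟩).1 ^ 2 + 1) * (ω ⟨I, h⟩).2 ^ 2 else 0

/-- The Bernoulli variable `X_I`. -/
noncomputable def selector (ω : Disorder n) (I : Finset ℕ) : ℝ :=
  if h : I ∈ Finset.powersetCard 4 (Finset.range (2 * n)) then (ω ⟨I, h⟩).2 else 0

lemma coupling_sq_le_weight (ω : Disorder n) (I : Finset ℕ) : coupling ω I ^ 2 ≤ weight ω I := by
  unfold coupling weight
  split_ifs
  · rw [mul_pow]; nlinarith [sq_nonneg (ω ⟨I, ‹_›⟩).2]
  · simp

lemma selector_sq_le_weight (ω : Disorder n) (I : Finset ℕ) : selector ω I ^ 2 ≤ weight ω I := by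
  unfold selector weight
  split_ifs with h
  · nlinarith [mul_nonneg (sq_nonneg (ω ⟨I, h⟩).1) (sq_nonneg (ω ⟨I, h⟩).2)]
  · simp

lemma sum_dite_quad {M : Type*} [AddCommMonoid M] {F : Finset (Finset ℕ)}
    (hF : F ⊆ Finset.powersetCard 4 (Finset.range (2 * n))) (f : Quad n → M) :
    ∑ I ∈ F, (if h : I ∈ Finset.powersetCard 4 (Finset.range (2 * n)) then f ⟨I, h⟩ else 0) =
      ∑ q ∈ F.subtype (· ∈ Finset.powersetCard 4 (Finset.range (2 * n))), f q := by
  rw [← Finset.sum_subtype_of_mem _ (fun I hI => hF hI)]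
  refine Finset.sum_congr rfl fun q _ => ?_
  rw [dif_pos q.2]

lemma card_subtype_quad {F : Finset (Finset ℕ)}
    (hF : F ⊆ Finset.powersetCard 4 (Finset.range (2 * n))) :
    (F.subtype (· ∈ Finset.powersetCard 4 (Finset.range (2 * n)))).card = F.card := by
  rw [Finset.card_subtype, Finset.filter_true_of_mem fun I hI => hF hI]

instance : IsProbabilityMeasure (disorderLaw n p) := by
  unfold disorderLaw; infer_instance

/-- The exponential Markov inequality. -/
lemma measure_le_of_exp_moment {Ω : Type*} [MeasurableSpace Ω] (μ : Measure Ω) {f : Ω → ℝ}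
    (hf : Measurable f) {s : Set Ω} {x c : ℝ} (hs : ∀ ω ∈ s, x ≤ f ω)
    (h : ∫⁻ ω, ENNReal.ofReal (Real.exp (f ω)) ∂μ ≤ ENNReal.ofReal (Real.exp c)) :
    μ s ≤ ENNReal.ofReal (Real.exp (c - x)) := by
  have h1 : ∀ ω, ENNReal.ofReal (Real.exp (f ω - x)) =
      ENNReal.ofReal (Real.exp (-x)) * ENNReal.ofReal (Real.exp (f ω)) := by
    intro ω
    rw [← ENNReal.ofReal_mul (Real.exp_pos _).le, ← Real.exp_add]; congr 2; ring
  have hm : Measurable fun ω => ENNReal.ofReal (Real.exp (f ω)) :=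
    (Real.measurable_exp.comp hf).ennreal_ofReal
  refine (meas_le_lintegral₀ (f := fun ω => ENNReal.ofReal (Real.exp (f ω - x))) ?_ ?_).trans ?_
  · simp only [h1]
    exact (hm.const_mul _).aemeasurable
  · intro ω hω
    rw [← ENNReal.ofReal_one]
    exact ENNReal.ofReal_le_ofReal (Real.one_le_exp (by linarith [hs ω hω]))
  · simp only [h1]
    rw [lintegral_const_mul _ hm]
    refine (mul_le_mul_right h _).trans (le_of_eq ?_)
    rw [← ENNReal.ofReal_mul (Real.exp_pos _).le, ← Real.exp_add]; congr 2; ring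

/-- Upper tail: a sum of weights exceeds its mean, of order `p m`, by a constant factor only with
probability exponentially small in `p m`. -/
lemma measure_weight_gt_le {F : Finset (Finset ℕ)}
    (hF : F ⊆ Finset.powersetCard 4 (Finset.range (2 * n))) {m : ℝ} (hm : (F.card : ℝ) ≤ m) :
    disorderLaw n p {ω | 8 * p * m < ∑ I ∈ F, weight ω I} ≤
      ENNReal.ofReal (Real.exp (-(p * m))) := by
  have hp := p.2.1
  have h := lintegral_exp_sum_le (siteLaw p)
    (F.subtype (· ∈ Finset.powersetCard 4 (Finset.range (2 * n))))
    (g := fun _ x => (x.1 ^ 2 + 1) * x.2 ^ 2 / 4) (fun _ => by fun_prop) (c := fun _ => (p : ℝ))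
    (fun _ _ => lintegral_exp_weight_le p)
  rw [Finset.sum_const, card_subtype_quad hF, nsmul_eq_mul] at h
  refine (measure_le_of_exp_moment (disorderLaw n p) (by fun_prop) (x := 2 * p * m) ?_ h).trans ?_
  · intro ω hω
    simp only [Set.mem_ofPred_eq, weight] at hω
    rw [sum_dite_quad hF fun q => ((ω q).1 ^ 2 + 1) * (ω q).2 ^ 2] at hω
    rw [← Finset.sum_div]
    linarith
  · refine ENNReal.ofReal_le_ofReal (Real.exp_le_exp.mpr ?_)
    nlinarith

/-- Lower tail for the sum of the squared couplings, whose mean is `p` times the number of terms. -/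
lemma measure_sum_sq_lt_le {F : Finset (Finset ℕ)}
    (hF : F ⊆ Finset.powersetCard 4 (Finset.range (2 * n))) :
    disorderLaw n p {ω | ∑ I ∈ F, coupling ω I ^ 2 < p * F.card / 6} ≤
      ENNReal.ofReal (Real.exp (-(p * F.card / 4))) := by
  have h := lintegral_exp_sum_le (siteLaw p)
    (F.subtype (· ∈ Finset.powersetCard 4 (Finset.range (2 * n))))
    (g := fun _ x => -(3 / 2 * (x.1 * x.2) ^ 2)) (fun _ => by fun_prop) (c := fun _ => -(p / 2 : ℝ))
    (fun _ _ => lintegral_exp_neg_sq_le p)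
  rw [Finset.sum_const, card_subtype_quad hF, nsmul_eq_mul] at h
  refine (measure_le_of_exp_moment (disorderLaw n p) (by fun_prop) (x := -(p * F.card / 4)) ?_
    h).trans ?_
  · intro ω hω
    have e : ∀ I, coupling ω I ^ 2 = if h : I ∈ Finset.powersetCard 4 (Finset.range (2 * n)) then
        ((ω ⟨I, h⟩).1 * (ω ⟨I, h⟩).2) ^ 2 else 0 := by
      intro I; unfold coupling; split_ifs <;> simp
    simp only [Set.mem_ofPred_eq, e] at hω
    rw [sum_dite_quad hF fun q => ((ω q).1 * (ω q).2) ^ 2] at hω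
    rw [Finset.sum_neg_distrib, ← Finset.mul_sum]
    linarith
  · refine ENNReal.ofReal_le_ofReal (Real.exp_le_exp.mpr ?_)
    linarith

end Chernoff

/-! ### The quads that do not enter the state -/

section Rest
open scoped ENNReal

variable {n : ℕ} (p : unitInterval)

/-- The normalization of the Hamiltonian. -/
noncomputable def hamScale (n : ℕ) (p : unitInterval) : ℝ :=
  (√((2 * n).choose 4 : ℝ))⁻¹ * (√(p : ℝ))⁻¹

lemma hamScale_sq_mul_le (n : ℕ) (p : unitInterval) :
    hamScale n p ^ 2 * (p * (2 * n).choose 4) ≤ 1 := by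
  rw [hamScale, mul_pow, inv_pow, inv_pow, Real.sq_sqrt (by positivity), Real.sq_sqrt p.2.1,
    ← mul_inv, mul_comm (p : ℝ)]
  exact inv_mul_le_one

lemma coupling_congr {ω ω' : Disorder n} {I : Finset ℕ}
    (h : ∀ hI : I ∈ Finset.powersetCard 4 (Finset.range (2 * n)), ω ⟨I, hI⟩ = ω' ⟨I, hI⟩) :
    coupling ω I = coupling ω' I := by
  unfold coupling
  split_ifs with hI
  · rw [h hI]
  · rfl

lemma tau_congr {ω ω' : Disorder n} {t : ℕ}
    (h : ∀ S ∈ Finset.powersetCard 3 (Finset.range (nOne n)),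
      coupling ω (insert (nOne n + t) S) = coupling ω' (insert (nOne n + t) S)) :
    tau p ω t = tau p ω' t := by
  unfold tau
  congr 1
  exact Finset.sum_congr rfl fun S hS => by rw [h S hS]

/-- The state only depends on the couplings of the mixed quads. -/
lemma hoState_congr {ω ω' : Disorder n} (h : ∀ I ∈ mixedQuads n, coupling ω I = coupling ω' I)
    (θ : ℝ) : hoState p ω θ = hoState p ω' θ := by
  have hz : zeta p ω = zeta p ω' := by
    unfold zeta
    refine Finset.sum_congr rfl fun t ht => ?_
    rw [tau_congr p fun S hS => h _ ?_]
    exact Finset.mem_image.mpr ⟨(t, S), Finset.mem_product.mpr ⟨ht, hS⟩, rfl⟩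
  rw [hoState, hoState, hz]

/-- Given the state, the energy of the other quads is a centered sum of independent variables of
total variance at most one. -/
lemma measure_restEnergy_lt_le {lam s x : ℝ} (hlam : lam ^ 2 * hamScale n p ^ 2 ≤ 1) :
    disorderLaw n p {ω | restEnergy p ω (-s) * lam < -x} ≤
      ENNReal.ofReal (Real.exp (lam ^ 2 - x)) := by
  have hmeas : Measurable fun ω : Disorder n => -(restEnergy p ω (-s) * lam) :=
    ((continuous_restEnergy p (-s)).measurable.mul_const lam).neg
  refine measure_le_of_exp_moment (disorderLaw n p) hmeas
    (fun ω (hω : restEnergy p ω (-s) * lam < -x) => by linarith) ?_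
  set Q := Finset.powersetCard 4 (Finset.range (2 * n)) with hQ
  set F := (Q \ mixedQuads n).subtype (· ∈ Q) with hF
  have hsub : Q \ mixedQuads n ⊆ Q := Finset.sdiff_subset
  -- The quads in `F` are integrated out first; they do not enter the state.
  have key : ∫⁻ ω, ENNReal.ofReal (Real.exp (-(restEnergy p ω (-s) * lam)))
      ∂Measure.pi (fun _ : Quad n => siteLaw p) ≤
      ∫⁻ _ω : Disorder n, ENNReal.ofReal (Real.exp (lam ^ 2))
        ∂Measure.pi (fun _ : Quad n => siteLaw p) := by
    refine lintegral_le_of_lmarginal_le (μ := fun _ : Quad n => siteLaw p) F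
      (Real.measurable_exp.comp hmeas).ennreal_ofReal measurable_const fun ω => ?_
    simp only [lmarginal, lintegral_const, measure_univ, mul_one]
    set a : Quad n → ℝ := fun q =>
      lam * hamScale n p * ((majoranaProd (hoQubits n) q.1 * hoState p ω (-s)).trace).re with ha
    have hrest : ∀ y : (i : F) → ℝ × ℝ,
        -(restEnergy p (Function.updateFinset ω F y) (-s) * lam) =
          ∑ i ∈ Finset.univ, a i.1 * ((y i).1 * (y i).2) := by
      intro y
      have hst : hoState p (Function.updateFinset ω F y) (-s) = hoState p ω (-s) := by
        refine hoState_congr p (fun I hI => coupling_congr fun hI' => ?_) _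
        rw [Function.updateFinset, dif_neg]
        simp [hF, hI]
      rw [restEnergy, hst, Finset.sum_mul, ← Finset.sum_neg_distrib]
      have e : ∀ I, -(hamCoeff p (Function.updateFinset ω F y) I *
          ((majoranaProd (hoQubits n) I * hoState p ω (-s)).trace).re * lam) =
          if h : I ∈ Q then a ⟨I, h⟩ * ((Function.updateFinset ω F y ⟨I, h⟩).1 *
            (Function.updateFinset ω F y ⟨I, h⟩).2) else 0 := by
        intro I
        by_cases h : I ∈ Q
        · rw [dif_pos h, hamCoeff, coupling, dif_pos h, ha, hamScale]; ring
        · rw [dif_neg h, hamCoeff, coupling, dif_neg h]; ring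
      simp only [e]
      rw [sum_dite_quad hsub fun q => a q * ((Function.updateFinset ω F y q).1 *
        (Function.updateFinset ω F y q).2), ← hF, ← Finset.sum_coe_sort F]
      refine Finset.sum_congr rfl fun i _ => ?_
      rw [Function.updateFinset, dif_pos i.2]
    simp only [hrest]
    have hb : ∀ q, a q ^ 2 ≤ lam ^ 2 * hamScale n p ^ 2 := by
      intro q
      have := abs_re_trace_majoranaProd_hoState_le p ω q.1 s
      rw [ha, mul_pow, mul_pow]
      exact mul_le_of_le_one_right (by positivity) ((sq_le_one_iff_abs_le_one _).mpr this)
    refine (lintegral_exp_sum_le (siteLaw p) Finset.univ (g := fun i x => a i.1 * (x.1 * x.2))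
      (fun _ => by fun_prop) (c := fun i : F => p * a i.1 ^ 2)
      (fun i _ => lintegral_exp_coupling_le p ((hb i.1).trans hlam))).trans ?_
    refine ENNReal.ofReal_le_ofReal (Real.exp_le_exp.mpr ?_)
    have hcard : (F.card : ℝ) ≤ (2 * n).choose 4 := by
      rw [hF, card_subtype_quad hsub]
      refine Nat.cast_le.mpr ((Finset.card_le_card hsub).trans (le_of_eq ?_))
      rw [hQ, Finset.card_powersetCard, Finset.card_range]
    calc ∑ i : F, p * a i.1 ^ 2 ≤ ∑ _i : F, p * (lam ^ 2 * hamScale n p ^ 2) := by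
          refine Finset.sum_le_sum fun i _ => ?_
          exact mul_le_mul_of_nonneg_left (hb i.1) p.2.1
      _ = F.card * (p * (lam ^ 2 * hamScale n p ^ 2)) := by simp
      _ ≤ (2 * n).choose 4 * (p * (lam ^ 2 * hamScale n p ^ 2)) := by
          refine mul_le_mul_of_nonneg_right hcard (mul_nonneg p.2.1 (by positivity))
      _ = lam ^ 2 * (hamScale n p ^ 2 * (p * (2 * n).choose 4)) := by ring
      _ ≤ lam ^ 2 := mul_le_of_le_one_right (sq_nonneg _) (hamScale_sq_mul_le n p)
  refine key.trans ?_
  simp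

end Rest

end SparseSYK
namespace SparseSYK

/-! ### Exponential moments of Gaussian matrix sums -/

section GaussianMatrix
open scoped ENNReal

lemma lintegral_exp_sq_linear_le {ι : Type*} [Fintype ι] (c : ι → ℝ) {t : ℝ} (ht : 0 ≤ t)
    (h : t * ∑ i, c i ^ 2 ≤ 1 / 4) :
    ∫⁻ J, ENNReal.ofReal (Real.exp (t * (∑ i, c i * J i) ^ 2))
      ∂Measure.pi (fun _ : ι => gaussianReal 0 1) ≤ ENNReal.ofReal 2 := by
  -- The square is linearized by an additional Gaussian variable `g`.
  have e : ∀ J : ι → ℝ, ENNReal.ofReal (Real.exp (t * (∑ i, c i * J i) ^ 2)) =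
      ∫⁻ g, ENNReal.ofReal (Real.exp (√(2 * t) * (∑ i, c i * J i) * g)) ∂gaussianReal 0 1 := by
    intro J
    rw [lintegral_exp_mul_gaussian, mul_pow, Real.sq_sqrt (by positivity)]
    congr 2; ring
  simp only [e]
  rw [lintegral_lintegral_swap (by fun_prop)]
  have h1 : ∀ g : ℝ, ∫⁻ J, ENNReal.ofReal (Real.exp (√(2 * t) * (∑ i, c i * J i) * g))
      ∂Measure.pi (fun _ : ι => gaussianReal 0 1) ≤
      ENNReal.ofReal (Real.exp ((t * ∑ i, c i ^ 2) * g ^ 2)) := by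
    intro g
    have h2 := lintegral_exp_sum_le (gaussianReal 0 1) Finset.univ
      (g := fun i x => √(2 * t) * g * c i * x) (fun _ => by fun_prop)
      (c := fun i : ι => (√(2 * t) * g * c i) ^ 2 / 2)
      (fun i _ => (lintegral_exp_mul_gaussian _).le)
    convert! h2 using 1
    · congr 1; ext J; congr 2
      rw [Finset.mul_sum, Finset.sum_mul]
      exact Finset.sum_congr rfl fun i _ => by ring
    · congr 2
      simp only [mul_pow, Real.sq_sqrt (show 0 ≤ 2 * t by positivity)]
      rw [← Finset.sum_div, ← Finset.mul_sum]
      ring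
  refine (lintegral_mono h1).trans ?_
  rw [lintegral_exp_sq_gaussian (by linarith)]
  refine ENNReal.ofReal_le_ofReal ?_
  rw [inv_le_comm₀ (Real.sqrt_pos.mpr (by linarith)) (by norm_num)]
  exact Real.le_sqrt_of_sq_le (by linarith)

/-- By convexity of the exponential function no independence of the components is needed. -/
lemma lintegral_exp_sum_sq_le {ι κ : Type*} [Fintype ι] [Fintype κ] (c : κ → ι → ℝ) {lam : ℝ}
    (hlam : 0 ≤ lam) (h : lam * ∑ u, ∑ i, c u i ^ 2 ≤ 1 / 4) :
    ∫⁻ J, ENNReal.ofReal (Real.exp (lam * ∑ u, (∑ i, c u i * J i) ^ 2))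
      ∂Measure.pi (fun _ : ι => gaussianReal 0 1) ≤ ENNReal.ofReal 2 := by
  set v : κ → ℝ := fun u => ∑ i, c u i ^ 2 with hv
  have hv0 : ∀ u, 0 ≤ v u := fun u => by positivity
  set M := ∑ u, v u with hM
  have hM0 : 0 ≤ M := Finset.sum_nonneg fun u _ => hv0 u
  have hvc : ∀ u, v u = 0 → ∀ i, c u i = 0 := by
    intro u hu i
    have := (Finset.sum_eq_zero_iff_of_nonneg (fun i _ => sq_nonneg (c u i))).mp hu i
      (Finset.mem_univ i)
    simpa using this
  rcases hM0.eq_or_lt with hM1 | hM1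
  · have hz : ∀ u i, c u i = 0 := fun u => hvc u
      ((Finset.sum_eq_zero_iff_of_nonneg fun u _ => hv0 u).mp hM1.symm u (Finset.mem_univ u))
    simp [hz]
  -- Jensen's inequality with the weights `v u / M` makes the exponents of all components equally
  -- harmless: each becomes `lam M / v u` times the square of a Gaussian of variance `v u`.
  have hw : ∑ u, v u / M = 1 := by rw [← Finset.sum_div, ← hM, div_self hM1.ne']
  have hJ : ∀ J : ι → ℝ, Real.exp (lam * ∑ u, (∑ i, c u i * J i) ^ 2) ≤
      ∑ u, v u / M * Real.exp (lam * M / v u * (∑ i, c u i * J i) ^ 2) := by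
    intro J
    have := convexOn_exp.map_sum_le (t := Finset.univ) (w := fun u => v u / M)
      (p := fun u => lam * M / v u * (∑ i, c u i * J i) ^ 2)
      (fun u _ => div_nonneg (hv0 u) hM0) hw (fun _ _ => Set.mem_univ _)
    simp only [smul_eq_mul] at this
    refine le_trans (le_of_eq ?_) this
    congr 1
    rw [Finset.mul_sum]
    refine Finset.sum_congr rfl fun u _ => ?_
    by_cases hu : v u = 0
    · simp [hvc u hu]
    · field_simp
  calc _ ≤ ∫⁻ J, ∑ u, ENNReal.ofReal (v u / M) *
        ENNReal.ofReal (Real.exp (lam * M / v u * (∑ i, c u i * J i) ^ 2))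
        ∂Measure.pi (fun _ : ι => gaussianReal 0 1) := by
        refine lintegral_mono fun J => (ENNReal.ofReal_le_ofReal (hJ J)).trans (le_of_eq ?_)
        rw [ENNReal.ofReal_sum_of_nonneg fun u _ => by
          have := hv0 u; positivity]
        refine Finset.sum_congr rfl fun u _ => ENNReal.ofReal_mul (div_nonneg (hv0 u) hM0)
    _ = ∑ u, ENNReal.ofReal (v u / M) *
        ∫⁻ J, ENNReal.ofReal (Real.exp (lam * M / v u * (∑ i, c u i * J i) ^ 2))
          ∂Measure.pi (fun _ : ι => gaussianReal 0 1) := by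
        rw [lintegral_finsetSum _ fun u _ => by fun_prop]
        refine Finset.sum_congr rfl fun u _ => lintegral_const_mul _ (by fun_prop)
    _ ≤ ∑ u, ENNReal.ofReal (v u / M) * ENNReal.ofReal 2 := by
        refine Finset.sum_le_sum fun u _ => mul_le_mul_right ?_ _
        refine lintegral_exp_sq_linear_le (c u) (div_nonneg (by positivity) (hv0 u)) ?_
        change lam * M / v u * v u ≤ 1 / 4
        by_cases hu : v u = 0
        · simp [hu]
        · rwa [div_mul_cancel₀ _ hu]
    _ = ENNReal.ofReal 2 := by
        rw [← Finset.sum_mul, ← ENNReal.ofReal_sum_of_nonneg fun u _ => div_nonneg (hv0 u) hM0, hw,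
          ENNReal.ofReal_one, one_mul]

open scoped Matrix.Norms.Frobenius

/-- A Gaussian combination of matrices: apply the scalar bound to the real and imaginary parts of the
entries. -/
lemma lintegral_exp_norm_sq_le {ι m : Type*} [Fintype ι] [Fintype m] (A : ι → Matrix m m ℂ)
    {lam : ℝ} (hlam : 0 ≤ lam) (h : lam * ∑ i, ‖A i‖ ^ 2 ≤ 1 / 4) :
    ∫⁻ J, ENNReal.ofReal (Real.exp (lam * ‖∑ i, (J i : ℂ) • A i‖ ^ 2))
      ∂Measure.pi (fun _ : ι => gaussianReal 0 1) ≤ ENNReal.ofReal 2 := by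
  set c : (m × m) × Bool → ι → ℝ := fun u i =>
    if u.2 then (A i u.1.1 u.1.2).re else (A i u.1.1 u.1.2).im with hc
  have hz : ∀ z : ℂ, ‖z‖ ^ 2 = z.re ^ 2 + z.im ^ 2 := fun z => by
    rw [← Complex.normSq_eq_norm_sq, Complex.normSq_apply]; ring
  have e1 : ∀ J : ι → ℝ, ‖∑ i, (J i : ℂ) • A i‖ ^ 2 = ∑ u, (∑ i, c u i * J i) ^ 2 := by
    intro J
    rw [frobenius_sq_eq_sum, Fintype.sum_prod_type, Fintype.sum_prod_type]
    refine Finset.sum_congr rfl fun x _ => Finset.sum_congr rfl fun y _ => ?_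
    rw [hz]
    simp [hc, Matrix.sum_apply, mul_comm]
  have e2 : ∑ i, ‖A i‖ ^ 2 = ∑ u, ∑ i, c u i ^ 2 := by
    rw [Finset.sum_comm]
    refine Finset.sum_congr rfl fun i _ => ?_
    rw [frobenius_sq_eq_sum, Fintype.sum_prod_type, Fintype.sum_prod_type]
    refine Finset.sum_congr rfl fun x _ => Finset.sum_congr rfl fun y _ => ?_
    rw [hz]
    simp [hc]
  simp only [e1]
  exact lintegral_exp_sum_sq_le c hlam (e2 ▸ h)

/-- The exponential moment of `‖∑ J_i X_i A_i‖²`, truncated to the event that few of the `X_i` are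
nonzero. -/
lemma lintegral_exp_norm_sq_siteLaw_le (p : unitInterval) {ι m : Type*} [Fintype ι] [Fintype m]
    (A : ι → Matrix m m ℂ) {lam a K : ℝ} (hlam : 0 ≤ lam) (ha : ∀ i, ‖A i‖ ^ 2 ≤ a)
    (ha0 : 0 ≤ a) (h : lam * (a * K) ≤ 1 / 4) :
    ∫⁻ y, (if ∑ i, (y i).2 ^ 2 ≤ K then
        ENNReal.ofReal (Real.exp (lam * ‖∑ i, (((y i).1 * (y i).2 : ℝ) : ℂ) • A i‖ ^ 2)) else 0)
      ∂Measure.pi (fun _ : ι => siteLaw p) ≤ 2 := by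
  set f : (ι → ℝ) × (ι → ℝ) → ℝ≥0∞ := fun z => if ∑ i, z.2 i ^ 2 ≤ K then
        ENNReal.ofReal (Real.exp (lam * ‖∑ i, ((z.1 i * z.2 i : ℝ) : ℂ) • A i‖ ^ 2)) else 0 with hf
  have hcont : Continuous fun z : (ι → ℝ) × (ι → ℝ) =>
      ‖∑ i, ((z.1 i * z.2 i : ℝ) : ℂ) • A i‖ := by
    refine continuous_norm.comp (continuous_finsetSum _ fun i _ => ?_)
    have : Continuous fun z : (ι → ℝ) × (ι → ℝ) => ((z.1 i * z.2 i : ℝ) : ℂ) :=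
      Complex.continuous_ofReal.comp (by fun_prop)
    exact this.fun_smul continuous_const
  have hfm : Measurable f := by
    refine Measurable.ite (measurableSet_le (by fun_prop) measurable_const) ?_ measurable_const
    exact (Real.measurable_exp.comp ((hcont.measurable.pow_const 2).const_mul lam)).ennreal_ofReal
  have hmp := measurePreserving_arrowProdEquivProdArrow ℝ ℝ ι (fun _ => gaussianReal 0 1)
    (fun _ => bernoulliMeasure (1 : ℝ) 0 p)
  have h1 := hmp.lintegral_comp hfm
  change ∫⁻ y, f (MeasurableEquiv.arrowProdEquivProdArrow ℝ ℝ ι y) ∂_ ≤ 2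
  rw [h1, lintegral_prod_symm _ hfm.aemeasurable]
  have h2 : ∀ X : ι → ℝ, ∫⁻ J, f (J, X) ∂Measure.pi (fun _ : ι => gaussianReal 0 1) ≤ 2 := by
    intro X
    by_cases hX : ∑ i, X i ^ 2 ≤ K
    · simp only [hf, hX, if_true]
      have := lintegral_exp_norm_sq_le (fun i => (X i : ℂ) • A i) hlam ?_
      · simp only [smul_smul, ← Complex.ofReal_mul] at this
        simpa using this
      · refine le_trans (mul_le_mul_of_nonneg_left ?_ hlam) h
        calc ∑ i, ‖(X i : ℂ) • A i‖ ^ 2 = ∑ i, X i ^ 2 * ‖A i‖ ^ 2 := by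
              refine Finset.sum_congr rfl fun i _ => ?_
              rw [norm_smul, mul_pow, Complex.norm_real, Real.norm_eq_abs, sq_abs]
          _ ≤ ∑ i, X i ^ 2 * a := by gcongr with i; exact ha i
          _ = a * ∑ i, X i ^ 2 := by rw [← Finset.sum_mul, mul_comm]
          _ ≤ a * K := by gcongr
    · simp [hf, hX]
  refine (lintegral_mono h2).trans ?_
  simp

/-- Integrating out the variables in `s`, on which the first factor does not depend. -/
lemma lintegral_mul_le_of_lmarginal {ι X : Type*} [Fintype ι] [DecidableEq ι] [MeasurableSpace X]
    (μ : Measure X) [IsProbabilityMeasure μ] (s : Finset ι) {h F : (ι → X) → ℝ≥0∞} {c : ℝ≥0∞}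
    (hh : Measurable h) (hF : Measurable F)
    (hs : ∀ x y, h (Function.updateFinset x s y) = h x)
    (hc : ∀ x, h x ≠ 0 →
      ∫⁻ y, F (Function.updateFinset x s y) ∂Measure.pi (fun _ : s => μ) ≤ c) :
    ∫⁻ x, h x * F x ∂Measure.pi (fun _ : ι => μ) ≤
      c * ∫⁻ x, h x ∂Measure.pi (fun _ : ι => μ) := by
  rw [← lintegral_const_mul _ hh]
  refine lintegral_le_of_lmarginal_le (μ := fun _ : ι => μ) s (hh.mul hF) (hh.const_mul c)
    fun x => ?_
  simp only [lmarginal, hs, lintegral_const, measure_univ, mul_one]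
  have hm : Measurable fun y : s → X => F (Function.updateFinset x s y) :=
    hF.comp measurable_updateFinset
  rw [lintegral_const_mul _ hm]
  by_cases hx : h x = 0
  · simp [hx]
  · rw [mul_comm]
    exact mul_le_mul_left (hc x hx) _

end GaussianMatrix

end SparseSYK
namespace SparseSYK

/-! ### The anticommutators of different `τ` operators -/

section Anticommutators
open scoped ENNReal Matrix.Norms.Frobenius

variable {n : ℕ} (p : unitInterval)

lemma tauScale_sq_mul_le (n : ℕ) (p : unitInterval) :
    tauScale n p ^ 2 * (p * (nOne n).choose 3) ≤ 1 := by
  rw [tauScale, mul_pow, inv_pow, inv_pow, Real.sq_sqrt (by positivity), Real.sq_sqrt p.2.1,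
    ← mul_inv, mul_comm (p : ℝ)]
  exact inv_mul_le_one

/-- The quads that consist of `χ_t` and three `φ` modes. -/
def chiQuads (n t : ℕ) : Finset (Quad n) :=
  ((Finset.powersetCard 3 (Finset.range (nOne n))).image (insert (nOne n + t))).subtype
    (· ∈ Finset.powersetCard 4 (Finset.range (2 * n)))

lemma insert_chi_inj {t u : ℕ} (ht : t < nTwo n) (hu : u < nTwo n) {S T : Finset ℕ}
    (hS : S ∈ Finset.powersetCard 3 (Finset.range (nOne n)))
    (hT : T ∈ Finset.powersetCard 3 (Finset.range (nOne n)))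
    (h : insert (nOne n + t) S = insert (nOne n + u) T) : t = u ∧ S = T := by
  have h1 : ∀ {t S}, t < nTwo n → S ∈ Finset.powersetCard 3 (Finset.range (nOne n)) → (t, S) ∈
      (Finset.range (nTwo n) ×ˢ Finset.powersetCard 3 (Finset.range (nOne n)) : Finset _) :=
    fun ht hS => Finset.mem_product.mpr ⟨Finset.mem_range.mpr ht, hS⟩
  exact Prod.mk.inj (insert_chi_injOn n (Finset.mem_coe.mpr (h1 ht hS))
    (Finset.mem_coe.mpr (h1 hu hT)) h)

lemma sum_chiQuads {M : Type*} [AddCommMonoid M] {t : ℕ} (ht : t < nTwo n) (g : Quad n → M) :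
    ∑ S ∈ Finset.powersetCard 3 (Finset.range (nOne n)),
      (if h : insert (nOne n + t) S ∈ Finset.powersetCard 4 (Finset.range (2 * n)) then
        g ⟨insert (nOne n + t) S, h⟩ else 0) = ∑ q : chiQuads n t, g q := by
  rw [Finset.sum_coe_sort (chiQuads n t) g, chiQuads, ← sum_dite_quad, Finset.sum_image]
  · intro S hS T hT h
    exact (insert_chi_inj ht ht hS hT h).2
  · intro I hI
    obtain ⟨S, hS, rfl⟩ := Finset.mem_image.mp hI
    exact insert_chi_mem ht hS

lemma insert_chi_notMem_chiQuads {t u : ℕ} (ht : t < nTwo n) (hu : u < nTwo n) (htu : u ≠ t)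
    {S : Finset ℕ} (hS : S ∈ Finset.powersetCard 3 (Finset.range (nOne n)))
    (h : insert (nOne n + u) S ∈ Finset.powersetCard 4 (Finset.range (2 * n))) :
    (⟨insert (nOne n + u) S, h⟩ : Quad n) ∉ chiQuads n t := by
  rw [chiQuads, Finset.mem_subtype, Finset.mem_image]
  rintro ⟨T, hT, hTS⟩
  exact htu (insert_chi_inj ht hu hT hS hTS).1.symm

lemma coupling_updateFinset {t u : ℕ} (ht : t < nTwo n) (hu : u < nTwo n) (htu : u ≠ t)
    {S : Finset ℕ} (hS : S ∈ Finset.powersetCard 3 (Finset.range (nOne n))) (ω : Disorder n)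
    (y : chiQuads n t → ℝ × ℝ) :
    coupling (Function.updateFinset ω (chiQuads n t) y) (insert (nOne n + u) S) =
      coupling ω (insert (nOne n + u) S) :=
  coupling_congr fun hI => by
    rw [Function.updateFinset, dif_neg (insert_chi_notMem_chiQuads ht hu htu hS hI)]

lemma selector_updateFinset {t u : ℕ} (ht : t < nTwo n) (hu : u < nTwo n) (htu : u ≠ t)
    {S : Finset ℕ} (hS : S ∈ Finset.powersetCard 3 (Finset.range (nOne n))) (ω : Disorder n)
    (y : chiQuads n t → ℝ × ℝ) :
    selector (Function.updateFinset ω (chiQuads n t) y) (insert (nOne n + u) S) =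
      selector ω (insert (nOne n + u) S) := by
  unfold selector
  split_ifs with hI
  · rw [Function.updateFinset, dif_neg (insert_chi_notMem_chiQuads ht hu htu hS hI)]
  · rfl

lemma tau_updateFinset {t u : ℕ} (ht : t < nTwo n) (hu : u < nTwo n) (htu : u ≠ t)
    (ω : Disorder n) (y : chiQuads n t → ℝ × ℝ) :
    tau p (Function.updateFinset ω (chiQuads n t) y) u = tau p ω u :=
  tau_congr p fun _ hS => coupling_updateFinset ht hu htu hS ω y

lemma measurable_selector (I : Finset ℕ) : Measurable fun ω : Disorder n => selector ω I := by
  unfold selector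
  split_ifs
  · fun_prop
  · fun_prop

/-- At most a typical number of the sets `S` have `X_{S,t} = 1`. -/
def FewSelected (p : unitInterval) (t : ℕ) (ω : Disorder n) : Prop :=
  ∑ S ∈ Finset.powersetCard 3 (Finset.range (nOne n)), selector ω (insert (nOne n + t) S) ^ 2 ≤
    8 * p * (nOne n).choose 3

/-- No `φ` mode carries too much of the weight of `τ_s`. -/
def Spread (p : unitInterval) (s : ℕ) (ω : Disorder n) : Prop :=
  ∀ i < nOne n, ∑ S ∈ (Finset.powersetCard 3 (Finset.range (nOne n))).filter (i ∈ ·),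
    coupling ω (insert (nOne n + s) S) ^ 2 ≤ 24 * p * (nOne n).choose 3 / nOne n

lemma measurableSet_fewSelected (t : ℕ) : MeasurableSet {ω : Disorder n | FewSelected p t ω} :=
  measurableSet_le (Finset.measurable_sum _ fun _ _ => (measurable_selector _).pow_const 2)
    measurable_const

lemma measurableSet_spread (s : ℕ) : MeasurableSet {ω : Disorder n | Spread p s ω} := by
  have : {ω : Disorder n | Spread p s ω} = ⋂ i, ⋂ (_ : i < nOne n), {ω : Disorder n |
      ∑ S ∈ (Finset.powersetCard 3 (Finset.range (nOne n))).filter (i ∈ ·),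
        coupling ω (insert (nOne n + s) S) ^ 2 ≤ 24 * p * (nOne n).choose 3 / nOne n} := by
    ext ω; simp [Spread]
  rw [this]
  refine MeasurableSet.iInter fun i => MeasurableSet.iInter fun _ => ?_
  exact measurableSet_le
    (Finset.measurable_sum _ fun _ _ => (continuous_coupling _).measurable.pow_const 2)
    measurable_const

lemma spread_updateFinset {t s : ℕ} (ht : t < nTwo n) (hs : s < nTwo n) (hst : s ≠ t)
    (ω : Disorder n) (y : chiQuads n t → ℝ × ℝ) :
    Spread p s (Function.updateFinset ω (chiQuads n t) y) ↔ Spread p s ω := by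
  refine forall₂_congr fun i _ => ?_
  rw [Finset.sum_congr rfl fun S hS => by
    rw [coupling_updateFinset ht hs hst (Finset.mem_filter.mp hS).1]]

lemma fewSelected_updateFinset {t u : ℕ} (ht : t < nTwo n) (hu : u < nTwo n) (hut : u ≠ t)
    (ω : Disorder n) (y : chiQuads n t → ℝ × ℝ) :
    FewSelected p u (Function.updateFinset ω (chiQuads n t) y) ↔ FewSelected p u ω := by
  rw [FewSelected, FewSelected, Finset.sum_congr rfl fun S hS => by
    rw [selector_updateFinset ht hu hut hS]]

/-- The anticommutator with one monomial, for a well spread `τ_s`. -/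
lemma norm_anticomm_monomial_sq_le {s : ℕ} {ω : Disorder n} (hω : Spread p s ω) {S : Finset ℕ}
    (hS : S ∈ Finset.powersetCard 3 (Finset.range (nOne n))) :
    ‖((tauScale n p : ℂ) * Complex.I) • (tau p ω s * majoranaProd (hoQubits n) S +
      majoranaProd (hoQubits n) S * tau p ω s)‖ ^ 2 ≤
      288 * 2 ^ hoQubits n * (tauScale n p ^ 2) ^ 2 * (p * (nOne n).choose 3) / nOne n := by
  obtain ⟨hS1, -, hS3⟩ := phi_index hS
  have h1 := norm_phiSum_anticomm_sq_le
    (fun S => tauScale n p * coupling ω (insert (nOne n + s) S)) hS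
  rw [← tau_eq] at h1
  have h2 : ∑ T ∈ (Finset.powersetCard 3 (Finset.range (nOne n))).filter (fun T => ¬ Disjoint T S),
      (tauScale n p * coupling ω (insert (nOne n + s) T)) ^ 2 ≤
      tauScale n p ^ 2 * (3 * (24 * p * (nOne n).choose 3 / nOne n)) := by
    simp only [mul_pow]
    rw [← Finset.mul_sum]
    refine mul_le_mul_of_nonneg_left ?_ (sq_nonneg _)
    calc _ ≤ ∑ T ∈ Finset.powersetCard 3 (Finset.range (nOne n)), ∑ i ∈ S,
          if i ∈ T then coupling ω (insert (nOne n + s) T) ^ 2 else 0 := by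
          rw [Finset.sum_filter]
          refine Finset.sum_le_sum fun T _ => ?_
          have h0 : ∀ i ∈ S, 0 ≤ if i ∈ T then coupling ω (insert (nOne n + s) T) ^ 2 else 0 :=
            fun i _ => by split_ifs <;> positivity
          rw [ite_not]
          split_ifs with h
          · exact Finset.sum_nonneg h0
          · obtain ⟨i, hiT, hiS⟩ := Finset.not_disjoint_iff.mp h
            refine le_trans (le_of_eq ?_) (Finset.single_le_sum h0 hiS)
            rw [if_pos hiT]
      _ = ∑ i ∈ S, ∑ T ∈ (Finset.powersetCard 3 (Finset.range (nOne n))).filter (i ∈ ·),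
          coupling ω (insert (nOne n + s) T) ^ 2 := by
          rw [Finset.sum_comm]
          exact Finset.sum_congr rfl fun i _ => (Finset.sum_filter _ _).symm
      _ ≤ ∑ _i ∈ S, 24 * (p : ℝ) * (nOne n).choose 3 / nOne n :=
          Finset.sum_le_sum fun i hi => hω i (hS1 i hi)
      _ = _ := ?_
    rw [Finset.sum_const, hS3, nsmul_eq_mul]; norm_num
  rw [norm_smul, mul_pow, norm_mul, Complex.norm_I, mul_one, Complex.norm_real, Real.norm_eq_abs,
    sq_abs]
  calc _ ≤ tauScale n p ^ 2 * (4 * (2 ^ hoQubits n *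
        (tauScale n p ^ 2 * (3 * (24 * p * (nOne n).choose 3 / nOne n))))) := by
        refine mul_le_mul_of_nonneg_left (h1.trans ?_) (sq_nonneg _)
        gcongr
    _ = _ := by ring

/-- The truncated exponential moment of the anticommutator of `τ_t` and `τ_s`. -/
noncomputable def anticommMoment (p : unitInterval) (lam : ℝ) (s t : ℕ) (ω : Disorder n) : ℝ≥0∞ :=
  {ω | FewSelected p t ω}.indicator (fun ω => ENNReal.ofReal (Real.exp
    (lam * ‖tau p ω t * tau p ω s + tau p ω s * tau p ω t‖ ^ 2))) ω

lemma measurable_anticomm (s t : ℕ) : Measurable fun ω : Disorder n =>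
    ‖tau p ω t * tau p ω s + tau p ω s * tau p ω t‖ := by
  have h := fun t => continuous_tau (n := n) p t
  exact (continuous_norm.comp (((h t).mul (h s)).add ((h s).mul (h t)))).measurable

lemma measurable_anticommMoment (lam : ℝ) (s t : ℕ) :
    Measurable (anticommMoment (n := n) p lam s t) :=
  ((Real.measurable_exp.comp (((measurable_anticomm p s t).pow_const 2).const_mul
    lam)).ennreal_ofReal).indicator (measurableSet_fewSelected p t)

/-- The exponent that `lintegral_anticommMoment_le` allows. -/
noncomputable def anticommRate (n : ℕ) : ℝ := nOne n / (9216 * 2 ^ hoQubits n)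

/-- The rate is chosen such that the variance condition of `lintegral_exp_norm_sq_siteLaw_le` holds:
the first factor bounds one `‖A_i‖²` and the last one the number of nonzero terms. -/
lemma anticommRate_mul_le (n : ℕ) (p : unitInterval) :
    anticommRate n * (288 * 2 ^ hoQubits n * (tauScale n p ^ 2) ^ 2 *
      (p * (nOne n).choose 3) / nOne n * (8 * p * (nOne n).choose 3)) ≤ 1 / 4 := by
  have h1 := tauScale_sq_mul_le n p
  have h0 : 0 ≤ tauScale n p ^ 2 * (p * (nOne n).choose 3) :=
    mul_nonneg (sq_nonneg _) (mul_nonneg p.2.1 (Nat.cast_nonneg _))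
  set u := tauScale n p ^ 2 * (p * (nOne n).choose 3) with hu
  have e : anticommRate n * (288 * 2 ^ hoQubits n * (tauScale n p ^ 2) ^ 2 *
      (p * (nOne n).choose 3) / nOne n * (8 * p * (nOne n).choose 3)) =
      (nOne n / nOne n : ℝ) * u ^ 2 / 4 := by
    rw [hu, anticommRate]
    have : (2 : ℝ) ^ hoQubits n ≠ 0 := by positivity
    field_simp
    ring
  rw [e]
  have h3 : (nOne n / nOne n : ℝ) ≤ 1 := div_self_le_one _
  have h4 : u ^ 2 ≤ 1 := pow_le_one₀ h0 h1
  have h5 : (0 : ℝ) ≤ nOne n / nOne n := by positivity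
  nlinarith [mul_le_mul h3 h4 (sq_nonneg u) zero_le_one]

/-- Conditionally on the other blocks, the entries of `τ_t` are independent of `τ_s`. -/
lemma lintegral_anticommMoment_le {s t : ℕ} (ht : t < nTwo n) (hs : s < nTwo n) (hst : s ≠ t)
    {ω : Disorder n} (hω : Spread p s ω) :
    ∫⁻ y, anticommMoment p (anticommRate n) s t (Function.updateFinset ω (chiQuads n t) y)
      ∂Measure.pi (fun _ : chiQuads n t => siteLaw p) ≤ 2 := by
  set a : ℝ := 288 * 2 ^ hoQubits n * (tauScale n p ^ 2) ^ 2 *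
    (p * (nOne n).choose 3) / nOne n with ha
  set A : chiQuads n t → Op (hoQubits n) := fun q => ((tauScale n p : ℂ) * Complex.I) •
    (tau p ω s * majoranaProd (hoQubits n) (q.1.1.erase (nOne n + t)) +
      majoranaProd (hoQubits n) (q.1.1.erase (nOne n + t)) * tau p ω s) with hA
  have hAa : ∀ q, ‖A q‖ ^ 2 ≤ a := by
    rintro ⟨⟨I, hI⟩, hq⟩
    rw [chiQuads, Finset.mem_subtype, Finset.mem_image] at hq
    obtain ⟨S, hS, rfl⟩ := hq
    have : nOne n + t ∉ S := fun h => absurd ((phi_index hS).1 _ h) (by omega)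
    simp only [hA, Finset.erase_insert this]
    exact norm_anticomm_monomial_sq_le p hω hS
  have ha0 : 0 ≤ a := by
    have := p.2.1; positivity
  have key := lintegral_exp_norm_sq_siteLaw_le p A (lam := anticommRate n)
    (K := 8 * p * (nOne n).choose 3) (by unfold anticommRate; positivity) hAa ha0
    (anticommRate_mul_le n p)
  refine le_trans (lintegral_mono fun y => le_of_eq ?_) key
  set ω' := Function.updateFinset ω (chiQuads n t) y with hω'
  have hval : ∀ q : chiQuads n t, ω' q = y q := fun q => by
    rw [hω', Function.updateFinset, dif_pos q.2]
  have hsel : ∑ S ∈ Finset.powersetCard 3 (Finset.range (nOne n)),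
      selector ω' (insert (nOne n + t) S) ^ 2 = ∑ q, (y q).2 ^ 2 := by
    have := sum_chiQuads ht fun q => (ω' q).2 ^ 2
    simp only [hval] at this
    rw [← this]
    refine Finset.sum_congr rfl fun S _ => ?_
    unfold selector; split_ifs <;> simp
  have hanti : tau p ω' t * tau p ω' s + tau p ω' s * tau p ω' t =
      ∑ q, (((y q).1 * (y q).2 : ℝ) : ℂ) • A q := by
    rw [hω', tau_updateFinset p ht hs hst, ← hω']
    have := sum_chiQuads ht fun q => (((ω' q).1 * (ω' q).2 : ℝ) : ℂ) •
      (((tauScale n p : ℂ) * Complex.I) •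
      (tau p ω s * majoranaProd (hoQubits n) (q.1.erase (nOne n + t)) +
        majoranaProd (hoQubits n) (q.1.erase (nOne n + t)) * tau p ω s))
    simp only [hval] at this
    rw [hA, ← this, tau_eq p ω' t, phiSum, Finset.sum_mul, Finset.mul_sum,
      ← Finset.sum_add_distrib]
    refine Finset.sum_congr rfl fun S hS => ?_
    have hS' : nOne n + t ∉ S := fun h => absurd ((phi_index hS).1 _ h) (by omega)
    rw [dif_pos (insert_chi_mem ht hS), coupling, dif_pos (insert_chi_mem ht hS),
      Finset.erase_insert hS', smul_mul_assoc, mul_smul_comm, ← smul_add, smul_smul,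
      add_comm (majoranaProd (hoQubits n) S * _)]
    congr 1
    push_cast
    ring
  classical
  rw [anticommMoment, Set.indicator_apply]
  simp only [Set.mem_ofPred_eq, FewSelected, hsel, hanti]

lemma indicator_congr_point {X M : Type*} [Zero M] {s : Set X} {f : X → M} {a b : X}
    (h : a ∈ s ↔ b ∈ s) (hf : f a = f b) : s.indicator f a = s.indicator f b := by
  classical
  simp only [Set.indicator_apply, h, hf]

/-- Different anticommutators are controlled one block after the other. -/
lemma lintegral_prod_anticommMoment_le {s : ℕ} (hs : s < nTwo n) (T : Finset ℕ)
    (hT : T ⊆ (Finset.range (nTwo n)).erase s) :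
    ∫⁻ ω, {ω | Spread p s ω}.indicator 1 ω * ∏ t ∈ T, anticommMoment p (anticommRate n) s t ω
      ∂disorderLaw n p ≤ 2 ^ T.card := by
  have hspread : Measurable ({ω : Disorder n | Spread p s ω}.indicator (1 : Disorder n → ℝ≥0∞)) :=
    measurable_one.indicator (measurableSet_spread p s)
  induction T using Finset.induction_on with
  | empty =>
    simp only [Finset.prod_empty, mul_one, Finset.card_empty, pow_zero]
    refine (lintegral_mono fun ω => Set.indicator_le_self' (fun _ _ => zero_le) ω).trans ?_
    simp
  | insert t T htT ih =>
    have ht := Finset.mem_erase.mp (hT (Finset.mem_insert_self t T))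
    have htn : t < nTwo n := Finset.mem_range.mp ht.2
    have hT' := (Finset.subset_insert t T).trans hT
    rw [Finset.card_insert_of_notMem htT, pow_succ, mul_comm (2 ^ _)]
    refine le_trans ?_ (mul_le_mul_right (ih hT') 2)
    have e : ∀ ω : Disorder n, {ω | Spread p s ω}.indicator (1 : Disorder n → ℝ≥0∞) ω *
        ∏ t ∈ insert t T, anticommMoment p (anticommRate n) s t ω =
        ({ω | Spread p s ω}.indicator 1 ω * ∏ t ∈ T, anticommMoment p (anticommRate n) s t ω) *
          anticommMoment p (anticommRate n) s t ω := by
      intro ω; rw [Finset.prod_insert htT]; ring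
    simp only [e]
    refine lintegral_mul_le_of_lmarginal (siteLaw p) (chiQuads n t)
      (hspread.mul (Finset.measurable_prod _ fun u _ => measurable_anticommMoment p _ s u))
      (measurable_anticommMoment p _ s t) (fun ω y => ?_) fun ω hω => ?_
    · refine congrArg₂ _ ?_ (Finset.prod_congr rfl fun u hu => ?_)
      · exact indicator_congr_point (spread_updateFinset p htn hs ht.1.symm ω y) rfl
      · have hu' := Finset.mem_erase.mp (hT' hu)
        have hun : u < nTwo n := Finset.mem_range.mp hu'.2
        have hut : u ≠ t := fun h => htT (h ▸ hu)
        refine indicator_congr_point (fewSelected_updateFinset p htn hun hut ω y) ?_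
        rw [tau_updateFinset p htn hun hut, tau_updateFinset p htn hs ht.1.symm]
    · refine lintegral_anticommMoment_le p htn hs ht.1.symm ?_
      by_contra h
      exact hω (by rw [Set.indicator_of_notMem h, zero_mul])

/-- The product of the exponential moments is at most `2 ^ n₂`, and exceeding the bound costs a factor
`e ^ (-n₁)`; since `n + n₂ ≤ n₁` this leaves `e ^ (-n)`. -/
lemma measure_anticomm_gt_le {s : ℕ} (hs : s < nTwo n) :
    disorderLaw n p {ω | Spread p s ω ∧ (∀ t < nTwo n, FewSelected p t ω) ∧
      9216 * 2 ^ hoQubits n < ∑ t ∈ (Finset.range (nTwo n)).erase s,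
        ‖tau p ω t * tau p ω s + tau p ω s * tau p ω t‖ ^ 2} ≤
      ENNReal.ofReal (Real.exp (-n)) := by
  have h := lintegral_prod_anticommMoment_le p hs _ subset_rfl
  have hspread : Measurable ({ω : Disorder n | Spread p s ω}.indicator (1 : Disorder n → ℝ≥0∞)) :=
    measurable_one.indicator (measurableSet_spread p s)
  have hm : Measurable fun ω : Disorder n =>
      {ω | Spread p s ω}.indicator (1 : Disorder n → ℝ≥0∞) ω *
      ∏ t ∈ (Finset.range (nTwo n)).erase s, anticommMoment p (anticommRate n) s t ω :=
    hspread.mul (Finset.measurable_prod _ fun u _ => measurable_anticommMoment p _ s u)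
  refine (meas_le_lintegral₀ (hm.const_mul (ENNReal.ofReal (Real.exp (-nOne n)))).aemeasurable
    ?_).trans ?_
  · rintro ω ⟨h1, h2, h3⟩
    have e : ∏ t ∈ (Finset.range (nTwo n)).erase s, anticommMoment p (anticommRate n) s t ω =
        ENNReal.ofReal (Real.exp (anticommRate n * ∑ t ∈ (Finset.range (nTwo n)).erase s,
          ‖tau p ω t * tau p ω s + tau p ω s * tau p ω t‖ ^ 2)) := by
      rw [Finset.mul_sum, Real.exp_sum, ENNReal.ofReal_prod_of_nonneg fun _ _ => (Real.exp_pos _).le]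
      refine Finset.prod_congr rfl fun t ht => ?_
      exact Set.indicator_of_mem (s := {ω | FewSelected p t ω})
        (h2 t (Finset.mem_range.mp (Finset.mem_erase.mp ht).2)) _
    simp only [Set.indicator_of_mem (show ω ∈ {ω | Spread p s ω} from h1), Pi.one_apply, one_mul, e]
    rw [← ENNReal.ofReal_mul (Real.exp_pos _).le, ← Real.exp_add, ← ENNReal.ofReal_one]
    refine ENNReal.ofReal_le_ofReal (Real.one_le_exp ?_)
    have h4 : anticommRate n * (9216 * 2 ^ hoQubits n) = nOne n := by
      unfold anticommRate; field_simp
    have h5 : 0 ≤ anticommRate n := by unfold anticommRate; positivity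
    have := mul_le_mul_of_nonneg_left h3.le h5
    linarith
  · rw [lintegral_const_mul _ hm]
    refine (mul_le_mul_right h _).trans ?_
    have hc : ((Finset.range (nTwo n)).erase s).card ≤ nTwo n :=
      (Finset.card_erase_le).trans (Finset.card_range _).le
    have h2 : (2 : ℝ≥0∞) ^ ((Finset.range (nTwo n)).erase s).card ≤
        ENNReal.ofReal (Real.exp (nTwo n)) := by
      refine (pow_le_pow_right₀ (by norm_num) hc).trans ?_
      have : (2 : ℝ≥0∞) = ENNReal.ofReal 2 := by simp
      rw [this, ← ENNReal.ofReal_pow (by norm_num)]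
      refine ENNReal.ofReal_le_ofReal ?_
      rw [← mul_one (nTwo n : ℝ), Real.exp_nat_mul]
      have := Real.add_one_le_exp (1 : ℝ)
      gcongr; linarith
    refine (mul_le_mul_right h2 _).trans ?_
    rw [← ENNReal.ofReal_mul (Real.exp_pos _).le, ← Real.exp_add]
    refine ENNReal.ofReal_le_ofReal (Real.exp_le_exp.mpr ?_)
    have h6 : n + nTwo n ≤ nOne n := by
      have := nTwo_le n; have := nOne_add_nTwo n; omega
    have : (n : ℝ) + nTwo n ≤ nOne n := by exact_mod_cast h6
    linarith

end Anticommutators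

end SparseSYK
namespace SparseSYK

/-! ### Typical disorder and the energy of the Hastings-O'Donnell state -/

section GoodDisorder
open scoped ENNReal Matrix.Norms.Frobenius

variable {n : ℕ} {p : unitInterval}

/-- The energy density `c₁`: the mixed quads contribute at least `c₁ √n` for typical disorder. -/
noncomputable def energyRate : ℝ := 1 / 725760

/-- Typical disorder: the event on which both claims about the energies hold. The mixed quads carry
enough weight in total (`lower`) and each `τ_t` has bounded norm (`block`); the anticommutators of
the `τ` operators are as small as for independent Gaussian ones (`anticomm`); the quads that are not
mixed do not spoil the energy (`rest`); and the Hamiltonian is bounded (`total`). -/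
structure Good (p : unitInterval) (ω : Disorder n) : Prop where
  lower : p * ((nTwo n * (nOne n).choose 3 : ℕ) : ℝ) / 6 ≤ ∑ I ∈ mixedQuads n, coupling ω I ^ 2
  block : ∀ t < nTwo n, ∑ S ∈ Finset.powersetCard 3 (Finset.range (nOne n)),
    weight ω (insert (nOne n + t) S) ≤ 8 * p * (nOne n).choose 3
  anticomm : ∀ s < nTwo n, ∑ t ∈ (Finset.range (nTwo n)).erase s,
    ‖tau p ω t * tau p ω s + tau p ω s * tau p ω t‖ ^ 2 ≤ 9216 * 2 ^ hoQubits n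
  rest : -(energyRate / 2 * √n) ≤ restEnergy p ω (-(1 / 15120))
  total : ∑ I ∈ Finset.powersetCard 4 (Finset.range (2 * n)), weight ω I ≤
    8 * p * (2 * n).choose 4

lemma choose_three_cast (m : ℕ) : ((m.choose 3 : ℕ) : ℝ) = m * (m - 1) * (m - 2) / 6 := by
  rw [Nat.cast_choose_eq_descPochhammer_div]
  simp [descPochhammer, Nat.factorial]
  ring

lemma choose_four_cast (m : ℕ) :
    ((m.choose 4 : ℕ) : ℝ) = m * (m - 1) * (m - 2) * (m - 3) / 24 := by
  rw [Nat.cast_choose_eq_descPochhammer_div]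
  simp [descPochhammer, Nat.factorial]
  ring

lemma three_mul_le_nOne (n : ℕ) : (3 * n / 2 : ℝ) ≤ nOne n := by
  have h : 3 * n ≤ 2 * nOne n := by have := nTwo_le n; have := nOne_add_nTwo n; omega
  have : (3 * n : ℝ) ≤ 2 * nOne n := by exact_mod_cast h
  linarith

lemma nOne_le (n : ℕ) : (nOne n : ℝ) ≤ 2 * n := by
  have h : nOne n ≤ 2 * n := by have := nOne_add_nTwo n; omega
  exact_mod_cast h

lemma le_four_mul_nTwo (hn : 8 ≤ n) : (n / 4 : ℝ) ≤ nTwo n := by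
  have h : n ≤ 4 * nTwo n := by unfold nTwo halfChi; omega
  have : (n : ℝ) ≤ 4 * nTwo n := by exact_mod_cast h
  linarith

lemma choose_three_nOne_ge (hn : 8 ≤ n) : (n ^ 3 / 4 : ℝ) ≤ (nOne n).choose 3 := by
  have h1 := three_mul_le_nOne n
  have hn' : (8 : ℝ) ≤ n := by exact_mod_cast hn
  rw [choose_three_cast]
  have h2 : (n : ℝ) ≤ nOne n - 2 := by linarith
  have h3 : (n : ℝ) ≤ nOne n - 1 := by linarith
  have h4 : (3 * n / 2 : ℝ) * n * n ≤ nOne n * (nOne n - 1) * (nOne n - 2) := by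
    have h5 : (0 : ℝ) ≤ nOne n - 1 := by linarith
    gcongr
  linarith [h4, show (3 * n / 2 : ℝ) * n * n = 3 / 2 * (n : ℝ) ^ 3 by ring]

lemma choose_three_nOne_pos (hn : 8 ≤ n) : 0 < (nOne n).choose 3 := by
  have h1 := choose_three_nOne_ge hn
  have hn' : (8 : ℝ) ≤ n := by exact_mod_cast hn
  have : (0 : ℝ) < (nOne n).choose 3 := lt_of_lt_of_le (by positivity) h1
  exact_mod_cast this

lemma choose_four_le (n : ℕ) (hn : 2 ≤ n) : ((2 * n).choose 4 : ℝ) ≤ 2 / 3 * n ^ 4 := by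
  have hn' : (2 : ℝ) ≤ n := by exact_mod_cast hn
  rw [choose_four_cast]
  push_cast
  have : (2 * n : ℝ) * (2 * n - 1) * (2 * n - 2) * (2 * n - 3) ≤
      (2 * n) * (2 * n) * (2 * n) * (2 * n) := by
    gcongr <;> linarith
  linarith [this, show (2 * n : ℝ) * (2 * n) * (2 * n) * (2 * n) = 16 * n ^ 4 by ring]

lemma choose_four_ge (hn : 8 ≤ n) : ((n : ℝ) ^ 4 / 24) ≤ (2 * n).choose 4 := by
  have hn' : (8 : ℝ) ≤ n := by exact_mod_cast hn
  rw [choose_four_cast]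
  push_cast
  have : (n : ℝ) * n * n * n ≤ (2 * n) * (2 * n - 1) * (2 * n - 2) * (2 * n - 3) := by
    have h1 : (0 : ℝ) ≤ 2 * n - 1 := by linarith
    have h2 : (0 : ℝ) ≤ 2 * n - 2 := by linarith
    gcongr <;> linarith
  linarith [this, show (n : ℝ) * n * n * n = n ^ 4 by ring]

lemma scaleRatio_ge (hn : 8 ≤ n) : 1 / (2 * √(n : ℝ)) ≤ scaleRatio n := by
  have h3 := choose_three_nOne_ge hn
  have h4 := choose_four_le n (by omega)
  have h4' := choose_four_ge hn
  have hn' : (8 : ℝ) ≤ n := by exact_mod_cast hn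
  rw [scaleRatio, ← Real.sqrt_div (by positivity)]
  refine Real.le_sqrt_of_sq_le ?_
  rw [div_pow, mul_pow, Real.sq_sqrt (by positivity),
    div_le_div_iff₀ (by positivity) (lt_of_lt_of_le (by positivity) h4')]
  nlinarith [mul_le_mul_of_nonneg_right h3 (show (0 : ℝ) ≤ 2 ^ 2 * n by positivity),
    show (0 : ℝ) ≤ n ^ 4 by positivity, show (n : ℝ) ^ 3 / 4 * (2 ^ 2 * n) = n ^ 4 by ring]

lemma tauScale_sq_mul (hn : 8 ≤ n) (hp : 0 < (p : ℝ)) :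
    tauScale n p ^ 2 * (p * (nOne n).choose 3) = 1 := by
  have h : (0 : ℝ) < (nOne n).choose 3 := by exact_mod_cast choose_three_nOne_pos hn
  rw [tauScale, mul_pow, inv_pow, inv_pow, Real.sq_sqrt h.le, Real.sq_sqrt p.2.1]
  field_simp

lemma norm_tau_sq (p : unitInterval) (ω : Disorder n) (t : ℕ) :
    ‖tau p ω t‖ ^ 2 = 2 ^ hoQubits n * (tauScale n p ^ 2 *
      ∑ S ∈ Finset.powersetCard 3 (Finset.range (nOne n)),
        coupling ω (insert (nOne n + t) S) ^ 2) := by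
  rw [tau_eq, norm_phiSum_sq, Finset.mul_sum (a := tauScale n p ^ 2)]
  simp only [mul_pow]

variable {ω : Disorder n}

lemma Good.norm_tau_sq_le (h : Good p ω) {t : ℕ} (ht : t < nTwo n) :
    ‖tau p ω t‖ ^ 2 ≤ 8 * 2 ^ hoQubits n := by
  rw [norm_tau_sq]
  have h1 : ∑ S ∈ Finset.powersetCard 3 (Finset.range (nOne n)),
      coupling ω (insert (nOne n + t) S) ^ 2 ≤ 8 * p * (nOne n).choose 3 :=
    (Finset.sum_le_sum fun S _ => coupling_sq_le_weight ω _).trans (h.block t ht)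
  have h2 := mul_le_mul_of_nonneg_left h1 (sq_nonneg (tauScale n p))
  have h3 := tauScale_sq_mul_le n p
  have h4 : (0 : ℝ) < 2 ^ hoQubits n := by positivity
  rw [mul_comm (8 : ℝ)]
  refine mul_le_mul_of_nonneg_left (h2.trans ?_) h4.le
  linarith

lemma Good.sum_norm_tau_sq_ge (h : Good p ω) (hn : 8 ≤ n) (hp : 0 < (p : ℝ)) :
    2 ^ hoQubits n * (nTwo n / 6 : ℝ) ≤ ∑ t ∈ Finset.range (nTwo n), ‖tau p ω t‖ ^ 2 := by
  simp only [norm_tau_sq]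
  rw [← Finset.mul_sum, ← Finset.mul_sum, ← sum_mixedQuads n fun I => coupling ω I ^ 2]
  have h1 := mul_le_mul_of_nonneg_left h.lower (sq_nonneg (tauScale n p))
  refine mul_le_mul_of_nonneg_left (le_trans (le_of_eq ?_) h1) (by positivity)
  have h2 := tauScale_sq_mul hn hp
  push_cast
  linear_combination (-(nTwo n : ℝ) / 6) * h2

/-- The commutator consists of the anticommutators with the other `τ` operators, which typical
disorder bounds by `9216`, and of the diagonal term `2 τ_s²`, which hypercontractivity bounds by
`4 · 729 · 8² = 186624`; their sum is `195840`, and `195840 · 8 ≤ 1252²`. -/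
lemma Good.norm_commutator_mul_le (h : Good p ω) {s : ℕ} (hs : s < nTwo n) :
    ‖zeta p ω * tau p ω s - tau p ω s * zeta p ω‖ * ‖tau p ω s‖ ≤ 1252 * 2 ^ hoQubits n := by
  have h1 := h.norm_tau_sq_le hs
  have h2 : ‖zeta p ω * tau p ω s - tau p ω s * zeta p ω‖ ^ 2 ≤ 195840 * 2 ^ hoQubits n := by
    rw [norm_zeta_commutator_tau_sq, ← Finset.sum_erase_add _ _ (Finset.mem_range.mpr hs)]
    have h3 := h.anticomm s hs
    have h4 : ‖tau p ω s * tau p ω s + tau p ω s * tau p ω s‖ ^ 2 ≤ 186624 * 2 ^ hoQubits n := by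
      have h5 : 2 ^ hoQubits n * ‖tau p ω s * tau p ω s‖ ^ 2 ≤ 729 * (‖tau p ω s‖ ^ 2) ^ 2 := by
        rw [tau_eq]; exact norm_phiSum_mul_self_sq_le _ _
      rw [← two_smul ℝ (tau p ω s * tau p ω s), norm_smul, mul_pow, Real.norm_eq_abs, abs_two]
      generalize ‖tau p ω s * tau p ω s‖ ^ 2 = u at *
      generalize hw : ‖tau p ω s‖ ^ 2 = w at *
      have hw0 : 0 ≤ w := hw ▸ sq_nonneg _
      have hq : (0 : ℝ) < 2 ^ hoQubits n := by positivity
      generalize (2 : ℝ) ^ hoQubits n = q at *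
      have h6 : w ^ 2 ≤ (8 * q) ^ 2 := by gcongr
      have h7 : q * u ≤ q * (46656 * q) := by nlinarith
      have := le_of_mul_le_mul_left h7 hq
      linarith
    linarith
  have hq : (0 : ℝ) < 2 ^ hoQubits n := by positivity
  generalize ‖zeta p ω * tau p ω s - tau p ω s * zeta p ω‖ = u at *
  generalize ‖tau p ω s‖ = w at *
  generalize (2 : ℝ) ^ hoQubits n = q at *
  refine abs_le_of_sq_le_sq' ?_ (by positivity) |>.2
  calc (u * w) ^ 2 = u ^ 2 * w ^ 2 := by ring
    _ ≤ (195840 * q) * (8 * q) := by gcongr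
    _ ≤ (1252 * q) ^ 2 := by nlinarith [sq_nonneg q]

/-- The energy of the Hastings-O'Donnell state for typical disorder. -/
lemma Good.sykEnergy_hoState_ge (h : Good p ω) (hn : 8 ≤ n) (hp : 0 < (p : ℝ)) :
    energyRate / 2 * √(n : ℝ) ≤ sykEnergy p ω (hoState p ω (-(1 / 15120))) := by
  rw [sykEnergy_hoState p ω (choose_three_nOne_pos hn)]
  have h1 := sum_trace_conjExp_zeta_ge p ω (s := 1 / 15120) (by norm_num)
  have h2 := h.sum_norm_tau_sq_ge hn hp
  have h3 : ∑ t ∈ Finset.range (nTwo n), ‖zeta p ω * tau p ω t - tau p ω t * zeta p ω‖ *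
      ‖tau p ω t‖ ≤ nTwo n * (1252 * 2 ^ hoQubits n) := by
    refine (Finset.sum_le_sum fun t ht =>
      h.norm_commutator_mul_le (Finset.mem_range.mp ht)).trans (le_of_eq ?_)
    rw [Finset.sum_const, Finset.card_range, nsmul_eq_mul]
  have h4 := h.rest
  have h5 := scaleRatio_ge hn
  have h6 := le_four_mul_nTwo hn
  have hn' : (8 : ℝ) ≤ n := by exact_mod_cast hn
  have hs : 0 < √(n : ℝ) := Real.sqrt_pos.mpr (by linarith)
  have hss : √(n : ℝ) * √(n : ℝ) = n := Real.mul_self_sqrt (by linarith)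
  have hq : (0 : ℝ) < 2 ^ hoQubits n := by positivity
  generalize ∑ t ∈ Finset.range (nTwo n), ‖tau p ω t‖ ^ 2 = A at *
  generalize ∑ t ∈ Finset.range (nTwo n), ‖zeta p ω * tau p ω t - tau p ω t * zeta p ω‖ *
      ‖tau p ω t‖ = B at *
  generalize ∑ t ∈ Finset.range (nTwo n),
    (conjExp (-zeta p ω) (tau p ω t) (1 / 15120) * sigmaOp n t).trace.re = T at *
  generalize restEnergy p ω (-(1 / 15120)) = R at *
  generalize (nTwo n : ℝ) = m at *
  generalize scaleRatio n = w at *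
  generalize (2 : ℝ) ^ hoQubits n = q at *
  generalize √(n : ℝ) = r at *
  have hm : 0 ≤ m := by linarith
  -- At the angle `1 / 15120` the quadratic correction is at most half of the linear term `m / 3`.
  have h7 : q * (1 / 15120 * m / 6) ≤ T := by
    refine le_trans ?_ h1
    have : 0 ≤ m * q := by positivity
    nlinarith
  have h8 : 1 / 15120 * m / 6 ≤ q⁻¹ * T := by
    rw [inv_mul_eq_div, le_div_iff₀ hq]; linarith
  -- Here `energyRate = 1 / (2 · 4 · 6 · 15120)`.
  have h9 : energyRate * r ≤ w * (q⁻¹ * T) := by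
    calc energyRate * r = 1 / (2 * r) * (1 / 15120 * (n / 4) / 6) := by
          rw [energyRate, ← hss]; field_simp; norm_num
      _ ≤ w * (q⁻¹ * T) := by
          refine mul_le_mul h5 (le_trans ?_ h8) (by positivity) (le_trans (by positivity) h5)
          linarith
  linarith

lemma card_chi_image {t : ℕ} (ht : t < nTwo n) {𝒮 : Finset (Finset ℕ)}
    (h𝒮 : 𝒮 ⊆ Finset.powersetCard 3 (Finset.range (nOne n))) :
    (𝒮.image (insert (nOne n + t))).card = 𝒮.card ∧
      𝒮.image (insert (nOne n + t)) ⊆ Finset.powersetCard 4 (Finset.range (2 * n)) ∧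
      ∀ f : Finset ℕ → ℝ, ∑ I ∈ 𝒮.image (insert (nOne n + t)), f I =
        ∑ S ∈ 𝒮, f (insert (nOne n + t) S) := by
  have hinj : Set.InjOn (insert (nOne n + t)) (𝒮 : Set (Finset ℕ)) :=
    fun S hS T hT h => (insert_chi_inj ht ht (h𝒮 hS) (h𝒮 hT) h).2
  refine ⟨Finset.card_image_of_injOn hinj, fun I hI => ?_, fun f => Finset.sum_image hinj⟩
  obtain ⟨S, hS, rfl⟩ := Finset.mem_image.mp hI
  exact insert_chi_mem ht (h𝒮 hS)

lemma card_filter_mem_powersetCard {i : ℕ} (hi : i < nOne n) :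
    ((Finset.powersetCard 3 (Finset.range (nOne n))).filter (i ∈ ·)).card =
      (nOne n - 1).choose 2 := by
  have : (Finset.powersetCard 3 (Finset.range (nOne n))).filter (i ∈ ·) =
      (Finset.powersetCard 2 ((Finset.range (nOne n)).erase i)).image (insert i) := by
    ext S
    simp only [Finset.mem_filter, Finset.mem_powersetCard, Finset.mem_image]
    constructor
    · rintro ⟨⟨h1, h2⟩, h3⟩
      refine ⟨S.erase i, ⟨Finset.erase_subset_erase _ h1, ?_⟩, Finset.insert_erase h3⟩
      rw [Finset.card_erase_of_mem h3, h2]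
    · rintro ⟨T, ⟨h1, h2⟩, rfl⟩
      have hiT : i ∉ T := fun h => Finset.notMem_erase i _ (h1 h)
      refine ⟨⟨Finset.insert_subset (Finset.mem_range.mpr hi)
        (h1.trans (Finset.erase_subset _ _)), ?_⟩, Finset.mem_insert_self _ _⟩
      rw [Finset.card_insert_of_notMem hiT, h2]
  rw [this, Finset.card_image_of_injOn, Finset.card_powersetCard,
    Finset.card_erase_of_mem (Finset.mem_range.mpr hi), Finset.card_range]
  intro S hS T hT h
  have h1 : ∀ {S}, S ∈ (Finset.powersetCard 2 ((Finset.range (nOne n)).erase i) : Finset _) →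
      i ∉ S := fun hS h => Finset.notMem_erase i _ ((Finset.mem_powersetCard.mp hS).1 h)
  rw [← Finset.erase_insert (h1 hS), ← Finset.erase_insert (h1 hT)]
  exact congrArg (Finset.erase · i) h

lemma card_mixedQuads (n : ℕ) : (mixedQuads n).card = nTwo n * (nOne n).choose 3 := by
  rw [mixedQuads, Finset.card_image_of_injOn (insert_chi_injOn n), Finset.card_product,
    Finset.card_powersetCard, Finset.card_range, Finset.card_range]

/-- The exponent of the failure probability of each single condition. -/
noncomputable def failRate : ℝ := energyRate ^ 2 / 16

lemma ofReal_exp_le {x y : ℝ} (h : y ≤ x) :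
    ENNReal.ofReal (Real.exp (-x)) ≤ ENNReal.ofReal (Real.exp (-y)) :=
  ENNReal.ofReal_le_ofReal (Real.exp_le_exp.mpr (by linarith))

lemma failRate_le : failRate ≤ 1 / 4 ∧ 0 < failRate := by
  unfold failRate energyRate; norm_num

/-- The remaining quads contribute a Gaussian-like term of variance of order one, which is below
`-(energyRate / 2) √n` only with exponentially small probability. -/
lemma measure_rest_lt_le (hn : 8 ≤ n) (hp : (n : ℝ)⁻¹ ≤ p) :
    disorderLaw n p {ω | restEnergy p ω (-(1 / 15120)) < -(energyRate / 2 * √n)} ≤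
      ENNReal.ofReal (Real.exp (-(failRate * n))) := by
  have hn' : (8 : ℝ) ≤ n := by exact_mod_cast hn
  have hp0 : (0 : ℝ) < p := lt_of_lt_of_le (by positivity) hp
  have hs : 0 < √(n : ℝ) := Real.sqrt_pos.mpr (by linarith)
  have hss : √(n : ℝ) ^ 2 = n := Real.sq_sqrt (by linarith)
  have he : (0 : ℝ) < energyRate := by unfold energyRate; norm_num
  -- This is the optimal exponent in `measure_restEnergy_lt_le`.
  set lam := energyRate * √n / 4 with hlam
  have hl0 : 0 < lam := by positivity
  have hl2 : lam ^ 2 = failRate * n := by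
    rw [hlam, div_pow, mul_pow, hss, failRate]; ring
  have hcond : lam ^ 2 * hamScale n p ^ 2 ≤ 1 := by
    have h1 := hamScale_sq_mul_le n p
    have h2 := choose_four_ge hn
    have h3 : lam ^ 2 ≤ p * (2 * n).choose 4 := by
      have h4 : (n : ℝ)⁻¹ * (n ^ 4 / 24) ≤ p * (2 * n).choose 4 := by gcongr
      have h5 : (n : ℝ)⁻¹ * (n ^ 4 / 24) = n * n ^ 2 / 24 := by field_simp
      have h6 : (64 : ℝ) ≤ n ^ 2 := by nlinarith
      rw [hl2]
      nlinarith [failRate_le.1]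
    refine le_trans ?_ h1
    rw [mul_comm]
    exact mul_le_mul_of_nonneg_left h3 (sq_nonneg _)
  refine (measure_mono fun ω (hω : restEnergy p ω (-(1 / 15120)) <
    -(energyRate / 2 * √n)) => ?_).trans
    ((measure_restEnergy_lt_le (x := 2 * lam ^ 2) p hcond (s := 1 / 15120)).trans (le_of_eq ?_))
  · change _ * lam < -(2 * lam ^ 2)
    have h1 := mul_lt_mul_of_pos_right hω hl0
    have h2 : -(energyRate / 2 * √n) * lam = -(2 * lam ^ 2) := by rw [hlam]; ring
    rwa [h2] at h1
  · rw [hl2]; congr 2; ring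

/-- Union bound over the conditions in `Good` and the auxiliary condition `Spread`. Each fails with
probability at most `exp (-failRate n)`, since `p ≥ 1 / n` makes every relevant mean at least of
order `n`. -/
lemma measure_not_good_le (hn : 8 ≤ n) (hp : (n : ℝ)⁻¹ ≤ p) :
    disorderLaw n p {ω | ¬ Good p ω} ≤
      ((3 + 2 * nTwo n + nTwo n * nOne n : ℕ) : ℝ≥0∞) *
        ENNReal.ofReal (Real.exp (-(failRate * n))) := by
  have hn' : (8 : ℝ) ≤ n := by exact_mod_cast hn
  have hp0 : (0 : ℝ) < p := lt_of_lt_of_le (by positivity) hp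
  obtain ⟨hf, hf0⟩ := failRate_le
  have h3 := choose_three_nOne_ge hn
  have h4 := choose_four_ge hn
  have hfn : failRate * n ≤ n / 4 := by nlinarith
  set e := ENNReal.ofReal (Real.exp (-(failRate * n))) with he
  set μ := disorderLaw n p
  set A : Set (Disorder n) := {ω | ∑ I ∈ mixedQuads n, coupling ω I ^ 2 <
    p * (mixedQuads n).card / 6} with hA
  set B : ℕ → Set (Disorder n) := fun t => {ω | 8 * p * (((nOne n).choose 3 : ℕ) : ℝ) <
    ∑ I ∈ (Finset.powersetCard 3 (Finset.range (nOne n))).image (insert (nOne n + t)),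
      weight ω I} with hB
  set C : ℕ × ℕ → Set (Disorder n) := fun x => {ω | 8 * p * (((nOne n - 1).choose 2 : ℕ) : ℝ) <
    ∑ I ∈ ((Finset.powersetCard 3 (Finset.range (nOne n))).filter (x.2 ∈ ·)).image
      (insert (nOne n + x.1)), weight ω I} with hC
  set D : ℕ → Set (Disorder n) := fun s => {ω | Spread p s ω ∧ (∀ t < nTwo n, FewSelected p t ω) ∧
      9216 * 2 ^ hoQubits n < ∑ t ∈ (Finset.range (nTwo n)).erase s,
        ‖tau p ω t * tau p ω s + tau p ω s * tau p ω t‖ ^ 2} with hD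
  set R : Set (Disorder n) := {ω | restEnergy p ω (-(1 / 15120)) < -(energyRate / 2 * √n)} with hR
  set W : Set (Disorder n) := {ω | 8 * p * (((2 * n).choose 4 : ℕ) : ℝ) <
    ∑ I ∈ Finset.powersetCard 4 (Finset.range (2 * n)), weight ω I} with hW
  -- The number of sets `S` that contain a given mode.
  have hc2 : (3 * ((nOne n).choose 3 : ℕ) / nOne n : ℝ) = ((nOne n - 1).choose 2 : ℕ) := by
    have h1 := three_mul_le_nOne n
    have h0 : (nOne n : ℝ) ≠ 0 := by
      have : (0 : ℝ) < nOne n := by linarith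
      exact this.ne'
    have h2 := Nat.add_one_mul_choose_eq (nOne n - 1) 2
    have h5 : nOne n - 1 + 1 = nOne n := by
      have : 0 < nOne n := by
        have : (0 : ℝ) < nOne n := by linarith
        exact_mod_cast this
      omega
    rw [h5] at h2
    have h6 : (nOne n : ℝ) * ((nOne n - 1).choose 2 : ℕ) = ((nOne n).choose 3 : ℕ) * 3 := by
      exact_mod_cast h2
    rw [div_eq_iff h0]; linarith
  have hpn : ∀ {x y : ℝ}, 0 ≤ y → n * y ≤ x → y ≤ p * x := by
    intro x y hy hxy
    have h1 : (n : ℝ)⁻¹ * (n * y) ≤ p * x := by gcongr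
    rwa [inv_mul_cancel_left₀ (by positivity)] at h1
  have hμA : μ A ≤ e := by
    refine (measure_sum_sq_lt_le p (mixedQuads_subset n)).trans (ofReal_exp_le (hfn.trans ?_))
    have h5 := le_four_mul_nTwo hn
    have h6 : (n / 4 : ℝ) * (n ^ 3 / 4) ≤ (mixedQuads n).card := by
      rw [card_mixedQuads]; push_cast; gcongr
    have h7 := hpn (y := n) (by positivity) (le_trans (b := (n / 4 : ℝ) * (n ^ 3 / 4))
      (by nlinarith [mul_nonneg (sq_nonneg (n : ℝ)) (show (0 : ℝ) ≤ n ^ 2 - 16 by nlinarith)]) h6)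
    linarith
  have hμB : ∀ t ∈ Finset.range (nTwo n), μ (B t) ≤ e := by
    intro t ht
    have h5 := card_chi_image (Finset.mem_range.mp ht)
      (subset_refl (Finset.powersetCard 3 (Finset.range (nOne n))))
    have h6 : (((Finset.powersetCard 3 (Finset.range (nOne n))).image
        (insert (nOne n + t))).card : ℝ) ≤ ((nOne n).choose 3 : ℕ) := by
      rw [h5.1, Finset.card_powersetCard, Finset.card_range]
    refine (measure_weight_gt_le p h5.2.1 h6).trans (ofReal_exp_le (hfn.trans ?_))
    refine hpn (by positivity) (le_trans ?_ h3)
    nlinarith [sq_nonneg (n : ℝ)]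
  have hμC : ∀ x ∈ Finset.range (nTwo n) ×ˢ Finset.range (nOne n), μ (C x) ≤ e := by
    intro x hx
    rw [Finset.mem_product, Finset.mem_range, Finset.mem_range] at hx
    have h5 := card_chi_image hx.1
      (Finset.filter_subset (x.2 ∈ ·) (Finset.powersetCard 3 (Finset.range (nOne n))))
    have h6 : ((((Finset.powersetCard 3 (Finset.range (nOne n))).filter (x.2 ∈ ·)).image
        (insert (nOne n + x.1))).card : ℝ) ≤ ((nOne n - 1).choose 2 : ℕ) := by
      rw [h5.1, card_filter_mem_powersetCard hx.2]
    refine (measure_weight_gt_le p h5.2.1 h6).trans (ofReal_exp_le (hfn.trans ?_))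
    refine hpn (by positivity) ?_
    have h8 := nOne_le n
    have h9 := three_mul_le_nOne n
    rw [← hc2, le_div_iff₀ (by linarith)]
    nlinarith [mul_le_mul_of_nonneg_left h8 (show (0 : ℝ) ≤ n * (n / 4) by positivity)]
  have hμD : ∀ s ∈ Finset.range (nTwo n), μ (D s) ≤ e := fun s hs =>
    (measure_anticomm_gt_le p (Finset.mem_range.mp hs)).trans (ofReal_exp_le (by linarith))
  have hμR : μ R ≤ e := measure_rest_lt_le hn hp
  have hμW : μ W ≤ e := by
    refine (measure_weight_gt_le p subset_rfl ?_).trans (ofReal_exp_le (hfn.trans ?_))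
    · rw [Finset.card_powersetCard, Finset.card_range]
    · refine hpn (by positivity) (le_trans ?_ h4)
      have h5 : (64 : ℝ) ≤ n ^ 2 := by nlinarith
      have h6 := mul_le_mul_of_nonneg_left h5 (sq_nonneg (n : ℝ))
      nlinarith [sq_nonneg (n : ℝ)]
  have hbi : ∀ {ι : Type} (T : Finset ι) (S : ι → Set (Disorder n)), (∀ i ∈ T, μ (S i) ≤ e) →
      μ (⋃ i ∈ T, S i) ≤ T.card * e := by
    intro ι T S h
    refine (measure_biUnion_finset_le T S).trans ((Finset.sum_le_sum h).trans (le_of_eq ?_))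
    rw [Finset.sum_const, nsmul_eq_mul]
  have hsub : {ω | ¬ Good p ω} ⊆ A ∪ R ∪ W ∪ (⋃ t ∈ Finset.range (nTwo n), B t) ∪
      (⋃ s ∈ Finset.range (nTwo n), D s) ∪
      ⋃ x ∈ Finset.range (nTwo n) ×ˢ Finset.range (nOne n), C x := by
    intro ω hω
    refine Classical.byContradiction fun hcon => ?_
    simp only [Set.mem_union, not_or, Set.mem_iUnion, not_exists, Finset.mem_range,
      Finset.mem_product] at hcon
    obtain ⟨⟨⟨⟨⟨h1, h2⟩, h3⟩, h4⟩, h5⟩, h6⟩ := hcon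
    have hblock : ∀ t < nTwo n, ∑ S ∈ Finset.powersetCard 3 (Finset.range (nOne n)),
        weight ω (insert (nOne n + t) S) ≤ 8 * p * (nOne n).choose 3 := fun t ht => by
      have := h4 t ht
      simp only [hB, Set.mem_ofPred_eq, not_lt] at this
      rwa [(card_chi_image ht subset_rfl).2.2] at this
    have hspread : ∀ s < nTwo n, ∀ i < nOne n,
        ∑ S ∈ (Finset.powersetCard 3 (Finset.range (nOne n))).filter (i ∈ ·),
          weight ω (insert (nOne n + s) S) ≤ 24 * p * (nOne n).choose 3 / nOne n := by
      intro s hs i hi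
      have := h6 (s, i) ⟨hs, hi⟩
      simp only [hC, Set.mem_ofPred_eq, not_lt] at this
      rw [(card_chi_image hs (Finset.filter_subset _ _)).2.2, ← hc2] at this
      refine this.trans (le_of_eq ?_)
      ring
    refine hω ⟨?_, hblock, fun s hs => ?_, not_lt.mp h2, not_lt.mp h3⟩
    · rw [← card_mixedQuads]; exact not_lt.mp h1
    · by_contra hlt
      refine h5 s hs ⟨fun i hi => ?_, fun t ht => ?_, not_le.mp hlt⟩
      · exact (Finset.sum_le_sum fun S _ => coupling_sq_le_weight ω _).trans (hspread s hs i hi)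
      · exact (Finset.sum_le_sum fun S _ => selector_sq_le_weight ω _).trans (hblock t ht)
  refine (measure_mono hsub).trans ?_
  have hB' := hbi _ B hμB
  have hD' := hbi _ D hμD
  have hC' := hbi _ C hμC
  rw [Finset.card_range] at hB' hD'
  rw [Finset.card_product, Finset.card_range, Finset.card_range] at hC'
  calc _ ≤ e + e + e + nTwo n * e + nTwo n * e + (nTwo n * nOne n : ℕ) * e := by
        refine (measure_union_le _ _).trans (add_le_add ?_ hC')
        refine (measure_union_le _ _).trans (add_le_add ?_ hD')
        refine (measure_union_le _ _).trans (add_le_add ?_ hB')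
        refine (measure_union_le _ _).trans (add_le_add ?_ hμW)
        exact (measure_union_le _ _).trans (add_le_add hμA hμR)
    _ = _ := by push_cast; ring

/-- The quadratic number of conditions is absorbed by half of the exponent. -/
lemma exists_measure_not_good_le : ∃ n₀ : ℕ, 8 ≤ n₀ ∧ ∀ (n : ℕ) (p : unitInterval), n₀ ≤ n →
    (n : ℝ)⁻¹ ≤ p → disorderLaw n p {ω | ¬ Good p ω} ≤
      ENNReal.ofReal (Real.exp (-(failRate / 2 * n))) := by
  have hf : 0 < failRate / 2 := half_pos failRate_le.2
  have h1 := (isLittleO_pow_exp_pos_mul_atTop 2 hf).bound (show (0 : ℝ) < 1 / 9 by norm_num)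
  obtain ⟨m, hm⟩ := Filter.eventually_atTop.mp
    (tendsto_natCast_atTop_atTop (R := ℝ) |>.eventually h1)
  refine ⟨max m 8, le_max_right _ _, fun n p hn hp => ?_⟩
  have hn8 : 8 ≤ n := (le_max_right _ _).trans hn
  refine (measure_not_good_le hn8 hp).trans ?_
  have h2 := hm n ((le_max_left _ _).trans hn)
  rw [Real.norm_of_nonneg (by positivity), Real.norm_of_nonneg (Real.exp_pos _).le] at h2
  rw [← ENNReal.ofReal_natCast, ← ENNReal.ofReal_mul (Nat.cast_nonneg _)]
  refine ENNReal.ofReal_le_ofReal ?_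
  have h3 : ((3 + 2 * nTwo n + nTwo n * nOne n : ℕ) : ℝ) ≤ 9 * (n : ℝ) ^ 2 := by
    have h4 : nTwo n ≤ n := by have := nTwo_le n; omega
    have h5 : nOne n ≤ 2 * n := by have := nOne_add_nTwo n; omega
    have h6 : nTwo n * nOne n ≤ n * (2 * n) := Nat.mul_le_mul h4 h5
    have : 3 + 2 * nTwo n + nTwo n * nOne n ≤ 9 * n ^ 2 := by nlinarith
    exact_mod_cast this
  have h7 : Real.exp (-(failRate / 2 * n)) =
      Real.exp (failRate / 2 * n) * Real.exp (-(failRate * n)) := by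
    rw [← Real.exp_add]; congr 1; ring
  rw [h7]
  refine mul_le_mul_of_nonneg_right ?_ (Real.exp_pos _).le
  linarith

end GoodDisorder

end SparseSYK
namespace SparseSYK

/-! ### Gate identities -/

section GateAlgebra

variable {N : ℕ}

lemma onQubit_apply {q : ℕ} (hq : q < N) (U : Matrix (Fin 2) (Fin 2) ℂ) (x y : Basis N) :
    onQubit N q U x y = U (x ⟨q, hq⟩) (y ⟨q, hq⟩) *
      ∏ i ∈ Finset.univ.erase (⟨q, hq⟩ : Fin N), (1 : Matrix (Fin 2) (Fin 2) ℂ) (x i) (y i) := by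
  rw [onQubit, tensor, Matrix.of_apply, ← Finset.mul_prod_erase _ _ (Finset.mem_univ ⟨q, hq⟩)]
  congr 1
  · simp
  · refine Finset.prod_congr rfl fun i hi => ?_
    rw [if_neg fun h => (Finset.mem_erase.mp hi).1 (Fin.ext h)]

lemma onQubit_add {q : ℕ} (hq : q < N) (U V : Matrix (Fin 2) (Fin 2) ℂ) :
    onQubit N q (U + V) = onQubit N q U + onQubit N q V := by
  ext x y
  simp only [Matrix.add_apply, onQubit_apply hq, add_mul]

lemma onQubit_smul {q : ℕ} (hq : q < N) (a : ℂ) (U : Matrix (Fin 2) (Fin 2) ℂ) :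
    onQubit N q (a • U) = a • onQubit N q U := by
  ext x y
  simp only [Matrix.smul_apply, onQubit_apply hq, smul_eq_mul, mul_assoc]

lemma onQubit_mul (q : ℕ) (U V : Matrix (Fin 2) (Fin 2) ℂ) :
    onQubit N q U * onQubit N q V = onQubit N q (U * V) := by
  rw [onQubit, onQubit, onQubit, tensor_mul]
  congr 1; funext i
  split_ifs <;> simp

lemma onQubit_one (q : ℕ) : onQubit N q 1 = 1 := by
  rw [onQubit, ← tensor_one]
  congr 1; funext i
  split_ifs <;> rfl

lemma onQubit_commute {q r : ℕ} (h : q ≠ r) (U V : Matrix (Fin 2) (Fin 2) ℂ) :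
    Commute (onQubit N q U) (onQubit N r V) := by
  refine tensor_commute fun i => ?_
  split_ifs with h1 h2
  · exact absurd (h1.symm.trans h2) h
  all_goals simp

lemma onQubit_pow (q r : ℕ) (U : Matrix (Fin 2) (Fin 2) ℂ) :
    onQubit N q U ^ r = onQubit N q (U ^ r) := by
  induction r with
  | zero => rw [pow_zero, pow_zero, onQubit_one]
  | succ r ih => rw [pow_succ, ih, onQubit_mul, pow_succ]

lemma majorana_mul_majorana_even {q : ℕ} (hq : q < N) :
    majorana N (2 * q) * majorana N (2 * q + 1) = Complex.I • onQubit N q pauliZ := by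
  rw [← onQubit_smul hq, majorana, majorana, tensor_mul, onQubit]
  have h1 : 2 * q / 2 = q := by omega
  have h2 : (2 * q + 1) / 2 = q := by omega
  have h3 : 2 * q % 2 = 0 := by omega
  have h4 : (2 * q + 1) % 2 ≠ 0 := by omega
  congr 1; funext i
  simp only [h1, h2, h3, h4, if_true, if_false]
  split_ifs with h5 h6 h6
  · omega
  · exact pauliZ_sq
  · exact pauliX_mul_pauliY
  · simp

lemma majorana_mul_majorana_odd {q : ℕ} (hq : q + 1 < N) :
    majorana N (2 * q + 1) * majorana N (2 * q + 2) =
      Complex.I • (onQubit N q pauliX * onQubit N (q + 1) pauliX) := by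
  rw [← smul_mul_assoc, ← onQubit_smul (by omega), majorana, majorana, onQubit, onQubit, tensor_mul,
    tensor_mul]
  have h1 : (2 * q + 2) / 2 = q + 1 := by omega
  have h2 : (2 * q + 1) / 2 = q := by omega
  have h3 : (2 * q + 2) % 2 = 0 := by omega
  have h4 : (2 * q + 1) % 2 ≠ 0 := by omega
  congr 1; funext i
  simp only [h1, h2, h3, h4, if_true, if_false]
  rcases lt_trichotomy (i : ℕ) q with h | h | h
  · have : (i : ℕ) ≠ q := by omega
    have : (i : ℕ) ≠ q + 1 := by omega
    have : (i : ℕ) < q + 1 := by omega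
    simp [*, pauliZ_sq]
  · simp [h, pauliY_mul_pauliZ]
  · have h5 : (i : ℕ) ≠ q := by omega
    have h6 : ¬ (i : ℕ) < q := by omega
    have h7 : ¬ (i : ℕ) < q + 1 := by omega
    simp [h5, h6, h7]

lemma circuitOp_append (l₁ l₂ : List Gate) :
    circuitOp N (l₁ ++ l₂) = circuitOp N l₂ * circuitOp N l₁ := by
  induction l₁ with
  | nil => simp [circuitOp]
  | cons g l ih => rw [List.cons_append, circuitOp, ih, circuitOp, mul_assoc]

lemma circuitOp_cons (g : Gate) (l : List Gate) :
    circuitOp N (g :: l) = circuitOp N l * g.toOp N := rfl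

lemma had_mul_self (q : ℕ) : (Gate.had q).toOp N * (Gate.had q).toOp N = 1 := by
  rw [Gate.toOp, onQubit_mul, ← onQubit_one q]
  congr 1
  have h : ((√2 : ℝ) : ℂ) * ((√2 : ℝ) : ℂ) = 2 := by
    rw [← Complex.ofReal_mul, Real.mul_self_sqrt (by norm_num)]; norm_num
  have h0 : ((√2 : ℝ) : ℂ) ≠ 0 := fun h0 => by simp [h0] at h
  ext i j
  fin_cases i <;> fin_cases j <;> simp [Matrix.mul_apply] <;> field_simp <;> linear_combination -h

lemma had_semiconj (q : ℕ) :
    SemiconjBy ((Gate.had q).toOp N) (onQubit N q pauliZ) (onQubit N q pauliX) := by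
  rw [SemiconjBy, Gate.toOp, onQubit_mul, onQubit_mul]
  congr 1
  ext i j
  fin_cases i <;> fin_cases j <;> simp [Matrix.mul_apply, pauliX, pauliZ]

lemma had_commute {q r : ℕ} (h : q ≠ r) (U : Matrix (Fin 2) (Fin 2) ℂ) :
    Commute ((Gate.had q).toOp N) (onQubit N r U) := onQubit_commute h _ _

lemma onQubit_projections {c : ℕ} (hc : c < N) :
    onQubit N c !![1, 0; 0, 0] + onQubit N c !![0, 0; 0, 1] = 1 ∧
    onQubit N c pauliZ = onQubit N c !![1, 0; 0, 0] - onQubit N c !![0, 0; 0, 1] ∧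
    onQubit N c !![1, 0; 0, 0] * onQubit N c !![1, 0; 0, 0] = onQubit N c !![1, 0; 0, 0] ∧
    onQubit N c !![0, 0; 0, 1] * onQubit N c !![0, 0; 0, 1] = onQubit N c !![0, 0; 0, 1] ∧
    onQubit N c !![1, 0; 0, 0] * onQubit N c !![0, 0; 0, 1] = 0 ∧
    onQubit N c !![0, 0; 0, 1] * onQubit N c !![1, 0; 0, 0] = 0 := by
  have hz : onQubit N c 0 = 0 := by
    have := onQubit_smul hc 0 0; rwa [zero_smul, zero_smul] at this
  refine ⟨?_, ?_, ?_, ?_, ?_, ?_⟩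
  · rw [← onQubit_add hc, ← onQubit_one c]
    congr 1
    ext i j; fin_cases i <;> fin_cases j <;> simp
  · rw [eq_sub_iff_add_eq, ← onQubit_add hc]
    congr 1
    ext i j; fin_cases i <;> fin_cases j <;> simp [pauliZ]
  · rw [onQubit_mul]; congr 1; ext i j; fin_cases i <;> fin_cases j <;> simp
  · rw [onQubit_mul]; congr 1; ext i j; fin_cases i <;> fin_cases j <;> simp
  · rw [onQubit_mul, ← hz]; congr 1; ext i j; fin_cases i <;> fin_cases j <;> simp
  · rw [onQubit_mul, ← hz]; congr 1; ext i j; fin_cases i <;> fin_cases j <;> simp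

lemma cnot_mul_self {c t : ℕ} (hc : c < N) (ht : t < N) (hct : c ≠ t) :
    (Gate.cnot c t).toOp N * (Gate.cnot c t).toOp N = 1 := by
  obtain ⟨h1, -, h2, h3, h4, h5⟩ := onQubit_projections hc
  have hX : onQubit N t pauliX * onQubit N t pauliX = 1 := by
    rw [onQubit_mul, pauliX_sq, onQubit_one]
  have c0 := onQubit_commute (N := N) hct !![1, 0; 0, 0] pauliX
  have c1 := onQubit_commute (N := N) hct !![0, 0; 0, 1] pauliX
  simp only [Gate.toOp, hc, ht, hct, ne_eq, not_false_iff, and_self, if_true]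
  rw [← h1, add_mul, mul_add, mul_add, h2, ← mul_assoc, h4, zero_mul, add_zero,
    mul_assoc, ← c0.eq, ← mul_assoc, h5, zero_mul, zero_add, mul_assoc,
    ← mul_assoc (onQubit N t pauliX), ← c1.eq, mul_assoc, hX, mul_one, h3]

/-- Conjugation by a CNOT gate spreads `Z` from the target to the control. -/
lemma cnot_semiconj {c t : ℕ} (hc : c < N) (ht : t < N) (hct : c ≠ t) :
    SemiconjBy ((Gate.cnot c t).toOp N) (onQubit N t pauliZ)
      (onQubit N c pauliZ * onQubit N t pauliZ) := by
  obtain ⟨-, hZ, h2, h3, h4, h5⟩ := onQubit_projections hc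
  have hXZ : onQubit N t pauliX * onQubit N t pauliZ =
      -(onQubit N t pauliZ * onQubit N t pauliX) := by
    rw [onQubit_mul, onQubit_mul, pauliX_mul_pauliZ, pauliZ_mul_pauliX, ← neg_one_smul ℂ,
      onQubit_smul ht, neg_one_smul]
  have c0 := onQubit_commute (N := N) hct !![1, 0; 0, 0] pauliZ
  have c1 := onQubit_commute (N := N) hct !![0, 0; 0, 1] pauliZ
  simp only [SemiconjBy, Gate.toOp, hc, ht, hct, ne_eq, not_false_iff, and_self, if_true, hZ]
  generalize onQubit N c !![1, 0; 0, 0] = P at *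
  generalize onQubit N c !![0, 0; 0, 1] = Q at *
  generalize onQubit N t pauliZ = Z at *
  generalize onQubit N t pauliX = X at *
  have e : Z * (P + Q * X) = P * Z + Q * (Z * X) := by
    rw [mul_add, ← c0.eq, ← mul_assoc, ← c1.eq, mul_assoc]
  have e1 : P * (P * Z + Q * (Z * X)) = P * Z := by
    rw [mul_add, ← mul_assoc, ← mul_assoc, h2, h4, zero_mul, add_zero]
  have e2 : Q * (P * Z + Q * (Z * X)) = Q * (Z * X) := by
    rw [mul_add, ← mul_assoc, ← mul_assoc, h5, h3, zero_mul, zero_add]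
  rw [mul_assoc (P - Q), e, sub_mul, e1, e2, add_mul, mul_assoc Q, hXZ, mul_neg, ← sub_eq_add_neg]

lemma semiconj_inverse {A : Type*} [Monoid A] {g h x y : A} (hgh : g * h = 1) (hhg : h * g = 1)
    (s : SemiconjBy g x y) : SemiconjBy h y x := by
  rw [SemiconjBy]
  calc h * y = h * (y * g) * h := by rw [mul_assoc, mul_assoc, hgh, mul_one]
    _ = x * h := by rw [← s.eq, ← mul_assoc, hhg, one_mul]

/-- Conjugation of `a + b A` by an involution. -/
lemma semiconj_conj {A : Type*} [Ring A] [Algebra ℂ A] {g h x y : A} (hgh : h * g = 1)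
    (hx : SemiconjBy g x y) (a b : ℂ) : h * (a • 1 + b • y) * g = a • 1 + b • x := by
  rw [mul_add, add_mul, mul_smul_comm, mul_one, smul_mul_assoc, hgh, mul_smul_comm, smul_mul_assoc,
    mul_assoc, ← hx.eq, ← mul_assoc, hgh, one_mul]

end GateAlgebra

/-! ### Circuits that permute the Majorana modes -/

section Braids

variable {N : ℕ}

/-- A circuit for `exp (± π γ_j γ_{j+1} / 4)` up to a phase; the sign is `+` for `r = 3`
and `-` for `r = 1`. -/
def braidCircuit (r j : ℕ) : List Gate :=
  if j % 2 = 0 then List.replicate r (Gate.phase (j / 2))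
  else [Gate.had (j / 2), Gate.had (j / 2 + 1), Gate.cnot (j / 2) (j / 2 + 1)] ++
    List.replicate r (Gate.phase (j / 2 + 1)) ++
    [Gate.cnot (j / 2) (j / 2 + 1), Gate.had (j / 2 + 1), Gate.had (j / 2)]

lemma circuitOp_replicate (r : ℕ) (g : Gate) :
    circuitOp N (List.replicate r g) = g.toOp N ^ r := by
  induction r with
  | zero => rfl
  | succ r ih => rw [List.replicate_succ, circuitOp, ih, pow_succ]

/-- For even `j` the product `γ_j γ_{j+1}` is a multiple of `Z` on one qubit; for odd `j` it is
a multiple of `X ⊗ X` on two adjacent qubits, which Hadamard and CNOT gates turn into `Z` on one. -/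
lemma circuitOp_braidCircuit {r j : ℕ} (hj : j + 1 < 2 * N) {a b : ℂ}
    (h : (!![1, 0; 0, Complex.I] : Matrix (Fin 2) (Fin 2) ℂ) ^ r = a • 1 + b • pauliZ) :
    circuitOp N (braidCircuit r j) =
      a • 1 + (-Complex.I * b) • (majorana N j * majorana N (j + 1)) := by
  have hphase : ∀ q < N, circuitOp N (List.replicate r (Gate.phase q)) =
      a • 1 + b • onQubit N q pauliZ := by
    intro q hq
    rw [circuitOp_replicate, Gate.toOp, onQubit_pow, h, onQubit_add hq, onQubit_smul hq,
      onQubit_smul hq, onQubit_one]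
  have hI : -Complex.I * b * Complex.I = b := by linear_combination (-b) * Complex.I_mul_I
  obtain ⟨q, rfl | rfl⟩ : ∃ q, j = 2 * q ∨ j = 2 * q + 1 := ⟨j / 2, by omega⟩
  · have h1 : 2 * q / 2 = q := by omega
    rw [braidCircuit, if_pos (by omega), h1, hphase q (by omega),
      majorana_mul_majorana_even (by omega), smul_smul, hI]
  · have h1 : (2 * q + 1) / 2 = q := by omega
    have hq : q < N := by omega
    have hq' : q + 1 < N := by omega
    have hne : q ≠ q + 1 := by omega
    rw [braidCircuit, if_neg (by omega), h1, majorana_mul_majorana_odd hq', smul_smul, hI]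
    simp only [circuitOp_append, circuitOp_cons, hphase _ hq']
    simp only [circuitOp, one_mul]
    have e1 := semiconj_conj (cnot_mul_self hq hq' hne)
      (y := onQubit N (q + 1) pauliZ) (x := onQubit N q pauliZ * onQubit N (q + 1) pauliZ)
      (semiconj_inverse (cnot_mul_self hq hq' hne) (cnot_mul_self hq hq' hne)
        (cnot_semiconj hq hq' hne)) a b
    have s2 : SemiconjBy ((Gate.had q).toOp N * (Gate.had (q + 1)).toOp N)
        (onQubit N q pauliZ * onQubit N (q + 1) pauliZ)
        (onQubit N q pauliX * onQubit N (q + 1) pauliX) :=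
      SemiconjBy.mul_right
        (SemiconjBy.mul_left (had_semiconj q) (had_commute hne.symm _))
        (SemiconjBy.mul_left (had_commute hne _) (had_semiconj (q + 1)))
    have hinv : (Gate.had q).toOp N * (Gate.had (q + 1)).toOp N *
        ((Gate.had (q + 1)).toOp N * (Gate.had q).toOp N) = 1 := by
      rw [mul_assoc, ← mul_assoc _ _ ((Gate.had q).toOp N), had_mul_self, one_mul, had_mul_self]
    have s3 : SemiconjBy ((Gate.had (q + 1)).toOp N * (Gate.had q).toOp N)
        (onQubit N q pauliX * onQubit N (q + 1) pauliX)
        (onQubit N q pauliZ * onQubit N (q + 1) pauliZ) :=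
      semiconj_inverse hinv (mul_eq_one_comm.mp hinv) s2
    have e2 := semiconj_conj hinv s3 a b
    rw [← e2, ← e1]
    simp only [mul_assoc]

/-- The braid of the modes `j` and `j + 1`. -/
noncomputable def braidOp (N j : ℕ) : Op N :=
  ((1 - Complex.I) / 2) • (1 + majorana N j * majorana N (j + 1))

lemma circuitOp_braid {j : ℕ} (hj : j + 1 < 2 * N) :
    circuitOp N (braidCircuit 3 j) = braidOp N j := by
  rw [circuitOp_braidCircuit (a := (1 - Complex.I) / 2) (b := (1 + Complex.I) / 2) hj, braidOp,
    smul_add]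
  · congr 2; linear_combination (-1 / 2 : ℂ) * Complex.I_mul_I
  · ext i k
    fin_cases i <;> fin_cases k <;> simp [pow_succ, Matrix.mul_apply, pauliZ] <;> ring

lemma majorana_pair_sq {i j : ℕ} (hij : i ≠ j) (hi : i < 2 * N) (hj : j < 2 * N) :
    majorana N i * majorana N j * (majorana N i * majorana N j) = -1 := by
  rw [mul_assoc, ← mul_assoc (majorana N j), majorana_anticommute hij.symm hj hi, neg_mul, mul_neg,
    mul_assoc, majorana_mul_self, mul_one, majorana_mul_self]

/-- One phase gate undoes three of them up to a scalar: `S · S³ = 1`. -/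
lemma circuitOp_unbraid_mul {j : ℕ} (hj : j + 1 < 2 * N) :
    circuitOp N (braidCircuit 1 j) * braidOp N j = 1 := by
  rw [circuitOp_braidCircuit (a := (1 + Complex.I) / 2) (b := (1 - Complex.I) / 2) hj, braidOp]
  · have h := majorana_pair_sq (N := N) (i := j) (j := j + 1) (by omega) (by omega) hj
    have e : -Complex.I * ((1 - Complex.I) / 2) = -((1 + Complex.I) / 2) := by
      linear_combination (1 / 2 : ℂ) * Complex.I_mul_I
    rw [e, neg_smul, ← sub_eq_add_neg, ← smul_sub, smul_mul_smul_comm, sub_mul, mul_add, mul_add, h]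
    simp only [one_mul, mul_one]
    have e2 : (1 + Complex.I) / 2 * ((1 - Complex.I) / 2) = 1 / 2 := by
      linear_combination (-1 / 4 : ℂ) * Complex.I_mul_I
    rw [e2, show (1 : Op N) + majorana N j * majorana N (j + 1) -
      (majorana N j * majorana N (j + 1) + -1) = (2 : ℂ) • 1 by rw [two_smul]; abel, smul_smul]
    norm_num
  · ext i k
    fin_cases i <;> fin_cases k <;> simp [pauliZ] <;> ring

/-- The general exchange `c (1 + γ_i γ_j)` maps `γ_j` to `γ_i` and `γ_i` to `-γ_j`. -/
lemma exchange_semiconj {i j : ℕ} (hij : i ≠ j) (hi : i < 2 * N) (hj : j < 2 * N) (c : ℂ) :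
    SemiconjBy (c • (1 + majorana N i * majorana N j)) (majorana N j) (majorana N i) ∧
    SemiconjBy (c • (1 + majorana N i * majorana N j)) (majorana N i) (-majorana N j) ∧
    ∀ k < 2 * N, k ≠ i → k ≠ j →
      Commute (c • (1 + majorana N i * majorana N j)) (majorana N k) := by
  have h := majorana_anticommute hij hi hj
  have hi2 := majorana_mul_self N i
  have hj2 := majorana_mul_self N j
  refine ⟨?_, ?_, fun k hk hki hkj => ?_⟩
  · rw [SemiconjBy, smul_mul_assoc, mul_smul_comm, add_mul, mul_add, mul_assoc, hj2, ← mul_assoc,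
      hi2, one_mul, mul_one, add_comm]
  · have e1 : majorana N i * majorana N j * majorana N i = -majorana N j := by
      rw [h, neg_mul, mul_assoc, hi2, mul_one]
    have e2 : majorana N j * (majorana N i * majorana N j) = -majorana N i := by
      rw [h, mul_neg, ← mul_assoc, hj2, one_mul]
    rw [SemiconjBy, smul_mul_assoc, mul_smul_comm, add_mul, mul_add, neg_mul, neg_mul, e1, e2, one_mul,
      mul_one, neg_neg, add_comm]
  · refine Commute.smul_left ((Commute.one_left _).add_left ?_) c
    rw [Commute, SemiconjBy, mul_assoc, majorana_anticommute hkj.symm hj hk, mul_neg, ← mul_assoc,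
      majorana_anticommute hki.symm hi hk, neg_mul, neg_neg, mul_assoc]

/-- Braids that move the mode `x` down to the place `y`. -/
def moveCircuit (x y : ℕ) : List Gate :=
  (List.range (x - y)).flatMap fun i => braidCircuit 3 (x - 1 - i)

/-- The inverse of `moveCircuit x y`. -/
def unmoveCircuit (x y : ℕ) : List Gate :=
  (List.range (x - y)).flatMap fun i => braidCircuit 1 (y + i)

lemma circuitOp_move_succ {y m : ℕ} (h : y + (m + 1) < 2 * N) :
    circuitOp N (moveCircuit (y + (m + 1)) y) =
      circuitOp N (moveCircuit (y + m) y) * braidOp N (y + m) := by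
  have e : moveCircuit (y + (m + 1)) y = braidCircuit 3 (y + m) ++ moveCircuit (y + m) y := by
    rw [moveCircuit, moveCircuit, Nat.add_sub_cancel_left, Nat.add_sub_cancel_left,
      List.range_succ_eq_map, List.flatMap_cons, List.flatMap_map]
    congr 2
    funext i
    congr 1
    omega
  rw [e, circuitOp_append, circuitOp_braid (by omega)]

/-- Moving the mode `y + m` down takes its Majorana operator to that of `y`. -/
lemma move_semiconj {y m : ℕ} (h : y + m < 2 * N) :
    SemiconjBy (circuitOp N (moveCircuit (y + m) y)) (majorana N (y + m)) (majorana N y) := by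
  induction m with
  | zero => simp [moveCircuit, circuitOp, SemiconjBy]
  | succ m ih =>
    rw [circuitOp_move_succ h]
    exact (ih (by omega)).mul_left
      (exchange_semiconj (by omega) (by omega) (by omega) _).1

/-- The modes outside of the range of the move are not affected. -/
lemma move_commute {y m i : ℕ} (h : y + m < 2 * N) (hi : i < 2 * N) (hiy : i < y ∨ y + m < i) :
    Commute (circuitOp N (moveCircuit (y + m) y)) (majorana N i) := by
  induction m with
  | zero => simp [moveCircuit, circuitOp]
  | succ m ih =>
    rw [circuitOp_move_succ h]
    exact (ih (by omega) (by omega)).mul_left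
      ((exchange_semiconj (by omega) (by omega) (by omega) _).2.2 i hi (by omega) (by omega))

lemma unmove_mul_move {y m : ℕ} (h : y + m < 2 * N) :
    circuitOp N (unmoveCircuit (y + m) y) * circuitOp N (moveCircuit (y + m) y) = 1 := by
  induction m with
  | zero => simp [moveCircuit, unmoveCircuit, circuitOp]
  | succ m ih =>
    have e : unmoveCircuit (y + (m + 1)) y = unmoveCircuit (y + m) y ++ braidCircuit 1 (y + m) := by
      rw [unmoveCircuit, unmoveCircuit, Nat.add_sub_cancel_left, Nat.add_sub_cancel_left,
        List.range_succ, List.flatMap_append, List.flatMap_singleton]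
    rw [circuitOp_move_succ h, e, circuitOp_append, mul_assoc, ← mul_assoc _ _ (braidOp N (y + m)),
      ih (by omega), one_mul, circuitOp_unbraid_mul (by omega)]

/-- Exchange of the modes `x < y`. -/
def exchangeCircuit (x y : ℕ) : List Gate :=
  moveCircuit y (x + 1) ++ braidCircuit 3 x ++ unmoveCircuit y (x + 1)

/-- Conjugating a braid by a move gives the exchange of two modes that are not adjacent. -/
lemma circuitOp_exchange {x y : ℕ} (hxy : x < y) (hy : y < 2 * N) :
    circuitOp N (exchangeCircuit x y) =
      ((1 - Complex.I) / 2) • (1 + majorana N x * majorana N y) := by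
  obtain ⟨m, rfl⟩ := Nat.exists_eq_add_of_le (Nat.succ_le_of_lt hxy)
  have h1 := unmove_mul_move hy
  have h2 : SemiconjBy (circuitOp N (moveCircuit (x + 1 + m) (x + 1)))
      (majorana N x * majorana N (x + 1 + m)) (majorana N x * majorana N (x + 1)) :=
    SemiconjBy.mul_right (move_commute hy (by omega) (by omega)) (move_semiconj hy)
  rw [exchangeCircuit, circuitOp_append, circuitOp_append, circuitOp_braid (by omega), braidOp,
    ← mul_assoc, smul_add, smul_add]
  exact semiconj_conj h1 h2 _ _

/-- A circuit for `exp (i (α / 2) γ_a γ_b γ_c γ_d)`, for `a < b < c < d`. -/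
def termCircuit (a b c d : ℕ) (α : ℚ) : List Gate :=
  moveCircuit a 0 ++ moveCircuit b 1 ++ moveCircuit c 2 ++ moveCircuit d 3 ++
    [Gate.cnot 0 1, Gate.rz 1 α, Gate.cnot 0 1] ++
    unmoveCircuit d 3 ++ unmoveCircuit c 2 ++ unmoveCircuit b 1 ++ unmoveCircuit a 0

lemma majorana_zero_one_two_three (hN : 1 < N) :
    majorana N 0 * majorana N 1 * (majorana N 2 * majorana N 3) =
      -(onQubit N 0 pauliZ * onQubit N 1 pauliZ) := by
  have h0 := majorana_mul_majorana_even (N := N) (q := 0) (by omega)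
  have h1 := majorana_mul_majorana_even (N := N) (q := 1) hN
  simp only [mul_zero, zero_add, mul_one] at h0 h1
  rw [h0, h1, smul_mul_smul_comm, Complex.I_mul_I, neg_one_smul]

/-- The rotation generated by the first four modes. -/
lemma circuitOp_rotation (hN : 1 < N) (α : ℚ) :
    circuitOp N [Gate.cnot 0 1, Gate.rz 1 α, Gate.cnot 0 1] =
      Complex.cos ((α : ℂ) / 2) • 1 + (Complex.I * Complex.sin ((α : ℂ) / 2)) •
        (majorana N 0 * majorana N 1 * (majorana N 2 * majorana N 3)) := by
  have hrz : (Gate.rz 1 α).toOp N = Complex.cos ((α : ℂ) / 2) • 1 +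
      (-(Complex.I * Complex.sin ((α : ℂ) / 2))) • onQubit N 1 pauliZ := by
    rw [← onQubit_one 1, ← onQubit_smul hN, ← onQubit_smul hN, ← onQubit_add hN, Gate.toOp]
    congr 1
    have e1 : Complex.exp (-(Complex.I * (α : ℂ) / 2)) =
        Complex.cos ((α : ℂ) / 2) - Complex.I * Complex.sin ((α : ℂ) / 2) := by
      rw [show -(Complex.I * (α : ℂ) / 2) = -((α : ℂ) / 2) * Complex.I by ring, Complex.exp_mul_I,
        Complex.cos_neg, Complex.sin_neg]
      ring
    have e2 : Complex.exp (Complex.I * (α : ℂ) / 2) =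
        Complex.cos ((α : ℂ) / 2) + Complex.I * Complex.sin ((α : ℂ) / 2) := by
      rw [show Complex.I * (α : ℂ) / 2 = ((α : ℂ) / 2) * Complex.I by ring, Complex.exp_mul_I]
      ring
    rw [e1, e2]
    ext i j
    fin_cases i <;> fin_cases j <;> simp [pauliZ]; ring
  have hc := cnot_mul_self (N := N) (c := 0) (t := 1) (by omega) hN (by omega)
  have hs : SemiconjBy ((Gate.cnot 0 1).toOp N) (onQubit N 0 pauliZ * onQubit N 1 pauliZ)
      (onQubit N 1 pauliZ) :=
    semiconj_inverse hc hc (cnot_semiconj (by omega) hN (by omega))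
  simp only [circuitOp, one_mul]
  rw [hrz, semiconj_conj hc hs, majorana_zero_one_two_three hN, smul_neg, neg_smul]

/-- The four modes are moved to the places `0, 1, 2, 3`, lowest first, so that no move disturbs the
modes that are in place already. -/
lemma circuitOp_term {a b c d : ℕ} (hab : a < b) (hbc : b < c) (hcd : c < d) (hd : d < 2 * N)
    (α : ℚ) :
    circuitOp N (termCircuit a b c d α) =
      Complex.cos ((α : ℂ) / 2) • 1 + (Complex.I * Complex.sin ((α : ℂ) / 2)) •
        (majorana N a * majorana N b * (majorana N c * majorana N d)) := by
  obtain ⟨a, rfl⟩ := Nat.exists_eq_add_of_le (Nat.zero_le a)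
  obtain ⟨b, rfl⟩ := Nat.exists_eq_add_of_le (show 1 ≤ b by omega)
  obtain ⟨c, rfl⟩ := Nat.exists_eq_add_of_le (show 2 ≤ c by omega)
  obtain ⟨d, rfl⟩ := Nat.exists_eq_add_of_le (show 3 ≤ d by omega)
  set A := circuitOp N (moveCircuit (0 + a) 0)
  set B := circuitOp N (moveCircuit (1 + b) 1)
  set C := circuitOp N (moveCircuit (2 + c) 2)
  set D := circuitOp N (moveCircuit (3 + d) 3)
  have mA : ∀ i, i < 2 * N → (i < 0 ∨ 0 + a < i) → Commute A (majorana N i) :=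
    fun i h1 h2 => move_commute (by omega) h1 h2
  have mB : ∀ i, i < 2 * N → (i < 1 ∨ 1 + b < i) → Commute B (majorana N i) :=
    fun i h1 h2 => move_commute (by omega) h1 h2
  have mC : ∀ i, i < 2 * N → (i < 2 ∨ 2 + c < i) → Commute C (majorana N i) :=
    fun i h1 h2 => move_commute (by omega) h1 h2
  have mD : ∀ i, i < 2 * N → (i < 3 ∨ 3 + d < i) → Commute D (majorana N i) :=
    fun i h1 h2 => move_commute (by omega) h1 h2
  have sA : SemiconjBy A (majorana N (0 + a)) (majorana N 0) := move_semiconj (by omega)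
  have sB : SemiconjBy B (majorana N (1 + b)) (majorana N 1) := move_semiconj (by omega)
  have sC : SemiconjBy C (majorana N (2 + c)) (majorana N 2) := move_semiconj (by omega)
  have sD : SemiconjBy D (majorana N (3 + d)) (majorana N 3) := move_semiconj (by omega)
  have s0 : SemiconjBy (D * (C * (B * A))) (majorana N (0 + a)) (majorana N 0) :=
    SemiconjBy.mul_left (mD 0 (by omega) (by omega)) (SemiconjBy.mul_left
      (mC 0 (by omega) (by omega)) (SemiconjBy.mul_left (mB 0 (by omega) (by omega)) sA))
  have s1 : SemiconjBy (D * (C * (B * A))) (majorana N (1 + b)) (majorana N 1) :=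
    SemiconjBy.mul_left (mD 1 (by omega) (by omega)) (SemiconjBy.mul_left
      (mC 1 (by omega) (by omega)) (SemiconjBy.mul_left sB (mA _ (by omega) (by omega))))
  have s2 : SemiconjBy (D * (C * (B * A))) (majorana N (2 + c)) (majorana N 2) :=
    SemiconjBy.mul_left (mD 2 (by omega) (by omega)) (SemiconjBy.mul_left sC (SemiconjBy.mul_left
      (mB _ (by omega) (by omega)) (mA _ (by omega) (by omega))))
  have s3 : SemiconjBy (D * (C * (B * A))) (majorana N (3 + d)) (majorana N 3) :=
    SemiconjBy.mul_left sD (SemiconjBy.mul_left (mC _ (by omega) (by omega)) (SemiconjBy.mul_left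
      (mB _ (by omega) (by omega)) (mA _ (by omega) (by omega))))
  have hinv : circuitOp N (unmoveCircuit (0 + a) 0) * (circuitOp N (unmoveCircuit (1 + b) 1) *
      (circuitOp N (unmoveCircuit (2 + c) 2) * circuitOp N (unmoveCircuit (3 + d) 3))) *
      (D * (C * (B * A))) = 1 := by
    have iA : circuitOp N (unmoveCircuit (0 + a) 0) * A = 1 := unmove_mul_move (by omega)
    have iB : circuitOp N (unmoveCircuit (1 + b) 1) * B = 1 := unmove_mul_move (by omega)
    have iC : circuitOp N (unmoveCircuit (2 + c) 2) * C = 1 := unmove_mul_move (by omega)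
    have iD : circuitOp N (unmoveCircuit (3 + d) 3) * D = 1 := unmove_mul_move (by omega)
    simp only [mul_assoc]
    rw [← mul_assoc _ D, iD, one_mul, ← mul_assoc _ C, iC, one_mul, ← mul_assoc _ B, iB, one_mul, iA]
  have := semiconj_conj hinv ((s0.mul_right s1).mul_right (s2.mul_right s3))
    (Complex.cos ((α : ℂ) / 2)) (Complex.I * Complex.sin ((α : ℂ) / 2))
  rw [← this, ← circuitOp_rotation (by omega), termCircuit]
  simp only [circuitOp_append, mul_assoc, A, B, C, D]

end Braids

end SparseSYK
namespace SparseSYK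

/-! ### Unitarity and locality of circuits -/

section Unitarity

lemma onQubit_conjTranspose (N q : ℕ) (U : Matrix (Fin 2) (Fin 2) ℂ) :
    (onQubit N q U).conjTranspose = onQubit N q U.conjTranspose := by
  rw [onQubit, tensor_conjTranspose, onQubit]
  congr 1; funext i
  split_ifs <;> simp

lemma Gate.toOp_isometry (N : ℕ) (g : Gate) : (g.toOp N).conjTranspose * g.toOp N = 1 := by
  cases g with
  | had q =>
    have h : ((Gate.had q).toOp N).conjTranspose = (Gate.had q).toOp N := by
      rw [Gate.toOp, onQubit_conjTranspose]
      congr 1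
      ext i j
      fin_cases i <;> fin_cases j <;> simp [Matrix.conjTranspose_apply]
    rw [h, had_mul_self]
  | phase q =>
    rw [Gate.toOp, onQubit_conjTranspose, onQubit_mul, ← onQubit_one q]
    congr 1
    ext i j
    fin_cases i <;> fin_cases j <;> simp [Matrix.mul_apply, Matrix.conjTranspose_apply]
  | cnot c t =>
    by_cases h : c < N ∧ t < N ∧ c ≠ t
    · have h1 : ((Gate.cnot c t).toOp N).conjTranspose = (Gate.cnot c t).toOp N := by
        rw [Gate.toOp, if_pos h, Matrix.conjTranspose_add, Matrix.conjTranspose_mul,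
          onQubit_conjTranspose, onQubit_conjTranspose, onQubit_conjTranspose, pauliX_conjTranspose,
          (onQubit_commute h.2.2.symm _ _).eq]
        congr 2
        · ext i j
          fin_cases i <;> fin_cases j <;> simp [Matrix.conjTranspose_apply]
        · congr 1
          ext i j
          fin_cases i <;> fin_cases j <;> simp [Matrix.conjTranspose_apply]
      rw [h1, cnot_mul_self h.1 h.2.1 h.2.2]
    · rw [Gate.toOp, if_neg h]; simp
  | rz q α =>
    rw [Gate.toOp, onQubit_conjTranspose, onQubit_mul, ← onQubit_one q]
    congr 1
    have e1 : (starRingEnd ℂ) (Complex.exp (-(Complex.I * (α : ℂ) / 2))) =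
        Complex.exp (Complex.I * (α : ℂ) / 2) := by
      have h2 : (starRingEnd ℂ) 2 = 2 := map_ofNat _ 2
      rw [← Complex.exp_conj]; congr 1; simp [h2, neg_div]
    have e2 : (starRingEnd ℂ) (Complex.exp (Complex.I * (α : ℂ) / 2)) =
        Complex.exp (-(Complex.I * (α : ℂ) / 2)) := by
      rw [← e1, Complex.conj_conj]
    ext i j
    fin_cases i <;> fin_cases j <;>
      simp [Matrix.mul_apply, Matrix.conjTranspose_apply, e1, e2, ← Complex.exp_add]

lemma circuitOp_isometry (N : ℕ) (l : List Gate) :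
    (circuitOp N l).conjTranspose * circuitOp N l = 1 := by
  induction l with
  | nil => simp [circuitOp]
  | cons g l ih =>
    rw [circuitOp, Matrix.conjTranspose_mul, mul_assoc, ← mul_assoc _ (circuitOp N l), ih, one_mul,
      Gate.toOp_isometry]

/-- A circuit that does not touch the last `N` of `N + N` qubits. -/
def IsLocal (N : ℕ) (l : List Gate) : Prop := circuitOp (N + N) l = extend N N (circuitOp N l)

lemma IsLocal.append {N : ℕ} {l₁ l₂ : List Gate} (h₁ : IsLocal N l₁) (h₂ : IsLocal N l₂) :
    IsLocal N (l₁ ++ l₂) := by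
  rw [IsLocal, circuitOp_append, circuitOp_append, map_mul, ← h₁, ← h₂]

lemma IsLocal.flatMap {N : ℕ} {ι : Type*} (L : List ι) {f : ι → List Gate}
    (h : ∀ i ∈ L, IsLocal N (f i)) : IsLocal N (L.flatMap f) := by
  induction L with
  | nil => simp [IsLocal, circuitOp]
  | cons i L ih =>
    rw [List.flatMap_cons]
    exact (h i (by simp)).append (ih fun j hj => h j (by simp [hj]))

lemma IsLocal.exchange {N x y : ℕ} (hxy : x < y) (hy : y < 2 * N) :
    IsLocal N (exchangeCircuit x y) := by
  rw [IsLocal, circuitOp_exchange hxy hy, circuitOp_exchange hxy (by omega), map_smul, map_add,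
    map_one, map_mul, extend_majorana hy, extend_majorana (by omega)]

lemma IsLocal.term {N a b c d : ℕ} (hab : a < b) (hbc : b < c) (hcd : c < d) (hd : d < 2 * N)
    (α : ℚ) : IsLocal N (termCircuit a b c d α) := by
  rw [IsLocal, circuitOp_term hab hbc hcd hd, circuitOp_term hab hbc hcd (by omega), map_add,
    map_smul, map_smul, map_one, map_mul, map_mul, map_mul, extend_majorana hd,
    extend_majorana (by omega), extend_majorana (by omega), extend_majorana (by omega)]

/-- A bit flip. -/
def flipCircuit (q : ℕ) : List Gate := [Gate.had q, Gate.phase q, Gate.phase q, Gate.had q]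

lemma circuitOp_flip (N q : ℕ) : circuitOp N (flipCircuit q) = onQubit N q pauliX := by
  have h : (Gate.phase q).toOp N * (Gate.phase q).toOp N = onQubit N q pauliZ := by
    rw [Gate.toOp, onQubit_mul]
    congr 1
    ext i j; fin_cases i <;> fin_cases j <;> simp [Matrix.mul_apply, pauliZ]
  simp only [flipCircuit, circuitOp, one_mul]
  rw [mul_assoc ((Gate.had q).toOp N), h, (had_semiconj q).eq, mul_assoc, had_mul_self, mul_one]

lemma IsLocal.flip {N q : ℕ} (hq : q < N) : IsLocal N (flipCircuit q) := by
  rw [IsLocal, circuitOp_flip, circuitOp_flip, extend_onQubit hq]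

end Unitarity

/-! ### Preparation of the initial state -/

section Preparation

/-- Bell pairs between the first `m` qubits and the workspace. -/
def bellCircuit (N m : ℕ) : List Gate :=
  (List.range m).flatMap fun i => [Gate.had (N + i), Gate.cnot (N + i) i]

/-- The amplitudes of the image of `|0 ⋯ 0⟩`, arranged as a matrix. -/
def amplitude {N : ℕ} (A : Op (N + N)) : Op N :=
  Matrix.of fun x z => A (Fin.append x z) 0

/-- The reduced state is `A A†` for the matrix `A` of amplitudes. -/
lemma reduce_single {N : ℕ} (A : Op (N + N)) :
    reduce (A * Matrix.single (0 : Basis (N + N)) (0 : Basis (N + N)) 1 * A.conjTranspose) =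
      amplitude A * (amplitude A).conjTranspose := by
  ext x y
  simp only [reduce, Matrix.of_apply, Matrix.mul_apply (M := amplitude A)]
  refine Finset.sum_congr rfl fun z _ => ?_
  rw [Matrix.mul_apply, Finset.sum_eq_single (0 : Basis (N + N))]
  · rw [Matrix.mul_single_apply_same, mul_one]; rfl
  · intro w _ hw
    rw [Matrix.mul_single_apply_of_ne _ _ _ _ _ hw, zero_mul]
  · simp

/-- Gates on the first `N` qubits multiply the matrix of amplitudes from the left. -/
lemma amplitude_extend_mul {N : ℕ} (B : Op N) (A : Op (N + N)) :
    amplitude (extend N N B * A) = B * amplitude A := by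
  ext x z
  simp only [amplitude, Matrix.of_apply, Matrix.mul_apply, sum_basis_append, extend_append,
    Matrix.one_apply]
  refine Finset.sum_congr rfl fun y _ => ?_
  simp

lemma onQubit_append {N i : ℕ} (U : Matrix (Fin 2) (Fin 2) ℂ) (x y z w : Basis N) :
    onQubit (N + N) (N + i) U (Fin.append x z) (Fin.append y w) =
      (1 : Op N) x y * onQubit N i U z w := by
  rw [← tensor_one]
  simp only [onQubit, tensor, Matrix.of_apply, Fin.prod_univ_add, Fin.append_left, Fin.append_right]
  congr 1
  · refine Finset.prod_congr rfl fun j _ => ?_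
    rw [if_neg (by simp; omega)]
  · refine Finset.prod_congr rfl fun j _ => ?_
    rw [Fin.val_natAdd]
    simp only [Nat.add_left_cancel_iff]

/-- Gates on the workspace multiply the matrix of amplitudes from the right, transposed. -/
lemma amplitude_onQubit_mul {N i : ℕ} (U : Matrix (Fin 2) (Fin 2) ℂ) (A : Op (N + N)) :
    amplitude (onQubit (N + N) (N + i) U * A) = amplitude A * (onQubit N i U).transpose := by
  ext x z
  simp only [amplitude, Matrix.of_apply, Matrix.mul_apply, sum_basis_append, onQubit_append,
    Matrix.one_apply, Matrix.transpose_apply]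
  rw [Finset.sum_comm]
  refine Finset.sum_congr rfl fun w _ => ?_
  simp [mul_comm]

lemma onQubit_transpose (N q : ℕ) (U : Matrix (Fin 2) (Fin 2) ℂ) :
    (onQubit N q U).transpose = onQubit N q U.transpose := by
  ext x y
  simp only [onQubit, tensor, Matrix.of_apply, Matrix.transpose_apply]
  refine Finset.prod_congr rfl fun i _ => ?_
  split_ifs
  · rfl
  · simp [Matrix.one_apply, eq_comm]

lemma amplitude_add {N : ℕ} (A B : Op (N + N)) : amplitude (A + B) = amplitude A + amplitude B :=
  rfl

lemma tensor_update_add {N m : ℕ} (hm : m < N) {f g k : Fin N → Matrix (Fin 2) (Fin 2) ℂ}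
    (hfg : ∀ i : Fin N, (i : ℕ) ≠ m → f i = g i) (hfk : ∀ i : Fin N, (i : ℕ) ≠ m → f i = k i)
    (h : f ⟨m, hm⟩ + g ⟨m, hm⟩ = k ⟨m, hm⟩) : tensor f + tensor g = tensor k := by
  ext x y
  have e : ∀ f' : Fin N → Matrix (Fin 2) (Fin 2) ℂ, (∀ i : Fin N, (i : ℕ) ≠ m → f i = f' i) →
      tensor f' x y = f' ⟨m, hm⟩ (x ⟨m, hm⟩) (y ⟨m, hm⟩) *
        ∏ i ∈ Finset.univ.erase (⟨m, hm⟩ : Fin N), f i (x i) (y i) := by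
    intro f' hf'
    rw [tensor, Matrix.of_apply, ← Finset.mul_prod_erase _ _ (Finset.mem_univ ⟨m, hm⟩)]
    congr 1
    refine Finset.prod_congr rfl fun i hi => ?_
    rw [hf' i fun h => (Finset.mem_erase.mp hi).1 (Fin.ext h)]
  rw [Matrix.add_apply, e f fun _ _ => rfl, e g hfg, e k hfk, ← add_mul, ← h, Matrix.add_apply]

/-- A Bell pair has the amplitude matrix `1 / √2`, and a pair of qubits in the state `|0⟩` that of the
projection to `|0⟩`. -/
lemma amplitude_bell {N m : ℕ} (hm : m ≤ N) :
    amplitude (circuitOp (N + N) (bellCircuit N m)) =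
      tensor fun i : Fin N => if (i : ℕ) < m then (((√2)⁻¹ : ℝ) : ℂ) • 1 else !![1, 0; 0, 0] := by
  induction m with
  | zero =>
    ext x z
    have h0 : (0 : Basis (N + N)) = Fin.append (0 : Basis N) (0 : Basis N) := by
      funext i
      exact Fin.addCases (fun i => by rw [Fin.append_left]; rfl)
        (fun i => by rw [Fin.append_right]; rfl) i
    have h1 : ∀ a b : Fin 2, (!![1, 0; 0, 0] : Matrix (Fin 2) (Fin 2) ℂ) a b =
        (1 : Matrix (Fin 2) (Fin 2) ℂ) a 0 * (1 : Matrix (Fin 2) (Fin 2) ℂ) b 0 := by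
      intro a b
      rw [Matrix.one_apply, Matrix.one_apply]
      fin_cases a <;> fin_cases b <;> simp
    rw [amplitude, bellCircuit, List.range_zero, List.flatMap_nil, circuitOp, Matrix.of_apply,
      ← tensor_one, h0]
    simp only [tensor, Matrix.of_apply, Fin.prod_univ_add, Nat.not_lt_zero, if_false, h1,
      Finset.prod_mul_distrib]
    congr 1
    · refine Finset.prod_congr rfl fun i _ => ?_
      rw [Fin.append_left, Fin.append_left]; rfl
    · refine Finset.prod_congr rfl fun i _ => ?_
      rw [Fin.append_right, Fin.append_right]; rfl
  | succ m ih =>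
    have hm' : m < N := hm
    have e : bellCircuit N (m + 1) =
        bellCircuit N m ++ [Gate.had (N + m), Gate.cnot (N + m) m] := by
      rw [bellCircuit, bellCircuit, List.range_succ, List.flatMap_append, List.flatMap_singleton]
    have h1 : circuitOp (N + N) [Gate.had (N + m), Gate.cnot (N + m) m] =
        onQubit (N + N) (N + m) !![1, 0; 0, 0] * (Gate.had (N + m)).toOp (N + N) +
        extend N N (onQubit N m pauliX) *
          (onQubit (N + N) (N + m) !![0, 0; 0, 1] * (Gate.had (N + m)).toOp (N + N)) := by
      simp only [circuitOp, one_mul]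
      rw [show (Gate.cnot (N + m) m).toOp (N + N) = _ from if_pos (by omega), add_mul, extend_onQubit hm',
        ← mul_assoc (onQubit (N + N) m pauliX),
        (onQubit_commute (show m ≠ N + m by omega) pauliX _).eq]
    rw [e, circuitOp_append, h1, add_mul, amplitude_add, mul_assoc, amplitude_onQubit_mul,
      mul_assoc (extend N N _), amplitude_extend_mul, mul_assoc (onQubit (N + N) (N + m) _),
      amplitude_onQubit_mul, Gate.toOp, amplitude_onQubit_mul, ih (by omega), onQubit_transpose,
      onQubit_transpose, onQubit_transpose, mul_assoc, mul_assoc, onQubit_mul, onQubit_mul]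
    simp only [onQubit, tensor_mul]
    refine tensor_update_add hm' (fun i hi => ?_) (fun i hi => ?_) ?_
    · simp [hi]
    · by_cases h2 : (i : ℕ) < m
      · simp [hi, h2, Nat.lt_succ_of_lt h2]
      · simp [hi, h2, show ¬ (i : ℕ) < m + 1 by omega]
    · simp only [if_true, lt_irrefl, if_false, Nat.lt_succ_self]
      ext i j
      simp only [Matrix.mul_apply, Matrix.add_apply, pauliX, Matrix.transpose_apply,
        Fin.sum_univ_two]
      fin_cases i <;> fin_cases j <;> simp

lemma inv_sqrt_two_mul_self : ((((√2)⁻¹ : ℝ) : ℂ)) * (((√2)⁻¹ : ℝ) : ℂ) = 1 / 2 := by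
  rw [← Complex.ofReal_mul, ← mul_inv, Real.mul_self_sqrt (by norm_num)]; norm_num

/-- The state of the first `N` qubits after `m` Bell pairs and `j` bit flips. -/
lemma flips_bell {N m h : ℕ} (hm : m + h ≤ N) (j : ℕ) (hj : j ≤ h) :
    circuitOp N ((List.range j).flatMap fun i => flipCircuit (m + i)) *
        (amplitude (circuitOp (N + N) (bellCircuit N m)) *
          (amplitude (circuitOp (N + N) (bellCircuit N m))).conjTranspose) *
        (circuitOp N ((List.range j).flatMap fun i => flipCircuit (m + i))).conjTranspose =
      tensor fun i : Fin N => if (i : ℕ) < m then (1 / 2 : ℂ) • 1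
        else if (i : ℕ) < m + j then !![0, 0; 0, 1] else !![1, 0; 0, 0] := by
  induction j with
  | zero =>
    simp only [List.range_zero, List.flatMap_nil, circuitOp, Matrix.conjTranspose_one, one_mul,
      mul_one, add_zero]
    rw [amplitude_bell (by omega), tensor_conjTranspose, tensor_mul]
    congr 1; funext i
    split_ifs
    · rw [Matrix.conjTranspose_smul, Matrix.conjTranspose_one, smul_mul_smul_comm, mul_one]
      congr 1
      rw [Complex.star_def, Complex.conj_ofReal, inv_sqrt_two_mul_self]
    · ext a b; fin_cases a <;> fin_cases b <;>
        simp [Matrix.mul_apply, Matrix.conjTranspose_apply]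
  | succ j ih =>
    rw [List.range_succ, List.flatMap_append, List.flatMap_singleton, circuitOp_append,
      circuitOp_flip, Matrix.conjTranspose_mul, onQubit_conjTranspose, pauliX_conjTranspose]
    have e : ∀ A F R : Op N, A * F * R * (F.conjTranspose * A) =
        A * (F * R * F.conjTranspose) * A := fun A F R => by simp only [mul_assoc]
    rw [e, ih (by omega), onQubit, tensor_mul, tensor_mul]
    congr 1; funext i
    rcases lt_trichotomy (i : ℕ) (m + j) with h1 | h1 | h1
    · have h2 : (i : ℕ) < m + (j + 1) := by omega
      simp [h1.ne, h1, h2]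
    · have h2 : ¬ (i : ℕ) < m := by omega
      have h3 : (i : ℕ) < m + (j + 1) := by omega
      simp only [h1, if_true, lt_irrefl, if_false]
      rw [if_neg (by omega), if_neg (by omega), if_pos (by omega)]
      ext a b; fin_cases a <;> fin_cases b <;>
        simp [Matrix.mul_apply, pauliX, Fin.sum_univ_two]
    · have h2 : ¬ (i : ℕ) < m := by omega
      have h3 : ¬ (i : ℕ) < m + (j + 1) := by omega
      have h4 : ¬ (i : ℕ) < m + j := by omega
      simp [h2, h3, h4, h1.ne']

lemma one_add_I_majorana_pair {N q : ℕ} (hq : q < N) :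
    1 + Complex.I • (majorana N (2 * q) * majorana N (2 * q + 1)) =
      (2 : ℂ) • onQubit N q !![0, 0; 0, 1] ∧
    1 - Complex.I • (majorana N (2 * q) * majorana N (2 * q + 1)) =
      (2 : ℂ) • onQubit N q !![1, 0; 0, 0] := by
  obtain ⟨h1, h2, -⟩ := onQubit_projections hq
  rw [majorana_mul_majorana_even hq, smul_smul, Complex.I_mul_I, neg_one_smul, h2, ← h1, two_smul,
    two_smul]
  constructor <;> abel

variable (n : ℕ)

/-- The stabilizers of the product state, from which the exchanges produce those of `rhoZero`. -/
noncomputable def productPair (j : ℕ) : Op (hoQubits n) :=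
  (1 + Complex.I • (chiOp n (2 * j) * chiOp n (2 * j + 1))) *
    (1 - Complex.I • (sigmaOp n (2 * j) * sigmaOp n (2 * j + 1)))

lemma nOne_eq : nOne n = 2 * (n - halfChi n) := by unfold nOne nTwo halfChi; omega

lemma sub_halfChi_add : n - halfChi n + halfChi n = n := by unfold halfChi; omega

/-- The product of the stabilizers projects the `χ` qubits to `|1⟩` and the `σ` qubits to `|0⟩`. -/
lemma prod_productPair (k : ℕ) (hk : k ≤ halfChi n) :
    ((List.range k).map (productPair n)).prod = (4 : ℂ) ^ k • tensor fun i : Fin (hoQubits n) =>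
      if n - halfChi n ≤ (i : ℕ) ∧ (i : ℕ) < n - halfChi n + k then !![0, 0; 0, 1]
      else if n ≤ (i : ℕ) ∧ (i : ℕ) < n + k then !![1, 0; 0, 0] else 1 := by
  have hsub := sub_halfChi_add n
  induction k with
  | zero =>
    simp only [List.range_zero, List.map_nil, List.prod_nil, pow_zero, one_smul]
    rw [← tensor_one]
    congr 1; funext i
    rw [if_neg (by omega), if_neg (by omega)]
  | succ k ih =>
    have hq1 : n - halfChi n + k < hoQubits n := by unfold hoQubits; omega
    have hq2 : n + k < hoQubits n := by unfold hoQubits; omega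
    have e : productPair n k = (4 : ℂ) • (onQubit (hoQubits n) (n - halfChi n + k) !![0, 0; 0, 1] *
        onQubit (hoQubits n) (n + k) !![1, 0; 0, 0]) := by
      have h1 := (one_add_I_majorana_pair hq1).1
      have h2 := (one_add_I_majorana_pair hq2).2
      rw [productPair, chiOp, chiOp, sigmaOp, sigmaOp, nOne_eq,
        show 2 * (n - halfChi n) + 2 * k = 2 * (n - halfChi n + k) by ring,
        show 2 * (n - halfChi n) + (2 * k + 1) = 2 * (n - halfChi n + k) + 1 by ring,
        show 2 * n + 2 * k = 2 * (n + k) by ring,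
        show 2 * n + (2 * k + 1) = 2 * (n + k) + 1 by ring, h1, h2, smul_mul_smul_comm]
      norm_num
    rw [List.range_succ, List.map_append, List.prod_append, ih (by omega), List.map_singleton,
      List.prod_singleton, e, smul_mul_smul_comm, ← pow_succ, onQubit, onQubit, tensor_mul,
      tensor_mul]
    congr 2; funext i
    by_cases h1 : (i : ℕ) = n - halfChi n + k
    · rw [if_neg (by omega), if_neg (by omega), if_pos h1, if_neg (by omega), if_pos (by omega)]
      simp
    by_cases h2 : (i : ℕ) = n + k
    · rw [if_neg (by omega), if_neg (by omega), if_neg h1, if_pos h2, if_neg (by omega),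
        if_pos (by omega)]
      simp
    rw [if_neg h1, if_neg h2, mul_one, mul_one]
    by_cases h3 : n - halfChi n ≤ (i : ℕ) ∧ (i : ℕ) < n - halfChi n + k
    · rw [if_pos h3, if_pos (by omega)]
    · rw [if_neg h3, if_neg (c := _ ∧ (i : ℕ) < n - halfChi n + (k + 1)) (by omega)]
      by_cases h4 : n ≤ (i : ℕ) ∧ (i : ℕ) < n + k
      · rw [if_pos h4, if_pos (by omega)]
      · rw [if_neg h4, if_neg (by omega)]

lemma prod_ite_lt {N m : ℕ} (hm : m ≤ N) (c : ℂ) :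
    ∏ i : Fin N, (if (i : ℕ) < m then c else 1) = c ^ m := by
  rw [Fin.prod_univ_eq_prod_range (fun i => if i < m then c else 1) N, Finset.prod_ite,
    Finset.prod_const_one, mul_one, Finset.prod_const]
  have : (Finset.range N).filter (· < m) = Finset.range m := by
    ext i
    simp only [Finset.mem_filter, Finset.mem_range]
    omega
  rw [this, Finset.card_range]

/-- The state before the exchanges: maximally mixed `φ` qubits, `χ` qubits in the state `|1⟩` and `σ`
qubits in the state `|0⟩`. -/
lemma product_state_eq :
    (tensor fun i : Fin (hoQubits n) => if (i : ℕ) < n - halfChi n then (1 / 2 : ℂ) • 1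
      else if (i : ℕ) < n - halfChi n + halfChi n then !![0, 0; 0, 1] else !![1, 0; 0, 0]) =
      ((2 : ℂ) ^ hoQubits n)⁻¹ • ((List.range (halfChi n)).map (productPair n)).prod := by
  have hsub := sub_halfChi_add n
  have hN : hoQubits n = n - halfChi n + 2 * halfChi n := by unfold hoQubits; omega
  rw [prod_productPair n _ le_rfl, smul_smul]
  have h1 : ((2 : ℂ) ^ hoQubits n)⁻¹ * 4 ^ halfChi n =
      ∏ i : Fin (hoQubits n), if (i : ℕ) < n - halfChi n then (1 / 2 : ℂ) else 1 := by
    rw [prod_ite_lt (by omega), hN, pow_add, pow_mul, mul_inv, mul_assoc, one_div, inv_pow]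
    norm_num
  rw [h1, ← tensor_smul]
  congr 1; funext i
  by_cases h2 : (i : ℕ) < n - halfChi n
  · rw [if_pos h2, if_pos h2, if_neg (by omega), if_neg (by omega)]
  · rw [if_neg h2, if_neg h2, one_smul]
    by_cases h3 : (i : ℕ) < n - halfChi n + halfChi n
    · rw [if_pos h3, if_pos (by omega)]
    · have := i.2
      rw [if_neg h3, if_neg (by omega), if_pos (by omega)]

/-- Exchange of `χ_{2j+1}` and `σ_{2j}` for all `j < k`. -/
def exchangesCircuit (k : ℕ) : List Gate :=
  (List.range k).flatMap fun j => exchangeCircuit (nOne n + 2 * j + 1) (2 * n + 2 * j)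

/-- The exchanges act on disjoint pairs of modes: on each pair they take `σ_{2j}` to `χ_{2j+1}` and
`χ_{2j+1}` to `-σ_{2j}`, and they fix all other modes. -/
lemma exchanges_semiconj (k : ℕ) (hk : k ≤ halfChi n) :
    (∀ j < k, SemiconjBy (circuitOp (hoQubits n) (exchangesCircuit n k)) (sigmaOp n (2 * j))
      (chiOp n (2 * j + 1))) ∧
    (∀ j < k, SemiconjBy (circuitOp (hoQubits n) (exchangesCircuit n k)) (chiOp n (2 * j + 1))
      (-sigmaOp n (2 * j))) ∧
    (∀ i < 2 * hoQubits n, (∀ j < k, i ≠ nOne n + 2 * j + 1 ∧ i ≠ 2 * n + 2 * j) →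
      Commute (circuitOp (hoQubits n) (exchangesCircuit n k)) (majorana (hoQubits n) i)) := by
  have h1 := nOne_add_nTwo n
  have h2 := two_mul_hoQubits n
  have h3 : nTwo n = 2 * halfChi n := rfl
  induction k with
  | zero => simp [exchangesCircuit, circuitOp]
  | succ k ih =>
    obtain ⟨ih1, ih2, ih3⟩ := ih (by omega)
    have e : circuitOp (hoQubits n) (exchangesCircuit n (k + 1)) =
        ((1 - Complex.I) / 2) • (1 + majorana (hoQubits n) (nOne n + 2 * k + 1) *
          majorana (hoQubits n) (2 * n + 2 * k)) *
            circuitOp (hoQubits n) (exchangesCircuit n k) := by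
      rw [← circuitOp_exchange (by omega) (by omega), ← circuitOp_append, exchangesCircuit,
        exchangesCircuit, List.range_succ, List.flatMap_append, List.flatMap_singleton]
    obtain ⟨x1, x2, x3⟩ := exchange_semiconj (N := hoQubits n) (i := nOne n + 2 * k + 1)
      (j := 2 * n + 2 * k) (by omega) (by omega) (by omega) ((1 - Complex.I) / 2)
    rw [e]
    refine ⟨fun j hj => ?_, fun j hj => ?_, fun i hi hij => ?_⟩
    · by_cases hjk : j = k
      · subst hjk
        refine SemiconjBy.mul_left x1 (ih3 _ (by omega) fun i hi => by omega)
      · exact SemiconjBy.mul_left (x3 _ (by omega) (by omega) (by omega)) (ih1 j (by omega))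
    · by_cases hjk : j = k
      · subst hjk
        refine SemiconjBy.mul_left x2 (ih3 _ (by omega) fun i hi => by omega)
      · exact SemiconjBy.mul_left ((x3 (2 * n + 2 * j) (by omega) (by omega) (by omega)).neg_right)
          (ih2 j (by omega))
    · exact Commute.mul_left (x3 i hi (hij k (by omega)).1 (hij k (by omega)).2)
        (ih3 i hi fun j hj => hij j (by omega))

/-- The exchanges turn the stabilizers of the product state into those of the maximally entangled
state. -/
lemma exchanges_semiconj_pair {j : ℕ} (hj : j < halfChi n) :
    SemiconjBy (circuitOp (hoQubits n) (exchangesCircuit n (halfChi n))) (productPair n j)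
      ((1 + Complex.I • (sigmaOp n (2 * j) * chiOp n (2 * j))) *
        (1 + Complex.I • (sigmaOp n (2 * j + 1) * chiOp n (2 * j + 1)))) := by
  obtain ⟨h1, h2, h3⟩ := exchanges_semiconj n (halfChi n) le_rfl
  have g1 := nOne_add_nTwo n
  have g2 := two_mul_hoQubits n
  have g3 : nTwo n = 2 * halfChi n := rfl
  have hI : ∀ A B : Op (hoQubits n), SemiconjBy (circuitOp (hoQubits n)
      (exchangesCircuit n (halfChi n))) A B → SemiconjBy (circuitOp (hoQubits n)
      (exchangesCircuit n (halfChi n))) (Complex.I • A) (Complex.I • B) := fun A B h => by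
    rw [SemiconjBy, mul_smul_comm, smul_mul_assoc, h.eq]
  have c1 : Commute (circuitOp (hoQubits n) (exchangesCircuit n (halfChi n))) (chiOp n (2 * j)) :=
    h3 _ (by omega) fun i hi => by omega
  have c2 : Commute (circuitOp (hoQubits n) (exchangesCircuit n (halfChi n)))
      (sigmaOp n (2 * j + 1)) := h3 _ (by omega) fun i hi => by omega
  refine SemiconjBy.mul_right ?_ ?_
  · refine (SemiconjBy.one_right _).add_right (hI _ _ ?_)
    have := SemiconjBy.mul_right c1 (h2 j hj)
    rwa [mul_neg, chi_sigma_anticommute (by omega) (by omega), neg_neg] at this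
  · rw [sub_eq_add_neg, ← smul_neg]
    refine (SemiconjBy.one_right _).add_right (hI _ _ ?_)
    have := (SemiconjBy.mul_right (h1 j hj) c2).neg_right
    rwa [chi_sigma_anticommute (by omega) (by omega), neg_neg] at this

lemma rhoZero_eq_pairs : rhoZero n = ((2 : ℂ) ^ hoQubits n)⁻¹ • ((List.range (halfChi n)).map
    fun j => (1 + Complex.I • (sigmaOp n (2 * j) * chiOp n (2 * j))) *
      (1 + Complex.I • (sigmaOp n (2 * j + 1) * chiOp n (2 * j + 1)))).prod := by
  rw [rhoZero, nTwo]
  congr 1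
  induction halfChi n with
  | zero => simp
  | succ k ih =>
    rw [show 2 * (k + 1) = 2 * k + 1 + 1 by ring, List.range_succ, List.range_succ, List.range_succ,
      List.map_append, List.map_append, List.prod_append, List.prod_append, ih, List.map_append,
      List.prod_append, mul_assoc]
    simp

/-- A circuit that prepares `rhoZero`. -/
def prepCircuit : List Gate :=
  bellCircuit (hoQubits n) (n - halfChi n) ++
    ((List.range (halfChi n)).flatMap fun j => flipCircuit (n - halfChi n + j)) ++
    exchangesCircuit n (halfChi n)

/-- The state that a circuit on the physical qubits makes of `rhoZero`. -/
lemma circuitState_prep {l : List Gate} (hl : IsLocal (hoQubits n) l) :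
    circuitState (hoQubits n) (prepCircuit n ++ l) =
      circuitOp (hoQubits n) l * rhoZero n * (circuitOp (hoQubits n) l).conjTranspose := by
  have hsub := sub_halfChi_add n
  have g1 := nOne_add_nTwo n
  have g2 := two_mul_hoQubits n
  have g3 : nTwo n = 2 * halfChi n := rfl
  have hN : hoQubits n = n + halfChi n := rfl
  have hflip : IsLocal (hoQubits n)
      ((List.range (halfChi n)).flatMap fun j => flipCircuit (n - halfChi n + j)) :=
    IsLocal.flatMap _ fun j hj => IsLocal.flip (by have := List.mem_range.mp hj; omega)
  have hex : IsLocal (hoQubits n) (exchangesCircuit n (halfChi n)) :=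
    IsLocal.flatMap _ fun j hj => IsLocal.exchange (by have := List.mem_range.mp hj; omega)
      (by have := List.mem_range.mp hj; omega)
  have hloc := (hflip.append hex).append hl
  have hpre : circuitOp (hoQubits n) (exchangesCircuit n (halfChi n)) *
      (((2 : ℂ) ^ hoQubits n)⁻¹ • ((List.range (halfChi n)).map (productPair n)).prod) *
      (circuitOp (hoQubits n) (exchangesCircuit n (halfChi n))).conjTranspose = rhoZero n := by
    have key : ∀ k ≤ halfChi n,
        SemiconjBy (circuitOp (hoQubits n) (exchangesCircuit n (halfChi n)))
        ((List.range k).map (productPair n)).prod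
        ((List.range k).map fun j => (1 + Complex.I • (sigmaOp n (2 * j) * chiOp n (2 * j))) *
          (1 + Complex.I • (sigmaOp n (2 * j + 1) * chiOp n (2 * j + 1)))).prod := by
      intro k hk
      induction k with
      | zero => simp
      | succ k ih =>
        rw [List.range_succ, List.map_append, List.map_append, List.prod_append, List.prod_append]
        refine (ih (by omega)).mul_right ?_
        simpa using exchanges_semiconj_pair n (j := k) (by omega)
    rw [mul_smul_comm, smul_mul_assoc, (key _ le_rfl).eq, mul_assoc,
      mul_eq_one_comm.mp (circuitOp_isometry _ _), mul_one, rhoZero_eq_pairs]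
  have e : prepCircuit n ++ l = bellCircuit (hoQubits n) (n - halfChi n) ++
      (((List.range (halfChi n)).flatMap fun j => flipCircuit (n - halfChi n + j)) ++
      exchangesCircuit n (halfChi n) ++ l) := by
    simp only [prepCircuit, List.append_assoc]
  rw [circuitState, reduce_single, e, circuitOp_append, hloc, amplitude_extend_mul,
    circuitOp_append, circuitOp_append, Matrix.conjTranspose_mul, Matrix.conjTranspose_mul,
    Matrix.conjTranspose_mul, ← hpre, ← product_state_eq,
    ← flips_bell (N := hoQubits n) (m := n - halfChi n) (h := halfChi n) (by omega) _ le_rfl]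
  simp only [mul_assoc]

end Preparation

end SparseSYK
namespace SparseSYK

/-! ### Trace distance -/

section TraceDistance
open scoped Matrix.Norms.L2Operator

lemma l2_opNorm_conj_le {m : Type*} [Fintype m] [DecidableEq m] {Q A : Matrix m m ℂ}
    (hQ : Q.conjTranspose * Q = 1) : ‖Q * A * Q.conjTranspose‖ ≤ ‖A‖ := by
  have h1 := l2_opNorm_le_one_of_isometry hQ
  have h2 : ‖Q.conjTranspose‖ ≤ 1 := by rwa [Matrix.l2_opNorm_conjTranspose]
  calc _ ≤ ‖Q‖ * ‖A‖ * ‖Q.conjTranspose‖ :=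
        (norm_mul_le _ _).trans (mul_le_mul_of_nonneg_right (norm_mul_le _ _) (norm_nonneg _))
    _ ≤ 1 * ‖A‖ * 1 := by gcongr
    _ = ‖A‖ := by ring

open scoped ComplexOrder in
/-- The sum of the singular values is attained at a contraction (polar decomposition). -/
lemma exists_contraction_trace_eq {m : Type*} [Fintype m] [DecidableEq m] (D : Matrix m m ℂ) :
    ∃ W : Matrix m m ℂ, ‖W‖ ≤ 1 ∧ ((W * D).trace).re =
      ∑ i, √((Matrix.isHermitian_conjTranspose_mul_self D).eigenvalues i) := by
  set hD := Matrix.isHermitian_conjTranspose_mul_self D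
  set lam := hD.eigenvalues with hlam
  have hlam0 : ∀ i, 0 ≤ lam i := fun i =>
    (Matrix.posSemidef_conjTranspose_mul_self D).eigenvalues_nonneg i
  set Q : Matrix m m ℂ := (hD.eigenvectorUnitary : Matrix m m ℂ) with hQ
  have hQ1 : Q.conjTranspose * Q = 1 := Unitary.coe_star_mul_self hD.eigenvectorUnitary
  have hspec : D.conjTranspose * D = Q * Matrix.diagonal (fun i => (lam i : ℂ)) *
      Q.conjTranspose := hD.spectral_theorem
  set R : Matrix m m ℂ := Matrix.diagonal fun i => (((√(lam i))⁻¹ : ℝ) : ℂ) with hR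
  have hRh : R.conjTranspose = R := by
    rw [hR, Matrix.diagonal_conjTranspose]
    congr 1; funext i
    simp
  have hdiag : ∀ X : Matrix m m ℂ, Q.conjTranspose * (Q * X * Q.conjTranspose) * Q = X := by
    intro X
    rw [mul_assoc Q, ← mul_assoc, hQ1, one_mul, mul_assoc, hQ1, mul_one]
  have hsq : ∀ i, √(lam i) * √(lam i) = lam i := fun i => Real.mul_self_sqrt (hlam0 i)
  have hRl : R * Matrix.diagonal (fun i => (lam i : ℂ)) =
      Matrix.diagonal fun i => ((√(lam i) : ℝ) : ℂ) := by
    rw [hR, Matrix.diagonal_mul_diagonal]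
    congr 1; funext i
    rw [← Complex.ofReal_mul]
    congr 1
    nth_rewrite 2 [← hsq i]
    rw [← mul_assoc, inv_mul_mul_self]
  refine ⟨Q * R * Q.conjTranspose * D.conjTranspose, ?_, ?_⟩
  · have h1 : (Q * R * Q.conjTranspose * D.conjTranspose) *
        (Q * R * Q.conjTranspose * D.conjTranspose).conjTranspose =
        Q * (R * Matrix.diagonal (fun i => (lam i : ℂ)) * R) * Q.conjTranspose := by
      have e : (Q * R * Q.conjTranspose * D.conjTranspose).conjTranspose =
          D * (Q * R * Q.conjTranspose) := by
        rw [Matrix.conjTranspose_mul, Matrix.conjTranspose_conjTranspose,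
          Matrix.conjTranspose_mul, Matrix.conjTranspose_mul, hRh,
          Matrix.conjTranspose_conjTranspose]
        simp only [mul_assoc]
      rw [e]
      calc _ = Q * R * (Q.conjTranspose * (D.conjTranspose * D) * Q) * R * Q.conjTranspose := by
            simp only [mul_assoc]
        _ = _ := by rw [hspec, hdiag]; simp only [mul_assoc]
    have h2 := Matrix.l2_opNorm_conjTranspose_mul_self
      (Q * R * Q.conjTranspose * D.conjTranspose).conjTranspose
    rw [Matrix.conjTranspose_conjTranspose, Matrix.l2_opNorm_conjTranspose, h1, hRl, hR,
      Matrix.diagonal_mul_diagonal] at h2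
    have h3 : ‖Matrix.diagonal fun i => (((√(lam i) : ℝ) : ℂ) * (((√(lam i))⁻¹ : ℝ) : ℂ))‖ ≤ 1 := by
      rw [Matrix.l2_opNorm_diagonal]
      refine (pi_norm_le_iff_of_nonneg zero_le_one).mpr fun i => ?_
      rw [← Complex.ofReal_mul, Complex.norm_real, Real.norm_of_nonneg (by positivity)]
      exact mul_inv_le_one
    have h4 := (l2_opNorm_conj_le hQ1).trans h3
    rw [h2] at h4
    nlinarith [norm_nonneg (Q * R * Q.conjTranspose * D.conjTranspose)]
  · have h1 : Q * R * Q.conjTranspose * D.conjTranspose * D =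
        Q * (Matrix.diagonal fun i => ((√(lam i) : ℝ) : ℂ)) * Q.conjTranspose := by
      calc _ = Q * R * (Q.conjTranspose * (D.conjTranspose * D) * Q) * Q.conjTranspose := by
            have hQ2 : Q * Q.conjTranspose = 1 := mul_eq_one_comm.mp hQ1
            simp only [mul_assoc, hQ2, mul_one]
        _ = _ := by rw [hspec, hdiag, mul_assoc Q R, hRl]
    rw [h1, Matrix.trace_mul_comm, ← mul_assoc, hQ1, one_mul, Matrix.trace_diagonal, Complex.re_sum]
    rfl

variable {n : ℕ}

/-- Two unitaries that are close make close states of `rhoZero`. -/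
lemma norm_trace_mul_sub_le {U V : Op (hoQubits n)} (hU : U.conjTranspose * U = 1)
    (hV : V.conjTranspose * V = 1) (W : Op (hoQubits n)) :
    ‖(W * (V * rhoZero n * V.conjTranspose - U * rhoZero n * U.conjTranspose)).trace‖ ≤
      2 * ‖W‖ * ‖V - U‖ := by
  have hU1 := l2_opNorm_le_one_of_isometry hU
  have hV1 : ‖V.conjTranspose‖ ≤ 1 := by
    rw [Matrix.l2_opNorm_conjTranspose]; exact l2_opNorm_le_one_of_isometry hV
  have e : (W * (V * rhoZero n * V.conjTranspose - U * rhoZero n * U.conjTranspose)).trace =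
      (V.conjTranspose * W * (V - U) * rhoZero n).trace +
        ((V - U).conjTranspose * W * U * rhoZero n).trace := by
    have h1 : W * (V * rhoZero n * V.conjTranspose - U * rhoZero n * U.conjTranspose) =
        (W * (V - U) * rhoZero n) * V.conjTranspose +
          (W * U * rhoZero n) * (V - U).conjTranspose := by
      rw [Matrix.conjTranspose_sub]; noncomm_ring
    rw [h1, Matrix.trace_add, Matrix.trace_mul_comm, Matrix.trace_mul_comm (W * U * rhoZero n)]
    simp only [mul_assoc]
  rw [e]
  refine (norm_add_le _ _).trans ?_
  have h2 : ‖(V.conjTranspose * W * (V - U) * rhoZero n).trace‖ ≤ ‖W‖ * ‖V - U‖ := by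
    refine (norm_trace_mul_rhoZero_le _).trans ?_
    calc _ ≤ ‖V.conjTranspose‖ * ‖W‖ * ‖V - U‖ :=
          (norm_mul_le _ _).trans (mul_le_mul_of_nonneg_right (norm_mul_le _ _) (norm_nonneg _))
      _ ≤ 1 * ‖W‖ * ‖V - U‖ := by gcongr
      _ = _ := by ring
  have h3 : ‖((V - U).conjTranspose * W * U * rhoZero n).trace‖ ≤ ‖W‖ * ‖V - U‖ := by
    refine (norm_trace_mul_rhoZero_le _).trans ?_
    calc _ ≤ ‖(V - U).conjTranspose‖ * ‖W‖ * ‖U‖ :=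
          (norm_mul_le _ _).trans (mul_le_mul_of_nonneg_right (norm_mul_le _ _) (norm_nonneg _))
      _ ≤ ‖V - U‖ * ‖W‖ * 1 := by rw [Matrix.l2_opNorm_conjTranspose]; gcongr
      _ = _ := by ring
  linarith

/-- The trace distance is half of the largest expectation of a contraction in the difference. -/
lemma traceDist_le {U V : Op (hoQubits n)} (hU : U.conjTranspose * U = 1)
    (hV : V.conjTranspose * V = 1) :
    traceDist (V * rhoZero n * V.conjTranspose) (U * rhoZero n * U.conjTranspose) ≤ ‖V - U‖ := by
  obtain ⟨W, hW, h⟩ := exists_contraction_trace_eq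
    (V * rhoZero n * V.conjTranspose - U * rhoZero n * U.conjTranspose)
  rw [traceDist, ← h]
  have h1 := (Complex.re_le_norm _).trans (norm_trace_mul_sub_le hU hV W)
  nlinarith [norm_nonneg (V - U)]

/-- The Hamiltonian has at most the operator norm `∑ |hamCoeff|`. -/
lemma sykEnergy_sub_le (p : unitInterval) (ω : Disorder n) {U V : Op (hoQubits n)}
    (hU : U.conjTranspose * U = 1) (hV : V.conjTranspose * V = 1) :
    sykEnergy p ω (U * rhoZero n * U.conjTranspose) -
      2 * (∑ I ∈ Finset.powersetCard 4 (Finset.range (2 * n)), |hamCoeff p ω I|) * ‖V - U‖ ≤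
      sykEnergy p ω (V * rhoZero n * V.conjTranspose) := by
  have hH : ‖hamExt p ω‖ ≤
        ∑ I ∈ Finset.powersetCard 4 (Finset.range (2 * n)), |hamCoeff p ω I| := by
    refine (norm_sum_le _ _).trans (Finset.sum_le_sum fun I _ => ?_)
    rw [norm_smul, Complex.norm_real, Real.norm_eq_abs]
    exact mul_le_of_le_one_right (abs_nonneg _)
      (l2_opNorm_le_one_of_isometry (majoranaProd_conjTranspose_mul_self _ _))
  have h1 := norm_trace_mul_sub_le hU hV (hamExt p ω)
  have h2 := neg_le_of_abs_le ((Complex.abs_re_le_norm _).trans h1)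
  rw [mul_sub, Matrix.trace_sub, Complex.sub_re, ← sykEnergy_eq, ← sykEnergy_eq] at h2
  have h3 : 2 * ‖hamExt p ω‖ * ‖V - U‖ ≤
      2 * (∑ I ∈ Finset.powersetCard 4 (Finset.range (2 * n)), |hamCoeff p ω I|) * ‖V - U‖ := by
    gcongr
  linarith

end TraceDistance

/-! ### The product formula -/

section Trotter
open scoped Matrix.Norms.L2Operator

variable {N : ℕ}

/-- The contraction `R` agrees with `1 + B` up to second order in the small quantity `y`. -/
def NearOne (R B : Op N) (y : ℝ) : Prop := ‖R‖ ≤ 1 ∧ ‖R - 1‖ ≤ y ∧ ‖R - 1 - B‖ ≤ y ^ 2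

/-- First-order approximations of contractions add up, with errors that are quadratic in the sum of
the sizes. -/
lemma NearOne.mul {R₁ R₂ B₁ B₂ : Op N} {y₁ y₂ : ℝ} (h₁ : NearOne R₁ B₁ y₁)
    (h₂ : NearOne R₂ B₂ y₂) : NearOne (R₂ * R₁) (B₁ + B₂) (y₁ + y₂) := by
  obtain ⟨a1, b1, c1⟩ := h₁
  obtain ⟨a2, b2, c2⟩ := h₂
  have y10 := (norm_nonneg _).trans b1
  have y20 := (norm_nonneg _).trans b2
  refine ⟨(norm_mul_le _ _).trans (mul_le_one₀ a2 (norm_nonneg _) a1), ?_, ?_⟩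
  · have e : R₂ * R₁ - 1 = (R₂ - 1) * R₁ + (R₁ - 1) := by noncomm_ring
    rw [e]
    calc _ ≤ ‖(R₂ - 1) * R₁‖ + ‖R₁ - 1‖ := norm_add_le _ _
      _ ≤ ‖R₂ - 1‖ * ‖R₁‖ + ‖R₁ - 1‖ := by gcongr; exact norm_mul_le _ _
      _ ≤ y₂ * 1 + y₁ := by gcongr
      _ = _ := by ring
  · have e : R₂ * R₁ - 1 - (B₁ + B₂) = (R₂ - 1) * (R₁ - 1) + (R₁ - 1 - B₁) + (R₂ - 1 - B₂) := by
      noncomm_ring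
    rw [e]
    calc _ ≤ ‖(R₂ - 1) * (R₁ - 1)‖ + ‖R₁ - 1 - B₁‖ + ‖R₂ - 1 - B₂‖ := norm_add₃_le
      _ ≤ ‖R₂ - 1‖ * ‖R₁ - 1‖ + ‖R₁ - 1 - B₁‖ + ‖R₂ - 1 - B₂‖ := by gcongr; exact norm_mul_le _ _
      _ ≤ y₂ * y₁ + y₁ ^ 2 + y₂ ^ 2 := by gcongr
      _ ≤ _ := by nlinarith

lemma nearOne_one : NearOne (1 : Op N) 0 0 :=
  ⟨l2_opNorm_le_one_of_isometry (by simp), by simp, by simp⟩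

lemma nearOne_flatMap {ι : Type*} (L : List ι) {f : ι → List Gate} {B : ι → Op N} {y : ι → ℝ}
    (h : ∀ i ∈ L, NearOne (circuitOp N (f i)) (B i) (y i)) :
    NearOne (circuitOp N (L.flatMap f)) (L.map B).sum (L.map y).sum := by
  induction L with
  | nil => exact nearOne_one
  | cons i L ih =>
    rw [List.flatMap_cons, circuitOp_append, List.map_cons, List.sum_cons, List.map_cons,
      List.sum_cons]
    exact (h i (by simp)).mul (ih fun j hj => h j (by simp [hj]))

lemma list_sum_range {M : Type*} [AddCommMonoid M] (m : ℕ) (f : ℕ → M) :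
    ((List.range m).map f).sum = ∑ i ∈ Finset.range m, f i := by
  induction m with
  | zero => simp
  | succ m ih =>
    rw [List.range_succ, List.map_append, List.sum_append, ih, Finset.sum_range_succ]
    simp

lemma nearOne_flatMap_range {m : ℕ} {f : ℕ → List Gate} {B : ℕ → Op N} {y : ℕ → ℝ}
    (h : ∀ i < m, NearOne (circuitOp N (f i)) (B i) (y i)) :
    NearOne (circuitOp N ((List.range m).flatMap f)) (∑ i ∈ Finset.range m, B i)
      (∑ i ∈ Finset.range m, y i) := by
  rw [← list_sum_range, ← list_sum_range]
  exact nearOne_flatMap _ fun i hi => h i (List.mem_range.mp hi)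

lemma abs_cos_sub_one_le (x : ℝ) : |Real.cos x - 1| ≤ |x| := by
  have := Real.abs_cos_sub_cos_le x 0
  simpa using this

/-- The exact rotation `exp (i x G)` for an involution `G` satisfies this up to constants. -/
lemma nearOne_rotation {G R : Op N} {x : ℝ} (hG : G.conjTranspose * G = 1)
    (hR : R.conjTranspose * R = 1)
    (h : R = Complex.cos (x : ℂ) • 1 + (Complex.I * Complex.sin (x : ℂ)) • G) :
    NearOne R ((Complex.I * (x : ℂ)) • G) (2 * |x|) := by
  have hG1 := l2_opNorm_le_one_of_isometry hG
  have h1 : ‖(1 : Op N)‖ ≤ 1 := l2_opNorm_le_one_of_isometry (by simp)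
  have hc : Complex.cos (x : ℂ) - 1 = ((Real.cos x - 1 : ℝ) : ℂ) := by push_cast; rfl
  refine ⟨l2_opNorm_le_one_of_isometry hR, ?_, ?_⟩
  · have e : R - 1 = (Complex.cos (x : ℂ) - 1) • 1 + (Complex.I * Complex.sin (x : ℂ)) • G := by
      rw [h, sub_smul, one_smul]; abel
    rw [e]
    calc _ ≤ ‖Complex.cos (x : ℂ) - 1‖ * ‖(1 : Op N)‖ + ‖Complex.I * Complex.sin (x : ℂ)‖ * ‖G‖ := by
          refine (norm_add_le _ _).trans ?_
          rw [norm_smul, norm_smul]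
      _ ≤ |x| * 1 + |x| * 1 := by
          gcongr
          · rw [hc, Complex.norm_real]; exact abs_cos_sub_one_le x
          · rw [norm_mul, Complex.norm_I, one_mul, ← Complex.ofReal_sin, Complex.norm_real]
            exact Real.abs_sin_le_abs
      _ = _ := by ring
  · have e : R - 1 - (Complex.I * (x : ℂ)) • G = (Complex.cos (x : ℂ) - 1) • 1 +
        (Complex.I * ((Real.sin x - x : ℝ) : ℂ)) • G := by
      rw [h, sub_smul, one_smul]
      push_cast
      rw [mul_sub, sub_smul]; abel
    rw [e]
    have hcos : |Real.cos x - 1| ≤ x ^ 2 := by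
      have h2 := Real.one_sub_sq_div_two_le_cos (x := x)
      rw [abs_le]
      constructor
      · nlinarith [sq_nonneg x]
      · have := Real.cos_le_one x; nlinarith [sq_nonneg x]
    have hsin : |Real.sin x - x| ≤ 2 * x ^ 2 := by
      rcases le_total |x| 1 with hx | hx
      · have h2 := Real.sin_bound hx
        have h3 : |x| ^ 2 ≤ 1 := pow_le_one₀ (abs_nonneg _) hx
        have e1 : Real.sin x - x = (Real.sin x - (x - x ^ 3 / 6)) - x ^ 3 / 6 := by ring
        have e2 : |x ^ 3 / 6| = |x| * |x| ^ 2 / 6 := by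
          rw [abs_div, abs_pow, abs_of_pos (show (0 : ℝ) < 6 by norm_num)]; ring
        rw [e1]
        refine (abs_sub _ _).trans ?_
        rw [e2, ← sq_abs x]
        have h4 : |x| ^ 4 = |x| ^ 2 * |x| ^ 2 := by ring
        nlinarith [sq_nonneg |x|, abs_nonneg x, mul_le_mul_of_nonneg_right hx (sq_nonneg |x|),
          mul_le_mul_of_nonneg_right h3 (sq_nonneg |x|)]
      · have h2 : |Real.sin x| ≤ |x| := Real.abs_sin_le_abs
        refine (abs_sub _ _).trans ?_
        rw [← sq_abs x]
        nlinarith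
    calc _ ≤ ‖Complex.cos (x : ℂ) - 1‖ * ‖(1 : Op N)‖ +
          ‖Complex.I * ((Real.sin x - x : ℝ) : ℂ)‖ * ‖G‖ := by
          refine (norm_add_le _ _).trans ?_
          rw [norm_smul, norm_smul]
      _ ≤ x ^ 2 * 1 + 2 * x ^ 2 * 1 := by
          gcongr
          · rw [hc, Complex.norm_real]; exact hcos
          · rw [norm_mul, Complex.norm_I, one_mul, Complex.norm_real]; exact hsin
      _ ≤ _ := by rw [mul_pow, sq_abs]; nlinarith [sq_nonneg x]

lemma norm_exp_sub_one_sub_id_le {X : Op N} (hX : ‖X‖ ≤ 1) :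
    ‖NormedSpace.exp X - 1 - X‖ ≤ ‖X‖ ^ 2 := by
  have hs := NormedSpace.norm_expSeries_summable' (𝕂 := ℂ) X
  have hs' := NormedSpace.expSeries_summable' (𝕂 := ℂ) X
  have h1 : NormedSpace.exp X = ∑' k : ℕ, ((k.factorial : ℂ))⁻¹ • X ^ k := by
    rw [NormedSpace.exp_eq_tsum ℂ]
  have h2 := hs'.sum_add_tsum_nat_add 2
  have h3 : NormedSpace.exp X - 1 - X = ∑' k : ℕ, (((k + 2).factorial : ℂ))⁻¹ • X ^ (k + 2) := by
    rw [h1, ← h2]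
    simp only [Finset.sum_range_succ, Finset.sum_range_zero, Nat.factorial, Nat.cast_one, inv_one,
      one_smul, pow_zero, pow_one, zero_add, mul_one]
    abel
  have hr := Real.summable_pow_div_factorial ‖X‖
  have hr2 := hr.sum_add_tsum_nat_add 2
  have hr3 : Real.exp ‖X‖ - 1 - ‖X‖ = ∑' k : ℕ, ‖X‖ ^ (k + 2) / ((k + 2).factorial : ℝ) := by
    have h4 : Real.exp ‖X‖ = ∑' k : ℕ, ‖X‖ ^ k / (k.factorial : ℝ) := by
      rw [Real.exp_eq_exp_ℝ, NormedSpace.exp_eq_tsum_div]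
    rw [h4, ← hr2]
    simp only [Finset.sum_range_succ, Finset.sum_range_zero, Nat.factorial, Nat.cast_one, div_one,
      pow_zero, pow_one, zero_add, mul_one]
    ring
  have hb := Real.abs_exp_sub_one_sub_id_le (x := ‖X‖) (by rwa [abs_of_nonneg (norm_nonneg _)])
  rw [h3]
  refine le_trans ?_ ((le_abs_self _).trans hb)
  rw [hr3]
  refine tsum_of_norm_bounded ((summable_nat_add_iff 2).mpr hr).hasSum fun k => ?_
  rw [norm_smul, norm_inv, Complex.norm_natCast, inv_mul_eq_div]
  gcongr
  exact norm_pow_le' X (by omega)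

/-- Telescoping: the errors of the factors of a product of contractions add up. -/
lemma norm_pow_sub_pow_le {A : Type*} [NormedRing A] (h1 : ‖(1 : A)‖ ≤ 1) {R T : A} (hR : ‖R‖ ≤ 1)
    (hT : ‖T‖ ≤ 1) (r : ℕ) : ‖R ^ r - T ^ r‖ ≤ r * ‖R - T‖ := by
  induction r with
  | zero => simp
  | succ r ih =>
    have hTr : ‖T ^ r‖ ≤ 1 := by
      rcases Nat.eq_zero_or_pos r with rfl | hr
      · rwa [pow_zero]
      · exact (norm_pow_le' T hr).trans (pow_le_one₀ (norm_nonneg _) hT)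
    have e : R ^ (r + 1) - T ^ (r + 1) = (R ^ r - T ^ r) * R + T ^ r * (R - T) := by
      rw [pow_succ, pow_succ]; noncomm_ring
    rw [e]
    calc _ ≤ ‖R ^ r - T ^ r‖ * ‖R‖ + ‖T ^ r‖ * ‖R - T‖ :=
          (norm_add_le _ _).trans (add_le_add (norm_mul_le _ _) (norm_mul_le _ _))
      _ ≤ (r * ‖R - T‖) * 1 + 1 * ‖R - T‖ := by gcongr
      _ = _ := by push_cast; ring

/-- The error of the product formula with `r` steps for the exponential of a skew-Hermitian
operator `X`. -/
lemma norm_pow_sub_exp_le {R B X : Op N} {y : ℝ} {r : ℕ} (hr : 0 < r) (hR : NearOne R B y)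
    (hX : X.conjTranspose = -X) (hXr : ‖X‖ ≤ r) :
    ‖R ^ r - NormedSpace.exp X‖ ≤ r * y ^ 2 + ‖X‖ ^ 2 / r + ‖(r : ℂ) • B - X‖ := by
  have hr' : (0 : ℝ) < r := by exact_mod_cast hr
  have hrc : (r : ℂ) ≠ 0 := by exact_mod_cast hr.ne'
  set T := NormedSpace.exp ((r : ℂ)⁻¹ • X) with hT
  have hTr : T ^ r = NormedSpace.exp X := by
    rw [hT, ← Matrix.exp_nsmul]
    congr 1
    rw [← Nat.cast_smul_eq_nsmul ℂ, smul_smul, mul_inv_cancel₀ hrc, one_smul]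
  have hn : ‖(r : ℂ)⁻¹ • X‖ = ‖X‖ / r := by
    rw [norm_smul, norm_inv, Complex.norm_natCast, inv_mul_eq_div]
  have hT1 : ‖T‖ ≤ 1 := by
    have := exp_skew_conjTranspose_mul (Y := X) hX (r : ℝ)⁻¹
    refine l2_opNorm_le_one_of_isometry ?_
    have e : (r : ℂ)⁻¹ • X = (r : ℝ)⁻¹ • X := by
      rw [← Complex.ofReal_natCast, ← Complex.ofReal_inv]; rfl
    rw [hT, e]; exact this
  have hexp := norm_exp_sub_one_sub_id_le (X := (r : ℂ)⁻¹ • X)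
    (by rw [hn, div_le_one hr']; exact hXr)
  rw [hn] at hexp
  have h1 := norm_pow_sub_pow_le (l2_opNorm_le_one_of_isometry (by simp)) hR.1 hT1 r
  rw [hTr] at h1
  have e : R - T = (R - 1 - B) - (T - 1 - (r : ℂ)⁻¹ • X) + (r : ℂ)⁻¹ • ((r : ℂ) • B - X) := by
    rw [smul_sub, smul_smul, inv_mul_cancel₀ hrc, one_smul]; abel
  have h2 : ‖R - T‖ ≤ y ^ 2 + (‖X‖ / r) ^ 2 + ‖(r : ℂ) • B - X‖ / r := by
    rw [e]
    refine (norm_add_le _ _).trans (add_le_add ((norm_sub_le _ _).trans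
      (add_le_add hR.2.2 hexp)) ?_)
    rw [norm_smul, norm_inv, Complex.norm_natCast, inv_mul_eq_div]
  refine h1.trans ?_
  calc _ ≤ (r : ℝ) * (y ^ 2 + (‖X‖ / r) ^ 2 + ‖(r : ℂ) • B - X‖ / r) := by gcongr
    _ = _ := by field_simp

lemma circuitOp_flatMap_const (r : ℕ) (l : List Gate) :
    circuitOp N ((List.range r).flatMap fun _ => l) = circuitOp N l ^ r := by
  induction r with
  | zero => rfl
  | succ r ih =>
    rw [List.range_succ, List.flatMap_append, List.flatMap_singleton, circuitOp_append, ih, pow_succ']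

end Trotter

end SparseSYK
namespace SparseSYK

/-! ### Programs built from nested loops -/

/-- The expression reads only registers below `w`. -/
def Expr.readsBelow (w : ℕ) : Expr → Bool
  | .lit _ => true
  | .reg x => decide (x < w)
  | .plus e₁ e₂ => e₁.readsBelow w && e₂.readsBelow w
  | .minus e₁ e₂ => e₁.readsBelow w && e₂.readsBelow w
  | .times e₁ e₂ => e₁.readsBelow w && e₂.readsBelow w
  | .quot e₁ e₂ => e₁.readsBelow w && e₂.readsBelow w
  | .entry e₁ e₂ e₃ e₄ =>
      e₁.readsBelow w && e₂.readsBelow w && (e₃.readsBelow w && e₄.readsBelow w)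

/-- The expression reads neither the table nor register `2`, which is reserved for a number of
polynomial length; its value is then polynomial in the other registers. -/
def Expr.isSmall : Expr → Bool
  | .lit _ => true
  | .reg x => decide (x ≠ 2)
  | .plus e₁ e₂ => e₁.isSmall && e₂.isSmall
  | .minus e₁ e₂ => e₁.isSmall && e₂.isSmall
  | .times e₁ e₂ => e₁.isSmall && e₂.isSmall
  | .quot e₁ e₂ => e₁.isSmall && e₂.isSmall
  | .entry _ _ _ _ => false

/-- The degree of the polynomial bound on the value of a small expression. -/
def Expr.degree : Expr → ℕ
  | .lit z => bitLen z
  | .reg _ => 1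
  | .plus e₁ e₂ => e₁.degree + e₂.degree + 1
  | .minus e₁ e₂ => e₁.degree + e₂.degree + 1
  | .times e₁ e₂ => e₁.degree + e₂.degree
  | .quot e₁ _ => e₁.degree
  | .entry _ _ _ _ => 0

/-- The factor by which the length of the value of an expression can exceed the lengths of the
registers and of the table entries. -/
def Expr.lenFactor : Expr → ℕ
  | .lit z => bitLen z
  | .reg _ => 1
  | .plus e₁ e₂ => e₁.lenFactor + e₂.lenFactor + 1
  | .minus e₁ e₂ => e₁.lenFactor + e₂.lenFactor + 1
  | .times e₁ e₂ => e₁.lenFactor + e₂.lenFactor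
  | .quot e₁ _ => e₁.lenFactor
  | .entry _ _ _ _ => 1

/-- The corresponding factor for the cost of the evaluation. -/
def Expr.costFactor (e : Expr) : ℕ :=
  1 + e.lenFactor +
    match e with
    | .lit _ => 0
    | .reg _ => 0
    | .plus e₁ e₂ => e₁.costFactor + e₂.costFactor
    | .minus e₁ e₂ => e₁.costFactor + e₂.costFactor
    | .times e₁ e₂ => e₁.costFactor + e₂.costFactor
    | .quot e₁ e₂ => e₁.costFactor + e₂.costFactor
    | .entry e₁ e₂ e₃ e₄ => e₁.costFactor + e₂.costFactor + e₃.costFactor + e₄.costFactor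

section Expressions

variable {n w : ℕ} {a : Quad n → ℤ} {r r' : ℕ → ℤ}

lemma Expr.eval_congr {e : Expr} (he : e.readsBelow w) (h : ∀ y < w, r y = r' y) :
    e.eval a r = e.eval a r' := by
  induction e with
  | lit z => rfl
  | reg x => exact h x (by simpa [Expr.readsBelow] using he)
  | plus e₁ e₂ h₁ h₂ | minus e₁ e₂ h₁ h₂ | times e₁ e₂ h₁ h₂ | quot e₁ e₂ h₁ h₂ =>
    simp only [Expr.readsBelow, Bool.and_eq_true] at he
    simp only [Expr.eval, h₁ he.1, h₂ he.2]
  | entry e₁ e₂ e₃ e₄ h₁ h₂ h₃ h₄ =>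
    simp only [Expr.readsBelow, Bool.and_eq_true] at he
    simp only [Expr.eval, h₁ he.1.1, h₂ he.1.2, h₃ he.2.1, h₄ he.2.2]

lemma natAbs_fdiv_le (x y : ℤ) : (Int.fdiv x y).natAbs ≤ x.natAbs := by
  rcases le_total 0 y with hy | hy
  · rw [Int.fdiv_eq_ediv_of_nonneg _ hy]
    exact Int.natAbs_ediv_le_natAbs _ _
  · have h : Int.fdiv x y = (-x) / (-y) := by
      rw [← Int.fdiv_eq_ediv_of_nonneg _ (by omega : 0 ≤ -y), Int.neg_fdiv_neg]
    rw [h, ← Int.natAbs_neg x]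
    exact Int.natAbs_ediv_le_natAbs _ _

lemma lt_two_pow_bitLen (z : ℤ) : z.natAbs < 2 ^ bitLen z := Nat.lt_size_self _

lemma bitLen_le_iff {z : ℤ} {m : ℕ} : bitLen z ≤ m ↔ z.natAbs < 2 ^ m := Nat.size_le

lemma bitLen_le_of_natAbs_le {z : ℤ} {m : ℕ} (h : z.natAbs ≤ m) : bitLen z ≤ m :=
  bitLen_le_iff.mpr (h.trans_lt Nat.lt_two_pow_self)

lemma bitLen_add_le {x y z : ℤ} (h : z.natAbs ≤ x.natAbs + y.natAbs) :
    bitLen z ≤ bitLen x + bitLen y + 1 := by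
  rw [bitLen_le_iff]
  have h1 := lt_two_pow_bitLen x
  have h2 := lt_two_pow_bitLen y
  have h3 : 2 ^ bitLen x ≤ 2 ^ (bitLen x + bitLen y) := Nat.pow_le_pow_right two_pos (by omega)
  have h4 : 2 ^ bitLen y ≤ 2 ^ (bitLen x + bitLen y) := Nat.pow_le_pow_right two_pos (by omega)
  rw [pow_succ]
  omega

lemma bitLen_mul_le (x y : ℤ) : bitLen (x * y) ≤ bitLen x + bitLen y := by
  rw [bitLen_le_iff, Int.natAbs_mul, pow_add]
  exact Nat.mul_lt_mul'' (lt_two_pow_bitLen x) (lt_two_pow_bitLen y)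

/-- Sums of powers are bounded by a single power, so that polynomial bounds can be recorded by
their exponents alone. -/
lemma pow_add_pow_le {V d₁ d₂ : ℕ} (hV : 2 ≤ V) : V ^ d₁ + V ^ d₂ ≤ V ^ (d₁ + d₂ + 1) := by
  have h1 : V ^ d₁ ≤ V ^ (d₁ + d₂) := Nat.pow_le_pow_right (by omega) (by omega)
  have h2 : V ^ d₂ ≤ V ^ (d₁ + d₂) := Nat.pow_le_pow_right (by omega) (by omega)
  have h3 : V ^ (d₁ + d₂) * 2 ≤ V ^ (d₁ + d₂) * V := Nat.mul_le_mul_left _ hV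
  rw [pow_succ]
  omega

lemma Expr.natAbs_eval_le {e : Expr} (he : e.readsBelow w) (hs : e.isSmall) {V : ℕ} (hV : 2 ≤ V)
    (h : ∀ y < w, y ≠ 2 → (r y).natAbs ≤ V) : (e.eval a r).natAbs ≤ V ^ e.degree := by
  have hadd : ∀ {x y d₁ d₂ : ℕ}, x ≤ V ^ d₁ → y ≤ V ^ d₂ → x + y ≤ V ^ (d₁ + d₂ + 1) :=
    fun hx hy => (add_le_add hx hy).trans (pow_add_pow_le hV)
  induction e with
  | lit z => exact (lt_two_pow_bitLen z).le.trans (Nat.pow_le_pow_left hV _)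
  | reg x =>
    rw [Expr.degree, pow_one]
    exact h x (by simpa [Expr.readsBelow] using he) (by simpa [Expr.isSmall] using hs)
  | plus e₁ e₂ h₁ h₂ =>
    simp only [Expr.readsBelow, Expr.isSmall, Bool.and_eq_true] at he hs
    exact (Int.natAbs_add_le _ _).trans (hadd (h₁ he.1 hs.1) (h₂ he.2 hs.2))
  | minus e₁ e₂ h₁ h₂ =>
    simp only [Expr.readsBelow, Expr.isSmall, Bool.and_eq_true] at he hs
    exact (Int.natAbs_sub_le _ _).trans (hadd (h₁ he.1 hs.1) (h₂ he.2 hs.2))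
  | times e₁ e₂ h₁ h₂ =>
    simp only [Expr.readsBelow, Expr.isSmall, Bool.and_eq_true] at he hs
    rw [Expr.eval, Int.natAbs_mul, Expr.degree, pow_add]
    exact Nat.mul_le_mul (h₁ he.1 hs.1) (h₂ he.2 hs.2)
  | quot e₁ e₂ h₁ h₂ =>
    simp only [Expr.readsBelow, Expr.isSmall, Bool.and_eq_true] at he hs
    exact (natAbs_fdiv_le _ _).trans (h₁ he.1 hs.1)
  | entry e₁ e₂ e₃ e₄ => simp [Expr.isSmall] at hs

lemma bitLen_tableEntry_le (i j k l : ℕ) : bitLen (tableEntry a i j k l) ≤ tableBits a := by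
  unfold tableEntry
  split_ifs with h
  · exact Finset.le_sup (f := fun I => bitLen (a I)) (Finset.mem_univ _)
  · simp [bitLen]

lemma Expr.bitLen_eval_le {e : Expr} (he : e.readsBelow w) {L : ℕ} (hL : 1 ≤ L)
    (ht : tableBits a ≤ L) (h : ∀ y < w, bitLen (r y) ≤ L) :
    bitLen (e.eval a r) ≤ e.lenFactor * L := by
  induction e with
  | lit z => exact Nat.le_mul_of_pos_right _ hL
  | reg x =>
    rw [Expr.lenFactor, one_mul]
    exact h x (by simpa [Expr.readsBelow] using he)
  | plus e₁ e₂ h₁ h₂ =>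
    simp only [Expr.readsBelow, Bool.and_eq_true] at he
    have := bitLen_add_le (Int.natAbs_add_le (e₁.eval a r) (e₂.eval a r))
    have h₁ := h₁ he.1
    have h₂ := h₂ he.2
    rw [Expr.eval, Expr.lenFactor, add_mul, add_mul]
    omega
  | minus e₁ e₂ h₁ h₂ =>
    simp only [Expr.readsBelow, Bool.and_eq_true] at he
    have := bitLen_add_le (Int.natAbs_sub_le (e₁.eval a r) (e₂.eval a r))
    have h₁ := h₁ he.1
    have h₂ := h₂ he.2
    rw [Expr.eval, Expr.lenFactor, add_mul, add_mul]
    omega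
  | times e₁ e₂ h₁ h₂ =>
    simp only [Expr.readsBelow, Bool.and_eq_true] at he
    rw [Expr.lenFactor, add_mul]
    exact (bitLen_mul_le _ _).trans (add_le_add (h₁ he.1) (h₂ he.2))
  | quot e₁ e₂ h₁ h₂ =>
    simp only [Expr.readsBelow, Bool.and_eq_true] at he
    exact (Nat.size_le_size (natAbs_fdiv_le _ _)).trans (h₁ he.1)
  | entry e₁ e₂ e₃ e₄ =>
    rw [Expr.lenFactor, one_mul]
    exact (bitLen_tableEntry_le _ _ _ _).trans ht

lemma Expr.cost_le {e : Expr} (he : e.readsBelow w) {L : ℕ} (hL : 1 ≤ L) (ht : tableBits a ≤ L)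
    (h : ∀ y < w, bitLen (r y) ≤ L) : e.cost a r ≤ e.costFactor * L := by
  have hb := Expr.bitLen_eval_le he hL ht h
  induction e with
  | lit z | reg x =>
    rw [Expr.cost, Expr.costFactor]
    simp only [add_mul, add_zero]
    omega
  | plus e₁ e₂ h₁ h₂ | minus e₁ e₂ h₁ h₂ | times e₁ e₂ h₁ h₂ | quot e₁ e₂ h₁ h₂ =>
    simp only [Expr.readsBelow, Bool.and_eq_true] at he
    have h₁ := h₁ he.1 (Expr.bitLen_eval_le he.1 hL ht h)
    have h₂ := h₂ he.2 (Expr.bitLen_eval_le he.2 hL ht h)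
    rw [Expr.cost, Expr.costFactor]
    simp only [add_mul] at hb ⊢
    omega
  | entry e₁ e₂ e₃ e₄ h₁ h₂ h₃ h₄ =>
    simp only [Expr.readsBelow, Bool.and_eq_true] at he
    have h₁ := h₁ he.1.1 (Expr.bitLen_eval_le he.1.1 hL ht h)
    have h₂ := h₂ he.1.2 (Expr.bitLen_eval_le he.1.2 hL ht h)
    have h₃ := h₃ he.2.1 (Expr.bitLen_eval_le he.2.1 hL ht h)
    have h₄ := h₄ he.2.2 (Expr.bitLen_eval_le he.2.2 hL ht h)
    rw [Expr.cost, Expr.costFactor]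
    simp only [add_mul] at hb ⊢
    omega

end Expressions

/-- The program makes no assignments, its loops at nesting depth `d` run over register `w + d` and
have a small number of rounds, and every expression reads only registers that are lower than those
of the loops inside which it does not lie. Such a program leaves the registers below `w` alone. -/
def Prog.isNested (w : ℕ) : Prog → Bool
  | .skip => true
  | .assign _ _ => false
  | .seq P Q => P.isNested w && Q.isNested w
  | .ifLe e₁ e₂ P Q => e₁.readsBelow w && e₂.readsBelow w && (P.isNested w && Q.isNested w)
  | .loop x e P => decide (x = w) && (e.readsBelow w && e.isSmall) && P.isNested (w + 1)
  | .had e => e.readsBelow w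
  | .phase e => e.readsBelow w
  | .cnot e₁ e₂ => e₁.readsBelow w && e₂.readsBelow w
  | .rz e e₁ e₂ => e.readsBelow w && (e₁.readsBelow w && e₂.readsBelow w)

/-- The circuit written by a program without assignments, as a function of the registers. -/
def Prog.output {n : ℕ} (a : Quad n → ℤ) : Prog → (ℕ → ℤ) → List Gate
  | .skip, _ => []
  | .assign _ _, _ => []
  | .seq P Q, r => P.output a r ++ Q.output a r
  | .ifLe e₁ e₂ P Q, r => if e₁.eval a r ≤ e₂.eval a r then P.output a r else Q.output a r
  | .loop x e P, r =>
      (List.range (e.eval a r).toNat).flatMap fun i : ℕ => P.output a (Function.update r x (i : ℤ))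
  | .had e, r => [.had (e.eval a r).toNat]
  | .phase e, r => [.phase (e.eval a r).toNat]
  | .cnot e₁ e₂, r => [.cnot (e₁.eval a r).toNat (e₂.eval a r).toNat]
  | .rz e e₁ e₂, r =>
      [.rz (e.eval a r).toNat ((e₁.eval a r : ℚ) / (e₂.eval a r : ℚ))]

lemma foldl_range_induction {α : Type*} (f : α → ℕ → α) (s : α) (Q : ℕ → α → Prop) (h0 : Q 0 s)
    (m : ℕ) (h : ∀ i < m, ∀ t, Q i t → Q (i + 1) (f t i)) : Q m ((List.range m).foldl f s) := by
  induction m with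
  | zero => exact h0
  | succ m ih =>
    rw [List.range_succ, List.foldl_append]
    exact h m (by omega) _ (ih fun i hi => h i (by omega))

lemma update_eq_of_lt {w : ℕ} {r r' : ℕ → ℤ} (h : ∀ y < w, r y = r' y) (z : ℤ) :
    ∀ y < w + 1, Function.update r w z y = Function.update r' w z y := by
  intro y hy
  rcases eq_or_ne y w with rfl | hne
  · simp
  · rw [Function.update_of_ne hne, Function.update_of_ne hne, h y (by omega)]

/-- The loop as a fold over natural numbers: its definition runs over a list of naturals that is
coerced to a list of integers. -/
lemma Prog.exec_loop {n : ℕ} (a : Quad n → ℤ) (x : ℕ) (e : Expr) (P : Prog) (s : Config) :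
    (Prog.loop x e P).exec a s = (List.range (e.eval a s.regs).toNat).foldl
      (fun (t : Config) (i : ℕ) => P.exec a ((t.set x (i : ℤ)).spend (1 + bitLen (i : ℤ))))
      (s.spend (1 + e.cost a s.regs)) := by
  rw [Prog.exec, ← List.foldl_map (f := fun i : ℕ => (i : ℤ))
    (g := fun t z => P.exec a ((Config.set t x z).spend (1 + bitLen z)))]
  congr 1
  rw [List.bind_eq_flatMap]
  exact List.flatMap_pure_eq_map _ _

section Nested

variable {n : ℕ} {a : Quad n → ℤ}

/-- The circuit of a nested program can be read off without running it. -/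
lemma Prog.exec_nested {P : Prog} {w : ℕ} (hP : P.isNested w) {s : Config} {r : ℕ → ℤ}
    (h : ∀ y < w, s.regs y = r y) :
    (P.exec a s).circuit = s.circuit ++ P.output a r ∧ ∀ y < w, (P.exec a s).regs y = r y := by
  induction P generalizing w s r with
  | skip => simpa [Prog.exec, Prog.output, Config.spend] using h
  | assign x e => simp [Prog.isNested] at hP
  | seq P Q hp hq =>
    simp only [Prog.isNested, Bool.and_eq_true] at hP
    obtain ⟨h1, h2⟩ := hp hP.1 h
    obtain ⟨h3, h4⟩ := hq hP.2 h2
    exact ⟨by rw [Prog.exec, h3, h1, Prog.output, List.append_assoc], h4⟩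
  | ifLe e₁ e₂ P Q hp hq =>
    simp only [Prog.isNested, Bool.and_eq_true] at hP
    rw [Prog.exec, Prog.output, Expr.eval_congr hP.1.1 h, Expr.eval_congr hP.1.2 h]
    split_ifs
    · exact hp hP.2.1 h
    · exact hq hP.2.2 h
  | loop x e P hp =>
    simp only [Prog.isNested, Bool.and_eq_true, decide_eq_true_eq] at hP
    obtain ⟨⟨rfl, he⟩, hP⟩ := hP
    rw [Prog.exec_loop, Prog.output, Expr.eval_congr he.1 h]
    refine foldl_range_induction _ _ (fun m (t : Config) =>
      t.circuit = s.circuit ++ (List.range m).flatMap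
      (fun i : ℕ => P.output a (Function.update r x (i : ℤ))) ∧ ∀ y < x, t.regs y = r y) ?_ _ ?_
    · exact ⟨by simp [Config.spend], h⟩
    · rintro i - t ⟨ht1, ht2⟩
      obtain ⟨h1, h2⟩ := hp hP (s := (t.set x i).spend (1 + bitLen i))
        (r := Function.update r x (i : ℤ)) (update_eq_of_lt ht2 _)
      refine ⟨?_, fun y hy => ?_⟩
      · rw [h1, List.range_succ, List.flatMap_append, List.flatMap_singleton, ← List.append_assoc,
          ← ht1]
        rfl
      · rw [h2 y (by omega), Function.update_of_ne hy.ne]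
  | had e | phase e =>
    rw [Prog.exec, Prog.output, Expr.eval_congr hP h]
    exact ⟨rfl, h⟩
  | cnot e₁ e₂ =>
    simp only [Prog.isNested, Bool.and_eq_true] at hP
    rw [Prog.exec, Prog.output, Expr.eval_congr hP.1 h, Expr.eval_congr hP.2 h]
    exact ⟨rfl, h⟩
  | rz e e₁ e₂ =>
    simp only [Prog.isNested, Bool.and_eq_true] at hP
    rw [Prog.exec, Prog.output, Expr.eval_congr hP.1 h, Expr.eval_congr hP.2.1 h,
      Expr.eval_congr hP.2.2 h]
    exact ⟨rfl, h⟩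

/-- The registers below `w` hold numbers that are at most `V` (at most of length `V` for
register `2`), and the table entries have at most length `V`. -/
structure Bounded (a : Quad n → ℤ) (w V : ℕ) (r : ℕ → ℤ) : Prop where
  two_le : 2 ≤ V
  table : tableBits a ≤ V
  value : ∀ y < w, y ≠ 2 → (r y).natAbs ≤ V
  length : ∀ y < w, bitLen (r y) ≤ V

lemma Bounded.congr {w V : ℕ} {r r' : ℕ → ℤ} (h : Bounded a w V r) (hr : ∀ y < w, r' y = r y) :
    Bounded a w V r' :=
  ⟨h.two_le, h.table, fun y hy hy' => by rw [hr y hy]; exact h.value y hy hy',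
    fun y hy => by rw [hr y hy]; exact h.length y hy⟩

lemma Bounded.cost_le {w V : ℕ} {r : ℕ → ℤ} (h : Bounded a w V r) {e : Expr}
    (he : e.readsBelow w) : e.cost a r ≤ V ^ (e.costFactor + 1) := by
  refine (Expr.cost_le he (by have := h.two_le; omega) h.table h.length).trans ?_
  rw [pow_succ]
  exact Nat.mul_le_mul_right _ (Nat.lt_pow_self (by have := h.two_le; omega)).le

lemma Bounded.update {w V V' : ℕ} {r : ℕ → ℤ} (h : Bounded a w V r) (hV : V ≤ V') {z : ℤ}
    (hz : z.natAbs ≤ V') : Bounded a (w + 1) V' (Function.update r w z) := by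
  refine ⟨h.two_le.trans hV, h.table.trans hV, fun y hy hy' => ?_, fun y hy => ?_⟩
  · rcases eq_or_ne y w with rfl | hne
    · simpa using hz
    · rw [Function.update_of_ne hne]; exact (h.value y (by omega) hy').trans hV
  · rcases eq_or_ne y w with rfl | hne
    · simpa using bitLen_le_of_natAbs_le hz
    · rw [Function.update_of_ne hne]; exact (h.length y (by omega)).trans hV

end Nested

/-- A nested program takes polynomial time. -/
lemma Prog.exists_time_le (P : Prog) (w : ℕ) (hP : P.isNested w) :
    ∃ d : ℕ, ∀ (n : ℕ) (a : Quad n → ℤ) (V : ℕ) (s : Config), Bounded a w V s.regs →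
      (P.exec a s).time ≤ s.time + V ^ d := by
  induction P generalizing w with
  | skip => exact ⟨0, fun n a V s h => by simp [Prog.exec, Config.spend]⟩
  | assign x e => simp [Prog.isNested] at hP
  | seq P Q hp hq =>
    simp only [Prog.isNested, Bool.and_eq_true] at hP
    obtain ⟨d₁, h₁⟩ := hp w hP.1
    obtain ⟨d₂, h₂⟩ := hq w hP.2
    refine ⟨d₁ + d₂ + 1, fun n a V s h => ?_⟩
    have h3 := h₁ n a V s h
    have h4 := h₂ n a V (P.exec a s) (h.congr (Prog.exec_nested hP.1 fun _ _ => rfl).2)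
    have h5 := pow_add_pow_le (d₁ := d₁) (d₂ := d₂) h.two_le
    rw [Prog.exec]
    omega
  | ifLe e₁ e₂ P Q hp hq =>
    simp only [Prog.isNested, Bool.and_eq_true] at hP
    obtain ⟨d₁, h₁⟩ := hp w hP.2.1
    obtain ⟨d₂, h₂⟩ := hq w hP.2.2
    refine ⟨0 + (e₁.costFactor + 1) + 1 + (e₂.costFactor + 1) + 1 + (d₁ + d₂ + 1) + 1,
      fun n a V s h => ?_⟩
    have c1 := h.cost_le hP.1.1
    have c2 := h.cost_le hP.1.2
    have h3 := h₁ n a V (s.spend (1 + e₁.cost a s.regs + e₂.cost a s.regs)) h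
    have h4 := h₂ n a V (s.spend (1 + e₁.cost a s.regs + e₂.cost a s.regs)) h
    have hV := h.two_le
    have b1 := pow_add_pow_le (d₁ := 0) (d₂ := e₁.costFactor + 1) hV
    have b2 := pow_add_pow_le (d₁ := 0 + (e₁.costFactor + 1) + 1) (d₂ := e₂.costFactor + 1) hV
    have b3 := pow_add_pow_le (d₁ := 0 + (e₁.costFactor + 1) + 1 + (e₂.costFactor + 1) + 1)
      (d₂ := d₁ + d₂ + 1) hV
    have b4 := pow_add_pow_le (d₁ := d₁) (d₂ := d₂) hV
    rw [pow_zero] at b1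
    simp only [Config.spend] at h3 h4
    rw [Prog.exec]
    split_ifs
    · simp only [Config.spend]; omega
    · simp only [Config.spend]; omega
  | loop x e P hp =>
    simp only [Prog.isNested, Bool.and_eq_true, decide_eq_true_eq] at hP
    obtain ⟨⟨rfl, he⟩, hP⟩ := hP
    obtain ⟨d, hd⟩ := hp (x + 1) hP
    -- In the body the bound is `V' = V ^ (e.degree + 1)`, which also bounds the number of rounds.
    refine ⟨0 + (e.costFactor + 1) + 1 + (e.degree + 1) * (1 + (0 + 1 + 1 + d + 1)) + 1,
      fun n a V s h => ?_⟩
    have hV := h.two_le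
    have c1 := h.cost_le he.1
    have hm := Expr.natAbs_eval_le (a := a) he.1 he.2 hV h.value
    generalize hV' : V ^ (e.degree + 1) = V'
    have hVV' : V ≤ V' := by rw [← hV']; exact Nat.le_self_pow (by omega) V
    have hm' : (e.eval a s.regs).toNat ≤ V' := by
      have h1 : V ^ e.degree ≤ V' := by rw [← hV']; exact Nat.pow_le_pow_right (by omega) (by omega)
      omega
    have key := foldl_range_induction
      (fun (s' : Config) (i : ℕ) => P.exec a ((s'.set x i).spend (1 + bitLen i)))
      (s.spend (1 + e.cost a s.regs))
      (fun m t => t.time ≤ s.time + (1 + e.cost a s.regs) + m * V' ^ (0 + 1 + 1 + d + 1) ∧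
        ∀ y < x, t.regs y = s.regs y) ⟨by simp [Config.spend], fun _ _ => rfl⟩
      (e.eval a s.regs).toNat (by
        rintro i hi t ⟨ht1, ht2⟩
        have hi' : ((i : ℕ) : ℤ).natAbs ≤ V' := by rw [Int.natAbs_natCast]; omega
        have hb : Bounded a (x + 1) V' ((t.set x i).spend (1 + bitLen i)).regs :=
          (h.congr ht2).update hVV' hi'
        refine ⟨?_, fun y hy => ?_⟩
        · have h1 := hd n a V' _ hb
          have h2 := bitLen_le_of_natAbs_le hi'
          have b1 := pow_add_pow_le (d₁ := 0) (d₂ := 1) (hV.trans hVV')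
          have b2 := pow_add_pow_le (d₁ := 0 + 1 + 1) (d₂ := d) (hV.trans hVV')
          simp only [Config.spend, Config.set, pow_zero, pow_one] at h1 b1
          rw [add_mul, one_mul]
          simp only [Config.spend, Config.set]
          omega
        · rw [(Prog.exec_nested hP fun _ _ => rfl).2 y (by omega)]
          simp only [Config.spend, Config.set]
          rw [Function.update_of_ne hy.ne, ht2 y hy])
    have b1 := pow_add_pow_le (d₁ := 0) (d₂ := e.costFactor + 1) hV
    have b2 := pow_add_pow_le (d₁ := 0 + (e.costFactor + 1) + 1)
      (d₂ := (e.degree + 1) * (1 + (0 + 1 + 1 + d + 1))) hV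
    have b3 : (e.eval a s.regs).toNat * V' ^ (0 + 1 + 1 + d + 1) ≤
        V ^ ((e.degree + 1) * (1 + (0 + 1 + 1 + d + 1))) := by
      rw [pow_mul, hV', pow_add V' 1, pow_one]
      exact Nat.mul_le_mul_right _ hm'
    rw [pow_zero] at b1
    rw [Prog.exec_loop]
    have := key.1
    omega
  | had e | phase e =>
    refine ⟨0 + (e.costFactor + 1) + 1, fun n a V s h => ?_⟩
    have c1 := h.cost_le hP
    have b1 := pow_add_pow_le (d₁ := 0) (d₂ := e.costFactor + 1) h.two_le
    rw [pow_zero] at b1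
    simp only [Prog.exec, Config.spend, Config.emit]
    omega
  | cnot e₁ e₂ =>
    simp only [Prog.isNested, Bool.and_eq_true] at hP
    refine ⟨0 + (e₁.costFactor + 1) + 1 + (e₂.costFactor + 1) + 1, fun n a V s h => ?_⟩
    have c1 := h.cost_le hP.1
    have c2 := h.cost_le hP.2
    have b1 := pow_add_pow_le (d₁ := 0) (d₂ := e₁.costFactor + 1) h.two_le
    have b2 := pow_add_pow_le (d₁ := 0 + (e₁.costFactor + 1) + 1) (d₂ := e₂.costFactor + 1) h.two_le
    rw [pow_zero] at b1
    simp only [Prog.exec, Config.spend, Config.emit]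
    omega
  | rz e e₁ e₂ =>
    simp only [Prog.isNested, Bool.and_eq_true] at hP
    refine ⟨0 + (e.costFactor + 1) + 1 + (e₁.costFactor + 1) + 1 + (e₂.costFactor + 1) + 1,
      fun n a V s h => ?_⟩
    have c0 := h.cost_le hP.1
    have c1 := h.cost_le hP.2.1
    have c2 := h.cost_le hP.2.2
    have b1 := pow_add_pow_le (d₁ := 0) (d₂ := e.costFactor + 1) h.two_le
    have b2 := pow_add_pow_le (d₁ := 0 + (e.costFactor + 1) + 1) (d₂ := e₁.costFactor + 1) h.two_le
    have b3 := pow_add_pow_le (d₁ := 0 + (e.costFactor + 1) + 1 + (e₁.costFactor + 1) + 1)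
      (d₂ := e₂.costFactor + 1) h.two_le
    rw [pow_zero] at b1
    simp only [Prog.exec, Config.spend, Config.emit]
    omega

end SparseSYK
namespace SparseSYK

/-! ### The program -/

lemma flatMap_range_congr {α : Type*} {z : ℤ} {m : ℕ} {f g : ℕ → List α} (hm : z = m)
    (h : ∀ i < m, f i = g i) : (List.range z.toNat).flatMap f = (List.range m).flatMap g := by
  rw [hm, Int.toNat_natCast]
  exact List.flatMap_congr fun i hi => h i (List.mem_range.mp hi)

/-- Powers of an expression. -/
def Expr.npow (e : Expr) : ℕ → Expr
  | 0 => .lit 1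
  | m + 1 => .times (e.npow m) e

/-- Repeated phase gates. -/
def phaseProg (e : Expr) : ℕ → Prog
  | 0 => .skip
  | r + 1 => .seq (.phase e) (phaseProg e r)

/-- Writes `braidCircuit r j` for the value `j` of `e`. -/
def braidProg (r : ℕ) (e : Expr) : Prog :=
  .ifLe (.minus e (.times (.lit 2) (.quot e (.lit 2)))) (.lit 0)
    (phaseProg (.quot e (.lit 2)) r)
    (.seq (.had (.quot e (.lit 2)))
      (.seq (.had (.plus (.quot e (.lit 2)) (.lit 1)))
        (.seq (.cnot (.quot e (.lit 2)) (.plus (.quot e (.lit 2)) (.lit 1)))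
          (.seq (phaseProg (.plus (.quot e (.lit 2)) (.lit 1)) r)
            (.seq (.cnot (.quot e (.lit 2)) (.plus (.quot e (.lit 2)) (.lit 1)))
              (.seq (.had (.plus (.quot e (.lit 2)) (.lit 1))) (.had (.quot e (.lit 2)))))))))

/-- Writes `moveCircuit`; register `w` is the loop register. -/
def moveProg (w : ℕ) (e₁ e₂ : Expr) : Prog :=
  .loop w (.minus e₁ e₂) (braidProg 3 (.minus (.minus e₁ (.lit 1)) (.reg w)))

/-- Writes `unmoveCircuit`; register `w` is the loop register. -/
def unmoveProg (w : ℕ) (e₁ e₂ : Expr) : Prog :=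
  .loop w (.minus e₁ e₂) (braidProg 1 (.plus e₂ (.reg w)))

/-- Writes `exchangeCircuit`. -/
def exchangeProg (w : ℕ) (e₁ e₂ : Expr) : Prog :=
  .seq (moveProg w e₂ (.plus e₁ (.lit 1)))
    (.seq (braidProg 3 e₁) (unmoveProg w e₂ (.plus e₁ (.lit 1))))

/-- Writes `termCircuit` for the angle `f₁ / f₂`. -/
def termProg (w : ℕ) (e₁ e₂ e₃ e₄ f₁ f₂ : Expr) : Prog :=
  .seq (moveProg w e₁ (.lit 0)) (.seq (moveProg w e₂ (.lit 1)) (.seq (moveProg w e₃ (.lit 2))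
    (.seq (moveProg w e₄ (.lit 3)) (.seq (.cnot (.lit 0) (.lit 1)) (.seq (.rz (.lit 1) f₁ f₂)
      (.seq (.cnot (.lit 0) (.lit 1)) (.seq (unmoveProg w e₄ (.lit 3))
        (.seq (unmoveProg w e₃ (.lit 2)) (.seq (unmoveProg w e₂ (.lit 1))
          (unmoveProg w e₁ (.lit 0)))))))))))

section Output

variable {n : ℕ} {a : Quad n → ℤ} {r : ℕ → ℤ}

lemma Expr.eval_lit (z : ℤ) : (Expr.lit z).eval a r = z := rfl

lemma Expr.eval_reg (x : ℕ) : (Expr.reg x).eval a r = r x := rfl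

lemma Expr.eval_plus (e₁ e₂ : Expr) :
    (Expr.plus e₁ e₂).eval a r = e₁.eval a r + e₂.eval a r := rfl

lemma Expr.eval_minus (e₁ e₂ : Expr) :
    (Expr.minus e₁ e₂).eval a r = e₁.eval a r - e₂.eval a r := rfl

lemma Expr.eval_times (e₁ e₂ : Expr) :
    (Expr.times e₁ e₂).eval a r = e₁.eval a r * e₂.eval a r := rfl

lemma Expr.eval_npow {e : Expr} (m : ℕ) : (e.npow m).eval a r = e.eval a r ^ m := by
  induction m with
  | zero => rw [Expr.npow, Expr.eval_lit, pow_zero]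
  | succ m ih => rw [Expr.npow, Expr.eval_times, ih, pow_succ]

lemma output_phaseProg {e : Expr} {q : ℕ} (he : e.eval a r = q) (m : ℕ) :
    (phaseProg e m).output a r = List.replicate m (Gate.phase q) := by
  induction m with
  | zero => rfl
  | succ m ih => simp [phaseProg, Prog.output, ih, he, List.replicate_succ]

lemma output_braidProg {e : Expr} {j : ℕ} (he : e.eval a r = j) (m : ℕ) :
    (braidProg m e).output a r = braidCircuit m j := by
  have hq : (Expr.quot e (.lit 2)).eval a r = ((j / 2 : ℕ) : ℤ) := by
    rw [Expr.eval, he]; exact (Int.ofNat_fdiv j 2).symm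
  have hq1 : (Expr.plus (.quot e (.lit 2)) (.lit 1)).eval a r = ((j / 2 + 1 : ℕ) : ℤ) := by
    rw [Expr.eval, hq]; rfl
  have hc : (Expr.minus e (.times (.lit 2) (.quot e (.lit 2)))).eval a r ≤
      (Expr.lit 0).eval a r ↔ j % 2 = 0 := by
    simp only [Expr.eval_minus, Expr.eval_times, hq, he, Expr.eval_lit]; omega
  rw [braidProg, Prog.output, braidCircuit]
  refine if_congr hc (output_phaseProg hq m) ?_
  simp only [Prog.output, hq, hq1, output_phaseProg hq1, Int.toNat_natCast]
  simp

lemma output_moveProg {w : ℕ} {e₁ e₂ : Expr} {x y : ℕ} (h₁ : e₁.eval a r = x)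
    (h₂ : e₂.eval a r = y) (hw : e₁.readsBelow w) (hxy : y ≤ x) :
    (moveProg w e₁ e₂).output a r = moveCircuit x y := by
  rw [moveProg, Prog.output, moveCircuit]
  refine flatMap_range_congr (by rw [Expr.eval, h₁, h₂, Nat.cast_sub hxy]) fun i hi => ?_
  refine output_braidProg ?_ 3
  have h := Expr.eval_congr (a := a) (r := Function.update r w (i : ℤ)) (r' := r) hw
    fun y hy => Function.update_of_ne hy.ne _ _
  simp only [Expr.eval_minus, Expr.eval_lit, Expr.eval_reg, h, h₁, Function.update_self]
  omega

lemma output_unmoveProg {w : ℕ} {e₁ e₂ : Expr} {x y : ℕ} (h₁ : e₁.eval a r = x)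
    (h₂ : e₂.eval a r = y) (hw : e₂.readsBelow w) (hxy : y ≤ x) :
    (unmoveProg w e₁ e₂).output a r = unmoveCircuit x y := by
  rw [unmoveProg, Prog.output, unmoveCircuit]
  refine flatMap_range_congr (by rw [Expr.eval, h₁, h₂, Nat.cast_sub hxy]) fun i hi => ?_
  refine output_braidProg ?_ 1
  have h := Expr.eval_congr (a := a) (r := Function.update r w (i : ℤ)) (r' := r) hw
    fun y hy => Function.update_of_ne hy.ne _ _
  rw [Expr.eval, h, h₂, Expr.eval, Function.update_self]
  omega

lemma output_exchangeProg {w : ℕ} {e₁ e₂ : Expr} {x y : ℕ} (h₁ : e₁.eval a r = x)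
    (h₂ : e₂.eval a r = y) (hw₁ : e₁.readsBelow w) (hw₂ : e₂.readsBelow w) (hxy : x < y) :
    (exchangeProg w e₁ e₂).output a r = exchangeCircuit x y := by
  have h1 : (Expr.plus e₁ (.lit 1)).eval a r = ((x + 1 : ℕ) : ℤ) := by
    rw [Expr.eval, h₁]; rfl
  have hw : (Expr.plus e₁ (.lit 1)).readsBelow w := by simpa [Expr.readsBelow] using hw₁
  rw [exchangeProg, Prog.output, Prog.output, output_moveProg h₂ h1 hw₂ hxy,
    output_braidProg h₁, output_unmoveProg h₂ h1 hw hxy, exchangeCircuit, List.append_assoc]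

lemma output_termProg {w : ℕ} {e₁ e₂ e₃ e₄ f₁ f₂ : Expr} {i j k l : ℕ} (h₁ : e₁.eval a r = i)
    (h₂ : e₂.eval a r = j) (h₃ : e₃.eval a r = k) (h₄ : e₄.eval a r = l)
    (hw₁ : e₁.readsBelow w) (hw₂ : e₂.readsBelow w) (hw₃ : e₃.readsBelow w)
    (hw₄ : e₄.readsBelow w) (hij : i < j) (hjk : j < k) (hkl : k < l) :
    (termProg w e₁ e₂ e₃ e₄ f₁ f₂).output a r =
      termCircuit i j k l ((f₁.eval a r : ℚ) / (f₂.eval a r : ℚ)) := by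
  simp only [termProg, Prog.output]
  rw [output_moveProg h₁ (y := 0) rfl hw₁ (by omega),
    output_moveProg h₂ (y := 1) rfl hw₂ (by omega), output_moveProg h₃ (y := 2) rfl hw₃ (by omega),
    output_moveProg h₄ (y := 3) rfl hw₄ (by omega), output_unmoveProg h₁ (y := 0) rfl rfl (by omega),
    output_unmoveProg h₂ (y := 1) rfl rfl (by omega),
    output_unmoveProg h₃ (y := 2) rfl rfl (by omega),
    output_unmoveProg h₄ (y := 3) rfl rfl (by omega), termCircuit]
  simp [Expr.eval]

end Output

/-- `halfChi n`, for `n` in register `0`. -/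
def halfExpr : Expr := .quot (.reg 0) (.lit 4)

/-- `2 * n`. -/
def modesExpr : Expr := .times (.lit 2) (.reg 0)

/-- `nTwo n`. -/
def nTwoExpr : Expr := .times (.lit 2) halfExpr

/-- `nOne n`. -/
def nOneExpr : Expr := .minus modesExpr nTwoExpr

/-- `hoQubits n`. -/
def qubitsExpr : Expr := .plus (.reg 0) halfExpr

/-- The number of steps of the product formula. -/
def trotterSteps (n k : ℕ) : ℕ := k * n ^ 9

/-- The factor by which the square root is scaled up before it is rounded down. -/
def rootScale (n k : ℕ) : ℕ := k * n ^ 5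

/-- `trotterSteps n k`, for `k` in register `1`. -/
def stepsExpr : Expr := .times (.reg 1) ((Expr.reg 0).npow 9)

/-- `rootScale n k`. -/
def scaleExpr : Expr := .times (.reg 1) ((Expr.reg 0).npow 5)

/-- Writes `prepCircuit`. -/
def prepProg : Prog :=
  .seq (.loop 4 (.minus (.reg 0) halfExpr)
      (.seq (.had (.plus qubitsExpr (.reg 4))) (.cnot (.plus qubitsExpr (.reg 4)) (.reg 4))))
    (.seq (.loop 4 halfExpr
        (.seq (.had (.plus (.minus (.reg 0) halfExpr) (.reg 4)))
          (.seq (.phase (.plus (.minus (.reg 0) halfExpr) (.reg 4)))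
            (.seq (.phase (.plus (.minus (.reg 0) halfExpr) (.reg 4)))
              (.had (.plus (.minus (.reg 0) halfExpr) (.reg 4)))))))
      (.loop 4 halfExpr
        (exchangeProg 5 (.plus (.plus nOneExpr (.times (.lit 2) (.reg 4))) (.lit 1))
          (.plus modesExpr (.times (.lit 2) (.reg 4))))))

/-- The angle of the rotation generated by `φ_a φ_b φ_c σ_t` in one step of the product formula:
`-2 s / 15120`-times the table entry, where `s / rootScale n k` approximates the inverse of
`scaleRatio n`, divided by the scale `2 ^ (n + k)` of the table and the number of steps. -/
def termAngle {n : ℕ} (k s : ℕ) (T : Quad n → ℤ) (a b c t : ℕ) : ℚ :=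
  ((-s * tableEntry T a b c (nOne n + t) : ℤ) : ℚ) /
    ((7560 * (rootScale n k * (2 ^ (n + k) * trotterSteps n k)) : ℤ) : ℚ)

/-- One step of the product formula. -/
def stepCircuit {n : ℕ} (k s : ℕ) (T : Quad n → ℤ) : List Gate :=
  (List.range (nTwo n)).flatMap fun t => (List.range (nOne n)).flatMap fun c =>
    (List.range c).flatMap fun b => (List.range b).flatMap fun a =>
      termCircuit a b c (2 * n + t) (termAngle k s T a b c t)

/-- The product formula for the exponential of `ζ`. -/
def trotterCircuit {n : ℕ} (k s : ℕ) (T : Quad n → ℤ) : List Gate :=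
  (List.range (trotterSteps n k)).flatMap fun _ => stepCircuit k s T

/-- Writes `trotterCircuit`, for `2 ^ (n + k)` in register `2` and `s` in register `3`. -/
def trotterProg : Prog :=
  .loop 4 stepsExpr (.loop 5 nTwoExpr (.loop 6 nOneExpr (.loop 7 (.reg 6) (.loop 8 (.reg 7)
    (termProg 9 (.reg 8) (.reg 7) (.reg 6) (.plus modesExpr (.reg 5))
      (.times (.minus (.lit 0) (.reg 3))
        (.entry (.reg 8) (.reg 7) (.reg 6) (.plus nOneExpr (.reg 5))))
      (.times (.lit 7560) (.times scaleExpr (.times (.reg 2) stepsExpr))))))))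

section Output

variable {n : ℕ} {a : Quad n → ℤ} {r : ℕ → ℤ}

lemma eval_halfExpr (h0 : r 0 = n) : halfExpr.eval a r = (halfChi n : ℤ) := by
  rw [halfExpr, Expr.eval, Expr.eval_reg, h0]
  exact (Int.ofNat_fdiv n 4).symm

lemma eval_modesExpr (h0 : r 0 = n) : modesExpr.eval a r = ((2 * n : ℕ) : ℤ) := by
  rw [modesExpr, Expr.eval, Expr.eval, Expr.eval, h0]; push_cast; rfl

lemma eval_nTwoExpr (h0 : r 0 = n) : nTwoExpr.eval a r = (nTwo n : ℤ) := by
  rw [nTwoExpr, Expr.eval, eval_halfExpr h0, nTwo]; push_cast; rfl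

lemma eval_nOneExpr (h0 : r 0 = n) : nOneExpr.eval a r = (nOne n : ℤ) := by
  rw [nOneExpr, Expr.eval, eval_modesExpr h0, eval_nTwoExpr h0]
  have := nOne_add_nTwo n
  omega

lemma eval_stepsExpr {k : ℕ} (h0 : r 0 = n) (h1 : r 1 = k) :
    stepsExpr.eval a r = (trotterSteps n k : ℤ) := by
  rw [stepsExpr, Expr.eval, Expr.eval_npow, Expr.eval, Expr.eval, h0, h1, trotterSteps]
  push_cast; rfl

lemma eval_scaleExpr {k : ℕ} (h0 : r 0 = n) (h1 : r 1 = k) :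
    scaleExpr.eval a r = (rootScale n k : ℤ) := by
  rw [scaleExpr, Expr.eval, Expr.eval_npow, Expr.eval, Expr.eval, h0, h1, rootScale]
  push_cast; rfl

lemma output_prepProg (h0 : r 0 = n) : prepProg.output a r = prepCircuit n := by
  have hle : halfChi n ≤ n := Nat.div_le_self _ _
  have h0' : ∀ i : ℕ, Function.update r 4 (i : ℤ) 0 = n := fun i => by simpa using h0
  have hsub : ∀ {r' : ℕ → ℤ}, r' 0 = n →
      (Expr.minus (.reg 0) halfExpr).eval a r' = ((n - halfChi n : ℕ) : ℤ) := fun {r'} h => by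
    rw [Expr.eval, Expr.eval, eval_halfExpr h, h, Nat.cast_sub hle]
  rw [prepProg, Prog.output, Prog.output, prepCircuit, List.append_assoc]
  congr 1
  · rw [Prog.output, bellCircuit]
    refine flatMap_range_congr (hsub h0) fun i _ => ?_
    have h1 : (Expr.plus qubitsExpr (.reg 4)).eval a (Function.update r 4 (i : ℤ)) =
        ((hoQubits n + i : ℕ) : ℤ) := by
      simp only [qubitsExpr, Expr.eval_plus, Expr.eval_reg, eval_halfExpr (h0' i), h0' i,
        Function.update_self, hoQubits]
      push_cast; rfl
    simp only [Prog.output, h1, Int.toNat_natCast]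
    simp [Expr.eval]
  congr 1
  · rw [Prog.output]
    refine flatMap_range_congr (eval_halfExpr h0) fun i _ => ?_
    have h1 : (Expr.plus (.minus (.reg 0) halfExpr) (.reg 4)).eval a
        (Function.update r 4 (i : ℤ)) = ((n - halfChi n + i : ℕ) : ℤ) := by
      rw [Expr.eval, hsub (h0' i), Expr.eval, Function.update_self, Nat.cast_add]
    simp only [Prog.output, h1, Int.toNat_natCast]
    rfl
  · rw [Prog.output, exchangesCircuit]
    refine flatMap_range_congr (eval_halfExpr h0) fun i hi => ?_
    refine output_exchangeProg ?_ ?_ (by decide) (by decide) ?_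
    · simp only [Expr.eval_plus, Expr.eval_times, Expr.eval_lit, Expr.eval_reg,
        eval_nOneExpr (h0' i), Function.update_self]
      push_cast; rfl
    · simp only [Expr.eval_plus, Expr.eval_times, Expr.eval_lit, Expr.eval_reg,
        eval_modesExpr (h0' i), Function.update_self]
      push_cast; rfl
    · have h1 := nOne_add_nTwo n
      have h2 : nTwo n = 2 * halfChi n := rfl
      omega

lemma output_trotterProg {k s : ℕ} (h0 : r 0 = n) (h1 : r 1 = k) (h2 : r 2 = 2 ^ (n + k))
    (h3 : r 3 = s) : trotterProg.output a r = trotterCircuit k s a := by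
  rw [trotterProg, Prog.output, trotterCircuit]
  refine flatMap_range_congr (eval_stepsExpr h0 h1) fun i _ => ?_
  rw [Prog.output, stepCircuit]
  refine flatMap_range_congr (eval_nTwoExpr (by simpa using h0)) fun t ht => ?_
  rw [Prog.output]
  refine flatMap_range_congr (eval_nOneExpr (by simpa using h0)) fun c hc => ?_
  rw [Prog.output]
  refine flatMap_range_congr (by simp [Expr.eval]) fun b hb => ?_
  rw [Prog.output]
  refine flatMap_range_congr (by simp [Expr.eval]) fun x hx => ?_
  generalize hr' : Function.update (Function.update (Function.update (Function.update
    (Function.update r 4 (i : ℤ)) 5 (t : ℤ)) 6 (c : ℤ)) 7 (b : ℤ)) 8 (x : ℤ) = r'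
  have g0 : r' 0 = n := by rw [← hr']; simpa using h0
  have g1 : r' 1 = k := by rw [← hr']; simpa using h1
  have g2 : r' 2 = 2 ^ (n + k) := by rw [← hr']; simpa using h2
  have g3 : r' 3 = s := by rw [← hr']; simpa using h3
  have g5 : r' 5 = t := by rw [← hr']; simp
  have g6 : r' 6 = c := by rw [← hr']; simp
  have g7 : r' 7 = b := by rw [← hr']; simp
  have g8 : r' 8 = x := by rw [← hr']; simp
  have g9 : (Expr.plus nOneExpr (.reg 5)).eval a r' = ((nOne n + t : ℕ) : ℤ) := by
    rw [Expr.eval_plus, eval_nOneExpr g0, Expr.eval_reg, g5, Nat.cast_add]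
  have hle := nOne_add_nTwo n
  have e8 : (Expr.reg 8).eval a r' = x := g8
  have e7 : (Expr.reg 7).eval a r' = b := g7
  have e6 : (Expr.reg 6).eval a r' = c := g6
  have e10 : (Expr.plus modesExpr (.reg 5)).eval a r' = ((2 * n + t : ℕ) : ℤ) := by
    rw [Expr.eval_plus, eval_modesExpr g0, Expr.eval_reg, g5, Nat.cast_add]
  rw [output_termProg e8 e7 e6 e10 rfl rfl rfl rfl hx hb (by omega)]
  have e11 : (Expr.entry (.reg 8) (.reg 7) (.reg 6) (.plus nOneExpr (.reg 5))).eval a r' =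
      tableEntry a x b c (nOne n + t) := by
    rw [Expr.eval, e8, e7, e6, g9]; rfl
  simp only [termAngle, Expr.eval_times, Expr.eval_minus, Expr.eval_lit, Expr.eval_reg, e11, g3, g2,
    eval_scaleExpr g0 g1, eval_stepsExpr g0 g1, zero_sub]

end Output

/-- The numerator of `rootScale n k ^ 2 / scaleRatio n ^ 2`. -/
def rootNum (n k : ℕ) : ℤ :=
  (rootScale n k : ℤ) ^ 2 * (((2 * n : ℕ) : ℤ) * ((2 * n : ℕ) - 1) * ((2 * n : ℕ) - 2) *
    ((2 * n : ℕ) - 3))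

/-- The denominator of `rootScale n k ^ 2 / scaleRatio n ^ 2`. -/
def rootDen (n : ℕ) : ℤ := 4 * (nOne n * (nOne n - 1) * (nOne n - 2))

/-- `rootNum n k`. -/
def numExpr : Expr :=
  .times (scaleExpr.npow 2) (.times (.times (.times modesExpr (.minus modesExpr (.lit 1)))
    (.minus modesExpr (.lit 2))) (.minus modesExpr (.lit 3)))

/-- `rootDen n`. -/
def denExpr : Expr :=
  .times (.lit 4) (.times (.times nOneExpr (.minus nOneExpr (.lit 1))) (.minus nOneExpr (.lit 2)))

/-- The square root of `rootNum n k / rootDen n`, rounded down, as found by `i` rounds of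
linear search. -/
def rootSearch (n k : ℕ) : ℕ → ℕ
  | 0 => 0
  | i + 1 => if ((rootSearch n k i : ℤ) + 1) ^ 2 * rootDen n ≤ rootNum n k then
      rootSearch n k i + 1 else rootSearch n k i

/-- The square root of `rootNum n k / rootDen n`, rounded down. -/
def approxRoot (n k : ℕ) : ℕ := rootSearch n k (n * rootScale n k)

/-- Puts `2 ^ (n + k)` into register `2`. -/
def powerProg : Prog :=
  .seq (.assign 2 (.lit 1))
    (.loop 4 (.plus (.reg 0) (.reg 1)) (.assign 2 (.times (.lit 2) (.reg 2))))

/-- Puts `approxRoot n k` into register `3`. -/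
def rootProg : Prog :=
  .loop 4 (.times (.reg 0) scaleExpr)
    (.ifLe (.times ((Expr.plus (.reg 3) (.lit 1)).npow 2) denExpr) numExpr
      (.assign 3 (.plus (.reg 3) (.lit 1))) .skip)

/-- The algorithm: preparation of the Gaussian state, followed by the product formula. -/
def hoProg : Prog := .seq (.seq powerProg rootProg) (.seq prepProg trotterProg)

end SparseSYK
namespace SparseSYK

/-! ### Correctness and running time of the program -/

section Execution

variable {n : ℕ} {a : Quad n → ℤ}

lemma one_add_le_pow {V d x : ℕ} (hV : 2 ≤ V) (hx : x ≤ V ^ d) : 1 + x ≤ V ^ (0 + d + 1) := by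
  have := pow_add_pow_le (d₁ := 0) (d₂ := d) hV
  rw [pow_zero] at this
  omega

lemma add_le_pow {V d₁ d₂ x y : ℕ} (hV : 2 ≤ V) (hx : x ≤ V ^ d₁) (hy : y ≤ V ^ d₂) :
    x + y ≤ V ^ (d₁ + d₂ + 1) :=
  (add_le_add hx hy).trans (pow_add_pow_le hV)

/-- An invariant of the registers for a loop that writes no gates. -/
lemma exec_loop_invariant {x : ℕ} {e : Expr} {P : Prog} {s : Config} {V c d m : ℕ}
    (Inv : ℕ → (ℕ → ℤ) → Prop) (hm : e.eval a s.regs = m) (hV : 2 ≤ V) (hmV : m ≤ V)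
    (hc : e.cost a s.regs ≤ V ^ c) (h0 : Inv 0 s.regs)
    (hstep : ∀ i < m, ∀ t : Config, Inv i t.regs →
      (P.exec a (t.set x (i : ℤ))).circuit = t.circuit ∧
      Inv (i + 1) (P.exec a (t.set x (i : ℤ))).regs ∧
      (P.exec a (t.set x (i : ℤ))).time ≤ t.time + V ^ d) :
    ((Prog.loop x e P).exec a s).circuit = s.circuit ∧
      Inv m ((Prog.loop x e P).exec a s).regs ∧
      ((Prog.loop x e P).exec a s).time ≤
        s.time + V ^ ((0 + c + 1) + (1 + ((0 + 1 + 1) + d + 1)) + 1) := by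
  rw [Prog.exec_loop, hm, Int.toNat_natCast]
  have key := foldl_range_induction
    (fun (t : Config) (i : ℕ) => P.exec a ((t.set x (i : ℤ)).spend (1 + bitLen (i : ℤ))))
    (s.spend (1 + e.cost a s.regs))
    (fun i t => t.circuit = s.circuit ∧ Inv i t.regs ∧
      t.time ≤ s.time + (1 + e.cost a s.regs) + i * V ^ ((0 + 1 + 1) + d + 1))
    ⟨rfl, h0, by simp [Config.spend]⟩ m (by
      rintro i hi t ⟨ht1, ht2, ht3⟩
      obtain ⟨h1, h2, h3⟩ := hstep i hi (t.spend (1 + bitLen (i : ℤ))) ht2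
      refine ⟨h1.trans ht1, h2, h3.trans ?_⟩
      have h4 : bitLen (i : ℤ) ≤ V ^ 1 := by
        rw [pow_one]; exact bitLen_le_of_natAbs_le (by rw [Int.natAbs_natCast]; omega)
      have h5 := add_le_pow hV (one_add_le_pow hV h4) (le_refl (V ^ d))
      rw [add_mul, one_mul]
      simp only [Config.spend]
      omega)
  refine ⟨key.1, key.2.1, key.2.2.trans ?_⟩
  have h1 : m * V ^ ((0 + 1 + 1) + d + 1) ≤ V ^ (1 + ((0 + 1 + 1) + d + 1)) := by
    rw [pow_add V 1, pow_one]
    exact Nat.mul_le_mul_right _ hmV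
  have h2 := add_le_pow hV (one_add_le_pow hV hc) h1
  omega

lemma rootSearch_le (n k i : ℕ) : rootSearch n k i ≤ i := by
  induction i with
  | zero => exact le_rfl
  | succ i ih => rw [rootSearch]; split_ifs <;> omega

/-- The registers during the computation of `2 ^ (n + k)` and of `approxRoot n k`. -/
def SetupRegs (n k p s : ℕ) (r : ℕ → ℤ) : Prop := r 0 = n ∧ r 1 = k ∧ r 2 = 2 ^ p ∧ r 3 = s

lemma SetupRegs.bounded {k p s V : ℕ} {r : ℕ → ℤ} (h : SetupRegs n k p s r) (hV : 2 ≤ V)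
    (ht : tableBits a ≤ V) (hn : n ≤ V) (hk : k ≤ V) (hp : p + 1 ≤ V) (hs : s ≤ V) :
    Bounded a 4 V r := by
  obtain ⟨h0, h1, h2, h3⟩ := h
  refine ⟨hV, ht, fun y hy hy' => ?_, fun y hy => ?_⟩
  · interval_cases y
    · rwa [h0, Int.natAbs_natCast]
    · rwa [h1, Int.natAbs_natCast]
    · exact absurd rfl hy'
    · rwa [h3, Int.natAbs_natCast]
  · interval_cases y
    · rw [h0]; exact bitLen_le_of_natAbs_le (by rwa [Int.natAbs_natCast])
    · rw [h1]; exact bitLen_le_of_natAbs_le (by rwa [Int.natAbs_natCast])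
    · refine le_trans ?_ hp
      rw [h2, bitLen_le_iff, Int.natAbs_pow]
      exact Nat.pow_lt_pow_right (by norm_num) (by omega)
    · rw [h3]; exact bitLen_le_of_natAbs_le (by rwa [Int.natAbs_natCast])

lemma SetupRegs.set {k p s : ℕ} {t : Config} (h : SetupRegs n k p s t.regs) (z : ℤ) :
    SetupRegs n k p s (t.set 4 z).regs := by
  simpa [SetupRegs, Config.set] using h

lemma eval_numExpr {k : ℕ} {r : ℕ → ℤ} (h0 : r 0 = n) (h1 : r 1 = k) :
    numExpr.eval a r = rootNum n k := by
  simp only [numExpr, Expr.eval_times, Expr.eval_npow, eval_scaleExpr h0 h1, Expr.eval_minus,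
    eval_modesExpr h0, Expr.eval_lit, rootNum]

lemma eval_denExpr {r : ℕ → ℤ} (h0 : r 0 = n) : denExpr.eval a r = rootDen n := by
  simp only [denExpr, Expr.eval_times, Expr.eval_minus, eval_nOneExpr h0, Expr.eval_lit, rootDen]

end Execution

/-- The loop doubles register `2` and keeps its length linear in the number of rounds. -/
lemma exists_powerProg : ∃ d : ℕ, ∀ (n k : ℕ) (a : Quad n → ℤ) (V : ℕ) (s : Config), 2 ≤ V →
    tableBits a ≤ V → n + k + 1 ≤ V → s.regs 0 = n → s.regs 1 = k → s.regs 3 = 0 →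
    Bounded a 4 V s.regs →
    (powerProg.exec a s).circuit = s.circuit ∧
      SetupRegs n k (n + k) 0 (powerProg.exec a s).regs ∧
      (powerProg.exec a s).time ≤ s.time + V ^ d := by
  refine ⟨(0 + ((Expr.lit 1).costFactor + 1) + 1) +
    ((0 + ((Expr.plus (.reg 0) (.reg 1)).costFactor + 1) + 1) + (1 + ((0 + 1 + 1) +
      (0 + ((Expr.times (.lit 2) (.reg 2)).costFactor + 1) + 1) + 1)) + 1) + 1,
    fun n k a V s hV ht hnk h0 h1 h3 hb => ?_⟩
  have hinit : SetupRegs n k 0 0 ((Prog.assign 2 (.lit 1)).exec a s).regs := by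
    simpa [SetupRegs, Prog.exec, Config.set, Config.spend, Expr.eval] using ⟨h0, h1, h3⟩
  have hb' := hinit.bounded (a := a) hV ht (by omega) (by omega) (by omega) (by omega)
  have hm : (Expr.plus (.reg 0) (.reg 1)).eval a ((Prog.assign 2 (.lit 1)).exec a s).regs =
      ((n + k : ℕ) : ℤ) := by
    rw [Expr.eval_plus, Expr.eval_reg, Expr.eval_reg, hinit.1, hinit.2.1, Nat.cast_add]
  obtain ⟨c1, c2, c3⟩ := exec_loop_invariant (a := a) (x := 4)
    (P := .assign 2 (.times (.lit 2) (.reg 2))) (fun i r => SetupRegs n k i 0 r) hm hV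
    (by omega) (hb'.cost_le rfl) hinit
    (d := 0 + ((Expr.times (.lit 2) (.reg 2)).costFactor + 1) + 1) (by
      intro i hi t hr
      have hr' := hr.set (i : ℤ)
      have hbt := hr'.bounded (a := a) hV ht (by omega) (by omega) (by omega) (by omega)
      have hc := one_add_le_pow hV (hbt.cost_le (e := .times (.lit 2) (.reg 2)) rfl)
      refine ⟨rfl, ?_, ?_⟩
      · obtain ⟨g0, g1, g2, g3⟩ := hr'
        refine ⟨?_, ?_, ?_, ?_⟩
        · simpa [Prog.exec, Config.spend, Config.set] using g0
        · simpa [Prog.exec, Config.spend, Config.set] using g1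
        · simp only [Prog.exec, Config.spend, Expr.eval_times, Expr.eval_lit, Expr.eval_reg, g2]
          simp only [Config.set, Function.update_self]
          rw [pow_succ, mul_comm]
        · simpa [Prog.exec, Config.spend, Config.set] using g3
      · simp only [Prog.exec, Config.spend]
        simp only [Config.set] at hc ⊢
        omega)
  refine ⟨c1, c2, c3.trans ?_⟩
  have hc := one_add_le_pow hV (hb.cost_le (e := .lit 1) rfl)
  have h5 := add_le_pow hV hc (le_refl (V ^ ((0 + ((Expr.plus (.reg 0) (.reg 1)).costFactor + 1) +
    1) + (1 + ((0 + 1 + 1) + (0 + ((Expr.times (.lit 2) (.reg 2)).costFactor + 1) + 1) + 1)) + 1)))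
  have h6 : ((Prog.assign 2 (.lit 1)).exec a s).time = s.time + (1 + (Expr.lit 1).cost a s.regs) :=
    rfl
  rw [h6, add_assoc]
  exact Nat.add_le_add_left h5 _

/-- The linear search takes polynomially many rounds. -/
lemma exists_rootProg : ∃ d : ℕ, ∀ (n k : ℕ) (a : Quad n → ℤ) (V : ℕ) (s : Config), 2 ≤ V →
    tableBits a ≤ V → n + k + 1 ≤ V → n * rootScale n k ≤ V → SetupRegs n k (n + k) 0 s.regs →
    (rootProg.exec a s).circuit = s.circuit ∧
      SetupRegs n k (n + k) (approxRoot n k) (rootProg.exec a s).regs ∧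
      (rootProg.exec a s).time ≤ s.time + V ^ d := by
  refine ⟨(0 + ((Expr.times (.reg 0) scaleExpr).costFactor + 1) + 1) + (1 + ((0 + 1 + 1) +
    ((0 + ((Expr.times ((Expr.plus (.reg 3) (.lit 1)).npow 2) denExpr).costFactor + 1) + 1) +
      (numExpr.costFactor + 1) + 1 + (0 + ((Expr.plus (.reg 3) (.lit 1)).costFactor + 1) + 1) + 1) +
    1)) + 1, fun n k a V s hV ht hnk hL hs => ?_⟩
  have hb := hs.bounded (a := a) hV ht (by omega) (by omega) (by omega) (by omega)
  have hm : (Expr.times (.reg 0) scaleExpr).eval a s.regs = ((n * rootScale n k : ℕ) : ℤ) := by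
    rw [Expr.eval_times, Expr.eval_reg, eval_scaleExpr hs.1 hs.2.1, hs.1, Nat.cast_mul]
  refine exec_loop_invariant (a := a) (x := 4)
    (fun i r => SetupRegs n k (n + k) (rootSearch n k i) r) hm hV hL (hb.cost_le rfl) hs
    (d := (0 + ((Expr.times ((Expr.plus (.reg 3) (.lit 1)).npow 2) denExpr).costFactor + 1) + 1) +
      (numExpr.costFactor + 1) + 1 + (0 + ((Expr.plus (.reg 3) (.lit 1)).costFactor + 1) + 1) + 1)
    ?_
  intro i hi t hr
  have hr' := hr.set (i : ℤ)
  have hle := rootSearch_le n k i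
  have hbt := hr'.bounded (a := a) hV ht (by omega) (by omega) (by omega) (by omega)
  have hc1 := hbt.cost_le (e := .times ((Expr.plus (.reg 3) (.lit 1)).npow 2) denExpr) rfl
  have hc2 := hbt.cost_le (e := numExpr) rfl
  have hc3 := hbt.cost_le (e := .plus (.reg 3) (.lit 1)) rfl
  have hc := add_le_pow hV (add_le_pow hV (one_add_le_pow hV hc1) hc2) (one_add_le_pow hV hc3)
  clear hc1 hc2 hc3
  revert hc
  generalize ((0 + ((Expr.times ((Expr.plus (.reg 3) (.lit 1)).npow 2) denExpr).costFactor + 1) + 1)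
    + (numExpr.costFactor + 1) + 1 + (0 + ((Expr.plus (.reg 3) (.lit 1)).costFactor + 1) + 1) + 1)
    = D
  intro hc
  have htime : (t.set 4 (i : ℤ)).time = t.time := rfl
  have hcirc : (t.set 4 (i : ℤ)).circuit = t.circuit := rfl
  generalize t.set 4 (i : ℤ) = u at *
  have hcond : (Expr.times ((Expr.plus (.reg 3) (.lit 1)).npow 2) denExpr).eval a u.regs ≤
      numExpr.eval a u.regs ↔
      ((rootSearch n k i : ℤ) + 1) ^ 2 * rootDen n ≤ rootNum n k := by
    rw [Expr.eval_times, Expr.eval_npow, Expr.eval_plus, Expr.eval_reg, Expr.eval_lit,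
      eval_denExpr hr'.1, eval_numExpr hr'.1 hr'.2.1, hr'.2.2.2]
  rw [Prog.exec, rootSearch]
  by_cases hif : ((rootSearch n k i : ℤ) + 1) ^ 2 * rootDen n ≤ rootNum n k
  · rw [if_pos hif, if_pos (hcond.mpr hif)]
    refine ⟨hcirc, ?_, ?_⟩
    · obtain ⟨g0, g1, g2, g3⟩ := hr'
      simp [SetupRegs, Prog.exec, Config.spend, Config.set, Expr.eval, g0, g1, g2, g3]
    · simp only [Prog.exec, Config.spend, Config.set] at hc ⊢
      omega
  · rw [if_neg hif, if_neg (mt hcond.mp hif)]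
    simp only [Prog.exec, Config.spend]
    exact ⟨hcirc, hr', by omega⟩

/-- By inspection of the syntax; only the part after the computation of `2 ^ (n + k)` and of the
square root, which makes assignments, is nested. -/
lemma isNested_hoProg : (Prog.seq prepProg trotterProg).isNested 4 := by decide +kernel

/-- The program writes the intended circuit, in polynomial time. -/
lemma exists_hoProg_run : ∃ d : ℕ, ∀ (n k : ℕ) (a : Quad n → ℤ),
    (hoProg.run n k a).circuit = prepCircuit n ++ trotterCircuit k (approxRoot n k) a ∧
      (hoProg.run n k a).time ≤ (n + k + tableBits a + 2) ^ d := by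
  obtain ⟨d₁, h₁⟩ := exists_powerProg
  obtain ⟨d₂, h₂⟩ := exists_rootProg
  obtain ⟨d₃, h₃⟩ := Prog.exists_time_le _ 4 isNested_hoProg
  refine ⟨7 * (d₁ + d₂ + 1 + d₃ + 1), fun n k a => ?_⟩
  generalize hB : n + k + tableBits a + 2 = B
  have hBV : B ≤ B ^ 7 := Nat.le_self_pow (by norm_num) B
  have hL : n * rootScale n k ≤ B ^ 7 := by
    calc n * rootScale n k = k * n ^ 6 := by rw [rootScale]; ring
      _ ≤ B * B ^ 6 := Nat.mul_le_mul (by omega) (Nat.pow_le_pow_left (by omega) 6)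
      _ = B ^ 7 := by ring
  rw [pow_mul]
  generalize B ^ 7 = V at *
  generalize hs : (⟨fun x => if x = 0 then (n : ℤ) else if x = 1 then (k : ℤ) else 0, [], 0⟩ :
    Config) = s
  have hrun : hoProg.run n k a = (Prog.seq prepProg trotterProg).exec a
      (rootProg.exec a (powerProg.exec a s)) := by rw [← hs]; rfl
  have hb : Bounded a 4 V s.regs := by
    rw [← hs]
    refine ⟨by omega, by omega, fun y _ _ => ?_, fun y _ => bitLen_le_of_natAbs_le ?_⟩ <;>
    · dsimp only
      split_ifs <;> simp <;> omega
  obtain ⟨a1, a2, a3⟩ := h₁ n k a V s (by omega) (by omega) (by omega) (by rw [← hs]; rfl)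
    (by rw [← hs]; rfl) (by rw [← hs]; rfl) hb
  obtain ⟨b1, b2, b3⟩ := h₂ n k a V _ (by omega) (by omega) (by omega) hL a2
  have hroot : approxRoot n k ≤ V := (rootSearch_le _ _ _).trans hL
  have c1 := (Prog.exec_nested (a := a) isNested_hoProg
    (s := rootProg.exec a (powerProg.exec a s)) fun _ _ => rfl).1
  have c2 := h₃ n a V _ (b2.bounded (by omega) (by omega) (by omega) (by omega) (by omega) hroot)
  rw [hrun]
  constructor
  · rw [c1, b1, a1, Prog.output, output_prepProg b2.1,
      output_trotterProg b2.1 b2.2.1 b2.2.2.1 b2.2.2.2, ← hs, List.nil_append]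
  · have h4 := add_le_pow (by omega) (add_le_pow (by omega) (le_refl (V ^ d₁)) (le_refl (V ^ d₂)))
      (le_refl (V ^ d₃))
    have h5 : s.time = 0 := by rw [← hs]
    omega

lemma hoProg_polyTime : hoProg.PolyTime := by
  obtain ⟨d, h⟩ := exists_hoProg_run
  exact ⟨d, fun n k a => (h n k a).2⟩

lemma hoProg_circuit (n k : ℕ) (a : Quad n → ℤ) :
    (hoProg.run n k a).circuit = prepCircuit n ++ trotterCircuit k (approxRoot n k) a := by
  obtain ⟨d, h⟩ := exists_hoProg_run
  exact (h n k a).1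

end SparseSYK
namespace SparseSYK

/-! ### The accuracy of the circuit -/

section Sums

/-- A finite set is listed by its largest element first. -/
lemma sum_powersetCard_succ_range {M : Type*} [AddCommMonoid M] (f : Finset ℕ → M) (j m : ℕ) :
    ∑ S ∈ Finset.powersetCard (j + 1) (Finset.range m), f S =
      ∑ c ∈ Finset.range m, ∑ S ∈ Finset.powersetCard j (Finset.range c), f (insert c S) := by
  induction m with
  | zero =>
    rw [Finset.range_zero, Finset.sum_empty, Finset.powersetCard_eq_empty.mpr (by simp),
      Finset.sum_empty]
  | succ m ih =>
    have hm : m ∉ Finset.range m := by simp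
    have hS : ∀ S ∈ Finset.powersetCard j (Finset.range m), m ∉ S := fun S hS h =>
      hm ((Finset.mem_powersetCard.mp hS).1 h)
    rw [Finset.range_add_one, Finset.powersetCard_succ_insert hm, Finset.sum_union, ih,
      Finset.sum_image, Finset.sum_insert hm, add_comm]
    · intro S h S' h' e
      rw [← Finset.erase_insert (hS S h), ← Finset.erase_insert (hS S' h'), e]
    · rw [Finset.disjoint_left]
      intro S h h'
      obtain ⟨S', -, rfl⟩ := Finset.mem_image.mp h'
      exact hm ((Finset.mem_powersetCard.mp h).1 (Finset.mem_insert_self _ _))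

lemma sum_powersetCard_three_range {M : Type*} [AddCommMonoid M] (f : Finset ℕ → M) (m : ℕ) :
    ∑ S ∈ Finset.powersetCard 3 (Finset.range m), f S =
      ∑ c ∈ Finset.range m, ∑ b ∈ Finset.range c, ∑ a ∈ Finset.range b, f {c, b, a} := by
  rw [sum_powersetCard_succ_range]
  refine Finset.sum_congr rfl fun c _ => ?_
  rw [sum_powersetCard_succ_range]
  refine Finset.sum_congr rfl fun b _ => ?_
  rw [sum_powersetCard_succ_range]
  refine Finset.sum_congr rfl fun a _ => ?_
  rw [Finset.powersetCard_zero, Finset.sum_singleton]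
  rfl

end Sums

section Root

lemma rootSearch_sq_le {n k : ℕ} (h : 0 ≤ rootNum n k) (i : ℕ) :
    (rootSearch n k i : ℤ) ^ 2 * rootDen n ≤ rootNum n k := by
  induction i with
  | zero => simpa [rootSearch] using h
  | succ i ih =>
    rw [rootSearch]
    split_ifs with hif
    · push_cast; exact hif
    · exact ih

/-- The search either advances in every round or has found the root. -/
lemma rootSearch_eq_or_lt (n k i : ℕ) : rootSearch n k i = i ∨
    rootNum n k < ((rootSearch n k i : ℤ) + 1) ^ 2 * rootDen n := by
  induction i with
  | zero => exact Or.inl rfl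
  | succ i ih =>
    rw [rootSearch]
    split_ifs with hif
    · rcases ih with ih | ih
      · exact Or.inl (by rw [ih])
      · exact absurd hif (not_le.mpr ih)
    · exact Or.inr (not_le.mp hif)

variable {n : ℕ}

lemma scaleRatio_inv_le (hn : 8 ≤ n) : (scaleRatio n)⁻¹ ≤ 2 * √(n : ℝ) := by
  have hn' : (0 : ℝ) < √(n : ℝ) := Real.sqrt_pos.mpr (by exact_mod_cast (by omega : 0 < n))
  have h := scaleRatio_ge hn
  rw [← one_div_one_div (2 * √(n : ℝ)), ← one_div]
  exact one_div_le_one_div_of_le (by positivity) h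

/-- The bound that shows that the search is long enough. -/
lemma scaleRatio_inv_lt (hn : 8 ≤ n) : (scaleRatio n)⁻¹ < n := by
  refine (scaleRatio_inv_le hn).trans_lt ?_
  have hn' : (8 : ℝ) ≤ n := by exact_mod_cast hn
  have h1 := Real.sq_sqrt (show (0 : ℝ) ≤ n by linarith)
  have h2 : 2 < √(n : ℝ) := by
    rw [Real.lt_sqrt (by norm_num)]; linarith
  nlinarith

lemma rootDen_pos (hn : 8 ≤ n) : (0 : ℝ) < (rootDen n : ℝ) := by
  have h := choose_three_nOne_pos hn
  have h1 : (0 : ℝ) < (nOne n).choose 3 := by exact_mod_cast h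
  rw [choose_three_cast] at h1
  rw [rootDen]
  push_cast
  linarith

lemma rootNum_eq (hn : 8 ≤ n) (k : ℕ) :
    (rootNum n k : ℝ) = (rootScale n k * (scaleRatio n)⁻¹) ^ 2 * rootDen n := by
  have h := choose_three_nOne_pos hn
  have h3 : (0 : ℝ) < (nOne n).choose 3 := by exact_mod_cast h
  have hs : (scaleRatio n)⁻¹ ^ 2 = ((2 * n).choose 4 : ℝ) / (nOne n).choose 3 := by
    rw [scaleRatio, inv_div, div_pow, Real.sq_sqrt (by positivity), Real.sq_sqrt (by positivity)]
  have hd : (rootDen n : ℝ) = 24 * (nOne n).choose 3 := by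
    rw [choose_three_cast, rootDen]; push_cast; ring
  have hN : (rootNum n k : ℝ) = (rootScale n k : ℝ) ^ 2 * (24 * (2 * n).choose 4) := by
    rw [choose_four_cast, rootNum]; push_cast; ring
  rw [mul_pow, hs, hd, hN]
  field_simp

lemma approxRoot_le (hn : 8 ≤ n) (k : ℕ) :
    (approxRoot n k : ℝ) ≤ rootScale n k * (scaleRatio n)⁻¹ := by
  have hD := rootDen_pos hn
  have hN := rootNum_eq hn k
  have h0 : (0 : ℤ) ≤ rootNum n k := by
    have : (0 : ℝ) ≤ rootNum n k := by rw [hN]; positivity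
    exact_mod_cast this
  have h1 : ((approxRoot n k : ℝ)) ^ 2 * rootDen n ≤ rootNum n k := by
    exact_mod_cast rootSearch_sq_le h0 (n * rootScale n k)
  rw [hN] at h1
  have hs : 0 ≤ scaleRatio n := by unfold scaleRatio; positivity
  exact le_of_sq_le_sq (le_of_mul_le_mul_right h1 hD) (by positivity)

lemma lt_approxRoot_add_one (hn : 8 ≤ n) {k : ℕ} (hk : 1 ≤ k) :
    rootScale n k * (scaleRatio n)⁻¹ < approxRoot n k + 1 := by
  have hD := rootDen_pos hn
  have hN := rootNum_eq hn k
  rcases rootSearch_eq_or_lt n k (n * rootScale n k) with h | h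
  · have h1 := approxRoot_le hn k
    have hM : (0 : ℝ) < rootScale n k := by
      have : 0 < rootScale n k := Nat.mul_pos hk (pow_pos (by omega) _)
      exact_mod_cast this
    have h2 : (approxRoot n k : ℝ) = n * rootScale n k := by rw [approxRoot, h]; push_cast; rfl
    have h3 := mul_lt_mul_of_pos_left (scaleRatio_inv_lt hn) hM
    linarith
  · have h1 : (rootNum n k : ℝ) < ((approxRoot n k : ℝ) + 1) ^ 2 * rootDen n := by
      exact_mod_cast h
    rw [hN] at h1
    exact lt_of_pow_lt_pow_left₀ 2 (by positivity) (lt_of_mul_lt_mul_right h1 hD.le)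

end Root

section Accuracy

open scoped Matrix.Norms.L2Operator

variable {n : ℕ}

/-- The entry of the table at the set `I` (`0` if this is not a four-element set of modes). -/
def tableAt (T : Quad n → ℤ) (I : Finset ℕ) : ℤ :=
  if h : I ∈ Finset.powersetCard 4 (Finset.range (2 * n)) then T ⟨I, h⟩ else 0

/-- Half the angle of the rotation generated by `φ_S σ_t` in one step of the product formula. -/
noncomputable def halfAngle (k s : ℕ) (T : Quad n → ℤ) (t : ℕ) (S : Finset ℕ) : ℝ :=
  -(s * tableAt T (insert (nOne n + t) S)) /
    (15120 * (rootScale n k * (2 ^ (n + k) * trotterSteps n k)))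

/-- A `Z`-rotation by the angle `α` rotates by `α / 2`. -/
lemma half_termAngle (k s : ℕ) (T : Quad n → ℤ) (a b c t : ℕ) :
    (termAngle k s T a b c t : ℂ) / 2 = (halfAngle k s T t {c, b, a} : ℂ) := by
  have h : tableEntry T a b c (nOne n + t) = tableAt T (insert (nOne n + t) {c, b, a}) := by
    have e : ({a, b, c, nOne n + t} : Finset ℕ) = insert (nOne n + t) {c, b, a} := by
      ext x; simp only [Finset.mem_insert, Finset.mem_singleton]; tauto
    rw [← e]; rfl
  rw [termAngle, halfAngle, h]
  push_cast
  rw [div_div]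
  congr 1
  · ring
  · ring

/-- The generator of a combination of the rotations. -/
noncomputable def generator (n : ℕ) (x : ℕ → Finset ℕ → ℝ) : Op (hoQubits n) :=
  ∑ t ∈ Finset.range (nTwo n), ∑ S ∈ Finset.powersetCard 3 (Finset.range (nOne n)),
    (Complex.I * (x t S : ℂ)) • (majoranaProd (hoQubits n) S * sigmaOp n t)

lemma norm_generator_le (x : ℕ → Finset ℕ → ℝ) : ‖generator n x‖ ≤
    ∑ t ∈ Finset.range (nTwo n), ∑ S ∈ Finset.powersetCard 3 (Finset.range (nOne n)), |x t S| := by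
  refine (norm_sum_le _ _).trans (Finset.sum_le_sum fun t _ => (norm_sum_le _ _).trans
    (Finset.sum_le_sum fun S hS => ?_))
  rw [norm_smul, norm_mul, Complex.norm_I, one_mul, Complex.norm_real, Real.norm_eq_abs]
  refine mul_le_of_le_one_right (abs_nonneg _) (l2_opNorm_le_one_of_isometry ?_)
  have hlt : ∀ i ∈ S, i < 2 * n + t := fun i hi => by
    have h1 := Finset.mem_range.mp ((Finset.mem_powersetCard.mp hS).1 hi)
    have h2 := nOne_add_nTwo n
    omega
  rw [sigmaOp, ← majoranaProd_insert hlt]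
  exact majoranaProd_conjTranspose_mul_self _ _

lemma generator_sub (x y : ℕ → Finset ℕ → ℝ) :
    generator n x - generator n y = generator n fun t S => x t S - y t S := by
  simp only [generator, ← Finset.sum_sub_distrib]
  refine Finset.sum_congr rfl fun t _ => Finset.sum_congr rfl fun S _ => ?_
  rw [← sub_smul, ← mul_sub, ← Complex.ofReal_sub]

lemma smul_generator (c : ℝ) (x : ℕ → Finset ℕ → ℝ) :
    (c : ℂ) • generator n x = generator n fun t S => c * x t S := by
  simp only [generator, Finset.smul_sum, smul_smul]
  refine Finset.sum_congr rfl fun t _ => Finset.sum_congr rfl fun S _ => ?_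
  congr 1
  push_cast
  ring

lemma smul_zeta_eq (p : unitInterval) (ω : Disorder n) (s : ℝ) :
    s • zeta p ω = generator n fun t S =>
      s * (tauScale n p * coupling ω (insert (nOne n + t) S)) := by
  have h : zeta p ω = generator n fun t S => tauScale n p * coupling ω (insert (nOne n + t) S) := by
    rw [zeta, generator]
    refine Finset.sum_congr rfl fun t _ => ?_
    rw [tau_eq, phiSum, Finset.sum_mul]
    exact Finset.sum_congr rfl fun S _ => smul_mul_assoc _ _ _
  rw [h]
  exact smul_generator s _

lemma majoranaProd_three {N a b c : ℕ} (hab : a < b) (hbc : b < c) :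
    majoranaProd N {c, b, a} = majorana N a * majorana N b * majorana N c := by
  rw [majoranaProd_insert (by simp; omega), majoranaProd_insert (by simpa using hab)]
  congr 2
  simp [majoranaProd]

/-- One step of the product formula is `1 + generator` up to second order in the sum of the angles. -/
lemma nearOne_stepCircuit (k s : ℕ) (T : Quad n → ℤ) :
    NearOne (circuitOp (hoQubits n) (stepCircuit k s T)) (generator n (halfAngle k s T))
      (∑ t ∈ Finset.range (nTwo n), ∑ S ∈ Finset.powersetCard 3 (Finset.range (nOne n)),
        2 * |halfAngle k s T t S|) := by
  rw [generator, stepCircuit]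
  refine nearOne_flatMap_range fun t ht => ?_
  rw [sum_powersetCard_three_range, sum_powersetCard_three_range]
  refine nearOne_flatMap_range fun c hc => nearOne_flatMap_range fun b hb =>
    nearOne_flatMap_range fun a ha => ?_
  have h1 := nOne_add_nTwo n
  have h2 := two_mul_hoQubits n
  have h := circuitOp_term (N := hoQubits n) ha hb (show c < 2 * n + t by omega) (by omega)
    (termAngle k s T a b c t)
  rw [half_termAngle] at h
  have e : majorana (hoQubits n) a * majorana (hoQubits n) b *
      (majorana (hoQubits n) c * majorana (hoQubits n) (2 * n + t)) =
      majoranaProd (hoQubits n) {c, b, a} * sigmaOp n t := by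
    rw [majoranaProd_three ha hb, sigmaOp]; simp only [mul_assoc]
  rw [e] at h
  refine nearOne_rotation ?_ (circuitOp_isometry _ _) h
  rw [sigmaOp, ← majoranaProd_insert (by simp; omega)]
  exact majoranaProd_conjTranspose_mul_self _ _

lemma isLocal_trotterCircuit (k s : ℕ) (T : Quad n → ℤ) :
    IsLocal (hoQubits n) (trotterCircuit k s T) := by
  have h1 := nOne_add_nTwo n
  have h2 := two_mul_hoQubits n
  refine IsLocal.flatMap _ fun _ _ => IsLocal.flatMap _ fun t ht => IsLocal.flatMap _ fun c hc =>
    IsLocal.flatMap _ fun b hb => IsLocal.flatMap _ fun a ha => ?_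
  rw [List.mem_range] at ht hc hb ha
  exact IsLocal.term ha hb (by omega) (by omega) _

end Accuracy

end SparseSYK
namespace SparseSYK

/-! ### Error bounds for the circuit -/

section ErrorBounds

open scoped Matrix.Norms.L2Operator

variable {n : ℕ} {p : unitInterval} {ω : Disorder n}

/-- The sum of squares is bounded by the total weight; the Cauchy-Schwarz inequality brings in the
square root of the number of quads. -/
lemma Good.sum_abs_hamCoeff_le (h : Good p ω) (hn : 8 ≤ n) :
    ∑ I ∈ Finset.powersetCard 4 (Finset.range (2 * n)), |hamCoeff p ω I| ≤ 3 * (n : ℝ) ^ 2 := by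
  have h1 : ∑ I ∈ Finset.powersetCard 4 (Finset.range (2 * n)), |hamCoeff p ω I| ^ 2 ≤ 8 := by
    have h2 : ∀ I, |hamCoeff p ω I| ^ 2 ≤ hamScale n p ^ 2 * weight ω I := fun I => by
      rw [sq_abs, hamCoeff, neg_sq, mul_pow]
      exact mul_le_mul_of_nonneg_left (coupling_sq_le_weight ω I) (sq_nonneg _)
    calc _ ≤ ∑ I ∈ Finset.powersetCard 4 (Finset.range (2 * n)), hamScale n p ^ 2 * weight ω I :=
          Finset.sum_le_sum fun I _ => h2 I
      _ ≤ hamScale n p ^ 2 * (8 * p * (2 * n).choose 4) := by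
          rw [← Finset.mul_sum]
          exact mul_le_mul_of_nonneg_left h.total (sq_nonneg _)
      _ ≤ 8 := by linarith [hamScale_sq_mul_le n p]
  have h3 := sq_sum_le_card_mul_sum_sq (s := Finset.powersetCard 4 (Finset.range (2 * n)))
    (f := fun I => |hamCoeff p ω I|)
  rw [Finset.card_powersetCard, Finset.card_range] at h3
  have h4 := choose_four_le n (by omega)
  refine le_of_sq_le_sq ?_ (by positivity)
  calc _ ≤ ((2 * n).choose 4 : ℝ) * 8 := h3.trans (mul_le_mul_of_nonneg_left h1 (by positivity))
    _ ≤ (3 * (n : ℝ) ^ 2) ^ 2 := by nlinarith [pow_nonneg (Nat.cast_nonneg (α := ℝ) n) 4]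

lemma zeta_generator (hn : 8 ≤ n) (s : ℝ) : s • zeta p ω = generator n fun t S =>
    -(s * (scaleRatio n)⁻¹ * hamCoeff p ω (insert (nOne n + t) S)) := by
  have h : scaleRatio n ≠ 0 := by
    have h1 := scaleRatio_ge hn
    have h2 : (0 : ℝ) < √(n : ℝ) := Real.sqrt_pos.mpr (by exact_mod_cast (by omega : 0 < n))
    exact (lt_of_lt_of_le (by positivity) h1).ne'
  rw [smul_zeta_eq]
  congr 1
  funext t S
  rw [hamCoeff_eq p ω (choose_three_nOne_pos hn)]
  field_simp

/-- The table rounds the coefficients down to `n + k` binary digits. -/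
lemma abs_tableAt_sub_le {k : ℕ} {I : Finset ℕ}
    (hI : I ∈ Finset.powersetCard 4 (Finset.range (2 * n))) :
    |(tableAt (hamTable p ω k) I : ℝ) / 2 ^ (n + k) - hamCoeff p ω I| ≤ 1 / 2 ^ (n + k) := by
  have h2 : (0 : ℝ) < 2 ^ (n + k) := by positivity
  rw [tableAt, dif_pos hI, hamTable]
  have h3 := Int.floor_le ((2 : ℝ) ^ (n + k) * hamCoeff p ω I)
  have h4 := Int.lt_floor_add_one ((2 : ℝ) ^ (n + k) * hamCoeff p ω I)
  rw [div_sub' h2.ne', abs_div, abs_of_pos h2]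
  gcongr
  rw [abs_le]
  constructor <;> linarith

lemma abs_mul_sub_mul_le {x y u v d e c : ℝ} (hx : |x - y| ≤ d) (hu : |u - v| ≤ e) (hx0 : 0 ≤ x)
    (hxc : x ≤ c) : |x * u - y * v| ≤ d * |v| + c * e := by
  have h : x * u - y * v = (x - y) * v + x * (u - v) := by ring
  rw [h]
  refine (abs_add_le _ _).trans (add_le_add ?_ ?_)
  · rw [abs_mul]; exact mul_le_mul_of_nonneg_right hx (abs_nonneg _)
  · rw [abs_mul, abs_of_nonneg hx0]
    exact mul_le_mul hxc hu (abs_nonneg _) (hx0.trans hxc)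

/-- The angles of the circuit have two sources of error: the rounded root and the rounded
coefficient. -/
lemma abs_halfAngle_sub_le (hn : 8 ≤ n) {k t : ℕ} (hk : 1 ≤ k) {S : Finset ℕ} (ht : t < nTwo n)
    (hS : S ∈ Finset.powersetCard 3 (Finset.range (nOne n))) :
    |trotterSteps n k * halfAngle k (approxRoot n k) (hamTable p ω k) t S -
      -(1 / 15120 * (scaleRatio n)⁻¹ * hamCoeff p ω (insert (nOne n + t) S))| ≤
      1 / rootScale n k * |hamCoeff p ω (insert (nOne n + t) S)| + n * (1 / 2 ^ (n + k)) := by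
  have hn0 : 0 < n := by omega
  have hr : (0 : ℝ) < trotterSteps n k := by
    exact_mod_cast (Nat.mul_pos hk (pow_pos hn0 _) : 0 < trotterSteps n k)
  have hM : (0 : ℝ) < rootScale n k := by
    exact_mod_cast (Nat.mul_pos hk (pow_pos hn0 _) : 0 < rootScale n k)
  have h1 := approxRoot_le hn k
  have h2 := lt_approxRoot_add_one hn hk
  have h3 := (scaleRatio_inv_lt hn).le
  have h4 := abs_tableAt_sub_le (p := p) (ω := ω) (k := k) (insert_chi_mem ht hS)
  have h5 : |(approxRoot n k : ℝ) / rootScale n k - (scaleRatio n)⁻¹| ≤ 1 / rootScale n k := by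
    rw [div_sub' hM.ne', abs_div, abs_of_pos hM]
    gcongr
    rw [abs_le]
    constructor <;> linarith
  have h6 : (approxRoot n k : ℝ) / rootScale n k ≤ n :=
    ((div_le_iff₀' hM).mpr h1).trans h3
  have h7 := abs_mul_sub_mul_le h5 h4 (by positivity) h6
  have e : trotterSteps n k * halfAngle k (approxRoot n k) (hamTable p ω k) t S =
      -(1 / 15120 * ((approxRoot n k : ℝ) / rootScale n k *
        ((tableAt (hamTable p ω k) (insert (nOne n + t) S) : ℝ) / 2 ^ (n + k)))) := by
    rw [halfAngle]; field_simp
  rw [e, mul_assoc, ← neg_mul, ← neg_mul, ← mul_sub, abs_mul]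
  refine le_trans (mul_le_of_le_one_left (abs_nonneg _) ?_) h7
  norm_num

lemma sum_mixed_le {f : Finset ℕ → ℝ} (hf : ∀ I, 0 ≤ f I) :
    ∑ t ∈ Finset.range (nTwo n), ∑ S ∈ Finset.powersetCard 3 (Finset.range (nOne n)),
      f (insert (nOne n + t) S) ≤ ∑ I ∈ Finset.powersetCard 4 (Finset.range (2 * n)), f I := by
  rw [← sum_mixedQuads]
  exact Finset.sum_le_sum_of_subset_of_nonneg (mixedQuads_subset n) fun I _ _ => hf I

/-- The table has `O(n⁴)` entries, each of accuracy `2 ^ (-n-k)`; this is made negligible by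
`n ^ 8 ≤ 2 ^ n`, and the error of the root by the factor `n ^ 5` in `rootScale`. -/
lemma Good.sum_abs_halfAngle_sub_le (h : Good p ω) (hn : 8 ≤ n) (hpow : n ^ 8 ≤ 2 ^ n) {k : ℕ}
    (hk : 1 ≤ k) :
    ∑ t ∈ Finset.range (nTwo n), ∑ S ∈ Finset.powersetCard 3 (Finset.range (nOne n)),
      |trotterSteps n k * halfAngle k (approxRoot n k) (hamTable p ω k) t S -
        -(1 / 15120 * (scaleRatio n)⁻¹ * hamCoeff p ω (insert (nOne n + t) S))| ≤
      4 / (k * (n : ℝ) ^ 3) := by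
  have hn0 : (0 : ℝ) < n := by exact_mod_cast (by omega : 0 < n)
  have hk0 : (0 : ℝ) < k := by exact_mod_cast hk
  have h2 : (k * (n : ℝ) ^ 8) ≤ 2 ^ (n + k) := by
    have : k * n ^ 8 ≤ 2 ^ (n + k) := by
      rw [pow_add, mul_comm]
      exact Nat.mul_le_mul hpow Nat.lt_two_pow_self.le
    exact_mod_cast this
  calc _ ≤ ∑ t ∈ Finset.range (nTwo n), ∑ S ∈ Finset.powersetCard 3 (Finset.range (nOne n)),
        (1 / rootScale n k * |hamCoeff p ω (insert (nOne n + t) S)| + n * (1 / 2 ^ (n + k))) :=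
        Finset.sum_le_sum fun t ht => Finset.sum_le_sum fun S hS =>
          abs_halfAngle_sub_le hn hk (Finset.mem_range.mp ht) hS
    _ ≤ ∑ I ∈ Finset.powersetCard 4 (Finset.range (2 * n)),
        (1 / rootScale n k * |hamCoeff p ω I| + n * (1 / 2 ^ (n + k))) :=
        sum_mixed_le (f := fun I => 1 / rootScale n k * |hamCoeff p ω I| + n * (1 / 2 ^ (n + k)))
          fun I => by positivity
    _ = 1 / rootScale n k * ∑ I ∈ Finset.powersetCard 4 (Finset.range (2 * n)), |hamCoeff p ω I| +
        (2 * n).choose 4 * (n * (1 / 2 ^ (n + k))) := by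
        rw [Finset.sum_add_distrib, ← Finset.mul_sum, Finset.sum_const, Finset.card_powersetCard,
          Finset.card_range, nsmul_eq_mul]
    _ ≤ 1 / (k * (n : ℝ) ^ 5) * (3 * (n : ℝ) ^ 2) + (n : ℝ) ^ 4 * (n * (1 / (k * (n : ℝ) ^ 8))) := by
        have h4 := choose_four_le n (by omega)
        have h5 := h.sum_abs_hamCoeff_le hn
        have h6 : (rootScale n k : ℝ) = k * (n : ℝ) ^ 5 := by rw [rootScale]; push_cast; rfl
        rw [h6]
        gcongr
        nlinarith [pow_pos hn0 4]
    _ = 4 / (k * (n : ℝ) ^ 3) := by field_simp; norm_num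

lemma Good.sum_abs_generator_le (h : Good p ω) (hn : 8 ≤ n) :
    ∑ t ∈ Finset.range (nTwo n), ∑ S ∈ Finset.powersetCard 3 (Finset.range (nOne n)),
      |-(1 / 15120 * (scaleRatio n)⁻¹ * hamCoeff p ω (insert (nOne n + t) S))| ≤ (n : ℝ) ^ 3 := by
  have hs : 0 ≤ (scaleRatio n)⁻¹ := by unfold scaleRatio; positivity
  have e : ∀ I, |-(1 / 15120 * (scaleRatio n)⁻¹ * hamCoeff p ω I)| =
      1 / 15120 * (scaleRatio n)⁻¹ * |hamCoeff p ω I| := fun I => by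
    rw [abs_neg, abs_mul, abs_of_nonneg (by positivity)]
  simp only [e]
  refine (sum_mixed_le (f := fun I => 1 / 15120 * (scaleRatio n)⁻¹ * |hamCoeff p ω I|)
    fun I => by positivity).trans ?_
  rw [← Finset.mul_sum]
  calc _ ≤ 1 / 15120 * (n : ℝ) * (3 * (n : ℝ) ^ 2) := by
        have := h.sum_abs_hamCoeff_le hn
        have := (scaleRatio_inv_lt hn).le
        gcongr
    _ ≤ (n : ℝ) ^ 3 := by nlinarith [pow_nonneg (Nat.cast_nonneg (α := ℝ) n) 3]

/-- The circuit approximates the unitary of the Hastings-O'Donnell state. -/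
lemma Good.norm_trotter_sub_exp_le (h : Good p ω) (hn : 8 ≤ n) (hpow : n ^ 8 ≤ 2 ^ n) {k : ℕ}
    (hk : 1 ≤ k) :
    ‖circuitOp (hoQubits n) (trotterCircuit k (approxRoot n k) (hamTable p ω k)) -
      NormedSpace.exp ((1 / 15120 : ℝ) • zeta p ω)‖ ≤ 21 / (k * (n : ℝ) ^ 3) := by
  have hn0 : (0 : ℝ) < n := by exact_mod_cast (by omega : 0 < n)
  have hn1 : (1 : ℝ) ≤ n := by exact_mod_cast (by omega : 1 ≤ n)
  have hk0 : (0 : ℝ) < k := by exact_mod_cast hk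
  have hk1 : (1 : ℝ) ≤ k := by exact_mod_cast hk
  have hr : 0 < trotterSteps n k := Nat.mul_pos hk (pow_pos (by omega) _)
  have hr0 : (0 : ℝ) < trotterSteps n k := by exact_mod_cast hr
  have hrn : (trotterSteps n k : ℝ) = k * (n : ℝ) ^ 9 := by rw [trotterSteps]; push_cast; rfl
  have hA := h.sum_abs_halfAngle_sub_le hn hpow hk
  have hB := h.sum_abs_generator_le hn
  have hX : ((1 / 15120 : ℝ) • zeta p ω).conjTranspose = -((1 / 15120 : ℝ) • zeta p ω) := by
    rw [Matrix.conjTranspose_smul, zeta_conjTranspose, star_trivial, smul_neg]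
  have hXn : ‖(1 / 15120 : ℝ) • zeta p ω‖ ≤ (n : ℝ) ^ 3 := by
    rw [zeta_generator hn]
    exact (norm_generator_le _).trans hB
  have hXr : ‖(1 / 15120 : ℝ) • zeta p ω‖ ≤ trotterSteps n k := by
    refine hXn.trans ?_
    rw [hrn]
    calc (n : ℝ) ^ 3 ≤ 1 * (n : ℝ) ^ 9 := by
          rw [one_mul]; exact pow_le_pow_right₀ hn1 (by norm_num)
      _ ≤ k * (n : ℝ) ^ 9 := by gcongr
  have hBX : ‖(trotterSteps n k : ℂ) • generator n
      (halfAngle k (approxRoot n k) (hamTable p ω k)) - (1 / 15120 : ℝ) • zeta p ω‖ ≤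
      4 / (k * (n : ℝ) ^ 3) := by
    rw [zeta_generator hn, ← Complex.ofReal_natCast, smul_generator, generator_sub]
    exact (norm_generator_le _).trans hA
  -- The rotation angles of one step add up to at most `4 n³ / r`.
  have hy : ∑ t ∈ Finset.range (nTwo n), ∑ S ∈ Finset.powersetCard 3 (Finset.range (nOne n)),
      2 * |halfAngle k (approxRoot n k) (hamTable p ω k) t S| ≤
      4 * (n : ℝ) ^ 3 / trotterSteps n k := by
    rw [le_div_iff₀ hr0, Finset.sum_mul]
    simp only [Finset.sum_mul]
    have h1 : 4 / (k * (n : ℝ) ^ 3) ≤ (n : ℝ) ^ 3 := by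
      rw [div_le_iff₀ (by positivity)]
      have h8 : (8 : ℝ) ≤ n := by exact_mod_cast hn
      have h3 : (1 : ℝ) ≤ (n : ℝ) ^ 2 := one_le_pow₀ hn1
      calc (4 : ℝ) ≤ n * 1 * (1 * 1) := by linarith
        _ ≤ n * (n : ℝ) ^ 2 * (k * (n * (n : ℝ) ^ 2)) := by
            have h4 : (1 : ℝ) ≤ n * (n : ℝ) ^ 2 := one_le_mul_of_one_le_of_one_le hn1 h3
            gcongr
        _ = _ := by ring
    calc _ ≤ ∑ t ∈ Finset.range (nTwo n), ∑ S ∈ Finset.powersetCard 3 (Finset.range (nOne n)),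
          (2 * |trotterSteps n k * halfAngle k (approxRoot n k) (hamTable p ω k) t S -
            -(1 / 15120 * (scaleRatio n)⁻¹ * hamCoeff p ω (insert (nOne n + t) S))| +
          2 * |-(1 / 15120 * (scaleRatio n)⁻¹ * hamCoeff p ω (insert (nOne n + t) S))|) := by
          refine Finset.sum_le_sum fun t _ => Finset.sum_le_sum fun S _ => ?_
          have h2 := abs_sub_abs_le_abs_sub
            (trotterSteps n k * halfAngle k (approxRoot n k) (hamTable p ω k) t S)
            (-(1 / 15120 * (scaleRatio n)⁻¹ * hamCoeff p ω (insert (nOne n + t) S)))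
          rw [abs_mul, abs_of_pos hr0] at h2
          linarith
      _ ≤ 2 * (n : ℝ) ^ 3 + 2 * (n : ℝ) ^ 3 := by
          simp only [Finset.sum_add_distrib, ← Finset.mul_sum]
          exact add_le_add (mul_le_mul_of_nonneg_left (hA.trans h1) (by norm_num))
            (mul_le_mul_of_nonneg_left hB (by norm_num))
      _ = _ := by ring
  have hy0 : 0 ≤ ∑ t ∈ Finset.range (nTwo n),
      ∑ S ∈ Finset.powersetCard 3 (Finset.range (nOne n)),
      2 * |halfAngle k (approxRoot n k) (hamTable p ω k) t S| := by positivity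
  have key := norm_pow_sub_exp_le hr
    (nearOne_stepCircuit k (approxRoot n k) (hamTable p ω k)) hX hXr
  rw [trotterCircuit, circuitOp_flatMap_const]
  refine key.trans ?_
  calc _ ≤ trotterSteps n k * (4 * (n : ℝ) ^ 3 / trotterSteps n k) ^ 2 +
        ((n : ℝ) ^ 3) ^ 2 / trotterSteps n k + 4 / (k * (n : ℝ) ^ 3) := by
        gcongr
    _ = 21 / (k * (n : ℝ) ^ 3) := by
        rw [hrn]
        field_simp
        ring

/-- On the good event the circuit meets both requirements. -/
lemma Good.algState_spec (h : Good p ω) (hn : 8 ≤ n) (hlarge : 504 / energyRate ≤ n)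
    (hpow : n ^ 8 ≤ 2 ^ n) (hp : (0 : ℝ) < p) {k : ℕ} (hk : 1 ≤ k) :
    traceDist (algState hoProg p ω k) (hoState p ω (-(1 / 15120))) ≤ 1 / (k : ℝ) ∧
      energyRate / 4 * √(n : ℝ) ≤ sykEnergy p ω (algState hoProg p ω k) := by
  have hn8 : (8 : ℝ) ≤ n := by exact_mod_cast hn
  have hk0 : (0 : ℝ) < k := by exact_mod_cast hk
  have hk1 : (1 : ℝ) ≤ k := by exact_mod_cast hk
  have he : 0 < energyRate := by unfold energyRate; norm_num
  have hE := h.sykEnergy_hoState_ge hn hp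
  have hV := h.norm_trotter_sub_exp_le hn hpow hk
  have hH := h.sum_abs_hamCoeff_le hn
  have hU := exp_zeta_isometry p ω (1 / 15120)
  have hVi := circuitOp_isometry (hoQubits n)
    (trotterCircuit k (approxRoot n k) (hamTable p ω k))
  have hstate : hoState p ω (-(1 / 15120)) = NormedSpace.exp ((1 / 15120 : ℝ) • zeta p ω) *
      rhoZero n * (NormedSpace.exp ((1 / 15120 : ℝ) • zeta p ω)).conjTranspose := by
    rw [hoState_neg, exp_neg_zeta]
  have halg : algState hoProg p ω k =
      circuitOp (hoQubits n) (trotterCircuit k (approxRoot n k) (hamTable p ω k)) * rhoZero n *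
        (circuitOp (hoQubits n)
          (trotterCircuit k (approxRoot n k) (hamTable p ω k))).conjTranspose := by
    rw [algState, hoProg_circuit, circuitState_prep _ (isLocal_trotterCircuit _ _ _)]
  rw [hstate] at hE ⊢
  rw [halg]
  have h1 := traceDist_le hU hVi
  have h2 := sykEnergy_sub_le p ω hU hVi
  have hδ := norm_nonneg (circuitOp (hoQubits n)
    (trotterCircuit k (approxRoot n k) (hamTable p ω k)) -
      NormedSpace.exp ((1 / 15120 : ℝ) • zeta p ω))
  generalize ‖circuitOp (hoQubits n) (trotterCircuit k (approxRoot n k) (hamTable p ω k)) -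
    NormedSpace.exp ((1 / 15120 : ℝ) • zeta p ω)‖ = δ at h1 h2 hV hδ
  generalize ∑ I ∈ Finset.powersetCard 4 (Finset.range (2 * n)), |hamCoeff p ω I| = Hs at h2 hH
  constructor
  · refine h1.trans (hV.trans ?_)
    rw [div_le_div_iff₀ (by positivity) hk0]
    have h3 : (8 : ℝ) ^ 3 ≤ (n : ℝ) ^ 3 := by gcongr
    nlinarith
  · have h3 : 2 * Hs * δ ≤ 126 / n := by
      calc 2 * Hs * δ ≤ 2 * (3 * (n : ℝ) ^ 2) * (21 / (k * (n : ℝ) ^ 3)) := by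
            gcongr
        _ = 126 / (k * n) := by field_simp; norm_num
        _ ≤ 126 / (1 * n) := by gcongr
        _ = 126 / n := by rw [one_mul]
    have h4 : 126 / (n : ℝ) ≤ energyRate / 4 * √(n : ℝ) := by
      have h5 : 1 ≤ √(n : ℝ) := by rw [Real.one_le_sqrt]; linarith
      rw [div_le_iff₀ he] at hlarge
      rw [div_le_iff₀ (by linarith)]
      calc (126 : ℝ) ≤ (n * energyRate) / 4 * 1 := by linarith
        _ ≤ (n * energyRate) / 4 * √(n : ℝ) := by gcongr
        _ = _ := by ring
    linarith

end ErrorBounds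

lemma exists_pow_eight_le : ∃ N : ℕ, ∀ n : ℕ, N ≤ n → n ^ 8 ≤ 2 ^ n := by
  have h := tendsto_pow_const_div_const_pow_of_one_lt 8 (r := (2 : ℝ)) (by norm_num)
  obtain ⟨N, hN⟩ := Filter.eventually_atTop.mp (h.eventually_lt_const zero_lt_one)
  refine ⟨N, fun n hn => ?_⟩
  have h1 := hN n hn
  rw [div_lt_one (by positivity)] at h1
  exact_mod_cast h1.le

end SparseSYK

theorem theorem1 (K : ℝ) (hK : 0 < K) :
    ∃ (θ c : ℝ) (n₀ : ℕ) (P : Prog), 0 < c ∧ P.PolyTime ∧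
      ∀ (n : ℕ) (p : unitInterval), n₀ ≤ n → K * Real.log n / n ≤ (p : ℝ) →
        disorderLaw n p
            {ω | ¬ (c * √(n : ℝ) ≤ sykEnergy p ω (hoState p ω θ) ∧
              ∀ k : ℕ, 1 ≤ k →
                traceDist (algState P p ω k) (hoState p ω θ) ≤ 1 / (k : ℝ) ∧
                c * √(n : ℝ) ≤ sykEnergy p ω (algState P p ω k))}
          ≤ ENNReal.ofReal (Real.exp (-(c * n))) := by
  obtain ⟨n₁, hn₁, h₁⟩ := exists_measure_not_good_le
  obtain ⟨n₂, h₂⟩ := exists_pow_eight_le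
  have hc : failRate / 2 ≤ energyRate / 4 := by unfold failRate energyRate; norm_num
  have he : 0 < energyRate := by unfold energyRate; norm_num
  refine ⟨-(1 / 15120), failRate / 2,
    max (max n₁ n₂) (max ⌈504 / energyRate⌉₊ ⌈Real.exp (1 / K)⌉₊), hoProg,
    half_pos failRate_le.2, hoProg_polyTime, fun n p hn hp => ?_⟩
  simp only [max_le_iff] at hn
  obtain ⟨⟨hn1, hn2⟩, hn3, hn4⟩ := hn
  have hn8 : 8 ≤ n := hn₁.trans hn1
  have hn0 : (0 : ℝ) < n := by exact_mod_cast (by omega : 0 < n)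
  have hlarge : 504 / energyRate ≤ n := Nat.ceil_le.mp hn3
  have hlog : 1 / K ≤ Real.log n := (Real.le_log_iff_exp_le hn0).mpr (Nat.ceil_le.mp hn4)
  -- For large `n` the sparsity is at least `1 / n`, which is all that the argument uses.
  have hpn : (n : ℝ)⁻¹ ≤ p := by
    refine le_trans ?_ hp
    rw [inv_eq_one_div]
    gcongr
    exact (div_le_iff₀' hK).mp hlog
  have hp0 : (0 : ℝ) < p := (inv_pos.mpr hn0).trans_le hpn
  refine (measure_mono fun ω hω => ?_).trans (h₁ n p hn1 hpn)
  rw [Set.mem_ofPred_eq] at hω ⊢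
  refine fun hgood => hω ⟨?_, fun k hk => ?_⟩
  · refine le_trans ?_ (hgood.sykEnergy_hoState_ge hn8 hp0)
    gcongr
    linarith
  · obtain ⟨h3, h4⟩ := hgood.algState_spec hn8 hlarge (h₂ n hn2) hp0 hk
    exact ⟨h3, le_trans (by gcongr) h4⟩
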